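/- Work over $\mathbb F_2$. Let $\mathcal Z$ be a pointed matched circle of genus $k$: marked points $0<1<\dots<4k-1$ (bottom to top) on a circle cut at its basepoint, with a fixed-point-free involution (matching) such that surgery along all matched pairs gives a connected circle. Let $\mathcal A=\mathcal A(\mathcal Z)$ be its strand algebra and $\mathcal A'=\mathcal A(-\mathcal Z)$; a generator consists of upward moving strands and double horizontal strands. Turning pictures upside down gives a bijection $a\mapsto\overline a$ between the generators of $\mathcal A$ and of $\mathcal A'$, which reverses products. For an indecomposable idempotent $i$ of $\mathcal A$ (a set of matched pairs) let $o(i)$ be the complementary one. **Large model.** $\widehat{CFDD}(\mathbb I_{\mathcal Z})$ is the type $DD$ structure over $\mathcal A,\mathcal A'$ generated by the pairs $i\otimes i'$ with $i'=\overline{o(i)}$, with $\delta^1(i\otimes i')=\sum_{\xi,j}\bigl(i\,a(\xi)\,j\otimes i'\,\overline{a(\xi)}\,j'\bigr)\otimes(j\otimes j')$, the sum being over chords $\xi$ and idempotents $j$, where $a(\xi)$ is the sum of all generators whose only moving strand is $\xi$. Let $\mathcal M=\overline{\widehat{CFDD}(\mathbb I_{\mathcal Z})}\boxtimes\mathcal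 A\boxtimes\overline{\mathcal A'}$, where bars denote duals; it has right actions of $\mathcal A'$ and $\mathcal A$ and is the algebraic model of $\widehat{CFAA}(\mathbb I_{\mathcal Z})$. Its generators are the pairs $[a_1,a_2]$ of generators of $\mathcal A$ whose left idempotents are complementary ($a_1$ stands for $\overline{a_1}\in\mathcal A'$). Let $(M,d)$ be the underlying complex, $f$ the inclusion into $M$ of the span $N$ of the generators $[o(i),i]$, and $g:M\to N$ the projection that kills all other generators. **The homotopy $H$.** "Left" and "right" refer to $a_1$ and $a_2$; $s\to t$ is a moving strand; strands not mentioned are unchanged. The multiplicity of $[a_1,a_2]$ at the segment $(p,p+1)$ is the number of strands of $a_1$ and $a_2$ that cover it. Order the segments by traversing downwards, from the top, the boundary of the circle with handles attached along the matching: after $(x,x+1)$ comes $(y-1,y)$, where $y$ is matched with $x$; the first segment is $(y-1,y)$ with $y$ matched with the topmost point. $H$ is the sum of the following arrows, and is $0$ on all other generators. *(a) All multiplicities are at most $1$, not all $0$.* Let $(P-1,P)$ be the first segment in this order with multiplicity $1$, and $Q$ the point matched with $P$. 1. $\{P,Q\}$ is a double horizontal on the left, $a\to b$ is on the left, $a<P<b$: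 replace both by $a\to P$ and $P\to b$. 2. $i\to P$ and $P\to j$ are on the right: replace them by $i\to j$ and a double horizontal at $\{P,Q\}$. If moreover some $r\to Q$ is on the left, there is a second arrow, moving $r\to Q$ to the right and $i\to P$ to the left. 3. $\{P,Q\}$ is a double horizontal on the left, $i\to j$ is on the right, $i<P\le j$: replace the double horizontal on the left by $i\to P$, and $i\to j$ on the right by $P\to j$ (by a double horizontal at $\{P,Q\}$ if $j=P$). 4. $P\to j$ is on the left and $i\to P$ is on the right: replace $P\to j$ by $i\to j$ on the left, and $i\to P$ by a double horizontal at $\{P,Q\}$ on the right. If moreover some $r\to Q$ is on the left ($r=P$ is allowed), there is a second arrow, moving $r\to Q$ to the right and $i\to P$ to the left. *(b) Some multiplicity exceeds $1$.* Let $(i,i+1)$ be the lowest such segment; let $i\to e$ be the strand that starts at $i$, and $j\to f$, $j<i<f$, the other strand that covers it. 1. Both on the left and $e<f$: replace them by $i\to f$, $j\to e$. 2. Both on the right and $f<e$: replace them by $i\to f$, $j\to e$. 3. $i\to e$ on the left and $j\to f$ on the right: replace them by $j\to e$ on the left and $i\to f$ on the right. **Theorem.** $\mathcal M$ is an $A_\infty$-bimodule,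 and $$d\circ H+H\circ d=\mathbb I_M+f\circ g .$$ Let $\mathcal N=\mathcal N_{\mathcal A',\mathcal A}$ have as generators $[i]$ the indecomposable idempotents $i$ of $\mathcal A$, the idempotent of $[i]$ being $i$ on the $\mathcal A$ side and $\overline{o(i)}$ on the $\mathcal A'$ side. Let the arrows of its action correspond one-to-one to the sequences of generators $x_1,\dots,x_{2n}$ ($n\ge1$) of $\mathcal M$, together with a choice of a generator $b'\in\mathcal A'$ or $b\in\mathcal A$ for each $r=1,\dots,n$, such that 1. $x_1=[o(i),i]$ and $x_{2n}=[o(j),j]$ for some idempotents $i,j$; 2. for each $r$, with $x_{2r-1}=[a_1,a_2]$ and $x_{2r}=[c_1,c_2]$, either $a_1=c_1\overline{b'}$ and $a_2=c_2$, or $c_2=a_2b$ and $a_1=c_1$, for the chosen $b'$ or $b$; 3. for each $r<n$ there is an $H$-arrow from $x_{2r}$ to $x_{2r+1}$. If $b_1',\dots,b_p'$ and $b_1,\dots,b_q$ are the elements chosen, in order, the arrow is $m_{1,p,q}([i];b_1',\dots,b_p';b_1,\dots,b_q)\to[j]$; that is, the coefficient of $[j]$ in this value of $m_{1,p,q}$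 is the number of such sequences modulo $2$. Then $\mathcal N$ is an $A_\infty$-bimodule of rank $1$ over the ring of idempotents, and it is homotopy equivalent to $\mathcal M$ as an $A_\infty$-bimodule (all bimodules, morphisms and homotopies being strictly unital and linear over the rings of idempotents); hence it is a model of $\widehat{CFAA}(\mathbb I_{\mathcal Z})_{\mathcal A',\mathcal A}$. -/

import Mathlib

/-! ### Pointed matched circles -/

/-- A pointed matched circle of genus `k`.  The circle is cut open at its basepoint and the
`4k` marked points are numbered `0, 1, …, 4k - 1` from bottom to top.  The matching is the
fixed-point-free involution `pair`.  The arcs of the circle are numbered by their lower end: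
arc `x` joins `x` to `x + 1`, and arc `4k - 1` is the one through the basepoint.  Walking down
arc `x` on the surgered circle one arrives at the point `x`, crosses the handle to `pair x`, and
continues down arc `pair x - 1` (cyclically); the surgered circle is connected. -/
structure PMC (k : ℕ) where
  pair : Equiv.Perm (Fin (4 * k))
  pair_pair : ∀ x, pair (pair x) = x
  pair_ne : ∀ x, pair x ≠ x
  connected : ∀ x y, ((finRotate (4 * k))⁻¹ * pair).SameCycle x y

namespace PMC

variable {k : ℕ}

/-- The arc met after arc `x` when the boundary is traversed downwards. -/
def next (Z : PMC k) : Equiv.Perm (Fin (4 * k)) := (finRotate (4 * k))⁻¹ * Z.pair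

theorem rev_rotate (n : ℕ) (x : Fin n) :
    (finRotate n) (Fin.rev ((finRotate n) x)) = Fin.rev x := by
  cases n with
  | zero => exact x.elim0
  | succ n =>
    ext
    rcases eq_or_ne x (Fin.last n) with rfl | h
    · cases n <;> simp
    · have h1 : (x : ℕ) < n := Fin.val_lt_last h
      have h2 : ((finRotate (n + 1)) x : ℕ) = x + 1 := coe_finRotate_of_ne_last h
      have h3 : Fin.rev ((finRotate (n + 1)) x) ≠ Fin.last n := by
        intro h4
        have := congrArg Fin.val h4
        rw [Fin.val_rev, h2, Fin.val_last] at this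
        omega
      rw [coe_finRotate_of_ne_last h3, Fin.val_rev, Fin.val_rev, h2]
      omega

/-- The orientation reversal `-Z`: point `x` of `Z` becomes point `4k - 1 - x`. -/
def rev (Z : PMC k) : PMC k where
  pair := Fin.revPerm * Z.pair * Fin.revPerm
  pair_pair x := by simp [Z.pair_pair]
  pair_ne x h := Z.pair_ne (Fin.rev x) (by
    have := congrArg Fin.rev h
    simpa using this)
  connected x y := by
    have hp : Z.pair⁻¹ = Z.pair := by
      ext x
      rw [Equiv.Perm.inv_eq_iff_eq.mpr (Z.pair_pair x).symm]
    have key : (finRotate (4 * k))⁻¹ * (Fin.revPerm * Z.pair * Fin.revPerm) =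
        (Fin.revPerm * Z.pair) * ((finRotate (4 * k))⁻¹ * Z.pair)⁻¹ *
          (Fin.revPerm * Z.pair)⁻¹ := by
      have h1 : (finRotate (4 * k))⁻¹ * Fin.revPerm = Fin.revPerm * finRotate (4 * k) := by
        rw [inv_mul_eq_iff_eq_mul]
        refine Equiv.ext fun x => ?_
        rw [Equiv.Perm.mul_apply, Equiv.Perm.mul_apply]
        exact (rev_rotate _ x).symm
      have h2 : (Fin.revPerm : Equiv.Perm (Fin (4 * k)))⁻¹ = Fin.revPerm := by
        ext x; rfl
      have h3 : Z.pair * Z.pair = 1 := by ext x; simp [Z.pair_pair]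
      rw [mul_inv_rev, mul_inv_rev, inv_inv, hp, h2]
      calc _ = ((finRotate (4 * k))⁻¹ * Fin.revPerm) * Z.pair * Fin.revPerm := by group
        _ = Fin.revPerm * finRotate (4 * k) * Z.pair * Fin.revPerm := by rw [h1]
        _ = Fin.revPerm * (Z.pair * Z.pair) * finRotate (4 * k) * Z.pair * Fin.revPerm := by
          rw [h3, mul_one]
        _ = _ := by group
    rw [key]
    set g : Equiv.Perm (Fin (4 * k)) := Fin.revPerm * Z.pair
    have := (Z.connected (g⁻¹ x) (g⁻¹ y)).inv.conj (g := g)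
    rwa [show g (g⁻¹ x) = x from g.apply_symm_apply x,
      show g (g⁻¹ y) = y from g.apply_symm_apply y] at this

end PMC

/-! ### The algebra of strand diagrams on `n` points, on its basis

A strand diagram is the graph of a bijection between two subsets of the points that never goes
down, stored as its finite set of strands `(start, end)`. -/

namespace Diagram

variable {n : ℕ}

/-- Crossings: pairs of strands whose starts and ends are in opposite order. -/
def crossings (f : Finset (Fin n × Fin n)) : Finset ((Fin n × Fin n) × (Fin n × Fin n)) :=
  (f ×ˢ f).filter fun c => c.1.1 < c.2.1 ∧ c.2.2 < c.1.2

/-- The number of crossings. -/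
def inv (f : Finset (Fin n × Fin n)) : ℕ := (crossings f).card

/-- Concatenation of strand diagrams. -/
def comp (f g : Finset (Fin n × Fin n)) : Finset (Fin n × Fin n) :=
  ((f ×ˢ g).filter fun c => c.1.2 = c.2.1).image fun c => (c.1.1, c.2.2)

/-- The product of `f` and `g` is nonzero and equal to `h`: the ends of `f` are the starts of `g`,
and no two strands cross twice in the concatenation. -/
def IsProd (f g h : Finset (Fin n × Fin n)) : Prop :=
  f.image Prod.snd = g.image Prod.fst ∧ inv (comp f g) = inv f + inv g ∧ comp f g = h

instance (f g h : Finset (Fin n × Fin n)) : Decidable (IsProd f g h) := by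
  unfold IsProd; infer_instance

/-- The diagram in which the crossing `c` of `f` is resolved. -/
def resolve (f : Finset (Fin n × Fin n)) (c : (Fin n × Fin n) × (Fin n × Fin n)) :
    Finset (Fin n × Fin n) :=
  insert (c.1.1, c.2.2) (insert (c.2.1, c.1.2) ((f.erase c.1).erase c.2))

/-- The number of crossings of `f` whose resolution is `h` and which lower the number of crossings
by exactly one: the coefficient of `h` in `d f`. -/
def dCount (f h : Finset (Fin n × Fin n)) : ℕ :=
  ((crossings f).filter fun c => resolve f c = h ∧ inv h + 1 = inv f).card

end Diagram

/-! ### Generators and indecomposable idempotents of `A(Z)` -/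

/-- An indecomposable idempotent of `A(Z)`: a set of matched pairs, stored as the set of all the
points in these pairs. -/
@[ext]
structure Idem {k : ℕ} (Z : PMC k) where
  pts : Finset (Fin (4 * k))
  pair_mem : ∀ x ∈ pts, Z.pair x ∈ pts

/-- A generator of `A(Z)`: upward-veering moving strands `(start, end)`, and double (paired)
horizontal strands, stored as the set `hor` of all the points on them.  No matched pair carries
two starts of strands, or two ends of strands. -/
@[ext]
structure Gen {k : ℕ} (Z : PMC k) where
  strands : Finset (Fin (4 * k) × Fin (4 * k))
  hor : Finset (Fin (4 * k))
  up : ∀ s ∈ strands, s.1 < s.2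
  start_ne : ∀ s ∈ strands, ∀ t ∈ strands, s ≠ t → s.1 ≠ t.1 ∧ s.1 ≠ Z.pair t.1
  end_ne : ∀ s ∈ strands, ∀ t ∈ strands, s ≠ t → s.2 ≠ t.2 ∧ s.2 ≠ Z.pair t.2
  hor_pair : ∀ x ∈ hor, Z.pair x ∈ hor
  start_notMem : ∀ s ∈ strands, s.1 ∉ hor
  end_notMem : ∀ s ∈ strands, s.2 ∉ hor

section Instances

variable {k : ℕ} {Z : PMC k}

instance : DecidableEq (Idem Z) := fun a b => decidable_of_iff (a.pts = b.pts) Idem.ext_iff.symm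

instance : DecidableEq (Gen Z) := fun a b =>
  decidable_of_iff (a.strands = b.strands ∧ a.hor = b.hor) Gen.ext_iff.symm

noncomputable instance : Fintype (Idem Z) :=
  Fintype.ofInjective Idem.pts fun _ _ h => Idem.ext h

noncomputable instance : Fintype (Gen Z) :=
  Fintype.ofInjective (fun a : Gen Z => (a.strands, a.hor)) fun _ _ h =>
    Gen.ext (congrArg Prod.fst h) (congrArg Prod.snd h)

end Instances

namespace Idem

variable {k : ℕ} {Z : PMC k}

/-- The complementary idempotent `o(i)`. -/
def o (i : Idem Z) : Idem Z where
  pts := i.ptsᶜ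
  pair_mem x hx := by
    rw [Finset.mem_compl] at hx ⊢
    exact fun h => hx (by simpa [Z.pair_pair] using i.pair_mem _ h)

/-- The idempotent of `A(-Z)` that corresponds to `i`. -/
def bar (i : Idem Z) : Idem Z.rev where
  pts := i.pts.image Fin.rev
  pair_mem x hx := by
    obtain ⟨y, hy, rfl⟩ := Finset.mem_image.mp hx
    exact Finset.mem_image.mpr ⟨Z.pair y, i.pair_mem y hy, by simp [PMC.rev]⟩

/-- The idempotent as a generator of the algebra. -/
def gen (i : Idem Z) : Gen Z where
  strands := ∅
  hor := i.pts
  up := by simp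
  start_ne := by simp
  end_ne := by simp
  hor_pair := i.pair_mem
  start_notMem := by simp
  end_notMem := by simp

end Idem

namespace Gen

variable {k : ℕ} {Z : PMC k}

/-- The left idempotent: all pairs at which some strand starts. -/
def left (a : Gen Z) : Idem Z where
  pts := a.hor ∪ (a.strands.image fun s => s.1) ∪ (a.strands.image fun s => Z.pair s.1)
  pair_mem x hx := by
    simp only [Finset.mem_union, Finset.mem_image] at hx ⊢
    rcases hx with (h | ⟨s, hs, rfl⟩) | ⟨s, hs, rfl⟩
    · exact Or.inl (Or.inl (a.hor_pair x h))
    · exact Or.inr ⟨s, hs, rfl⟩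
    · exact Or.inl (Or.inr ⟨s, hs, (Z.pair_pair s.1).symm⟩)

/-- The right idempotent: all pairs at which some strand ends. -/
def right (a : Gen Z) : Idem Z where
  pts := a.hor ∪ (a.strands.image fun s => s.2) ∪ (a.strands.image fun s => Z.pair s.2)
  pair_mem x hx := by
    simp only [Finset.mem_union, Finset.mem_image] at hx ⊢
    rcases hx with (h | ⟨s, hs, rfl⟩) | ⟨s, hs, rfl⟩
    · exact Or.inl (Or.inl (a.hor_pair x h))
    · exact Or.inr ⟨s, hs, rfl⟩
    · exact Or.inl (Or.inr ⟨s, hs, (Z.pair_pair s.2).symm⟩)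

/-- The generator of `A(Z)` that corresponds to a generator of `A(-Z)`: each strand is traversed
backwards and the picture is turned upside down. -/
def bar (a : Gen Z.rev) : Gen Z where
  strands := a.strands.image fun s => (Fin.rev s.2, Fin.rev s.1)
  hor := a.hor.image Fin.rev
  up s hs := by
    obtain ⟨t, ht, rfl⟩ := Finset.mem_image.mp hs
    exact Fin.rev_lt_rev.mpr (a.up t ht)
  start_ne s hs t ht hne := by
    obtain ⟨s, hs', rfl⟩ := Finset.mem_image.mp hs
    obtain ⟨t, ht', rfl⟩ := Finset.mem_image.mp ht
    have h := a.end_ne s hs' t ht' (by rintro rfl; exact hne rfl)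
    refine ⟨fun e => h.1 (Fin.rev_injective e), fun e => h.2 ?_⟩
    have := congrArg Fin.rev e
    simpa [PMC.rev] using this
  end_ne s hs t ht hne := by
    obtain ⟨s, hs', rfl⟩ := Finset.mem_image.mp hs
    obtain ⟨t, ht', rfl⟩ := Finset.mem_image.mp ht
    have h := a.start_ne s hs' t ht' (by rintro rfl; exact hne rfl)
    refine ⟨fun e => h.1 (Fin.rev_injective e), fun e => h.2 ?_⟩
    have := congrArg Fin.rev e
    simpa [PMC.rev] using this
  hor_pair x hx := by
    obtain ⟨y, hy, rfl⟩ := Finset.mem_image.mp hx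
    exact Finset.mem_image.mpr ⟨_, a.hor_pair y hy, by simp [PMC.rev]⟩
  start_notMem s hs := by
    obtain ⟨s, hs', rfl⟩ := Finset.mem_image.mp hs
    simpa using a.end_notMem s hs'
  end_notMem s hs := by
    obtain ⟨s, hs', rfl⟩ := Finset.mem_image.mp hs
    simpa using a.start_notMem s hs'

/-- The strand diagram made of the moving strands of `a` and of horizontal strands at `c`. -/
def diagram (a : Gen Z) (c : Finset (Fin (4 * k))) : Finset (Fin (4 * k) × Fin (4 * k)) :=
  a.strands ∪ c.image fun x => (x, x)

/-- As an element of the algebra of strand diagrams, `a` is the sum of these diagrams: in each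
double horizontal strand exactly one of the two horizontal strands is kept. -/
def expand (a : Gen Z) : Finset (Finset (Fin (4 * k) × Fin (4 * k))) :=
  (a.hor.powerset.filter fun c => ∀ x ∈ a.hor, (x ∈ c ↔ Z.pair x ∉ c)).image a.diagram

/-- One of the diagrams in `a.expand`; it occurs in `b.expand` for no other generator `b`, so that
the coefficient of `a` in an element of `A(Z)` is the coefficient of this diagram. -/
def rep (a : Gen Z) : Finset (Fin (4 * k) × Fin (4 * k)) :=
  a.diagram (a.hor.filter fun x => x < Z.pair x)

end Gen

/-! ### Differential algebras, bimodules and type `DD` structures over `𝔽₂` with chosen generators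

All linear and multilinear maps are given by their matrix coefficients on generators. -/

/-- The structure constants of a differential algebra over `𝔽₂`, with generators `G` and
indecomposable idempotents `I`: `d a b` is the coefficient of `b` in `da`, and `mul a b c` is the
coefficient of `c` in `ab`. -/
structure DGAlg (G I : Type) where
  left : G → I
  right : G → I
  one : I → G
  d : G → G → ZMod 2
  mul : G → G → G → ZMod 2

/-- The strand algebra `A(Z)`. -/
def strandAlg {k : ℕ} (Z : PMC k) : DGAlg (Gen Z) (Idem Z) where
  left := Gen.left
  right := Gen.right
  one := Idem.gen
  d a b := ((∑ f ∈ a.expand, Diagram.dCount f b.rep : ℕ) : ZMod 2)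
  mul a b c :=
    ((((a.expand ×ˢ b.expand).filter fun p => Diagram.IsProd p.1 p.2 c.rep).card : ℕ) : ZMod 2)

/-- The data of a left-right differential bimodule over `A` with generators `P`; here
`lact b x y` is the coefficient of `y` in `b x`, and `ract x b y` that of `y` in `x b`. -/
structure DGBimod {G I : Type} (A : DGAlg G I) (P : Type) where
  lidem : P → I
  ridem : P → I
  d : P → P → ZMod 2
  lact : G → P → P → ZMod 2
  ract : P → G → P → ZMod 2

/-- The algebra as a bimodule over itself. -/
def DGAlg.regular {G I : Type} (A : DGAlg G I) : DGBimod A G where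
  lidem := A.left
  ridem := A.right
  d := A.d
  lact := A.mul
  ract := A.mul

/-- The dual bimodule: arrows are reversed, and the algebra acts on the opposite side. -/
def DGBimod.dual {G I P : Type} {A : DGAlg G I} (B : DGBimod A P) : DGBimod A P where
  lidem := B.ridem
  ridem := B.lidem
  d x y := B.d y x
  lact b x y := B.ract y b x
  ract x b y := B.lact b y x

/-- The data of a type `DD` structure over `A` and `B`: `δ x a b y` is the coefficient of
`(a ⊗ b) ⊗ y` in `δ¹ x`. -/
structure TypeDD {G I G' I' : Type} (A : DGAlg G I) (B : DGAlg G' I') (X : Type) where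
  idem₁ : X → I
  idem₂ : X → I'
  δ : X → G → G' → X → ZMod 2

/-- The dual type `DD` structure (left actions become right actions), with the order of the two
algebras exchanged: arrows are reversed and keep their coefficients. -/
def TypeDD.dual {G I G' I' X : Type} {A : DGAlg G I} {B : DGAlg G' I'} (D : TypeDD A B X) :
    TypeDD B A X where
  idem₁ := D.idem₂
  idem₂ := D.idem₁
  δ y b a x := D.δ x a b y

/-- The type `DD` structure `CFDD(𝕀_Z)` over `A(Z)` and `A(-Z)`.  It is generated by the pairs
`i ⊗ i'` with `i' = bar (o i)`, and the coefficient of `(b ⊗ b') ⊗ (j ⊗ j')` in `δ¹(i ⊗ i')` is the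
number of chords `ξ` such that `b` is a term of `i a(ξ) j` and `b'` a term of
`i' (bar a(ξ)) j'`, where `a(ξ)` is the sum of all generators with `ξ` as their only moving
strand. -/
def cfddId {k : ℕ} (Z : PMC k) : TypeDD (strandAlg Z) (strandAlg Z.rev) (Idem Z) where
  idem₁ i := i
  idem₂ i := i.o.bar
  δ i b b' j :=
    ((((Finset.univ : Finset (Fin (4 * k) × Fin (4 * k))).filter fun ξ =>
        ξ.1 < ξ.2 ∧
        (b.strands = {ξ} ∧ b.left = i ∧ b.right = j) ∧
        (b'.bar.strands = {ξ} ∧ b'.left = i.o.bar ∧ b'.right = j.o.bar)).card : ℕ) : ZMod 2)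

/-! ### `A_∞`-bimodules -/

/-- Idempotents match along the list `l` of algebra inputs, from `i` to `j`. -/
def DGAlg.Matches {G I : Type} (A : DGAlg G I) : I → List G → I → Prop
  | i, [], j => i = j
  | i, a :: l, j => A.left a = i ∧ A.Matches (A.right a) l j

/-- `φ` summed over the result of applying the differential to one entry of a list. -/
def DGAlg.dSum {G I : Type} [Fintype G] (A : DGAlg G I) :
    (List G → ZMod 2) → List G → ZMod 2
  | _, [] => 0
  | φ, a :: l => (∑ c, A.d a c * φ (c :: l)) + A.dSum (fun l' => φ (a :: l')) l

/-- `φ` summed over the result of multiplying two consecutive entries of a list. -/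
def DGAlg.mulSum {G I : Type} [Fintype G] (A : DGAlg G I) :
    (List G → ZMod 2) → List G → ZMod 2
  | _, [] => 0
  | _, [_] => 0
  | φ, a :: b :: l =>
    (∑ c, A.mul a b c * φ (c :: l)) + A.mulSum (fun l' => φ (a :: l')) (b :: l)

section AInf

variable {G' I' G I X Y W : Type}

/-- The matrix coefficients of a family of multilinear maps `X ⊗ (A')^{⊗ p} ⊗ A^{⊗ q} → Y`:
`T x l' l y` is the coefficient of `y` in `T_{1,p,q}(x; l'; l)`. -/
abbrev Coeffs (G' G X Y : Type) : Type := X → List G' → List G → Y → ZMod 2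

/-- Composition: `S` takes the first few inputs of each kind, `T` takes the remaining ones. -/
def Coeffs.comp [Fintype Y] (S : Coeffs G' G X Y) (T : Coeffs G' G Y W) : Coeffs G' G X W :=
  fun x l' l z => ∑ i ∈ Finset.range (l'.length + 1), ∑ j ∈ Finset.range (l.length + 1), ∑ y,
    S x (l'.take i) (l.take j) y * T y (l'.drop i) (l.drop j) z

/-- `T` after the differential or the multiplication has been applied to its inputs. -/
def Coeffs.alg [Fintype G'] [Fintype G] (A' : DGAlg G' I') (A : DGAlg G I)
    (T : Coeffs G' G X Y) : Coeffs G' G X Y :=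
  fun x l' l y =>
    A'.dSum (fun r' => T x r' l y) l' + A.dSum (fun r => T x l' r y) l +
    A'.mulSum (fun r' => T x r' l y) l' + A.mulSum (fun r => T x l' r y) l

/-- The identity morphism. -/
def Coeffs.id [DecidableEq X] : Coeffs G' G X X :=
  fun x l' l y => if x = y ∧ l' = [] ∧ l = [] then 1 else 0

/-- The data of an `A_∞`-bimodule with two right actions, by `A'` and by `A`.  Each generator has
an idempotent on either side; `m x l' l y` is the coefficient of `y` in `m_{1,p,q}(x; l'; l)`. -/
structure AInfBimod (A' : DGAlg G' I') (A : DGAlg G I) (X : Type) where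
  idem' : X → I'
  idem : X → I
  m : Coeffs G' G X X

/-- The maps `T` are defined on tensor products over the rings of idempotents. -/
def IdemBalanced {A' : DGAlg G' I'} {A : DGAlg G I} (M : AInfBimod A' A X) (N : AInfBimod A' A Y)
    (T : Coeffs G' G X Y) : Prop :=
  ∀ x l' l y, T x l' l y ≠ 0 →
    A'.Matches (M.idem' x) l' (N.idem' y) ∧ A.Matches (M.idem x) l (N.idem y)

/-- Some algebra input is an idempotent. -/
def HasIdem (A' : DGAlg G' I') (A : DGAlg G I) (l' : List G') (l : List G) : Prop :=
  (∃ i, A'.one i ∈ l') ∨ ∃ i, A.one i ∈ l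

/-- The data `M` form a (strictly unital) `A_∞`-bimodule. -/
structure AInfBimod.IsAInf [Fintype G'] [Fintype G] [Fintype X] [DecidableEq X]
    {A' : DGAlg G' I'} {A : DGAlg G I} (M : AInfBimod A' A X) : Prop where
  balanced : IdemBalanced M M M.m
  relation : ∀ x l' l y, M.m.comp M.m x l' l y + M.m.alg A' A x l' l y = 0
  unit_left : ∀ x y, M.m x [A'.one (M.idem' x)] [] y = if x = y then 1 else 0
  unit_right : ∀ x y, M.m x [] [A.one (M.idem x)] y = if x = y then 1 else 0
  unit_high : ∀ x l' l y, 2 ≤ l'.length + l.length → HasIdem A' A l' l → M.m x l' l y = 0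

/-- The differential on the complex of (pre)morphisms from `M` to `N`. -/
def morD [Fintype G'] [Fintype G] [Fintype X] [Fintype Y] {A' : DGAlg G' I'} {A : DGAlg G I}
    (M : AInfBimod A' A X) (N : AInfBimod A' A Y) (T : Coeffs G' G X Y) : Coeffs G' G X Y :=
  fun x l' l y => M.m.comp T x l' l y + T.comp N.m x l' l y + T.alg A' A x l' l y

/-- `T` is a (strictly unital) premorphism from `M` to `N`. -/
def IsPreMor {A' : DGAlg G' I'} {A : DGAlg G I} (M : AInfBimod A' A X) (N : AInfBimod A' A Y)
    (T : Coeffs G' G X Y) : Prop :=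
  IdemBalanced M N T ∧ ∀ x l' l y, HasIdem A' A l' l → T x l' l y = 0

/-- `M` and `N` are homotopy equivalent as `A_∞`-bimodules. -/
def HomotopyEquivalent [Fintype G'] [Fintype G] [Fintype X] [Fintype Y] [DecidableEq X]
    [DecidableEq Y] {A' : DGAlg G' I'} {A : DGAlg G I} (M : AInfBimod A' A X)
    (N : AInfBimod A' A Y) : Prop :=
  ∃ (F : Coeffs G' G X Y) (E : Coeffs G' G Y X) (K : Coeffs G' G X X) (L : Coeffs G' G Y Y),
    IsPreMor M N F ∧ IsPreMor N M E ∧ IsPreMor M M K ∧ IsPreMor N N L ∧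
    (∀ x l' l y, morD M N F x l' l y = 0) ∧
    (∀ y l' l x, morD N M E y l' l x = 0) ∧
    (∀ x l' l z, F.comp E x l' l z + Coeffs.id x l' l z = morD M M K x l' l z) ∧
    (∀ y l' l z, E.comp F y l' l z + Coeffs.id y l' l z = morD N N L y l' l z)

/-- The underlying module is free of rank one over the ring of idempotents, on either side. -/
def AInfBimod.IsRankOne {A' : DGAlg G' I'} {A : DGAlg G I} (M : AInfBimod A' A X) : Prop :=
  Function.Bijective M.idem' ∧ Function.Bijective M.idem

end AInf

/-! ### The box tensor product and the large model -/

section Box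

variable {G' I' G I X P Q : Type} {A' : DGAlg G' I'} {A : DGAlg G I}

/-- Generators `[q, x, p]` of `D ⊠ P ⊠ Q`. -/
@[ext]
structure BoxGen (D : TypeDD A' A X) (BP : DGBimod A P) (BQ : DGBimod A' Q) where
  q : Q
  x : X
  p : P
  idem_q : BQ.lidem q = D.idem₁ x
  idem_p : BP.lidem p = D.idem₂ x

variable {D : TypeDD A' A X} {BP : DGBimod A P} {BQ : DGBimod A' Q}

instance [DecidableEq Q] [DecidableEq X] [DecidableEq P] : DecidableEq (BoxGen D BP BQ) :=
  fun s t => decidable_of_iff (s.q = t.q ∧ s.x = t.x ∧ s.p = t.p) BoxGen.ext_iff.symm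

noncomputable instance [Fintype Q] [Fintype X] [Fintype P] : Fintype (BoxGen D BP BQ) :=
  Fintype.ofInjective (fun t : BoxGen D BP BQ => (t.q, t.x, t.p)) fun s t h => by
    simp only [Prod.mk.injEq] at h
    exact BoxGen.ext h.1 h.2.1 h.2.2

/-- The box tensor product of a right type `DD` structure over `A'` and `A` with a bimodule over
`A` and a bimodule over `A'`, as an `A_∞`-bimodule with right actions of `A'` and `A`.  Since the
left actions on differential bimodules have no higher terms, and no terms with inputs on both
sides, the differential consists of the differentials of the two bimodules and of `δ¹` followed by
the two left actions, and the right actions are those on the two bimodules. -/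
def box [Fintype G'] [Fintype G] [DecidableEq Q] [DecidableEq X] [DecidableEq P]
    (D : TypeDD A' A X) (BP : DGBimod A P) (BQ : DGBimod A' Q) :
    AInfBimod A' A (BoxGen D BP BQ) where
  idem' t := BQ.ridem t.q
  idem t := BP.ridem t.p
  m s l' l t :=
    match l', l with
    | [], [] =>
      (if s.x = t.x ∧ s.q = t.q then BP.d s.p t.p else 0) +
      (if s.x = t.x ∧ s.p = t.p then BQ.d s.q t.q else 0) +
      ∑ b' : G', ∑ b : G, D.δ s.x b' b t.x * BQ.lact b' s.q t.q * BP.lact b s.p t.p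
    | [b'], [] => if s.x = t.x ∧ s.p = t.p then BQ.ract s.q b' t.q else 0
    | [], [b] => if s.x = t.x ∧ s.q = t.q then BP.ract s.p b t.p else 0
    | _, _ => 0

end Box

section Models

variable {k : ℕ}

/-- Generators `[a', i' ⊗ i, a]` of the large model. -/
abbrev MGen (Z : PMC k) : Type :=
  BoxGen (cfddId Z).dual (strandAlg Z).regular (strandAlg Z.rev).regular.dual

/-- The large model `dual (CFDD(𝕀_Z)) ⊠ A(Z) ⊠ dual (A(-Z))`. -/
noncomputable def largeModel (Z : PMC k) :
    AInfBimod (strandAlg Z.rev) (strandAlg Z) (MGen Z) :=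
  box (cfddId Z).dual (strandAlg Z).regular (strandAlg Z.rev).regular.dual

namespace MGen

variable {Z : PMC k}

/-- A generator of the large model is written as a pair `[a₁, a₂]` of generators of `A(Z)`; this is
the first one. -/
def fst (x : MGen Z) : Gen Z := Gen.bar x.q

/-- The second entry of `[a₁, a₂]`. -/
def snd (x : MGen Z) : Gen Z := x.p

end MGen

/-! ### The homotopy -/

variable {Z : PMC k}

/-- The multiplicity of `[a₁, a₂]` at the segment from `p` to `p + 1`. -/
def mult (a₁ a₂ : Gen Z) (p : Fin (4 * k)) : ℕ :=
  (a₁.strands.filter fun s => s.1 ≤ p ∧ p < s.2).card +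
    (a₂.strands.filter fun s => s.1 ≤ p ∧ p < s.2).card

/-- Multiplicity at most one at each segment. -/
def MultOne (a₁ a₂ : Gen Z) : Prop := ∀ p, mult a₁ a₂ p ≤ 1

/-- `P` is the upper end of the key segment of `[a₁, a₂]`: when the boundary of the circle with
handles is traversed from the top (the arc `top` through the basepoint) downwards, the segment just
below `P` is the first one met at which the multiplicity is not zero.  The key pair is
`{P, Z.pair P}`. -/
def IsKey (a₁ a₂ : Gen Z) (P : Fin (4 * k)) : Prop :=
  ∃ p top : Fin (4 * k), p.val + 1 = P.val ∧ top.val + 1 = 4 * k ∧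
    ∃ r : ℕ, (Z.next ^ r) top = p ∧ mult a₁ a₂ p ≠ 0 ∧
      ∀ r' < r, mult a₁ a₂ ((Z.next ^ r') top) = 0

/-- The segment above `i` is the bottom-most one with multiplicity greater than one. -/
def IsBottom (a₁ a₂ : Gen Z) (i : Fin (4 * k)) : Prop :=
  1 < mult a₁ a₂ i ∧ ∀ i' < i, mult a₁ a₂ i' ≤ 1

/-- Multiplicity one, case 1: key segment on the left, key pair on the left as a double horizontal.
The crossing of the strand `a → b` with the horizontal strand at `P` is resolved. -/
def HCase1 (a₁ a₂ b₁ b₂ : Gen Z) : Prop :=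
  MultOne a₁ a₂ ∧ ∃ P, IsKey a₁ a₂ P ∧ P ∈ a₁.hor ∧ ∃ a b, (a, b) ∈ a₁.strands ∧ a < P ∧ P < b ∧
    b₁.strands = a₁.strands \ {(a, b)} ∪ {(a, P), (P, b)} ∧ b₁.hor = a₁.hor \ {P, Z.pair P} ∧
    b₂ = a₂

/-- Multiplicity one, case 2, ordinary term: key segment on the right, key pair on the right with a
moving strand.  The strands `i → P` and `P → j` become `i → j` and a double horizontal at the key
pair. -/
def HCase2 (a₁ a₂ b₁ b₂ : Gen Z) : Prop :=
  MultOne a₁ a₂ ∧ ∃ P, IsKey a₁ a₂ P ∧ ∃ i j, (i, P) ∈ a₂.strands ∧ (P, j) ∈ a₂.strands ∧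
    b₁ = a₁ ∧
    b₂.strands = a₂.strands \ {(i, P), (P, j)} ∪ {(i, j)} ∧ b₂.hor = a₂.hor ∪ {P, Z.pair P}

/-- Multiplicity one, case 2, special term: a strand `r → q` on the left that ends at the point `q`
paired with `P` moves to the right, and `i → P` moves to the left. -/
def HCase2sp (a₁ a₂ b₁ b₂ : Gen Z) : Prop :=
  MultOne a₁ a₂ ∧ ∃ P, IsKey a₁ a₂ P ∧ ∃ i j, (i, P) ∈ a₂.strands ∧ (P, j) ∈ a₂.strands ∧
    ∃ r, (r, Z.pair P) ∈ a₁.strands ∧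
    b₁.strands = a₁.strands \ {(r, Z.pair P)} ∪ {(i, P)} ∧ b₁.hor = a₁.hor ∧
    b₂.strands = a₂.strands \ {(i, P)} ∪ {(r, Z.pair P)} ∧ b₂.hor = a₂.hor

/-- Multiplicity one, case 3: key segment on the right, covered by `i → j`, and key pair on the
left as a double horizontal.  The strand `i → P` is split off and moved to the left.  What remains
on the right is `P → j`, or a double horizontal at the key pair if `j = P`. -/
def HCase3 (a₁ a₂ b₁ b₂ : Gen Z) : Prop :=
  MultOne a₁ a₂ ∧ ∃ P, IsKey a₁ a₂ P ∧ P ∈ a₁.hor ∧ ∃ i j, (i, j) ∈ a₂.strands ∧ i < P ∧ P ≤ j ∧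
    b₁.strands = a₁.strands ∪ {(i, P)} ∧ b₁.hor = a₁.hor \ {P, Z.pair P} ∧
    ((P < j ∧ b₂.strands = a₂.strands \ {(i, j)} ∪ {(P, j)} ∧ b₂.hor = a₂.hor) ∨
      (P = j ∧ b₂.strands = a₂.strands \ {(i, j)} ∧ b₂.hor = a₂.hor ∪ {P, Z.pair P}))

/-- Multiplicity one, case 4, ordinary term: key segment on the right, key pair on the left with a
moving strand.  The strand `i → P` moves to the left, where it is attached to `P → j`, and leaves a
double horizontal at the key pair on the right. -/
def HCase4 (a₁ a₂ b₁ b₂ : Gen Z) : Prop :=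
  MultOne a₁ a₂ ∧ ∃ P, IsKey a₁ a₂ P ∧ ∃ i j, (i, P) ∈ a₂.strands ∧ (P, j) ∈ a₁.strands ∧
    b₁.strands = a₁.strands \ {(P, j)} ∪ {(i, j)} ∧ b₁.hor = a₁.hor ∧
    b₂.strands = a₂.strands \ {(i, P)} ∧ b₂.hor = a₂.hor ∪ {P, Z.pair P}

/-- Multiplicity one, case 4, first special term: a strand `r → q` on the left with `r ≠ P` that
ends at the point `q` paired with `P` moves to the right, and `i → P` moves to the left. -/
def HCase4sp₁ (a₁ a₂ b₁ b₂ : Gen Z) : Prop :=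
  MultOne a₁ a₂ ∧ ∃ P, IsKey a₁ a₂ P ∧ ∃ i j, (i, P) ∈ a₂.strands ∧ (P, j) ∈ a₁.strands ∧
    ∃ r, r ≠ P ∧ (r, Z.pair P) ∈ a₁.strands ∧
    b₁.strands = a₁.strands \ {(r, Z.pair P)} ∪ {(i, P)} ∧ b₁.hor = a₁.hor ∧
    b₂.strands = a₂.strands \ {(i, P)} ∪ {(r, Z.pair P)} ∧ b₂.hor = a₂.hor

/-- Multiplicity one, case 4, second special term: the strand `P → q` on the left to the point `q`
paired with `P` moves to the right, and `i → P` moves to the left. -/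
def HCase4sp₂ (a₁ a₂ b₁ b₂ : Gen Z) : Prop :=
  MultOne a₁ a₂ ∧ ∃ P, IsKey a₁ a₂ P ∧ ∃ i, (i, P) ∈ a₂.strands ∧ (P, Z.pair P) ∈ a₁.strands ∧
    b₁.strands = a₁.strands \ {(P, Z.pair P)} ∪ {(i, P)} ∧ b₁.hor = a₁.hor ∧
    b₂.strands = a₂.strands \ {(i, P)} ∪ {(P, Z.pair P)} ∧ b₂.hor = a₂.hor

/-- Other generators, case 1: the strands `i → e` and `j → f` with `j < i < f` are on the left and
cross; they are uncrossed. -/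
def HCaseA (a₁ a₂ b₁ b₂ : Gen Z) : Prop :=
  ∃ i, IsBottom a₁ a₂ i ∧ ∃ j e f, (i, e) ∈ a₁.strands ∧ (j, f) ∈ a₁.strands ∧ j < i ∧ i < f ∧
    e < f ∧
    b₁.strands = a₁.strands \ {(i, e), (j, f)} ∪ {(i, f), (j, e)} ∧ b₁.hor = a₁.hor ∧ b₂ = a₂

/-- Other generators, case 2: the strands `i → e` and `j → f` with `j < i < f` are on the right and
do not cross; they are crossed. -/
def HCaseB (a₁ a₂ b₁ b₂ : Gen Z) : Prop :=
  ∃ i, IsBottom a₁ a₂ i ∧ ∃ j e f, (i, e) ∈ a₂.strands ∧ (j, f) ∈ a₂.strands ∧ j < i ∧ i < f ∧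
    f < e ∧
    b₁ = a₁ ∧ b₂.strands = a₂.strands \ {(i, e), (j, f)} ∪ {(i, f), (j, e)} ∧ b₂.hor = a₂.hor

/-- Other generators, case 3: the strand `i → e` is on the left and `j → f` with `j < i < f` is on
the right; `j → i` is split off from the latter and attached to the former. -/
def HCaseC (a₁ a₂ b₁ b₂ : Gen Z) : Prop :=
  ∃ i, IsBottom a₁ a₂ i ∧ ∃ j e f, (i, e) ∈ a₁.strands ∧ (j, f) ∈ a₂.strands ∧ j < i ∧ i < f ∧
    b₁.strands = a₁.strands \ {(i, e)} ∪ {(j, e)} ∧ b₁.hor = a₁.hor ∧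
    b₂.strands = a₂.strands \ {(j, f)} ∪ {(i, f)} ∧ b₂.hor = a₂.hor

/-- There is an `H`-arrow from `[a₁, a₂]` to `[b₁, b₂]`. -/
def HArrow (a₁ a₂ b₁ b₂ : Gen Z) : Prop :=
  HCase1 a₁ a₂ b₁ b₂ ∨ HCase2 a₁ a₂ b₁ b₂ ∨ HCase2sp a₁ a₂ b₁ b₂ ∨ HCase3 a₁ a₂ b₁ b₂ ∨
  HCase4 a₁ a₂ b₁ b₂ ∨ HCase4sp₁ a₁ a₂ b₁ b₂ ∨ HCase4sp₂ a₁ a₂ b₁ b₂ ∨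
  HCaseA a₁ a₂ b₁ b₂ ∨ HCaseB a₁ a₂ b₁ b₂ ∨ HCaseC a₁ a₂ b₁ b₂

/-- The generator `[o(i), i]` of the large model. -/
def idemGen (i : Idem Z) : MGen Z where
  q := i.o.bar.gen
  x := i
  p := i.gen
  idem_q := by
    ext
    simp [DGBimod.dual, DGAlg.regular, strandAlg, TypeDD.dual, cfddId, Gen.right, Idem.gen]
  idem_p := by
    ext
    simp [DGAlg.regular, strandAlg, TypeDD.dual, cfddId, Gen.left, Idem.gen]

/-! Linear maps between complexes with chosen generators are written as matrices whose rows are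
indexed by the source, so that the matrix of `S ∘ T` is the product `T * S`. -/

/-- The differential of the complex underlying the large model. -/
noncomputable def dMat (Z : PMC k) : Matrix (MGen Z) (MGen Z) (ZMod 2) :=
  fun x y => (largeModel Z).m x [] [] y

open Classical in
/-- The homotopy `H`, the sum of all `H`-arrows. -/
noncomputable def hMat (Z : PMC k) : Matrix (MGen Z) (MGen Z) (ZMod 2) :=
  fun x y => if HArrow x.fst x.snd y.fst y.snd then 1 else 0

/-- The inclusion `f` of the span of the idempotent generators. -/
def fMat (Z : PMC k) : Matrix (Idem Z) (MGen Z) (ZMod 2) :=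
  fun i y => if y = idemGen i then 1 else 0

/-- The projection `g` to the span of the idempotent generators. -/
def gMat (Z : PMC k) : Matrix (MGen Z) (Idem Z) (ZMod 2) :=
  fun x j => if x = idemGen j then 1 else 0

/-! ### The rank one model -/

/-- `y` is obtained from `x` by factoring out `bar b'` on the right of the first entry, or by
multiplying the second entry by `b` on the right. -/
def IsStep (x : MGen Z) (c : Gen Z.rev ⊕ Gen Z) (y : MGen Z) : Prop :=
  match c with
  | Sum.inl b' => (strandAlg Z).mul y.fst b'.bar x.fst = 1 ∧ x.snd = y.snd
  | Sum.inr b => (strandAlg Z).mul x.snd b y.snd = 1 ∧ x.fst = y.fst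

/-- The sequence of `2n` generators of the large model is stored as the list of the `n` consecutive
steps `(x_{2r-1}, c_r, x_{2r})`, where `c_r` is the algebra element used in the step.  It starts at
`[o(i), i]` and ends at `[o(j), j]`, there is an `H`-arrow from `x_{2r}` to `x_{2r+1}`, and the
elements used are, in their order, those of `l'` and of `l`. -/
structure IsArrowSeq (i j : Idem Z) (l' : List (Gen Z.rev)) (l : List (Gen Z))
    (w : List (MGen Z × (Gen Z.rev ⊕ Gen Z) × MGen Z)) : Prop where
  first : w.head?.map (fun t => t.1) = some (idemGen i)
  last : w.getLast?.map (fun t => t.2.2) = some (idemGen j)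
  step : ∀ t ∈ w, IsStep t.1 t.2.1 t.2.2
  arrow : w.IsChain fun t u => HArrow t.2.2.fst t.2.2.snd u.1.fst u.1.snd
  inputs' : w.filterMap (fun t => t.2.1.getLeft?) = l'
  inputs : w.filterMap (fun t => t.2.1.getRight?) = l

/-- The rank one model: its generators are the idempotents of `A(Z)`, and the arrows
`m_{1,p,q}([i]; l'; l) → [j]` are in bijection with the sequences above. -/
noncomputable def rankOneModel (Z : PMC k) :
    AInfBimod (strandAlg Z.rev) (strandAlg Z) (Idem Z) where
  idem' i := i.o.bar
  idem i := i
  m i l' l j := ((Set.ncard {w | IsArrowSeq i j l' l w} : ℕ) : ZMod 2)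

end Models

/-! ### Configurations -/

/-- The pairs `[a₁, a₂]` as functions on the marked points: `x s` is `v` if a strand of `a₂` goes
from `s` to `v`, it is `2 * n - 1 - v` if a strand of `a₁` does, and `2 * n` if no strand starts at
`s`. Both points of a double horizontal strand are fixed. -/
structure IsConf {n : ℕ} (π : Fin n → Fin n) (x : Fin n → ℕ) : Prop where
  valid : ∀ s : Fin n, ((s : ℕ) ≤ x s ∧ s + x s < 2 * n) ∨ x s = 2 * n
  horR : ∀ s : Fin n, x s = s → x (π s) = π s
  horL : ∀ s : Fin n, x s + s + 1 = 2 * n → x (π s) + π s + 1 = 2 * n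
  mov : ∀ s : Fin n, (s : ℕ) < x s → x s + s + 1 < 2 * n → x (π s) = 2 * n
  none : ∀ s : Fin n, x s = 2 * n → x (π s) ≠ 2 * n
  inj : ∀ s r, x s = x r → x s < 2 * n → s = r
  pairR : ∀ (s r v : Fin n), x s = v → x r = π v → r = π s
  pairL : ∀ (s r v : Fin n), x s + v + 1 = 2 * n → x r + π v + 1 = 2 * n → r = π s

/-- Exchange the values of `x` at `s` and `t`, adjusting the partner of `t` so that a double
horizontal strand appears or disappears there as needed. -/
def cswap {n : ℕ} (π : Fin n → Fin n) (s t : Fin n) (x : Fin n → ℕ) : Fin n → ℕ := fun r =>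
  if r = s then x t else if r = t then x s else if r = π t then
    (if x s = t then (π t : ℕ) else if x s + t + 1 = 2 * n then 2 * n - 1 - π t else 2 * n)
  else x r

/-- `y` arises from `x` by resolving a minimal crossing of the strands at `s` and `t`. These are
the arrows of the differential. -/
structure IsArrow {n : ℕ} (π : Fin n → Fin n) (s t : Fin n) (x y : Fin n → ℕ) : Prop where
  lt : s < t
  le : (t : ℕ) ≤ x t
  inv : x t < x s
  up : x s + t < 2 * n
  empty : ∀ p, s < p → p < t → x t < x p → x p < x s → False
  eq : y = cswap π s t x

/-- The strand that starts at `s` covers the segment from `p` to `p + 1`. -/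
def Cov {n : ℕ} (x : Fin n → ℕ) (s : Fin n) (p : ℕ) : Prop :=
  s ≤ p ∧ p < x s ∧ x s + p + 1 < 2 * n

/-- A strand from `j` covers the segment below `P`, below `P` no two strands overlap, `P` is
the start of a strand or a double horizontal on the right, and its partner does not move. -/
structure Good {n : ℕ} (π : Fin n → Fin n) (x : Fin n → ℕ) (P j : Fin n) : Prop where
  lt : j < P
  le : (P : ℕ) ≤ x j
  up : x j + P < 2 * n
  uniq : ∀ s s' p, p < (P : ℕ) → Cov x s p → Cov x s' p → s = s'
  start : (P : ℕ) ≤ x P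
  start' : x P + P < 2 * n
  nmov : ¬ ((π P : ℕ) < x (π P) ∧ x (π P) + π P + 1 < 2 * n)
  alt : (∀ s, ¬ Cov x s (π P)) ∨ ((P : ℕ) < x P ∧ x P + P + 1 < 2 * n)

section
variable {n : ℕ} {π : Fin n → Fin n} {x y : Fin n → ℕ} {s t j P : Fin n}

theorem cswap_left : cswap π s t x s = x t := by simp [cswap]
theorem cswap_right (h : s ≠ t) : cswap π s t x t = x s := by simp [cswap, h.symm]
theorem cswap_pair (h : π t ≠ s) (h' : π t ≠ t) : cswap π s t x (π t) =
    if x s = t then (π t : ℕ) else if x s + t + 1 = 2 * n then 2 * n - 1 - π t else 2 * n := by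
  simp [cswap, h, h']
theorem cswap_of_ne {r : Fin n} (h : r ≠ s) (h' : r ≠ t) (h'' : r ≠ π t) :
    cswap π s t x r = x r := by
  simp [cswap, h, h', h'']

theorem IsConf.pair_ne_of_start (hx : IsConf π x) (h2 : ∀ s, π (π s) = s) (hst : s < t) (h : (t : ℕ) ≤ x s) (h1 : x s + t < 2 * n)
    (h3 : (t : ℕ) ≤ x t) (h4 : x t + t < 2 * n) : π t ≠ s := by
  rintro rfl
  have := hx.mov (π t) (by omega) (by omega)
  rw [h2] at this
  omega

theorem IsConf.isConf_cswap (hx : IsConf π x) (h2 : ∀ s, π (π s) = s) (hne : ∀ s, π s ≠ s)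
    (hst : s < t) (h : (t : ℕ) ≤ x s) (h1 : x s + t < 2 * n)
    (h3 : (t : ℕ) ≤ x t) (h4 : x t + t < 2 * n) : IsConf π (cswap π s t x) := by
  have hps := hx.pair_ne_of_start h2 hst h h1 h3 h4
  have hpt := hne t
  have hxps : x (π s) = 2 * n := hx.mov s (by omega) (by omega)
  have ys : cswap π s t x s = x t := cswap_left
  have yt : cswap π s t x t = x s := cswap_right hst.ne
  have yq := cswap_pair (x := x) hps hpt
  have yo : ∀ r, r ≠ s → r ≠ t → r ≠ π t → cswap π s t x r = x r := fun r => cswap_of_ne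
  have hpi : ∀ a b, π a = b → a = π b := by rintro a b rfl; exact (h2 a).symm
  have hqn := (π t).isLt
  generalize cswap π s t x = y at *
  have own : ∀ r, r ≠ π t → ∃ r', y r = x r' ∧ (r = s ∧ r' = t ∨ r = t ∧ r' = s ∨
      r ≠ s ∧ r ≠ t ∧ r' = r) := by
    intro r hr
    by_cases h5 : r = s
    · exact ⟨t, by rw [h5, ys], Or.inl ⟨h5, rfl⟩⟩
    by_cases h6 : r = t
    · exact ⟨s, by rw [h6, yt], Or.inr (Or.inl ⟨h6, rfl⟩)⟩
    · exact ⟨r, yo r h5 h6 hr, Or.inr (Or.inr ⟨h5, h6, rfl⟩)⟩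
  have yps : y (π s) = 2 * n := by
    rw [yo _ (hne s) (fun h => hps (hpi _ _ h).symm) (fun h => hst.ne (by rw [← h2 s, h, h2])), hxps]
  -- cases for a point and its partner
  have cases : ∀ (p : Fin n → Prop), p s → p (π s) → p t → p (π t) →
      (∀ r, y r = x r → y (π r) = x (π r) → p r) → ∀ r, p r := by
    intro p p1 p2 p3 p4 p5 r
    by_cases h5 : r = s
    · exact h5 ▸ p1
    by_cases h6 : r = t
    · exact h6 ▸ p3
    by_cases h7 : r = π t
    · exact h7 ▸ p4
    by_cases h8 : r = π s
    · exact h8 ▸ p2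
    refine p5 r (yo r h5 h6 h7) (yo _ (fun h => h8 (hpi _ _ h)) (fun h => h7 (hpi _ _ h))
      (fun h => h6 (by rw [← h2 r, h, h2])))
  have owns : ∀ r, x r = t → x s = t → r = s := fun r h5 h6 => hx.inj r s (by omega) (by omega)
  have ownsL : ∀ r, x r + t + 1 = 2 * n → x s + t + 1 = 2 * n → r = s :=
    fun r h5 h6 => hx.inj r s (by omega) (by omega)
  constructor
  · refine cases _ ?_ ?_ ?_ ?_ ?_
    · omega
    · omega
    · omega
    · rw [yq]; split_ifs <;> omega
    · intro r h5 h6; rw [h5]; exact hx.valid r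
  · refine cases _ ?_ ?_ ?_ ?_ ?_
    · omega
    · omega
    · intro h5; rw [yq, if_pos (by omega)]
    · intro h5; rw [h2]; rw [yq] at h5; split_ifs at h5 <;> omega
    · intro r h5 h6; rw [h5, h6]; exact hx.horR r
  · refine cases _ ?_ ?_ ?_ ?_ ?_
    · omega
    · omega
    · intro h5; rw [yq, if_neg (by omega), if_pos (by omega)]; omega
    · intro h5; rw [h2]; rw [yq] at h5; split_ifs at h5 <;> omega
    · intro r h5 h6; rw [h5, h6]; exact hx.horL r
  · refine cases _ ?_ ?_ ?_ ?_ ?_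
    · omega
    · omega
    · intro h5 h6; rw [yq, if_neg (by omega), if_neg (by omega)]
    · intro h5 h6; rw [yq] at h5 h6; split_ifs at h5 h6 <;> omega
    · intro r h5 h6; rw [h5, h6]; exact hx.mov r
  · refine cases _ ?_ ?_ ?_ ?_ ?_
    · omega
    · rw [h2]; omega
    · omega
    · rw [h2]; omega
    · intro r h5 h6; rw [h5, h6]; exact hx.none r
  · have main : ∀ r, r ≠ π t → y r = y (π t) → y r < 2 * n → False := by
      intro r hr h5 h6
      obtain ⟨r', h7, h8⟩ := own r hr
      rw [h5] at h6
      rw [yq] at h5 h6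
      split_ifs at h5 h6 with h9 h10
      · have := hx.pairR s r' t h9 (by omega)
        rw [this] at h7; omega
      · have := hx.pairL s r' t h10 (by omega)
        rw [this] at h7; omega
      · omega
    intro a b hab ha
    by_cases h5 : a = π t
    · by_contra h6
      exact main b (fun h7 => h6 (h5.trans h7.symm)) (by rw [← hab, h5]) (by omega)
    by_cases h6 : b = π t
    · exact (main a h5 (by rw [hab, h6]) ha).elim
    obtain ⟨a', h7, h8⟩ := own a h5
    obtain ⟨b', h9, h10⟩ := own b h6
    have := hx.inj a' b' (by omega) (by omega)
    grind
  · intro a b v ha hb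
    by_cases h5 : a = π t
    · rw [h5] at ha ⊢
      rw [yq] at ha
      split_ifs at ha with h6 h7
      · have hv : v = π t := Fin.ext ha.symm
        rw [hv, h2] at hb
        have h8 : b ≠ π t := by
          rintro rfl; rw [yq, if_pos h6] at hb; exact hpt (Fin.ext hb)
        obtain ⟨b', h9, h10⟩ := own b h8
        have := owns b' (by omega) h6
        rw [h2]; grind
      · omega
      · omega
    by_cases h6 : b = π t
    · rw [h6] at hb ⊢
      rw [yq] at hb
      split_ifs at hb with h7 h8
      · have hv : v = t := by
          have : π t = π v := Fin.ext hb
          rw [← h2 v, ← this, h2]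
        obtain ⟨a', h9, h10⟩ := own a h5
        have := owns a' (by rw [← h9, ha, hv]) h7
        congr 1; grind
      · omega
      · omega
    obtain ⟨a', h7, h8⟩ := own a h5
    obtain ⟨b', h9, h10⟩ := own b h6
    have := hx.pairR a' b' v (by omega) (by omega)
    have h11 : x b' < 2 * n := by omega
    have h12 : x a' < 2 * n := by omega
    grind
  · intro a b v ha hb
    by_cases h5 : a = π t
    · rw [h5] at ha ⊢
      rw [yq] at ha
      split_ifs at ha with h6 h7
      · omega
      · have hv : v = π t := Fin.ext (by omega)
        rw [hv, h2] at hb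
        have h8 : b ≠ π t := by
          rintro rfl; rw [yq, if_neg h6, if_pos h7] at hb; exact hpt (Fin.ext (by omega))
        obtain ⟨b', h9, h10⟩ := own b h8
        have := ownsL b' (by omega) h7
        rw [h2]; grind
      · omega
    by_cases h6 : b = π t
    · rw [h6] at hb ⊢
      rw [yq] at hb
      split_ifs at hb with h7 h8
      · omega
      · have hv : v = t := by
          have : π t = π v := Fin.ext (by omega)
          rw [← h2 v, ← this, h2]
        obtain ⟨a', h9, h10⟩ := own a h5
        have := ownsL a' (by rw [← h9]; rw [hv] at ha; exact ha) h8
        congr 1; grind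
      · omega
    obtain ⟨a', h7, h8⟩ := own a h5
    obtain ⟨b', h9, h10⟩ := own b h6
    have := hx.pairL a' b' v (by omega) (by omega)
    have h11 : x b' < 2 * n := by omega
    have h12 : x a' < 2 * n := by omega
    grind

theorem IsConf.cswap_cswap (hx : IsConf π x) (h2 : ∀ s, π (π s) = s) (hne : ∀ s, π s ≠ s)
    (hst : s < t) (h : (t : ℕ) ≤ x s) (h1 : x s + t < 2 * n)
    (h3 : (t : ℕ) ≤ x t) (h4 : x t + t < 2 * n) : cswap π s t (cswap π s t x) = x := by
  have hps := hx.pair_ne_of_start h2 hst h h1 h3 h4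
  have hpt := hne t
  have ys : cswap π s t x s = x t := cswap_left
  have yt : cswap π s t x t = x s := cswap_right hst.ne
  have r0 := hx.horR t
  have l0 := hx.horL t
  have m0 := hx.mov t
  funext r
  by_cases h5 : r = s
  · rw [h5, cswap_left, yt]
  by_cases h6 : r = t
  · rw [h6, cswap_right hst.ne, ys]
  by_cases h7 : r = π t
  · rw [h7, cswap_pair hps hpt, ys]
    split_ifs <;> omega
  · rw [cswap_of_ne h5 h6 h7, cswap_of_ne h5 h6 h7]
end

section
variable {n : ℕ} {π : Fin n → Fin n} {x y : Fin n → ℕ} {s t j k P : Fin n}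

theorem IsConf.pair_eq (hx : IsConf π x) (hy : IsConf π y) {r : Fin n} (h : x r = y r)
    (hlt : x r < 2 * n) : x (π r) = y (π r) := by
  rcases hx.valid r with h1 | h1
  · rcases Nat.eq_or_lt_of_le h1.1 with h2 | h2
    · rw [hx.horR r h2.symm, hy.horR r (by omega)]
    · by_cases h3 : x r + r + 1 = 2 * n
      · have := hx.horL r h3
        have := hy.horL r (by omega)
        omega
      · rw [hx.mov r h2 (by omega), hy.mov r (by omega) (by omega)]
  · omega

theorem IsConf.eq_cswap (hx : IsConf π x) (hy : IsConf π y) (h2 : ∀ s, π (π s) = s)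
    (hne : ∀ s, π s ≠ s)
    (hst : s < t) (h : (t : ℕ) ≤ x s) (h1 : x s + t < 2 * n)
    (h3 : (t : ℕ) ≤ x t) (h4 : x t + t < 2 * n)
    (hs : y s = x t) (ht : y t = x s) (ho : ∀ r, r ≠ s → r ≠ t → r ≠ π t → y r = x r) :
    y = cswap π s t x := by
  have hc := hx.isConf_cswap h2 hne hst h h1 h3 h4
  funext r
  by_cases h5 : r = s
  · rw [h5, cswap_left, hs]
  by_cases h6 : r = t
  · rw [h6, cswap_right hst.ne, ht]
  by_cases h7 : r = π t
  · rw [h7]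
    exact hy.pair_eq hc (by rw [cswap_right hst.ne, ht]) (by omega)
  · rw [cswap_of_ne h5 h6 h7, ho r h5 h6 h7]

theorem Good.start_eq (hg : Good π x P j) (h : k < P) (h1 : (P : ℕ) ≤ x k)
    (h2 : x k + P < 2 * n) : k = j := by
  have h3 := hg.lt
  have h4 := hg.le
  have h5 := hg.up
  refine hg.uniq k j (P - 1) (by omega) ?_ ?_ <;> refine ⟨?_, ?_, ?_⟩ <;> omega

theorem Good.pair_ne (hg : Good π x P j) (hx : IsConf π x) (h2 : ∀ s, π (π s) = s) : π P ≠ j :=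
  hx.pair_ne_of_start h2 hg.lt hg.le hg.up hg.start hg.start'

theorem Good.conf (hg : Good π x P j) (hx : IsConf π x) (h2 : ∀ s, π (π s) = s)
    (hne : ∀ s, π s ≠ s) : IsConf π (cswap π j P x) :=
  hx.isConf_cswap h2 hne hg.lt hg.le hg.up hg.start hg.start'

theorem IsArrow.conf {s t : Fin n} (ha : IsArrow π s t x y) (hx : IsConf π x)
    (h2 : ∀ s, π (π s) = s) (hne : ∀ s, π s ≠ s) : IsConf π y := by
  obtain ⟨h3, h4, h5, h6, h7, rfl⟩ := ha
  exact hx.isConf_cswap h2 hne h3 (by omega) h6 h4 (by omega)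

/-- Arrows that do not cross from inverted to noninverted generators commute with the swap. -/
theorem IsArrow.swap (ha : IsArrow π s t x y) (hx : IsConf π x) (h2 : ∀ s, π (π s) = s)
    (hne : ∀ s, π s ≠ s) (gx : Good π x P j) (gy : Good π y P k)
    (hAB : x P < x j ∧ y P < y k ∨ x j < x P ∧ y k < y P) :
    ∃ s' t', IsArrow π s' t' (cswap π j P x) (cswap π k P y) := by
  have hy := ha.conf hx h2 hne
  have hv := gy.conf hy h2 hne
  have hu := gx.conf hx h2 hne
  have hjP := gx.pair_ne hx h2
  have hkP := gy.pair_ne hy h2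
  obtain ⟨a1, a2, a3, a4, a5, a6⟩ := ha
  obtain ⟨x1, x2, x3, x4, x5, x6, x7, x8⟩ := id gx
  obtain ⟨y1, y2, y3, y4, y5, y6, y7, y8⟩ := id gy
  have hpi : ∀ a b, π a = b → a = π b := by rintro a b rfl; exact (h2 a).symm
  have hts : π t ≠ s := hx.pair_ne_of_start h2 a1 (by omega) (by omega) (by omega) (by omega)
  have ys : y s = x t := by rw [a6, cswap_left]
  have yt : y t = x s := by rw [a6, cswap_right a1.ne]
  have yo : ∀ r, r ≠ s → r ≠ t → r ≠ π t → y r = x r := by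
    intro r h h' h''; rw [a6, cswap_of_ne h h' h'']
  have uj : cswap π j P x j = x P := cswap_left
  have uP : cswap π j P x P = x j := cswap_right x1.ne
  have uq := cswap_pair (x := x) hjP (hne P)
  have uo : ∀ r, r ≠ j → r ≠ P → r ≠ π P → cswap π j P x r = x r := fun r => cswap_of_ne
  have vk : cswap π k P y k = y P := cswap_left
  have vP : cswap π k P y P = y k := cswap_right y1.ne
  have vo : ∀ r, r ≠ k → r ≠ P → r ≠ π P → cswap π k P y r = y r := fun r => cswap_of_ne
  generalize cswap π j P x = u at *
  generalize cswap π k P y = v at *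
  have hj0 : x (π j) = 2 * n := hx.mov j (by omega) (by omega)
  have hbet : ∀ p, j < p → p < P → x p = p ∨ x p + p + 1 = 2 * n ∨ x p = 2 * n := by
    intro p hp hp'
    rcases hx.valid p with h | h
    · by_contra h'
      have := x4 p j p hp' ⟨le_rfl, by omega, by omega⟩ ⟨by omega, by omega, by omega⟩
      omega
    · exact Or.inr (Or.inr h)
  have hsq : s ≠ π P := by rintro rfl; exact x7 ⟨by omega, by omega⟩
  have hjt : j ≠ π t := by
    rintro rfl; rw [h2] at hj0; omega
  have htq : t ≠ π P := by
    rintro rfl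
    rcases x8 with h | h
    · have hc := h s
      have h3 : x s + π P + 1 = 2 * n := by
        by_contra h'; exact hc ⟨by omega, by omega, by omega⟩
      have h4 : x (π P) = π P := by
        by_contra h'; exact x7 ⟨by omega, by omega⟩
      have h5 := hx.horR _ h4
      have h6 := hy.horL (π P) (by omega)
      rw [h2] at h5 h6
      omega
    · have := hx.mov P h.1 (by omega)
      omega
  have htP : t ≠ P := by
    rintro rfl
    have := gx.start_eq a1 (by omega) (by omega)
    subst this
    have := gy.start_eq a1 (by omega) (by omega)
    subst this
    omega
  have fin : ∀ s', s' < t → (t : ℕ) ≤ u s' → u s' + t < 2 * n → u t = x t → u t < u s' →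
      (∀ p, s' < p → p < t → u t < u p → u p < u s' → False) →
      v s' = u t → v t = u s' → (∀ r, r ≠ s' → r ≠ t → r ≠ π t → v r = u r) →
      ∃ s' t', IsArrow π s' t' u v := by
    intro s' c1 c2 c3 c4 c5 c6 c7 c8 c9
    exact ⟨s', t, c1, by omega, c5, c3, c6,
      hu.eq_cswap hv h2 hne c1 c2 c3 (by omega) (by omega) c7 c8 c9⟩
  have huvq : π P ≠ π t := fun h => htP (by rw [← h2 t, ← h, h2])
  have pq : u P = v P → u P < 2 * n → u (π P) = v (π P) := hu.pair_eq hv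
  by_cases hsj : s = j
  · subst hsj
    rcases lt_or_gt_of_ne htP with htP' | htP'
    · -- `t` lies below `P`
      have hxt : x t = t := by
        rcases hbet t a1 htP' with h | h | h <;> omega
      have : t = k := gy.start_eq htP' (by omega) (by omega)
      subst this
      have yP : y P = x P := yo P (by omega) (by omega) (by
        intro h; exact htq (hpi _ _ h.symm))
      have ut := uo t (by omega) htP htq
      have vs := vo s (by omega) (by omega) hsq
      refine fin s a1 (by omega) (by omega) ut (by omega) ?_ (by omega) (by omega) ?_
      · intro p p1 p2 p3 p4
        have := hbet p p1 (by omega)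
        by_cases hpq : p = π P
        · subst hpq
          rw [uq] at p3 p4
          split_ifs at p3 p4 <;> omega
        · have := uo p (by omega) (by omega) hpq
          omega
      · intro r r1 r2 r3
        by_cases hrP : r = P
        · subst hrP; omega
        by_cases hrq : r = π P
        · subst hrq; exact (pq (by omega) (by omega)).symm
        rw [uo r r1 hrP hrq, vo r r2 hrP hrq, yo r r1 r2 r3]
    · -- `t` lies above `P`
      have : s = k := gy.start_eq x1 (by omega) (by omega)
      subst this
      have yP : y P = x P := yo P (by omega) (by omega) (by
        intro h; exact htq (hpi _ _ h.symm))
      have ut := uo t (by omega) htP htq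
      have vt := vo t (by omega) htP htq
      refine fin P htP' (by omega) (by omega) ut (by omega) ?_ (by omega) (by omega) ?_
      · intro p p1 p2 p3 p4
        by_cases hpq : p = π P
        · subst hpq
          rw [uq] at p3 p4
          split_ifs at p3 p4 <;> omega
        · have := uo p (by omega) (by omega) hpq
          exact a5 p (by omega) p2 (by omega) (by omega)
      · intro r r1 r2 r3
        by_cases hrs : r = s
        · subst hrs; omega
        by_cases hrq : r = π P
        · subst hrq
          rw [hu.mov P (by omega) (by omega), hv.mov P (by omega) (by omega)]
        rw [uo r hrs r1 hrq, vo r hrs r1 hrq, yo r hrs r2 r3]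
  by_cases hsP : s = P
  · subst hsP
    have yj : y j = x j := yo j (by omega) (by omega) hjt
    have : j = k := gy.start_eq x1 (by omega) (by omega)
    subst this
    have ut := uo t (by omega) htP htq
    have vt := vo t (by omega) htP htq
    refine fin j (by omega) (by omega) (by omega) ut (by omega) ?_ (by omega) (by omega) ?_
    · intro p p1 p2 p3 p4
      by_cases hpq : p = π s
      · subst hpq
        rw [uq] at p3 p4
        split_ifs at p3 p4 <;> omega
      by_cases hps : p = s
      · subst hps; omega
      have h3 := uo p (by omega) hps hpq
      rcases lt_or_gt_of_ne hps with h | h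
      · have := hbet p p1 h
        omega
      · exact a5 p h p2 (by omega) (by omega)
    · intro r r1 r2 r3
      by_cases hrP : r = s
      · subst hrP; omega
      by_cases hrq : r = π s
      · subst hrq; exact (pq (by omega) (by omega)).symm
      rw [uo r r1 hrP hrq, vo r r1 hrP hrq, yo r hrP r2 r3]
  by_cases htj : t = j
  · subst htj
    have hxs : x s + t + 1 = 2 * n := by
      by_contra h
      have := x4 s t t x1 ⟨by omega, by omega, by omega⟩ ⟨by omega, by omega, by omega⟩
      omega
    have : s = k := gy.start_eq (by omega) (by omega) (by omega)
    subst this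
    have yP : y P = x P := yo P (by omega) (by omega) (by
        intro h; exact htq (hpi _ _ h.symm))
    have us := uo s (by omega) (by omega) hsq
    have vt := vo t (by omega) htP htq
    refine ⟨s, t, a1, by omega, by omega, by omega, ?_, hu.eq_cswap hv h2 hne a1 (by omega)
      (by omega) (by omega) (by omega) (by omega) (by omega) ?_⟩
    · intro p p1 p2 p3 p4
      by_cases hpq : p = π P
      · subst hpq
        rw [uq] at p3 p4
        split_ifs at p3 p4 <;> omega
      have := uo p (by omega) (by omega) hpq
      have := x4 s p p (by omega) ⟨by omega, by omega, by omega⟩ ⟨by omega, by omega, by omega⟩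
      omega
    · intro r r1 r2 r3
      by_cases hrP : r = P
      · subst hrP; omega
      by_cases hrq : r = π P
      · subst hrq; exact (pq (by omega) (by omega)).symm
      rw [uo r r2 hrP hrq, vo r r1 hrP hrq, yo r r1 r2 r3]
  · have yj : y j = x j := yo j (Ne.symm hsj) (Ne.symm htj) hjt
    have : j = k := gy.start_eq x1 (by omega) (by omega)
    subst this
    have yP : y P = x P := yo P (Ne.symm hsP) (Ne.symm htP) (by
        intro h; exact htq (hpi _ _ h.symm))
    have us := uo s hsj hsP hsq
    have ut := uo t htj htP htq
    have vs := vo s hsj hsP hsq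
    have vt := vo t htj htP htq
    refine fin s a1 (by omega) (by omega) ut (by omega) ?_ (by omega) (by omega) ?_
    · intro p p1 p2 p3 p4
      by_cases hpq : p = π P
      · subst hpq
        rw [uq] at p3 p4
        split_ifs at p3 p4 <;> omega
      by_cases hpj : p = j
      · subst hpj
        rcases lt_or_gt_of_ne htP with h | h
        · have := x4 s p p x1 ⟨by omega, by omega, by omega⟩ ⟨by omega, by omega, by omega⟩
          omega
        · exact a5 P (by omega) h (by omega) (by omega)
      by_cases hpP : p = P
      · subst hpP
        rcases lt_or_gt_of_ne hsj with h | h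
        · exact a5 j h (by omega) (by omega) (by omega)
        · have := x4 s j s p1 ⟨by omega, by omega, by omega⟩ ⟨by omega, by omega, by omega⟩
          omega
      have := uo p hpj hpP hpq
      exact a5 p p1 p2 (by omega) (by omega)
    · intro r r1 r2 r3
      by_cases hrP : r = P
      · subst hrP; omega
      by_cases hrq : r = π P
      · subst hrq; exact (pq (by omega) (by omega)).symm
      by_cases hrj : r = j
      · subst hrj; omega
      rw [uo r hrj hrP hrq, vo r hrj hrP hrq, yo r r1 r2 r3]

end

section
variable {n : ℕ} {π : Fin n → Fin n} {x y : Fin n → ℕ} {s t j k P : Fin n}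

theorem Good.between (gx : Good π x P j) (hx : IsConf π x) (p : Fin n) (hp : j < p) (hp' : p < P) :
    x p = p ∨ x p + p + 1 = 2 * n ∨ x p = 2 * n := by
  have h1 := gx.le
  have h2 := gx.up
  rcases hx.valid p with h | h
  · by_contra h'
    have := gx.uniq p j p hp' ⟨le_rfl, by omega, by omega⟩ ⟨by omega, by omega, by omega⟩
    omega
  · exact Or.inr (Or.inr h)

theorem Good.isArrow (gx : Good π x P j) (hx : IsConf π x) (h : x P < x j) :
    IsArrow π j P x (cswap π j P x) := by
  refine ⟨gx.lt, gx.start, h, gx.up, ?_, rfl⟩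
  intro p p1 p2 p3 p4
  have := gx.between hx p p1 p2
  have := gx.start
  have := gx.start'
  have := gx.up
  omega

/-- The arrow at the partner of the key point. -/
theorem Good.isArrow_pair (gx : Good π x P j) (hx : IsConf π x) (h : x P = P)
    (hs : x s + π P + 1 = 2 * n) (hlt : s < π P) :
    IsArrow π s (π P) x (cswap π s (π P) x) := by
  have h1 := hx.horR P h
  have h0 := (π P).isLt
  refine ⟨hlt, h1.ge, by omega, by omega, ?_, rfl⟩
  intro p p1 p2 p3 p4
  rcases gx.alt with h2 | h2
  · exact h2 p ⟨by omega, by omega, by omega⟩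
  · omega

theorem Good.noninverted_of_pair (gx : Good π x P j) (gy : Good π y P k)
    (hx : IsConf π x) (hy : IsConf π y) (h2 : ∀ s, π (π s) = s)
    (ha : IsArrow π s (π P) x y) :
    x P = P ∧ x s + π P + 1 = 2 * n ∧ y P + P + 1 = 2 * n ∧ y k < y P := by
  have y3 := gy.up
  obtain ⟨a1, a2, a3, a4, a5, a6⟩ := ha
  have yt : y (π P) = x s := by rw [a6, cswap_right a1.ne]
  rcases gx.alt with h | h
  · have hc := h s
    have h3 : x s + π P + 1 = 2 * n := by
      by_contra h'; exact hc ⟨by omega, by omega, by omega⟩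
    have h4 : x (π P) = π P := by
      by_contra h'; exact gx.nmov ⟨by omega, by omega⟩
    have h5 := hx.horR _ h4
    have h6 := hy.horL (π P) (by omega)
    rw [h2] at h5 h6
    have h7 : y k ≠ y P := fun h => gy.lt.ne (hy.inj k P h (by omega))
    exact ⟨h5, h3, h6, by omega⟩
  · have := hx.mov P h.1 (by omega)
    omega

theorem IsArrow.eq_or_pair (ha : IsArrow π s t x y) (hx : IsConf π x) (h2 : ∀ s, π (π s) = s)
    (hne : ∀ s, π s ≠ s) (gx : Good π x P j) (gy : Good π y P k)
    (hA : x P < x j) (hB : y k < y P) : (s = j ∧ t = P) ∨ t = π P := by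
  have hy := ha.conf hx h2 hne
  by_contra hcon
  push Not at hcon
  obtain ⟨a1, a2, a3, a4, a5, a6⟩ := ha
  obtain ⟨x1, x2, x3, x4, x5, x6, x7, x8⟩ := id gx
  have hpi : ∀ a b, π a = b → a = π b := by rintro a b rfl; exact (h2 a).symm
  have ys : y s = x t := by rw [a6, cswap_left]
  have yt : y t = x s := by rw [a6, cswap_right a1.ne]
  have yo : ∀ r, r ≠ s → r ≠ t → r ≠ π t → y r = x r := by
    intro r h h' h''; rw [a6, cswap_of_ne h h' h'']
  have htq := hcon.2
  have htP : t ≠ P := by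
    rintro rfl
    exact hcon.1 (gx.start_eq a1 (by omega) (by omega)) rfl
  have hPt : P ≠ π t := fun h => htq (hpi _ _ h.symm)
  have hj0 : x (π j) = 2 * n := hx.mov j (by omega) (by omega)
  have hjt : j ≠ π t := by
    rintro rfl; rw [h2] at hj0; omega
  have key : ∀ i, i < P → (P : ℕ) ≤ y i → y i + P < 2 * n → y i < y P :=
    fun i h h' h'' => (gy.start_eq h h' h'') ▸ hB
  by_cases hsj : s = j
  · subst hsj
    have yP : y P = x P := yo P (by omega) (by omega) hPt
    rcases lt_or_gt_of_ne htP with htP' | htP'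
    · have := key t htP' (by omega) (by omega)
      omega
    · have := key s x1 (by omega) (by omega)
      exact a5 P x1 htP' (by omega) (by omega)
  by_cases hsP : s = P
  · subst hsP
    have yj : y j = x j := yo j (by omega) (by omega) hjt
    have := key j x1 (by omega) (by omega)
    omega
  have yP : y P = x P := yo P (Ne.symm hsP) (Ne.symm htP) hPt
  by_cases htj : t = j
  · subst htj
    have := key s (by omega) (by omega) (by omega)
    omega
  · have yj : y j = x j := yo j (Ne.symm hsj) (Ne.symm htj) hjt
    have := key j x1 (by omega) (by omega)
    omega

/-! ### Multiplicities -/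

open Classical in
/-- The number of strands over the segment from `p` to `p + 1`. -/
noncomputable def cmult (x : Fin n → ℕ) (p : ℕ) : ℕ := (Finset.univ.filter fun s => Cov x s p).card

theorem IsConf.cov_cswap (hx : IsConf π x) (h2 : ∀ s, π (π s) = s) (hne : ∀ s, π s ≠ s)
    (hst : s < t) (h : (t : ℕ) ≤ x s) (h1 : x s + t < 2 * n)
    (h3 : (t : ℕ) ≤ x t) (h4 : x t + t < 2 * n) (r : Fin n) (p : ℕ) :
    Cov (cswap π s t x) r p ↔ Cov x ((if p < t then Equiv.refl _ else Equiv.swap s t) r) p := by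
  have hps := hx.pair_ne_of_start h2 hst h h1 h3 h4
  have hpt := hne t
  have ys : cswap π s t x s = x t := cswap_left
  have yt : cswap π s t x t = x s := cswap_right hst.ne
  have yq := cswap_pair (x := x) hps hpt
  have hm := hx.mov t
  have hr := hx.horR t
  have hl := hx.horL t
  by_cases h5 : r = s
  · subst h5
    split_ifs with h6
    · simp only [Cov, ys, Equiv.refl_apply]; omega
    · simp only [Cov, ys, Equiv.swap_apply_left]; omega
  by_cases h6 : r = t
  · subst h6
    split_ifs with h6
    · simp only [Cov, yt, Equiv.refl_apply]; omega
    · simp only [Cov, yt, Equiv.swap_apply_right]; omega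
  have h7 : (if p < t then Equiv.refl _ else Equiv.swap s t) r = r := by
    split_ifs
    · rfl
    · exact Equiv.swap_apply_of_ne_of_ne h5 h6
  rw [h7]
  by_cases h8 : r = π t
  · subst h8
    have h9 : (π t : ℕ) < n := (π t).isLt
    simp only [Cov, yq]
    split_ifs <;> omega
  · simp only [Cov, cswap_of_ne h5 h6 h8]

theorem IsConf.cmult_cswap (hx : IsConf π x) (h2 : ∀ s, π (π s) = s) (hne : ∀ s, π s ≠ s)
    (hst : s < t) (h : (t : ℕ) ≤ x s) (h1 : x s + t < 2 * n)
    (h3 : (t : ℕ) ≤ x t) (h4 : x t + t < 2 * n) : cmult (cswap π s t x) = cmult x := by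
  classical
  funext p
  unfold cmult
  refine Finset.card_equiv (if p < t then Equiv.refl _ else Equiv.swap s t) fun r => ?_
  simpa using hx.cov_cswap h2 hne hst h h1 h3 h4 r p

theorem IsArrow.cmult_eq (ha : IsArrow π s t x y) (hx : IsConf π x) (h2 : ∀ s, π (π s) = s)
    (hne : ∀ s, π s ≠ s) : cmult y = cmult x := by
  obtain ⟨h3, h4, h5, h6, h7, rfl⟩ := ha
  exact hx.cmult_cswap h2 hne h3 (by omega) h6 h4 (by omega)

theorem cmult_le_one_iff {p : ℕ} : cmult x p ≤ 1 ↔ ∀ s s', Cov x s p → Cov x s' p → s = s' := by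
  classical
  simp [cmult, Finset.card_le_one]
  tauto

theorem cmult_ne_zero_iff {p : ℕ} : cmult x p ≠ 0 ↔ ∃ s, Cov x s p := by
  classical
  simp [cmult, Finset.card_eq_zero, Finset.filter_eq_empty_iff]

end

/-! ### The key point -/

theorem finRotate_eq_of_val_succ {n : ℕ} {p P : Fin n} (h : p.val + 1 = P.val) :
    finRotate n p = P := by
  cases n with
  | zero => exact p.elim0
  | succ n =>
    apply Fin.ext
    rw [← h]
    refine coe_finRotate_of_ne_last fun h' => ?_
    have := P.isLt
    rw [h', Fin.val_last] at h
    omega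

section
variable {k : ℕ} (Z : PMC k)

/-- `P` is the upper end of the first segment in the boundary order at which `m` does not vanish. -/
def IsFirst (m : ℕ → ℕ) (P : Fin (4 * k)) : Prop :=
  ∃ p top : Fin (4 * k), p.val + 1 = P.val ∧ top.val + 1 = 4 * k ∧
    ∃ r : ℕ, (Z.next ^ r) top = p ∧ m p ≠ 0 ∧ ∀ r' < r, m ((Z.next ^ r') top) = 0

/-- The point at which the homotopy acts. -/
def IsPivot (m : ℕ → ℕ) (P : Fin (4 * k)) : Prop :=
  ((∀ p : Fin (4 * k), m p ≤ 1) ∧ IsFirst Z m P) ∨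
    (1 < m P ∧ ∀ p : Fin (4 * k), p < P → m p ≤ 1)

variable {Z} {m : ℕ → ℕ} {P P' : Fin (4 * k)}

theorem IsPivot.unique (h : IsPivot Z m P) (h' : IsPivot Z m P') : P = P' := by
  rcases h with ⟨h0, p, top, h1, h2, r, h3, h4, h5⟩ | ⟨h1, h2⟩
  · rcases h' with ⟨_, p', top', h1', h2', r', h3', h4', h5'⟩ | ⟨h1', _⟩
    · have ht : top = top' := Fin.ext (by omega)
      subst ht
      have hr : r = r' := by
        rcases lt_trichotomy r r' with h | h | h
        · exact absurd (h5' r h) (by rwa [h3])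
        · exact h
        · exact absurd (h5 r' h) (by rwa [h3'])
      subst hr
      rw [h3] at h3'
      subst h3'
      exact Fin.ext (by omega)
    · have := h0 P'; omega
  · rcases h' with ⟨h0, _⟩ | ⟨h1', h2'⟩
    · have := h0 P; omega
    · rcases lt_trichotomy P P' with h | h | h
      · have := h2' P h; omega
      · exact h
      · have := h2 P' h; omega

theorem exists_isPivot (hm : ∃ p : Fin (4 * k), m p ≠ 0) (htop : m (4 * k - 1) = 0) :
    ∃ P, IsPivot Z m P := by
  classical
  obtain ⟨p, hp⟩ := hm
  by_cases h1 : ∀ p : Fin (4 * k), m p ≤ 1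
  · have hk := p.isLt
    let top : Fin (4 * k) := ⟨4 * k - 1, by omega⟩
    have hex : ∃ r : ℕ, m ((Z.next ^ r) top) ≠ 0 := by
      obtain ⟨r, _, hr⟩ := (Z.connected top p).exists_pow_eq'
      exact ⟨r, by rw [show Z.next = (finRotate (4 * k))⁻¹ * Z.pair from rfl, hr]; exact hp⟩
    have hf := Nat.find_spec hex
    set p' := (Z.next ^ Nat.find hex) top with hp'
    have hne : (p' : ℕ) ≠ 4 * k - 1 := fun h => hf (by rw [h, htop])
    refine ⟨⟨p' + 1, by omega⟩, Or.inl ⟨h1, p', top, rfl, ?_, Nat.find hex, rfl, hf, ?_⟩⟩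
    · change 4 * k - 1 + 1 = 4 * k; omega
    · intro r' hr'
      simpa using Nat.find_min hex hr'
  · push Not at h1
    have hex : ∃ q : ℕ, ∃ h : q < 4 * k, 1 < m q := by
      obtain ⟨q, hq⟩ := h1; exact ⟨q, q.isLt, hq⟩
    obtain ⟨h2, h3⟩ := Nat.find_spec hex
    refine ⟨⟨Nat.find hex, h2⟩, Or.inr ⟨h3, fun p hp => ?_⟩⟩
    have := Nat.find_min hex (m := p) hp
    push Not at this
    exact this p.isLt

variable {x : Fin (4 * k) → ℕ}

theorem cmult_top (x : Fin (4 * k) → ℕ) : cmult x (4 * k - 1) = 0 := by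
  by_contra h
  obtain ⟨s, h1, h2, h3⟩ := cmult_ne_zero_iff.mp h
  omega

theorem IsPivot.good (h : IsPivot Z (cmult x) P) (hx : IsConf Z.pair x) :
    ∃ j, Good Z.pair x P j := by
  rcases h with ⟨h0, p, top, h1, h2, r, h3, h4, h5⟩ | ⟨h1, h2⟩
  · obtain ⟨j, c1, c2, c3⟩ := cmult_ne_zero_iff.mp h4
    have hr : r ≠ 0 := by
      rintro rfl
      rw [pow_zero, Equiv.Perm.one_apply] at h3
      subst h3
      have := P.isLt
      omega
    obtain ⟨r, rfl⟩ := Nat.exists_eq_succ_of_ne_zero hr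
    have h6 := h5 r (Nat.lt_succ_self r)
    have h7 : (Z.next ^ r) top = Z.pair P := by
      rw [pow_succ', Equiv.Perm.mul_apply, PMC.next, Equiv.Perm.mul_apply,
        Equiv.Perm.inv_eq_iff_eq] at h3
      have h8 : finRotate (4 * k) p = P := finRotate_eq_of_val_succ h1
      rw [h8] at h3
      rw [← h3, Z.pair_pair]; rfl
    rw [h7] at h6
    have h8 : ∀ s, ¬ Cov x s (Z.pair P) := by
      intro s hs
      exact absurd h6 (cmult_ne_zero_iff.mpr ⟨s, hs⟩)
    have hnm : ¬ ((Z.pair P : ℕ) < x (Z.pair P) ∧ x (Z.pair P) + Z.pair P + 1 < 2 * (4 * k)) :=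
      fun h => h8 _ ⟨le_rfl, h.1, h.2⟩
    have hst : (P : ℕ) ≤ x P ∧ P + x P < 2 * (4 * k) := by
      rcases hx.valid P with h | h
      · exact h
      · exfalso
        have h9 := hx.none P h
        have h10 := hx.horR (Z.pair P)
        have h11 := hx.horL (Z.pair P)
        rw [Z.pair_pair] at h10 h11
        rcases hx.valid (Z.pair P) with h12 | h12
        · refine hnm ⟨?_, ?_⟩ <;> omega
        · exact h9 h12
    refine ⟨j, ⟨by omega, by omega, by omega, ?_, hst.1, by omega, hnm, Or.inl h8⟩⟩
    intro s s' q hq hs hs'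
    exact cmult_le_one_iff.mp (h0 ⟨q, by omega⟩) s s' hs hs'
  · have huniq : ∀ s s' q, q < (P : ℕ) → Cov x s q → Cov x s' q → s = s' := by
      intro s s' q hq hs hs'
      have hP := P.isLt
      exact cmult_le_one_iff.mp (h2 ⟨q, by omega⟩ hq) s s' hs hs'
    have : ∃ s s', Cov x s P ∧ Cov x s' P ∧ s ≠ s' := by
      by_contra hcon
      push Not at hcon
      have := cmult_le_one_iff.mpr hcon
      omega
    obtain ⟨s, s', ⟨a1, a2, a3⟩, ⟨b1, b2, b3⟩, hne⟩ := this
    have main : ∀ s s' : Fin (4 * k), s ≠ s' → (s : ℕ) ≤ P → (P : ℕ) < x s →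
        x s + P + 1 < 2 * (4 * k) → (s' : ℕ) ≤ P → (P : ℕ) < x s' →
        x s' + P + 1 < 2 * (4 * k) → s < s' → ∃ j, Good Z.pair x P j := by
      intro s s' hne a1 a2 a3 b1 b2 b3 hlt
      have hs' : s' = P := by
        by_contra h
        exact hne (huniq s s' (P - 1) (by omega) ⟨by omega, by omega, by omega⟩
          ⟨by omega, by omega, by omega⟩)
      subst hs'
      refine ⟨s, hlt, by omega, by omega, huniq, by omega, by omega, ?_, Or.inr ⟨b2, b3⟩⟩
      rw [hx.mov s' b2 b3]; omega
    rcases lt_or_gt_of_ne hne with h | h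
    · exact main s s' hne a1 a2 a3 b1 b2 b3 h
    · exact main s' s hne.symm b1 b2 b3 a1 a2 a3 h

end

/-! ### Resolving crossings of injective functions -/

section
variable {α β : Type*} [LinearOrder α] [LinearOrder β]

/-- `s` and `t` are inverted by `f`, and no point between them has its value between theirs. -/
def MinInv (f : α → β) (s t : α) : Prop :=
  s < t ∧ f t < f s ∧ ∀ p, s < p → p < t → f t < f p → f p < f s → False

/-- `g` arises from `f` by resolving one crossing, the number of crossings dropping by one. -/
def Resolves (f g : α → β) : Prop := ∃ s t, MinInv f s t ∧ g = f ∘ Equiv.swap s t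

variable {f g h : α → β} {i i' : α}

theorem Resolves.injective (hr : Resolves f g) (hf : f.Injective) : g.Injective := by
  obtain ⟨s, t, -, rfl⟩ := hr
  exact hf.comp (Equiv.injective _)

theorem swap_lt_swap (hi : i ⋖ i') {s t : α} (hst : s < t) (hne : ¬ (s = i ∧ t = i')) :
    Equiv.swap i i' s < Equiv.swap i i' t := by
  have hlt := hi.lt
  have hb : ∀ p, i < p → p < i' → False := fun p h h' => hi.2 h h'
  simp only [Equiv.swap_apply_def]
  split_ifs with h1 h2 h3 h4 h5 h6 h7 h8 <;> subst_vars
  all_goals grind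

theorem comp_swap_comp_swap (i i' : α) (f : α → β) :
    (f ∘ Equiv.swap i i') ∘ Equiv.swap i i' = f := by
  funext r; simp

theorem Resolves.comp_swap (hi : i ⋖ i') (hf : f.Injective) (hr : Resolves f g)
    (hAB : f i' < f i ∧ g i' < g i ∨ f i < f i' ∧ g i < g i') :
    Resolves (f ∘ Equiv.swap i i') (g ∘ Equiv.swap i i') := by
  obtain ⟨s, t, ⟨h1, h2, h3⟩, rfl⟩ := hr
  have hlt := hi.lt
  have hne : ¬ (s = i ∧ t = i') := by
    rintro ⟨rfl, rfl⟩
    simp at hAB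
    rcases hAB with h | h
    · exact lt_asymm h.1 h.2
    · exact lt_asymm h.1 h.2
  refine ⟨Equiv.swap i i' s, Equiv.swap i i' t, ⟨swap_lt_swap hi h1 hne, by simpa using h2, ?_⟩, ?_⟩
  · intro p p1 p2 p3 p4
    obtain ⟨q, rfl⟩ : ∃ q, p = Equiv.swap i i' q := ⟨Equiv.swap i i' p, by simp⟩
    simp only [Function.comp, Equiv.swap_apply_self] at p3 p4
    by_cases hsq : s < q
    · by_cases hqt : q < t
      · exact h3 q hsq hqt p3 p4
      · have htq : t < q := lt_of_le_of_ne (not_lt.mp hqt) (by rintro rfl; exact lt_irrefl _ p3)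
        by_cases h5 : t = i ∧ q = i'
        · obtain ⟨rfl, rfl⟩ := h5
          have e1 : (f ∘ Equiv.swap s t) t = f s := by simp
          have e2 : (f ∘ Equiv.swap s t) q = f q := by
            simp [Equiv.swap_apply_of_ne_of_ne hsq.ne' htq.ne']
          rw [e1, e2] at hAB
          rcases hAB with h | h
          · exact lt_asymm h.1 p3
          · exact lt_asymm h.2 p4
        · exact lt_asymm p2 (swap_lt_swap hi htq h5)
    · have hqs : q < s := lt_of_le_of_ne (not_lt.mp hsq) (by rintro rfl; exact lt_irrefl _ p4)
      by_cases h5 : q = i ∧ s = i'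
      · obtain ⟨rfl, rfl⟩ := h5
        have e1 : (f ∘ Equiv.swap s t) s = f t := by simp
        have e2 : (f ∘ Equiv.swap s t) q = f q := by
          simp [Equiv.swap_apply_of_ne_of_ne hqs.ne (hqs.trans h1).ne]
        rw [e1, e2] at hAB
        rcases hAB with h | h
        · exact lt_asymm h.1 p4
        · exact lt_asymm h.2 p3
      · exact lt_asymm p1 (swap_lt_swap hi hqs h5)
  · funext r
    simp only [Function.comp]
    congr 1
    have := Equiv.swap_apply_apply (Equiv.swap i i') s t
    rw [this]
    simp

theorem Resolves.comp_swap_iff (hi : i ⋖ i') (hf : f.Injective) (hg : g.Injective)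
    (hAB : f i' < f i ∧ g i' < g i ∨ f i < f i' ∧ g i < g i') :
    Resolves (f ∘ Equiv.swap i i') (g ∘ Equiv.swap i i') ↔ Resolves f g := by
  refine ⟨fun hr => ?_, fun hr => hr.comp_swap hi hf hAB⟩
  have := hr.comp_swap hi (hf.comp (Equiv.injective _)) (by simpa using hAB.symm)
  rwa [comp_swap_comp_swap, comp_swap_comp_swap] at this

theorem Resolves.eq_comp_swap_iff (hi : i ⋖ i')
    (hA : f i' < f i) (hB : g i < g i') : Resolves f g ↔ g = f ∘ Equiv.swap i i' := by
  constructor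
  · rintro ⟨s, t, ⟨h1, h2, h3⟩, rfl⟩
    have hlt := hi.lt
    have hb : ∀ p, i < p → p < i' → False := fun p h h' => hi.2 h h'
    by_cases hne : s = i ∧ t = i'
    · rw [hne.1, hne.2]
    exfalso
    simp only [Function.comp, Equiv.swap_apply_def] at hB
    split_ifs at hB <;> subst_vars
    all_goals grind
  · rintro rfl
    exact ⟨i, i', ⟨hi.lt, hA, fun p h h' => (hi.2 h h').elim⟩, rfl⟩

variable [Fintype α] [Fintype β]

open Classical in
/-- Resolving two crossings one after the other gives zero modulo two. -/
theorem sum_resolves_resolves (f h : α → β) (hf : f.Injective) :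
    ∑ g : α → β, (if Resolves f g then 1 else 0) * (if Resolves g h then 1 else 0) = (0 : ZMod 2) := by
  by_cases hh : h.Injective
  swap
  · refine Finset.sum_eq_zero fun g _ => ?_
    split_ifs with h1 h2 <;> simp
    exact hh (h2.injective (h1.injective hf))
  have two : ∀ a : ZMod 2, a + a = 0 := fun a => CharTwo.add_self_eq_zero a
  letI : LocallyFiniteOrder α := Fintype.toLocallyFiniteOrder
  haveI : WellFoundedLT (Lex (α → β)) := inferInstance
  obtain ⟨f', hf'⟩ : ∃ f' : Lex (α → β), f' = toLex f := ⟨_, rfl⟩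
  induction f' using WellFoundedLT.induction generalizing f h with
  | ind f' ih =>
  by_cases hm : ∀ a b : α, a ⋖ b → f a ≤ f b
  · have := (monotone_iff_forall_covBy f).mpr hm
    refine Finset.sum_eq_zero fun g _ => ?_
    rw [if_neg, zero_mul]
    rintro ⟨s, t, ⟨h1, h2, -⟩, -⟩
    exact absurd (this h1.le) (not_le.mpr h2)
  push Not at hm
  obtain ⟨i, i', hi, hA⟩ := hm
  set σ := Equiv.swap i i' with hσ
  have hfσ : (f ∘ σ).Injective := hf.comp σ.injective
  have hhσ : (h ∘ σ).Injective := hh.comp σ.injective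
  have hfB : (f ∘ σ) i < (f ∘ σ) i' := by simpa [hσ] using hA
  have hlex : toLex (f ∘ σ) < toLex f := by
    refine ⟨i, fun j hj => ?_, ?_⟩
    · change f (σ j) = f j
      rw [hσ, Equiv.swap_apply_of_ne_of_ne hj.ne (hj.trans hi.lt).ne]
    · change f (σ i) < f i
      simpa [hσ] using hA
  have dich : ∀ g : α → β, g.Injective → g i' < g i ∨ g i < g i' := fun g hg =>
    (lt_or_gt_of_ne (hg.ne hi.lt.ne)).symm
  rcases dich h hh with hz | hz
  · have hzB : (h ∘ σ) i < (h ∘ σ) i' := by simpa [hσ] using hz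
    have key := ih (toLex (f ∘ σ)) (hf' ▸ hlex) (f ∘ σ) (h ∘ σ) hfσ hhσ rfl
    rw [← Equiv.sum_comp (Equiv.arrowCongr σ (Equiv.refl β))] at key
    have e : ∀ g : α → β, (Equiv.arrowCongr σ (Equiv.refl β)) g = g ∘ σ := by
      intro g; funext r; simp [hσ]
    simp only [e] at key
    have : ∀ g : α → β, ((if Resolves f g then 1 else 0) * (if Resolves g h then 1 else 0) +
        (if Resolves (f ∘ σ) (g ∘ σ) then 1 else 0) * (if Resolves (g ∘ σ) (h ∘ σ) then 1 else 0) :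
          ZMod 2) = (if g = f ∘ σ then (if Resolves (f ∘ σ) h then 1 else 0) else 0) +
          (if g = h ∘ σ then (if Resolves (f ∘ σ) h then 1 else 0) else 0) := by
      intro g
      by_cases hg : g.Injective
      · rcases dich g hg with hgA | hgB
        · have n1 : g ≠ f ∘ σ := by rintro rfl; exact lt_asymm hgA hfB
          have n2 : g ≠ h ∘ σ := by rintro rfl; exact lt_asymm hgA hzB
          rw [if_congr (Resolves.comp_swap_iff hi hf hg (Or.inl ⟨hA, hgA⟩)) rfl rfl,
            if_congr (Resolves.comp_swap_iff hi hg hh (Or.inl ⟨hgA, hz⟩)) rfl rfl, two,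
            if_neg n1, if_neg n2, add_zero]
        · have e1 : Resolves f g ↔ g = f ∘ σ := Resolves.eq_comp_swap_iff hi hA hgB
          have hgA' : (g ∘ σ) i' < (g ∘ σ) i := by simpa [hσ] using hgB
          have e2 : Resolves (g ∘ σ) (h ∘ σ) ↔ g = h ∘ σ := by
            rw [Resolves.eq_comp_swap_iff hi hgA' hzB, comp_swap_comp_swap]
            exact eq_comm
          rw [if_congr e1 rfl rfl, if_congr e2 rfl rfl]
          congr 1
          · split_ifs with h1 h2 h3 <;> simp_all
          · by_cases h1 : g = h ∘ σ
            · subst h1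
              rw [hσ, comp_swap_comp_swap]; simp
            · simp [h1]
      · have n1 : g ≠ f ∘ σ := by rintro rfl; exact hg hfσ
        have n2 : g ≠ h ∘ σ := by rintro rfl; exact hg hhσ
        have n3 : ¬ Resolves f g := fun hr => hg (hr.injective hf)
        have n4 : ¬ Resolves (f ∘ σ) (g ∘ σ) := fun hr => hg (by
          have := (hr.injective hfσ).comp σ.injective
          rwa [hσ, comp_swap_comp_swap] at this)
        rw [if_neg n1, if_neg n2, if_neg n3, if_neg n4]; simp
    have h4 := Finset.sum_congr rfl fun g (_ : g ∈ Finset.univ) => this g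
    rw [Finset.sum_add_distrib, Finset.sum_add_distrib, key, add_zero] at h4
    rw [h4]
    simp [two]
  · have hzA : (h ∘ σ) i' < (h ∘ σ) i := by simpa [hσ] using hz
    have this : ∀ g : α → β, ((if Resolves f g then 1 else 0) * (if Resolves g h then 1 else 0) :
        ZMod 2) = (if g = h ∘ σ then (if Resolves f (h ∘ σ) then 1 else 0) else 0) +
          (if g = f ∘ σ then (if Resolves f (h ∘ σ) then 1 else 0) else 0) := by
      intro g
      by_cases hg : g.Injective
      · rcases dich g hg with hgA | hgB
        · have n1 : g ≠ f ∘ σ := by rintro rfl; exact lt_asymm hgA hfB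
          have e2 : Resolves g h ↔ g = h ∘ σ := by
            rw [Resolves.eq_comp_swap_iff hi hgA hz]
            constructor
            · rintro rfl; rw [hσ, comp_swap_comp_swap]
            · rintro rfl; rw [hσ, comp_swap_comp_swap]
          rw [if_neg n1, add_zero, if_congr e2 rfl rfl]
          split_ifs <;> simp_all
        · have n2 : g ≠ h ∘ σ := by rintro rfl; exact lt_asymm hgB hzA
          have e1 : Resolves f g ↔ g = f ∘ σ := Resolves.eq_comp_swap_iff hi hA hgB
          rw [if_neg n2, zero_add, if_congr e1 rfl rfl]
          by_cases h1 : g = f ∘ σ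
          · subst h1
            have := Resolves.comp_swap_iff hi hf hhσ (Or.inl ⟨hA, hzA⟩)
            rw [← hσ] at this
            rw [show (h ∘ σ) ∘ σ = h from comp_swap_comp_swap i i' h] at this
            simp [this]
          · simp [h1]
      · have n1 : g ≠ f ∘ σ := by rintro rfl; exact hg hfσ
        have n2 : g ≠ h ∘ σ := by rintro rfl; exact hg hhσ
        have n3 : ¬ Resolves f g := fun hr => hg (hr.injective hf)
        rw [if_neg n1, if_neg n2, if_neg n3]; simp
    rw [Finset.sum_congr rfl fun g _ => this g, Finset.sum_add_distrib]
    simp [two]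

end

section
variable {n : ℕ} {π : Fin n → Fin n} {x y z : Fin n → ℕ} {s t p q : Fin n}

/-- A moving strand starts at `r`. -/
def Mov (x : Fin n → ℕ) (r : Fin n) : Prop := (r : ℕ) < x r ∧ x r + r + 1 < 2 * n

theorem IsArrow.mov_left (ha : IsArrow π s t x y) : Mov x s := by
  obtain ⟨a1, a2, a3, a4, -, -⟩ := ha
  exact ⟨by omega, by omega⟩

theorem IsArrow.apply_left (ha : IsArrow π s t x y) : y s = x t := by
  rw [ha.eq, cswap_left]

theorem IsArrow.apply_right (ha : IsArrow π s t x y) : y t = x s := by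
  rw [ha.eq, cswap_right ha.lt.ne]

theorem IsArrow.apply_of_ne (ha : IsArrow π s t x y) {r : Fin n} (h1 : r ≠ s) (h2 : r ≠ t)
    (h3 : r ≠ π t) : y r = x r := by
  rw [ha.eq, cswap_of_ne h1 h2 h3]

theorem IsArrow.pair_ne (ha : IsArrow π s t x y) (hx : IsConf π x) (h2 : ∀ s, π (π s) = s) :
    π t ≠ s := by
  obtain ⟨a1, a2, a3, a4, -, -⟩ := ha
  exact hx.pair_ne_of_start h2 a1 (by omega) (by omega) (by omega) (by omega)

theorem IsArrow.not_mov_pair (ha : IsArrow π s t x y) (hx : IsConf π x)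
    (h2 : ∀ s, π (π s) = s) : ¬ Mov x (π t) := by
  intro h
  have := hx.mov _ h.1 h.2
  rw [h2] at this
  have := ha.inv; have := ha.up
  omega

theorem IsArrow.mov_or (ha : IsArrow π s t x y) (hx : IsConf π x) (h2 : ∀ s, π (π s) = s)
    (hne : ∀ s, π s ≠ s) {r : Fin n} (h : Mov y r) : Mov x r ∨ r = t := by
  by_cases h3 : r = s
  · exact Or.inl (h3 ▸ ha.mov_left)
  by_cases h4 : r = t
  · exact Or.inr h4
  by_cases h5 : r = π t
  · have hy := ha.conf hx h2 hne
    have := hy.mov r h.1 h.2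
    rw [h5, h2, ha.apply_right] at this
    have := ha.up
    omega
  · left
    have := ha.apply_of_ne h3 h4 h5
    exact ⟨by rw [← this]; exact h.1, by rw [← this]; exact h.2⟩

/-- The end of a moving strand stays an end. -/
theorem IsArrow.exists_eq (ha : IsArrow π s t x y) (hx : IsConf π x) (h2 : ∀ s, π (π s) = s)
    {r : Fin n} (h : Mov x r) : ∃ r', y r' = x r := by
  by_cases h3 : r = s
  · exact ⟨t, by rw [h3, ha.apply_right]⟩
  by_cases h4 : r = t
  · exact ⟨s, by rw [h4, ha.apply_left]⟩
  exact ⟨r, ha.apply_of_ne h3 h4 (fun h5 => ha.not_mov_pair hx h2 (h5 ▸ h))⟩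

/-- The points at which paths of two arrows from `x` to `z` act. -/
def Section (π : Fin n → Fin n) (x z : Fin n → ℕ) (r : Fin n) : Prop :=
  Mov x r ∨ (x r + r + 1 = 2 * n ∧ r < π r) ∨
    (x r = r ∧ (Mov z r ∨ (z r = r ∧ r < π r) ∨ (z r + r + 1 = 2 * n ∧ ∃ u, z u = r)))

theorem IsArrow.section_right (hx : IsConf π x)
    (h2 : ∀ s, π (π s) = s) (hne : ∀ s, π s ≠ s)
    (ha : IsArrow π s t x y) (hb : IsArrow π p q y z) :
    Section π x z t := by
  have hy := ha.conf hx h2 hne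
  have hz := hb.conf hy h2 hne
  have a1 := ha.lt; have a2 := ha.le; have a3 := ha.inv; have a4 := ha.up
  have b1 := hb.lt; have b2 := hb.le; have b3 := hb.inv; have b4 := hb.up
  by_cases hm : Mov x t
  · exact Or.inl hm
  have hxt : x t = t := by
    by_contra h; exact hm ⟨by omega, by omega⟩
  refine Or.inr (Or.inr ⟨hxt, ?_⟩)
  have hys : y s = t := by rw [ha.apply_left, hxt]
  have hyt := ha.apply_right
  obtain ⟨u, hu⟩ := hb.exists_eq hy h2 (r := s) ⟨by omega, by omega⟩
  have hzt : Mov z t ∨ z t + t + 1 = 2 * n := by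
    have h3 : z t = y t ∨ z t = y q ∧ t = p ∨ z t = y p ∧ t = q ∨ t = π q := by
      by_cases h3 : t = p
      · exact Or.inr (Or.inl ⟨h3 ▸ hb.apply_left, h3⟩)
      by_cases h4 : t = q
      · exact Or.inr (Or.inr (Or.inl ⟨h4 ▸ hb.apply_right, h4⟩))
      by_cases h5 : t = π q
      · exact Or.inr (Or.inr (Or.inr h5))
      · exact Or.inl (hb.apply_of_ne h3 h4 h5)
    rcases h3 with h3 | ⟨h3, h4⟩ | ⟨h3, h4⟩ | h3
    · unfold Mov; omega
    · left; constructor <;> omega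
    · subst h4; unfold Mov; omega
    · exfalso
      have h5 : ¬ Mov y t := h3 ▸ hb.not_mov_pair hy h2
      have h6 : y t + t + 1 = 2 * n := by
        by_contra h; exact h5 ⟨by omega, by omega⟩
      have := hy.horL t h6
      rw [h3, h2] at this
      omega
  rcases hzt with h | h
  · exact Or.inl h
  · exact Or.inr (Or.inr ⟨h, u, by omega⟩)

theorem IsArrow.section_mov (hx : IsConf π x)
    (h2 : ∀ s, π (π s) = s) (hne : ∀ s, π s ≠ s)
    (ha : IsArrow π s t x y) (hb : IsArrow π p q y z) {r : Fin n}
    (hr : Mov y r) : Section π x z r := by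
  rcases ha.mov_or hx h2 hne hr with h | h
  · exact Or.inl h
  · exact h ▸ ha.section_right hx h2 hne hb

theorem IsArrow.horR_of_horR (hx : IsConf π x)
    (h2 : ∀ s, π (π s) = s) (hne : ∀ s, π s ≠ s)
    (ha : IsArrow π s t x y) {r : Fin n} (hr : y r = r) :
    x r = r ∧ r ≠ t ∧ r ≠ π t := by
  have hy := ha.conf hx h2 hne
  have a1 := ha.lt; have a2 := ha.le; have a3 := ha.inv; have a4 := ha.up
  have h1 := ha.apply_left
  have h4 := ha.apply_right
  have h3 : r ≠ s := by rintro rfl; omega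
  have h5 : r ≠ t := by rintro rfl; omega
  have h6 : r ≠ π t := by
    rintro rfl
    have := hy.horR _ hr
    rw [h2] at this
    omega
  exact ⟨by rw [← ha.apply_of_ne h3 h5 h6, hr], h5, h6⟩

theorem IsArrow.section_right' (hx : IsConf π x)
    (h2 : ∀ s, π (π s) = s) (hne : ∀ s, π s ≠ s)
    (ha : IsArrow π s t x y) (hb : IsArrow π p q y z) :
    Section π x z q := by
  have hy := ha.conf hx h2 hne
  have b1 := hb.lt; have b2 := hb.le; have b3 := hb.inv; have b4 := hb.up
  by_cases hm : Mov y q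
  · exact ha.section_mov hx h2 hne hb hm
  have hyq : y q = q := by
    by_contra h; exact hm ⟨by omega, by omega⟩
  have h3 := hb.apply_right
  refine Or.inr (Or.inr ⟨(ha.horR_of_horR hx h2 hne hyq).1, ?_⟩)
  by_cases h : z q + q + 1 = 2 * n
  · exact Or.inr (Or.inr ⟨h, p, by rw [hb.apply_left, hyq]⟩)
  · exact Or.inl ⟨by omega, by omega⟩

/-- The points of the section form a set of representatives of the pairs. -/
theorem IsArrow.section_pair (hx : IsConf π x)
    (h2 : ∀ s, π (π s) = s) (hne : ∀ s, π s ≠ s)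
    (ha : IsArrow π s t x y) (hb : IsArrow π p q y z) (r : Fin n) :
    Section π x z (π r) ↔ ¬ Section π x z r := by
  have hy := ha.conf hx h2 hne
  have hz := hb.conf hy h2 hne
  have hr := hne r
  have hlt : r < π r ↔ ¬ π r < r := by
    constructor
    · intro h; exact not_lt.mpr h.le
    · intro h; exact lt_of_le_of_ne (not_lt.mp h) hr.symm
  -- the statement follows from these two halves, up to exchanging `r` and its partner
  have one : ∀ r, Mov x r → Section π x z r ∧ ¬ Section π x z (π r) := by
    intro r h
    refine ⟨Or.inl h, ?_⟩
    have := hx.mov r h.1 h.2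
    have h4 := (π r).isLt
    rintro (h5 | h5 | h5)
    · have := h5.2; omega
    · have := h5.1; omega
    · have := h5.1; omega
  have two : ∀ r, x r = r → Mov z r → Section π x z r ∧ ¬ Section π x z (π r) := by
    intro r h0 h
    refine ⟨Or.inr (Or.inr ⟨h0, Or.inl h⟩), ?_⟩
    have := hz.mov r h.1 h.2
    have := hx.horR r h0
    have h4 := (π r).isLt
    rintro (h5 | h5 | ⟨-, h5 | h5 | h5⟩)
    · have := h5.1; omega
    · have := h5.1; omega
    · have := h5.2; omega
    · have := h5.1; omega
    · have := h5.1; omega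
  have v1 := hx.valid r
  have w1 := hz.valid r
  by_cases m1 : Mov x r
  · have := one r m1; tauto
  by_cases m2 : Mov x (π r)
  · have := one _ m2; rw [h2] at this; tauto
  have hnn : x r ≠ 2 * n := by
    intro h
    have h4 := hx.none r h
    have h5 := hx.horR (π r)
    have h6 := hx.horL (π r)
    rw [h2] at h5 h6
    refine m2 ⟨?_, ?_⟩ <;> rcases hx.valid (π r) with h7 | h7 <;> omega
  by_cases hL : x r + r + 1 = 2 * n
  · have hL' := hx.horL r hL
    have h4 : ¬ x r = r := by omega
    have h5 : ¬ x (π r) = π r := by have := (π r).isLt; omega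
    simp only [Section, m1, m2, hL, hL', h4, h5, h2, true_and, false_or, false_and, or_false]
    rw [hlt, not_not]
  have hR : x r = r := by
    by_contra h; exact m1 ⟨by omega, by omega⟩
  have hR' := hx.horR r hR
  by_cases m3 : Mov z r
  · have := two r hR m3; tauto
  by_cases m4 : Mov z (π r)
  · have := two _ hR' m4; rw [h2] at this; tauto
  have hnn' : z r ≠ 2 * n := by
    intro h
    have h4 := hz.none r h
    have h5 := hz.horR (π r)
    have h6 := hz.horL (π r)
    rw [h2] at h5 h6
    refine m4 ⟨?_, ?_⟩ <;> rcases hz.valid (π r) with h7 | h7 <;> omega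
  have odd : ∀ u : Fin n, ¬ (u : ℕ) + u + 1 = 2 * n := fun u => by omega
  have hn1 : ¬ x (π r) + π r + 1 = 2 * n := by have := (π r).isLt; omega
  by_cases hL2 : z r + r + 1 = 2 * n
  · have hL2' := hz.horL r hL2
    have h4 : ¬ z r = r := by omega
    have h5 : ¬ z (π r) = π r := by have := (π r).isLt; omega
    simp only [Section, m1, m2, hL, hR, hR', hn1, m3, m4, h4, h5, h2, hL2, hL2', odd, true_and,
      false_or, false_and]
    rw [iff_not_comm]
    constructor
    · rintro ⟨u, hu⟩ ⟨v, hv⟩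
      have huv := hz.pairR u v r hu hv
      have h6 : ¬ Mov z u := by
        intro h
        have := hz.mov u h.1 h.2
        rw [← huv] at this
        have := (π r).isLt
        omega
      have h7 : z u = u := by
        by_contra h
        rcases hz.valid u with h8 | h8
        · exact h6 ⟨by omega, by omega⟩
        · omega
      have : u = r := Fin.ext (by omega)
      subst this
      omega
    · intro hno
      by_contra hno2
      -- where the double horizontal strand disappears
      have main : ∀ r, x r = r → z r + r + 1 = 2 * n → (r = t ∨ r = q) → ∃ u, z u = r := by
        intro r h1 h3 h4
        by_cases h5 : r = t
        · obtain ⟨u, hu⟩ := hb.exists_eq hy h2 (r := s) (by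
            have a1 := ha.lt; have a2 := ha.le; have a3 := ha.inv; have a4 := ha.up
            have := ha.apply_left
            exact ⟨by omega, by omega⟩)
          exact ⟨u, by rw [hu, ha.apply_left, ← h5, h1]⟩
        · have h6 : r = q := by tauto
          refine ⟨p, ?_⟩
          rw [hb.apply_left, ← h6]
          by_cases h7 : r = π t
          · have h8 := ha.apply_right
            have a3 := ha.inv; have a2 := ha.le
            have b3 := hb.inv; have b4 := hb.up
            subst h7
            rw [ha.eq] at b3 ⊢
            rw [cswap_pair (ha.pair_ne hx h2) (hne t)]
            rw [← h6] at b3 b4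
            rw [cswap_pair (ha.pair_ne hx h2) (hne t)] at b3
            rw [ha.eq] at b4
            split_ifs at b3 with c1 c2 <;> omega
          · have h8 : r ≠ s := by
              rintro rfl
              have := ha.mov_left.1; omega
            rw [ha.apply_of_ne h8 h5 h7, h1]
      have h8 : ∀ r, x r = r → z r + r + 1 = 2 * n → r = t ∨ r = q ∨ π r = t ∨ π r = q := by
        intro r h1 h3
        by_contra h
        push Not at h
        have h4 : r ≠ s := by
          rintro rfl
          have := ha.mov_left.1; omega
        have h5 : y r = r := by
          rw [ha.apply_of_ne h4 h.1 (fun h6 => h.2.2.1 (by rw [h6, h2])), h1]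
        have h6 : r ≠ p := by
          rintro rfl
          have := hb.mov_left.1; omega
        have h7 : z r = r := by
          rw [hb.apply_of_ne h6 h.2.1 (fun h6 => h.2.2.2 (by rw [h6, h2])), h5]
        omega
      rcases h8 r hR hL2 with h | h | h | h
      · exact hno2 (main r hR hL2 (Or.inl h))
      · exact hno2 (main r hR hL2 (Or.inr h))
      · exact hno (main _ hR' hL2' (Or.inl h))
      · exact hno (main _ hR' hL2' (Or.inr h))
  · have hR2 : z r = r := by
      by_contra h; exact m3 ⟨by omega, by omega⟩
    have hR2' := hz.horR r hR2
    have hn2 : ¬ z (π r) + π r + 1 = 2 * n := by have := (π r).isLt; omega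
    simp only [Section, m1, m2, hL, hR, hR', hn1, m3, m4, hR2, hR2', h2, hL2, hn2, odd, true_and,
      false_or, false_and, or_false]
    rw [hlt, not_not]

end

section
variable {n : ℕ} {π : Fin n → Fin n} {x y z : Fin n → ℕ} {s t p q : Fin n}

/-- There is an arrow of the differential from `x` to `y`. -/
def HasArrow (π : Fin n → Fin n) (x y : Fin n → ℕ) : Prop := ∃ s t, IsArrow π s t x y

variable {c : Fin n → Prop}

theorem IsConf.lt_of_mem (hx : IsConf π x) (h2 : ∀ s, π (π s) = s)
    (hc : ∀ r, c (π r) ↔ ¬ c r) (hm : ∀ r, Mov x r → c r) {r : Fin n} (hr : c r) : x r < 2 * n := by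
  rcases hx.valid r with h | h
  · omega
  · exfalso
    have h4 := hx.none r h
    have h5 := hx.horR (π r)
    have h6 := hx.horL (π r)
    rw [h2] at h5 h6
    refine (hc r).mp (hm _ ⟨?_, ?_⟩) hr <;> rcases hx.valid (π r) with h7 | h7 <;> omega

theorem IsConf.eq_of_mem (hx : IsConf π x) (hy : IsConf π y) (h2 : ∀ s, π (π s) = s)
    (hc : ∀ r, c (π r) ↔ ¬ c r) (hm : ∀ r, Mov x r → c r) (h : ∀ r, c r → x r = y r) : x = y := by
  funext r
  by_cases hr : c r
  · exact h r hr
  · have hr' := (hc r).mpr hr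
    have := hx.pair_eq hy (h _ hr') (hx.lt_of_mem h2 hc hm hr')
    rwa [h2] at this

theorem IsConf.start_of_lt (hx : IsConf π x) {r : Fin n} (h : x r < 2 * n) :
    (r : ℕ) ≤ x r ∧ x r + r < 2 * n := by
  rcases hx.valid r with h | h <;> omega

theorem IsConf.hor_of_not_mem (hx : IsConf π x) (hm : ∀ r, Mov x r → c r) {r : Fin n}
    (hr : ¬ c r) : x r = r ∨ x r + r + 1 = 2 * n ∨ x r = 2 * n := by
  have := mt (hm r) hr
  unfold Mov at this
  rcases hx.valid r with h | h <;> omega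

theorem IsConf.isArrow_of_mem (hx : IsConf π x) (hy : IsConf π y) (h2 : ∀ s, π (π s) = s)
    (hne : ∀ s, π s ≠ s)
    (hc : ∀ r, c (π r) ↔ ¬ c r) (hm : ∀ r, Mov x r → c r) (hs : c s) (ht : c t)
    (hst : s < t) (hlt : x t < x s) (hup : x s + t < 2 * n)
    (hem : ∀ p, c p → s < p → p < t → x t < x p → x p < x s → False)
    (ys : y s = x t) (yt : y t = x s) (yo : ∀ r, c r → r ≠ s → r ≠ t → y r = x r) :
    IsArrow π s t x y := by
  have h3 := hx.start_of_lt (hx.lt_of_mem h2 hc hm ht)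
  refine ⟨hst, h3.1, hlt, hup, ?_, hx.eq_cswap hy h2 hne hst (by omega) hup h3.1 h3.2 ys yt ?_⟩
  · intro p p1 p2 p3 p4
    by_cases hp : c p
    · exact hem p hp p1 p2 p3 p4
    · rcases hx.hor_of_not_mem hm hp with h | h | h <;> omega
  · intro r r1 r2 r3
    by_cases hr : c r
    · exact yo r hr r1 r2
    have hr' := (hc r).mpr hr
    by_cases h4 : π r = s
    · have e1 := hx.mov s (by omega) (by omega)
      have e2 := hy.mov s (by omega) (by omega)
      rw [← h4, h2] at e1 e2
      rw [e1, e2]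
    · have h5 : π r ≠ t := fun h => r3 (by rw [← h, h2])
      have h6 := yo _ hr' h4 h5
      have := hx.pair_eq hy h6.symm (hx.lt_of_mem h2 hc hm hr')
      rw [h2] at this
      exact this.symm

open Classical in
/-- The differential squares to zero. -/
theorem sum_hasArrow_hasArrow {X : Type*} [Fintype X] (τ : X → Fin n → ℕ)
    (hτ : Function.Injective τ) (hconf : ∀ x, IsConf π (τ x))
    (hsurj : ∀ x, IsConf π x → ∃ a, τ a = x) (h2 : ∀ s, π (π s) = s) (hne : ∀ s, π s ≠ s)
    (a b : X) : ∑ u : X, (if HasArrow π (τ a) (τ u) then 1 else 0) *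
      (if HasArrow π (τ u) (τ b) then 1 else 0) = (0 : ZMod 2) := by
  by_cases hex : ∃ u, HasArrow π (τ a) (τ u) ∧ HasArrow π (τ u) (τ b)
  swap
  · push Not at hex
    refine Finset.sum_eq_zero fun u _ => ?_
    split_ifs with h3 h4
    · exact absurd h4 (hex u h3)
    all_goals simp
  obtain ⟨u0, ⟨s0, t0, ha0⟩, ⟨p0, q0, hb0⟩⟩ := hex
  obtain ⟨x, hx0⟩ : ∃ x, x = τ a := ⟨_, rfl⟩
  obtain ⟨z, hz0⟩ : ∃ z, z = τ b := ⟨_, rfl⟩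
  have hx : IsConf π x := hx0 ▸ hconf a
  have hz : IsConf π z := hz0 ▸ hconf b
  rw [← hx0] at ha0 ⊢
  rw [← hz0] at hb0 ⊢
  obtain ⟨c, hcdef⟩ : ∃ c, c = Section π x z := ⟨_, rfl⟩
  have hc : ∀ r, c (π r) ↔ ¬ c r := hcdef ▸ ha0.section_pair hx h2 hne hb0
  have hmx : ∀ r, Mov x r → c r := fun r h => hcdef ▸ Or.inl h
  have hmz : ∀ r, Mov z r → c r := by
    intro r h
    rcases hb0.mov_or (hconf u0) h2 hne h with h3 | h3
    · exact hcdef ▸ ha0.section_mov hx h2 hne hb0 h3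
    · exact hcdef ▸ h3 ▸ ha0.section_right' hx h2 hne hb0
  have restr : ∀ y : Fin n → ℕ, (∀ r, c r → y r < 2 * n) → ∃ f : {r // c r} → Fin (2 * n), ∀ r, (f r : ℕ) = y r :=
    fun y hy => ⟨fun r => ⟨y r, hy r r.2⟩, fun r => rfl⟩
  obtain ⟨fx, hfx⟩ := restr x fun r => hx.lt_of_mem h2 hc hmx
  obtain ⟨fz, hfz⟩ := restr z fun r => hz.lt_of_mem h2 hc hmz
  have hinj : Function.Injective fx := by
    intro r r' h
    have h3 : x r = x r' := by rw [← hfx, ← hfx, h]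
    exact Subtype.ext (hx.inj _ _ h3 (by rw [← hfx]; exact (fx r).isLt))
  -- restricting an arrow
  have down : ∀ (x y : Fin n → ℕ) (f g : {r // c r} → Fin (2 * n)), (∀ r, (f r : ℕ) = x r) →
      (∀ r, (g r : ℕ) = y r) → ∀ s t, IsArrow π s t x y → c s → c t → Resolves f g := by
    intro x y f g hf hg s t ha hs ht
    refine ⟨⟨s, hs⟩, ⟨t, ht⟩, ⟨ha.lt, ?_, ?_⟩, ?_⟩
    · rw [Fin.lt_def, hf, hf]; exact ha.inv
    · intro p p1 p2 p3 p4
      rw [Fin.lt_def, hf, hf] at p3 p4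
      exact ha.empty p p1 p2 p3 p4
    · funext r
      apply Fin.ext
      rw [Function.comp, hg, hf]
      by_cases h3 : r = ⟨s, hs⟩
      · rw [h3, Equiv.swap_apply_left]; exact ha.apply_left
      by_cases h4 : r = ⟨t, ht⟩
      · rw [h4, Equiv.swap_apply_right]; exact ha.apply_right
      rw [Equiv.swap_apply_of_ne_of_ne (by exact h3) (by exact h4)]
      refine ha.apply_of_ne (fun h => h3 (Subtype.ext h)) (fun h => h4 (Subtype.ext h)) fun h => ?_
      have := r.2
      rw [h, hc] at this
      exact this ht
  have mid : ∀ u, HasArrow π x (τ u) ∧ HasArrow π (τ u) z →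
      (∀ r, Mov (τ u) r → c r) ∧
      ∃ f : {r // c r} → Fin (2 * n), (∀ r, (f r : ℕ) = τ u r) ∧ Resolves fx f ∧ Resolves f fz := by
    rintro u ⟨⟨s, t, ha⟩, ⟨p, q, hb⟩⟩
    have hm : ∀ r, Mov (τ u) r → c r := fun r h => hcdef ▸ ha.section_mov hx h2 hne hb h
    obtain ⟨f, hf⟩ := restr (τ u) fun r => (hconf u).lt_of_mem h2 hc hm
    refine ⟨hm, f, hf, ?_, ?_⟩
    · exact down x (τ u) fx f hfx hf s t ha (hmx s ha.mov_left) (hcdef ▸ ha.section_right hx h2 hne hb)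
    · exact down (τ u) z f fz hf hfz p q hb (hm p hb.mov_left)
        (hcdef ▸ ha.section_right' hx h2 hne hb)
  choose hm F hF using mid
  refine Eq.trans ?_ (sum_resolves_resolves fx fz hinj)
  simp only [← ite_and, mul_ite, mul_one, mul_zero]
  rw [← Finset.sum_filter, ← Finset.sum_filter]
  refine Finset.sum_bij (fun u hu => F u (by simpa [and_comm] using hu)) ?_ ?_ ?_ (fun _ _ => rfl)
  · intro u hu
    have := (hF u (by simpa [and_comm] using hu)).2
    simpa [and_comm] using this
  · intro u hu v hv huv
    simp only [Finset.mem_filter, Finset.mem_univ, true_and] at hu hv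
    apply hτ
    refine (hconf u).eq_of_mem (hconf v) h2 hc (hm u hu.symm) fun r hr => ?_
    rw [← (hF u hu.symm).1 ⟨r, hr⟩, ← (hF v hv.symm).1 ⟨r, hr⟩, huv]
  · intro g hg
    simp only [Finset.mem_filter, Finset.mem_univ, true_and] at hg
    obtain ⟨⟨p, q, ⟨b1, b2, b3⟩, b4⟩, ⟨s, t, ⟨a1, a2, a3⟩, a4⟩⟩ := hg
    have gv : ∀ r : {r // c r}, (g r : ℕ) + r < 2 * n := by
      intro r
      have hzr : ∀ r : {r // c r}, (fz r : ℕ) + r < 2 * n := fun r => by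
        rw [hfz]; exact (hz.start_of_lt (hz.lt_of_mem h2 hc hmz r.2)).2
      have b1' : (p : Fin n).val < (q : Fin n).val := b1
      rw [Fin.lt_def] at b2
      have e1 : fz q = g p := by rw [b4]; simp
      have e2 := hzr q
      rw [e1] at e2
      by_cases h3 : r = p
      · rw [h3]; omega
      by_cases h4 : r = q
      · rw [h4]; omega
      have e3 : fz r = g r := by
        rw [b4, Function.comp, Equiv.swap_apply_of_ne_of_ne (by exact h3) (by exact h4)]
      rw [← e3]; exact hzr r
    have gs : g s = fx t := by rw [a4]; simp
    have gt : g t = fx s := by rw [a4]; simp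
    have go : ∀ r, r ≠ s → r ≠ t → g r = fx r := fun r h h' => by
      rw [a4, Function.comp, Equiv.swap_apply_of_ne_of_ne (by exact h) (by exact h')]
    have ht := hx.start_of_lt (hx.lt_of_mem h2 hc hmx t.2)
    have hup := gv t
    rw [gt, hfx] at hup
    rw [Fin.lt_def, hfx, hfx] at a2
    have hst : (s : Fin n) < t := a1
    obtain ⟨u, hu⟩ := hsurj _ (hx.isConf_cswap h2 hne hst (by omega) hup ht.1 ht.2)
    have ha : IsArrow π s t x (τ u) := by
      refine hx.isArrow_of_mem (hconf u) h2 hne hc hmx s.2 t.2 hst a2 hup ?_ ?_ ?_ ?_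
      · intro r hr r1 r2 r3 r4
        refine a3 ⟨r, hr⟩ r1 r2 ?_ ?_ <;> rw [Fin.lt_def, hfx, hfx] <;> assumption
      · rw [hu, cswap_left]
      · rw [hu, cswap_right hst.ne]
      · intro r hr r1 r2
        rw [hu, cswap_of_ne r1 r2]
        rintro rfl
        exact (hc _).mp hr t.2
    have hgu : ∀ r : {r // c r}, (g r : ℕ) = τ u r := by
      intro r
      by_cases h3 : r = s
      · rw [h3, gs, ha.apply_left, hfx]
      by_cases h4 : r = t
      · rw [h4, gt, ha.apply_right, hfx]
      rw [go r h3 h4, hfx, ha.apply_of_ne (fun h => h3 (Subtype.ext h))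
        (fun h => h4 (Subtype.ext h))]
      intro h
      have := r.2
      rw [h, hc] at this
      exact this t.2
    have hmu : ∀ r, Mov (τ u) r → c r := by
      intro r hr
      rcases ha.mov_or hx h2 hne hr with h | h
      · exact hmx r h
      · exact h ▸ t.2
    have hb : IsArrow π p q (τ u) z := by
      rw [Fin.lt_def, hgu, hgu] at b2
      have e0 := gv p
      refine (hconf u).isArrow_of_mem hz h2 hne hc hmu p.2 q.2 b1 b2 ?_ ?_ ?_ ?_ ?_
      · have : fz q = g p := by rw [b4]; simp
        have h3 := (hz.start_of_lt (hz.lt_of_mem h2 hc hmz q.2)).2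
        rw [← hfz, this, hgu] at h3
        exact h3
      · intro r hr r1 r2 r3 r4
        refine b3 ⟨r, hr⟩ r1 r2 ?_ ?_ <;> rw [Fin.lt_def, hgu, hgu] <;> assumption
      · rw [← hfz, ← hgu, b4]; simp
      · rw [← hfz, ← hgu, b4]; simp
      · intro r hr r1 r2
        have h3 : fz ⟨r, hr⟩ = g ⟨r, hr⟩ := by
          rw [b4, Function.comp, Equiv.swap_apply_of_ne_of_ne
            (by exact fun h => r1 (congrArg Subtype.val h))
            (by exact fun h => r2 (congrArg Subtype.val h))]
        have h4 := hfz ⟨r, hr⟩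
        have h5 := hgu ⟨r, hr⟩
        rw [h3] at h4
        exact h4.symm.trans h5
    have hpath : HasArrow π x (τ u) ∧ HasArrow π (τ u) z := ⟨⟨s, t, ha⟩, ⟨p, q, hb⟩⟩
    refine ⟨u, by simpa using hpath.symm, ?_⟩
    funext r
    apply Fin.ext
    rw [(hF u hpath).1, hgu]

end

/-! ### Contractions that invert a part of the differential -/

section
variable {X : Type*} [Fintype X] [DecidableEq X] {D H : X → X → ZMod 2} {I A : X → Prop} {θ : X → X}

theorem matching_sq (hHI : ∀ x y, I x ∨ I y → H x y = 0)
    (hH : ∀ x y, ¬ I x → ¬ I y → ¬ (¬ A x ∧ A y) → H x y = 0) (x z : X) :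
    ∑ y, H x y * H y z = 0 := by
  refine Finset.sum_eq_zero fun y _ => ?_
  by_cases h1 : I x ∨ I y
  · rw [hHI x y h1, zero_mul]
  by_cases h2 : I y ∨ I z
  · rw [hHI y z h2, mul_zero]
  push Not at h1 h2
  by_cases h3 : A y
  · rw [hH y z h1.2 h2.2 (by tauto), mul_zero]
  · rw [hH x y h1.1 h1.2 (by tauto), zero_mul]

open Classical in
theorem matching_homotopy (hD2 : ∀ x z, ∑ y, D x y * D y z = 0)
    (hDI : ∀ x y, I x ∨ I y → D x y = 0) (hHI : ∀ x y, I x ∨ I y → H x y = 0)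
    (hθ : Function.Involutive θ) (hθI : ∀ x, I (θ x) ↔ I x) (hθA : ∀ x, ¬ I x → (A (θ x) ↔ ¬ A x))
    (hDD : ∀ x y, ¬ I x → ¬ I y → A x → A y → D (θ x) (θ y) = D x y)
    (hH0 : ∀ x y, ¬ I x → ¬ I y → ¬ (¬ A x ∧ A y) → H x y = 0)
    (hH1 : ∀ x y, ¬ I x → ¬ I y → ¬ A x → A y → H x y = D (θ x) (θ y))
    (hinv : ∀ x z, ¬ I x → ¬ I z → A x → A z →
      ∑ w, (if ¬ I w ∧ A w then D x (θ w) * D w (θ z) else 0) = if x = z then 1 else 0)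
    (x z : X) :
    ∑ y, H x y * D y z + ∑ y, D x y * H y z = if x = z ∧ ¬ I x then 1 else 0 := by
  by_cases hx : I x
  · simp only [hHI x _ (Or.inl hx), hDI x _ (Or.inl hx)]
    simp [hx]
  by_cases hz : I z
  · simp only [hHI _ z (Or.inr hz), hDI _ z (Or.inr hz)]
    have : x ≠ z := by rintro rfl; exact hx hz
    simp [this]
  simp only [hx, not_false_eq_true, and_true]
  have hθx : ¬ I (θ x) := by rwa [hθI]
  have hθz : ¬ I (θ z) := by rwa [hθI]
  by_cases hAx : A x
  · have e1 : ∀ y, H x y = 0 := by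
      intro y
      by_cases hy : I y
      · exact hHI x y (Or.inr hy)
      · exact hH0 x y hx hy (by tauto)
    simp only [e1, zero_mul, Finset.sum_const_zero, zero_add]
    by_cases hAz : A z
    · rw [← hinv x z hx hz hAx hAz, ← Equiv.sum_comp hθ.toPerm]
      refine Finset.sum_congr rfl fun w _ => ?_
      simp only [Function.Involutive.coe_toPerm]
      by_cases hw : I w
      · have : I (θ w) := (hθI w).mpr hw
        simp [hw, hDI x _ (Or.inr this)]
      by_cases hAw : A w
      · rw [if_pos ⟨hw, hAw⟩, hH1 (θ w) z (by rwa [hθI]) hz (by rw [hθA w hw]; tauto) hAz, hθ w]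
      · rw [if_neg (by tauto), hH0 (θ w) z (by rwa [hθI]) hz (by rw [hθA w hw]; tauto), mul_zero]
    · have : x ≠ z := by rintro rfl; exact hAz hAx
      rw [if_neg this]
      refine Finset.sum_eq_zero fun y _ => ?_
      by_cases hy : I y
      · rw [hDI x y (Or.inr hy), zero_mul]
      · rw [hH0 y z hy hz (by tauto), mul_zero]
  · have hAθx : A (θ x) := (hθA x hx).mpr hAx
    by_cases hAz : A z
    · have hne : x ≠ z := by rintro rfl; exact hAx hAz
      rw [if_neg hne, ← hD2 (θ x) (θ z)]
      have e1 : ∀ y, H x y * D y z = if A y then D (θ x) (θ y) * D (θ y) (θ z) else 0 := by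
        intro y
        by_cases hy : I y
        · have : I (θ y) := (hθI y).mpr hy
          rw [hDI y z (Or.inl hy), hDI _ (θ z) (Or.inl this)]; simp
        split_ifs with hAy
        · rw [hH1 x y hx hy hAx hAy, hDD y z hy hz hAy hAz]
        · rw [hH0 x y hx hy (by tauto), zero_mul]
      have e2 : ∀ y, D x y * H y z = if ¬ A y then D (θ x) (θ y) * D (θ y) (θ z) else 0 := by
        intro y
        by_cases hy : I y
        · have : I (θ y) := (hθI y).mpr hy
          rw [hDI x y (Or.inr hy), hDI _ (θ z) (Or.inl this)]; simp
        by_cases hAy : A y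
        · rw [hH0 y z hy hz (by tauto), mul_zero, if_neg (not_not.mpr hAy)]
        · rw [if_pos hAy, hH1 y z hy hz hAy hAz, ← hDD (θ x) (θ y) hθx (by rwa [hθI]) hAθx
            ((hθA y hy).mpr hAy), hθ x, hθ y]
      rw [← Equiv.sum_comp hθ.toPerm (fun y => D (θ x) y * D y (θ z)), ← Finset.sum_add_distrib]
      refine Finset.sum_congr rfl fun y _ => ?_
      rw [e1, e2]
      simp only [Function.Involutive.coe_toPerm]
      by_cases hAy : A y <;> simp [hAy]
    · have e2 : ∀ y, D x y * H y z = 0 := by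
        intro y
        by_cases hy : I y
        · rw [hDI x y (Or.inr hy), zero_mul]
        · rw [hH0 y z hy hz (by tauto), mul_zero]
      have := hinv (θ x) (θ z) hθx hθz hAθx ((hθA z hz).mpr hAz)
      simp only [e2, Finset.sum_const_zero, add_zero]
      simp only [hθ.injective.eq_iff] at this
      rw [← this]
      refine Finset.sum_congr rfl fun w _ => ?_
      by_cases hw : I w
      · rw [hDI w z (Or.inl hw)]; simp [hw]
      by_cases hAw : A w
      · rw [if_pos ⟨hw, hAw⟩, hH1 x w hx hw hAx hAw, hθ z]
      · rw [if_neg (by tauto), hH0 x w hx hw (by tauto), zero_mul]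

end

/-! ### The homotopy on configurations -/

section
variable {k : ℕ} {Z : PMC k} {x y z : Fin (4 * k) → ℕ} {P j : Fin (4 * k)}

/-- `P` is the pivot of `x`, and `j` is the start of the strand that covers the segment below it. -/
structure IsPivotal (Z : PMC k) (x : Fin (4 * k) → ℕ) (P j : Fin (4 * k)) : Prop where
  pivot : IsPivot Z (cmult x) P
  good : Good Z.pair x P j

theorem IsPivotal.unique {P' j' : Fin (4 * k)} (h : IsPivotal Z x P j) (h' : IsPivotal Z x P' j') :
    P = P' ∧ j = j' := by
  obtain rfl := h.pivot.unique h'.pivot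
  exact ⟨rfl, h'.good.start_eq h.good.lt h.good.le h.good.up⟩

theorem IsPivotal.swap (h : IsPivotal Z x P j) (hx : IsConf Z.pair x) :
    IsPivotal Z (cswap Z.pair j P x) P j := by
  obtain ⟨h1, h2⟩ := h
  have hc := h2.conf hx Z.pair_pair Z.pair_ne
  have hm := hx.cmult_cswap Z.pair_pair Z.pair_ne h2.lt h2.le h2.up h2.start h2.start'
  have hp : IsPivot Z (cmult (cswap Z.pair j P x)) P := by rwa [hm]
  obtain ⟨j', hj'⟩ := hp.good hc
  have : j = j' := by
    refine hj'.start_eq h2.lt ?_ ?_ <;> rw [cswap_left]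
    · exact h2.start
    · exact h2.start'
  subst this
  exact ⟨hp, hj'⟩

theorem IsPivotal.swap_swap (h : IsPivotal Z x P j) (hx : IsConf Z.pair x) :
    cswap Z.pair j P (cswap Z.pair j P x) = x :=
  hx.cswap_cswap Z.pair_pair Z.pair_ne h.good.lt h.good.le h.good.up h.good.start h.good.start'

theorem IsPivotal.lt_or (h : IsPivotal Z x P j) (hx : IsConf Z.pair x) : x P < x j ∨ x j < x P := by
  have h1 := h.good.lt
  have h2 := h.good.up
  refine lt_or_gt_of_ne fun h3 => ?_
  have := hx.inj _ _ h3 (by omega)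
  omega

theorem HasArrow.pivotal (h : HasArrow Z.pair x y) (hx : IsConf Z.pair x) (hp : IsPivotal Z x P j) :
    ∃ j', IsPivotal Z y P j' := by
  obtain ⟨s, t, ha⟩ := h
  have hy := ha.conf hx Z.pair_pair Z.pair_ne
  have hm := ha.cmult_eq hx Z.pair_pair Z.pair_ne
  have hpy : IsPivot Z (cmult y) P := by rw [hm]; exact hp.pivot
  obtain ⟨u, hu⟩ := hpy.good hy
  exact ⟨u, hpy, hu⟩

/-- An arrow of the homotopy from `x` to `y`. -/
def HConf (Z : PMC k) (x y : Fin (4 * k) → ℕ) : Prop :=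
  ∃ P i j, IsPivotal Z x P i ∧ IsPivotal Z y P j ∧ x i < x P ∧ y P < y j ∧
    HasArrow Z.pair (cswap Z.pair i P x) (cswap Z.pair j P y)

theorem isConf_hasArrow_pivotal (hx : IsConf Z.pair x) (h : HasArrow Z.pair x y) :
    (∃ P j, IsPivotal Z x P j) ∧ ∃ P j, IsPivotal Z y P j := by
  have h0 := h
  obtain ⟨s, t, ha⟩ := h
  have h1 : cmult x s ≠ 0 := cmult_ne_zero_iff.mpr
    ⟨s, le_rfl, by have := ha.lt; have := ha.le; have := ha.inv; omega,
      by have := ha.lt; have := ha.up; omega⟩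
  obtain ⟨P, hP⟩ := exists_isPivot (Z := Z) ⟨s, h1⟩ (cmult_top x)
  obtain ⟨j, hj⟩ := hP.good hx
  obtain ⟨j', hj'⟩ := h0.pivotal hx ⟨hP, hj⟩
  exact ⟨⟨P, j, hP, hj⟩, P, j', hj'⟩

open Classical in
theorem hConf_identities {X : Type*} [Fintype X] [DecidableEq X] (τ : X → Fin (4 * k) → ℕ)
    (hτ : Function.Injective τ) (hconf : ∀ x, IsConf Z.pair (τ x))
    (hsurj : ∀ x, IsConf Z.pair x → ∃ a, τ a = x) :
    (∀ a b : X, ∑ u, (if HConf Z (τ a) (τ u) then 1 else 0) *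
        (if HasArrow Z.pair (τ u) (τ b) then 1 else 0) +
      ∑ u, (if HasArrow Z.pair (τ a) (τ u) then 1 else 0) *
        (if HConf Z (τ u) (τ b) then 1 else 0) =
      (if a = b ∧ ∃ P j, IsPivotal Z (τ a) P j then 1 else 0 : ZMod 2)) ∧
    (∀ a b : X, ∑ u, (if HConf Z (τ a) (τ u) then 1 else 0) *
        (if HConf Z (τ u) (τ b) then 1 else 0) = (0 : ZMod 2)) := by
  have hθex : ∀ a : X, ∃ u : X, ((¬ ∃ P j, IsPivotal Z (τ a) P j) → u = a) ∧
      ∀ P j, IsPivotal Z (τ a) P j → τ u = cswap Z.pair j P (τ a) := by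
    intro a
    by_cases h : ∃ P j, IsPivotal Z (τ a) P j
    · obtain ⟨P, j, hp⟩ := h
      obtain ⟨u, hu⟩ := hsurj _ (hp.good.conf (hconf a) Z.pair_pair Z.pair_ne)
      refine ⟨u, fun h => absurd ⟨P, j, hp⟩ h, fun P' j' hp' => ?_⟩
      obtain ⟨rfl, rfl⟩ := hp.unique hp'
      exact hu
    · exact ⟨a, fun _ => rfl, fun P j hp => absurd ⟨P, j, hp⟩ h⟩
  choose θ hθ0 hθ1 using hθex
  obtain ⟨I, hI⟩ : ∃ I : X → Prop, ∀ a, I a ↔ ¬ ∃ P j, IsPivotal Z (τ a) P j := ⟨_, fun _ => Iff.rfl⟩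
  obtain ⟨A, hA⟩ : ∃ A : X → Prop, ∀ a P j, IsPivotal Z (τ a) P j → (A a ↔ τ a P < τ a j) := by
    refine ⟨fun a => ∃ P j, IsPivotal Z (τ a) P j ∧ τ a P < τ a j, fun a P j hp => ?_⟩
    constructor
    · rintro ⟨P', j', hp', h⟩
      obtain ⟨rfl, rfl⟩ := hp.unique hp'
      exact h
    · exact fun h => ⟨P, j, hp, h⟩
  have hNI : ∀ a, ¬ I a → ∃ P j, IsPivotal Z (τ a) P j := fun a h => by rwa [hI, not_not] at h
  have hθp : ∀ a P j, IsPivotal Z (τ a) P j → IsPivotal Z (τ (θ a)) P j := by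
    intro a P j hp; rw [hθ1 a P j hp]; exact hp.swap (hconf a)
  have hθθ : Function.Involutive θ := by
    intro a
    by_cases h : ∃ P j, IsPivotal Z (τ a) P j
    · obtain ⟨P, j, hp⟩ := h
      apply hτ
      rw [hθ1 _ P j (hθp a P j hp), hθ1 a P j hp, hp.swap_swap (hconf a)]
    · rw [hθ0 a h, hθ0 a h]
  have hθI : ∀ a, I (θ a) ↔ I a := by
    intro a
    rw [hI, hI, not_iff_not]
    constructor
    · rintro ⟨P, j, hp⟩
      have := hθp _ P j hp
      rw [hθθ a] at this
      exact ⟨P, j, this⟩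
    · rintro ⟨P, j, hp⟩; exact ⟨P, j, hθp a P j hp⟩
  have hθA : ∀ a, ¬ I a → (A (θ a) ↔ ¬ A a) := by
    intro a ha
    obtain ⟨P, j, hp⟩ := hNI a ha
    rw [hA a P j hp, hA _ P j (hθp a P j hp), hθ1 a P j hp, cswap_left, cswap_right hp.good.lt.ne]
    have := hp.lt_or (hconf a)
    omega
  set D : X → X → ZMod 2 := fun a b => if HasArrow Z.pair (τ a) (τ b) then 1 else 0 with hD
  set H : X → X → ZMod 2 := fun a b => if HConf Z (τ a) (τ b) then 1 else 0 with hH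
  have hDI : ∀ a b, I a ∨ I b → D a b = 0 := by
    intro a b hab
    refine if_neg fun h => ?_
    have := isConf_hasArrow_pivotal (hconf a) h
    rw [hI, hI] at hab
    rcases hab with h' | h'
    · exact h' this.1
    · exact h' this.2
  have hHI : ∀ a b, I a ∨ I b → H a b = 0 := by
    intro a b hab
    refine if_neg fun h => ?_
    obtain ⟨P, i, j, h1, h2, -⟩ := h
    rw [hI, hI] at hab
    rcases hab with h | h
    · exact h ⟨_, _, h1⟩
    · exact h ⟨_, _, h2⟩
  have hH0 : ∀ a b, ¬ I a → ¬ I b → ¬ (¬ A a ∧ A b) → H a b = 0 := by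
    intro a b ha hb hab
    refine if_neg fun h => hab ?_
    obtain ⟨P, i, j, h1, h2, h3, h4, -⟩ := h
    rw [hA a P i h1, hA b P j h2]
    omega
  have hH1 : ∀ a b, ¬ I a → ¬ I b → ¬ A a → A b → H a b = D (θ a) (θ b) := by
    intro a b ha hb hAa hAb
    refine if_congr ?_ rfl rfl
    constructor
    · rintro ⟨P, i, j, h1, h2, h3, h4, h5⟩
      rwa [hθ1 a P i h1, hθ1 b P j h2]
    · intro h
      obtain ⟨P, i, hp⟩ := hNI a ha
      obtain ⟨j, hq⟩ := h.pivotal (hconf _) (hθp a P i hp)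
      have hq' := hθp _ P j hq
      rw [hθθ b] at hq'
      rw [hA a P i hp] at hAa
      rw [hA b P j hq'] at hAb
      have := hp.lt_or (hconf a)
      refine ⟨P, i, j, hp, hq', by omega, hAb, ?_⟩
      rwa [hθ1 a P i hp, hθ1 b P j hq'] at h
  have hDD : ∀ a b, ¬ I a → ¬ I b → A a → A b → D (θ a) (θ b) = D a b := by
    intro a b ha hb hAa hAb
    obtain ⟨P, i, hp⟩ := hNI a ha
    refine if_congr ?_ rfl rfl
    constructor
    · intro h
      obtain ⟨j, hq⟩ := h.pivotal (hconf _) (hθp a P i hp)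
      have hq' := hθp _ P j hq
      rw [hθθ b] at hq'
      have n1 : ¬ A (θ a) := by rw [hθA a ha]; tauto
      have n2 : ¬ A (θ b) := by rw [hθA b hb]; tauto
      rw [hA _ P i (hθp a P i hp)] at n1
      rw [hA _ P j hq] at n2
      have l1 := (hθp a P i hp).lt_or (hconf _)
      have l2 := hq.lt_or (hconf _)
      obtain ⟨s, t, hst⟩ := h
      have := hst.swap (hconf _) Z.pair_pair Z.pair_ne (hθp a P i hp).good hq.good
        (Or.inr ⟨by omega, by omega⟩)
      rw [← hθ1 _ P i (hθp a P i hp), ← hθ1 _ P j hq, hθθ, hθθ] at this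
      exact this
    · intro h
      obtain ⟨j, hq⟩ := h.pivotal (hconf _) hp
      rw [hA a P i hp] at hAa
      rw [hA b P j hq] at hAb
      obtain ⟨s, t, hst⟩ := h
      have := hst.swap (hconf _) Z.pair_pair Z.pair_ne hp.good hq.good (Or.inl ⟨hAa, hAb⟩)
      rw [← hθ1 _ P i hp, ← hθ1 _ P j hq] at this
      exact this
  have hself : ∀ a, ¬ I a → A a → D a (θ a) = 1 := by
    intro a ha hAa
    obtain ⟨P, i, hp⟩ := hNI a ha
    rw [hA a P i hp] at hAa
    refine if_pos ⟨i, P, ?_⟩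
    rw [hθ1 a P i hp]
    exact hp.good.isArrow (hconf a) hAa
  -- an exceptional arrow cannot be followed by another one
  have hexc : ∀ a b c, ¬ I a → ¬ I b → ¬ I c → A a → A b → A c → a ≠ b → D a (θ b) ≠ 0 → b ≠ c →
      D b (θ c) = 0 := by
    intro a b c ha hb hc hAa hAb hAc hab h hbc
    have har : HasArrow Z.pair (τ a) (τ (θ b)) := by
      by_contra h'; exact h (if_neg h')
    refine if_neg fun h' => ?_
    obtain ⟨P, i, hp⟩ := hNI a ha
    obtain ⟨j, hq⟩ := har.pivotal (hconf _) hp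
    have hq' := hθp _ P j hq
    rw [hθθ b] at hq'
    obtain ⟨l, hr⟩ := h'.pivotal (hconf _) hq'
    have hB : τ (θ b) j < τ (θ b) P := by
      have n2 : ¬ A (θ b) := by rw [hθA b hb]; tauto
      rw [hA _ P j hq] at n2
      have := hq.lt_or (hconf _)
      omega
    have hC : τ (θ c) l < τ (θ c) P := by
      have n2 : ¬ A (θ c) := by rw [hθA c hc]; tauto
      rw [hA _ P l hr] at n2
      have := hr.lt_or (hconf _)
      omega
    rw [hA a P i hp] at hAa
    rw [hA b P j hq'] at hAb
    obtain ⟨s, t, hst⟩ := har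
    obtain ⟨s', t', hst'⟩ := h'
    have e1 : t = Z.pair P := by
      rcases hst.eq_or_pair (hconf _) Z.pair_pair Z.pair_ne hp.good hq.good hAa hB with h | h
      · exfalso
        apply hab
        have := hst.eq
        rw [h.1, h.2, ← hθ1 a P i hp] at this
        exact hθθ.injective (hτ this.symm)
      · exact h
    have e2 : t' = Z.pair P := by
      rcases hst'.eq_or_pair (hconf _) Z.pair_pair Z.pair_ne hq'.good hr.good hAb hC with h | h
      · exfalso
        apply hbc
        have := hst'.eq
        rw [h.1, h.2, ← hθ1 b P j hq'] at this
        exact hθθ.injective (hτ this.symm)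
      · exact h
    subst e1 e2
    have f1 := hp.good.noninverted_of_pair hq.good (hconf _) (hconf _) Z.pair_pair hst
    have f2 := hq'.good.noninverted_of_pair hr.good (hconf _) (hconf _) Z.pair_pair hst'
    have f3 : τ b P = τ (θ b) j := by
      rw [← hθθ b, hθ1 (θ b) P j hq, cswap_right hq.good.lt.ne, hθθ b]
    have g1 := hq.good.le
    have g2 := hq.good.up
    have g3 := hq.good.lt
    -- the strand that covers the key segment does not end at `P`
    have f4 : τ (θ b) j ≠ P := by
      intro h
      by_cases k1 : j = s
      · rw [k1, hst.apply_left] at h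
        have := (hconf a).horR P f1.1
        rw [this] at h
        exact Z.pair_ne P (Fin.ext h)
      by_cases k2 : j = Z.pair P
      · have := (hconf (θ b)).horL P f1.2.2.1
        rw [← k2] at this
        omega
      rw [hst.apply_of_ne k1 k2 (by rw [Z.pair_pair]; exact g3.ne)] at h
      have := (hconf a).inj j P (by rw [h, f1.1]) (by omega)
      omega
    omega
  have hD2 : ∀ a b, ∑ u, D a u * D u b = 0 :=
    sum_hasArrow_hasArrow τ hτ hconf hsurj Z.pair_pair Z.pair_ne
  refine ⟨fun a b => ?_, fun a b => matching_sq (I := I) (A := A) hHI hH0 a b⟩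
  have := matching_homotopy (H := H) (A := A) hD2 hDI hHI hθθ hθI hθA hDD hH0 hH1 ?_ a b
  · rw [this]
    refine if_congr ?_ rfl rfl
    rw [hI, not_not]
  · intro a c ha hc hAa hAc
    have : ∀ w, (if ¬ I w ∧ A w then D a (θ w) * D w (θ c) else 0) =
        (if w = a then D a (θ c) else 0) + (if w = c then (if a = c then 0 else D a (θ c)) else 0) := by
      intro w
      by_cases h1 : w = a
      · subst h1
        rw [if_pos ⟨ha, hAa⟩, hself w ha hAa, one_mul, if_pos rfl]
        by_cases h2 : w = c <;> simp [h2]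
      rw [if_neg h1, zero_add]
      by_cases h2 : w = c
      · subst h2
        rw [if_pos ⟨hc, hAc⟩, hself w hc hAc, mul_one, if_pos rfl, if_neg (Ne.symm h1)]
      rw [if_neg h2]
      split_ifs with h3
      · by_cases h4 : D a (θ w) = 0
        · rw [h4, zero_mul]
        · rw [hexc a w c ha h3.1 hc hAa h3.2 hAc (Ne.symm h1) h4 h2, mul_zero]
      · rfl
    rw [Finset.sum_congr rfl fun w _ => this w, Finset.sum_add_distrib]
    simp only [Finset.sum_ite_eq', Finset.mem_univ, if_true]
    by_cases h : a = c
    · subst h; simp [hself a ha hAa]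
    · simp [h, CharTwo.add_self_eq_zero]

end

/-! ### Strand diagrams as graphs of permutations -/

namespace Diagram

variable {n : ℕ}

/-- The restriction of a permutation to `S`, as a strand diagram. -/
def graph (S : Finset (Fin n)) (σ : Equiv.Perm (Fin n)) : Finset (Fin n × Fin n) :=
  S.image fun s => (s, σ s)

/-- The inversions of a permutation on `S`. -/
def invs (S : Finset (Fin n)) (σ : Equiv.Perm (Fin n)) : Finset (Fin n × Fin n) :=
  (S ×ˢ S).filter fun c => c.1 < c.2 ∧ σ c.2 < σ c.1

variable {S : Finset (Fin n)} {σ ρ : Equiv.Perm (Fin n)} {a b : Fin n}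

theorem mem_graph {p : Fin n × Fin n} : p ∈ graph S σ ↔ p.1 ∈ S ∧ σ p.1 = p.2 := by
  constructor
  · intro h
    obtain ⟨s, hs, rfl⟩ := Finset.mem_image.mp h
    exact ⟨hs, rfl⟩
  · rintro ⟨h1, h2⟩
    exact Finset.mem_image.mpr ⟨p.1, h1, by rw [h2]⟩

theorem mem_invs {c : Fin n × Fin n} :
    c ∈ invs S σ ↔ (c.1 ∈ S ∧ c.2 ∈ S) ∧ c.1 < c.2 ∧ σ c.2 < σ c.1 := by
  rw [invs, Finset.mem_filter, Finset.mem_product]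

theorem crossings_graph : crossings (graph S σ) =
    (invs S σ).image fun c => ((c.1, σ c.1), (c.2, σ c.2)) := by
  ext ⟨⟨p, q⟩, ⟨r, s⟩⟩
  simp only [crossings, Finset.mem_filter, Finset.mem_product, mem_graph, Finset.mem_image, mem_invs,
    Prod.mk.injEq, Prod.exists]
  constructor
  · rintro ⟨⟨⟨h1, rfl⟩, h2, rfl⟩, h3, h4⟩
    exact ⟨p, r, ⟨⟨h1, h2⟩, h3, h4⟩, ⟨rfl, rfl⟩, rfl, rfl⟩
  · rintro ⟨_, _, ⟨⟨h1, h2⟩, h3, h4⟩, ⟨rfl, rfl⟩, rfl, rfl⟩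
    exact ⟨⟨⟨h1, rfl⟩, h2, rfl⟩, h3, h4⟩

theorem strand_pair_injective :
    Function.Injective fun c : Fin n × Fin n => ((c.1, σ c.1), (c.2, σ c.2)) := by
  rintro ⟨a, b⟩ ⟨c, d⟩ h
  simp only [Prod.mk.injEq] at h
  exact Prod.ext h.1.1 h.2.1

theorem inv_graph : inv (graph S σ) = (invs S σ).card := by
  rw [inv, crossings_graph, Finset.card_image_of_injective _ strand_pair_injective]

theorem image_fst_graph : (graph S σ).image Prod.fst = S := by
  rw [graph, Finset.image_image]; exact Finset.image_id

theorem image_snd_graph : (graph S σ).image Prod.snd = S.image σ := by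
  rw [graph, Finset.image_image]; rfl

theorem comp_graph : comp (graph S σ) (graph (S.image σ) ρ) = graph S (ρ * σ) := by
  ext ⟨p, q⟩
  simp only [comp, Finset.mem_image, Finset.mem_filter, Finset.mem_product, mem_graph, Prod.exists,
    Prod.mk.injEq]
  constructor
  · rintro ⟨_, _, _, _, ⟨⟨⟨h1, rfl⟩, h2, rfl⟩, rfl⟩, rfl, rfl⟩
    exact ⟨h1, rfl⟩
  · rintro ⟨h1, rfl⟩
    exact ⟨p, σ p, σ p, _, ⟨⟨⟨h1, rfl⟩, ⟨p, h1, rfl⟩, rfl⟩, rfl⟩, rfl, rfl⟩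

theorem resolve_graph (ha : a ∈ S) (hb : b ∈ S) (hab : a ≠ b) :
    resolve (graph S σ) ((a, σ a), (b, σ b)) = graph S (σ * Equiv.swap a b) := by
  ext ⟨p, q⟩
  simp only [resolve, Finset.mem_insert, Finset.mem_erase, mem_graph, Prod.mk.injEq,
    Equiv.Perm.mul_apply, ne_eq]
  by_cases h1 : p = a
  · subst h1
    rw [Equiv.swap_apply_left]
    constructor
    · rintro (h | h | ⟨h, h', h'', rfl⟩)
      · exact ⟨ha, h.2.symm⟩
      · exact absurd h.1 hab
      · exact absurd ⟨rfl, rfl⟩ h'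
    · rintro ⟨-, rfl⟩; exact Or.inl ⟨rfl, rfl⟩
  by_cases h2 : p = b
  · subst h2
    rw [Equiv.swap_apply_right]
    constructor
    · rintro (h | h | ⟨h, h', h'', rfl⟩)
      · exact absurd h.1 h1
      · exact ⟨hb, h.2.symm⟩
      · exact absurd ⟨rfl, rfl⟩ h
    · rintro ⟨-, rfl⟩; exact Or.inr (Or.inl ⟨rfl, rfl⟩)
  · rw [Equiv.swap_apply_of_ne_of_ne h1 h2]
    simp [h1, h2]

theorem graph_eq_graph_iff : graph S σ = graph S ρ ↔ ∀ s ∈ S, σ s = ρ s := by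
  constructor
  · intro h s hs
    have : (s, σ s) ∈ graph S ρ := h ▸ mem_graph.mpr ⟨hs, rfl⟩
    exact (mem_graph.mp this).2.symm
  · intro h
    exact Finset.image_congr fun s hs => by simp only [h s hs]

theorem exists_graph {f : Finset (Fin n × Fin n)} (h1 : ∀ p ∈ f, ∀ q ∈ f, p.1 = q.1 → p = q)
    (h2 : ∀ p ∈ f, ∀ q ∈ f, p.2 = q.2 → p = q) : ∃ σ, f = graph (f.image Prod.fst) σ := by
  classical
  have hex : ∀ s ∈ f.image Prod.fst, ∃ t, (s, t) ∈ f := by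
    intro s hs
    obtain ⟨p, hp, rfl⟩ := Finset.mem_image.mp hs
    exact ⟨p.2, hp⟩
  let F : Fin n → Fin n := fun s => if h : ∃ t, (s, t) ∈ f then h.choose else s
  have hF : ∀ s ∈ f.image Prod.fst, (s, F s) ∈ f := by
    intro s hs
    have h := hex s hs
    simp only [F, dif_pos h]
    exact h.choose_spec
  obtain ⟨g, hg⟩ := Finset.exists_equiv_extend_of_card_eq (α := Fin n) (t := (Finset.univ : Finset (Fin n)))
    (by simp) (s := f.image Prod.fst) (f := F) (Finset.subset_univ _) (by
      intro s hs t ht hst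
      exact congrArg Prod.fst (h2 _ (hF s hs) _ (hF t ht) hst))
  refine ⟨g.trans (Equiv.subtypeUnivEquiv (by simp)), ?_⟩
  ext ⟨p, q⟩
  rw [mem_graph]
  have hgp : p ∈ f.image Prod.fst → (g.trans (Equiv.subtypeUnivEquiv (by simp))) p = F p :=
    fun hp => hg p hp
  constructor
  · intro h
    have hp : p ∈ f.image Prod.fst := Finset.mem_image.mpr ⟨_, h, rfl⟩
    refine ⟨hp, ?_⟩
    rw [hgp hp]
    exact congrArg Prod.snd (h1 _ (hF p hp) _ h rfl)
  · rintro ⟨hp, h⟩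
    simp only at hp h
    rw [hgp hp] at h
    rw [← h]
    exact hF p hp

/-! ### Counting crossings -/

theorem card_invs_add :
    (invs S σ).card + (invs (S.image σ) ρ).card = (invs S (ρ * σ)).card +
      2 * ((S ×ˢ S).filter fun c => c.1 < c.2 ∧ σ c.2 < σ c.1 ∧ ρ (σ c.1) < ρ (σ c.2)).card := by
  have e1 : (invs (S.image σ) ρ).card =
      ((S ×ˢ S).filter fun c => c.1 < c.2 ∧ σ c.1 < σ c.2 ∧ ρ (σ c.2) < ρ (σ c.1)).card +
      ((S ×ˢ S).filter fun c => c.1 < c.2 ∧ σ c.2 < σ c.1 ∧ ρ (σ c.1) < ρ (σ c.2)).card := by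
    have : invs (S.image σ) ρ =
        (((S ×ˢ S).filter fun c => c.1 < c.2 ∧ σ c.1 < σ c.2 ∧ ρ (σ c.2) < ρ (σ c.1)).image
          fun c => (σ c.1, σ c.2)) ∪
        (((S ×ˢ S).filter fun c => c.1 < c.2 ∧ σ c.2 < σ c.1 ∧ ρ (σ c.1) < ρ (σ c.2)).image
          fun c => (σ c.2, σ c.1)) := by
      ext ⟨p, q⟩
      simp only [mem_invs, Finset.mem_union, Finset.mem_image, Finset.mem_filter, Finset.mem_product,
        Prod.exists, Prod.mk.injEq]
      constructor
      · rintro ⟨⟨⟨a, ha, rfl⟩, ⟨b, hb, rfl⟩⟩, h1, h2⟩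
        rcases lt_trichotomy a b with h | rfl | h
        · exact Or.inl ⟨a, b, ⟨⟨ha, hb⟩, h, h1, h2⟩, rfl, rfl⟩
        · exact absurd h1 (lt_irrefl _)
        · exact Or.inr ⟨b, a, ⟨⟨hb, ha⟩, h, h1, h2⟩, rfl, rfl⟩
      · rintro (⟨a, b, ⟨⟨ha, hb⟩, h, h1, h2⟩, rfl, rfl⟩ | ⟨b, a, ⟨⟨hb, ha⟩, h, h1, h2⟩, rfl, rfl⟩)
        · exact ⟨⟨⟨a, ha, rfl⟩, ⟨b, hb, rfl⟩⟩, h1, h2⟩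
        · exact ⟨⟨⟨a, ha, rfl⟩, ⟨b, hb, rfl⟩⟩, h1, h2⟩
    rw [this, Finset.card_union_of_disjoint, Finset.card_image_of_injective, Finset.card_image_of_injective]
    · rintro ⟨a, b⟩ ⟨c, d⟩ h
      simpa [and_comm] using h
    · rintro ⟨a, b⟩ ⟨c, d⟩ h
      simpa using h
    · rw [Finset.disjoint_left]
      rintro ⟨p, q⟩ h1 h2
      simp only [Finset.mem_image, Finset.mem_filter, Finset.mem_product, Prod.exists,
        Prod.mk.injEq] at h1 h2
      obtain ⟨a, b, ⟨-, h, -⟩, rfl, rfl⟩ := h1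
      obtain ⟨c, d, ⟨-, h', -⟩, h1, h2⟩ := h2
      rw [σ.injective h1, σ.injective h2] at h'
      exact absurd h (not_lt.mpr h'.le)
  have e2 : (invs S σ).card =
      ((S ×ˢ S).filter fun c => c.1 < c.2 ∧ σ c.2 < σ c.1 ∧ ρ (σ c.2) < ρ (σ c.1)).card +
      ((S ×ˢ S).filter fun c => c.1 < c.2 ∧ σ c.2 < σ c.1 ∧ ρ (σ c.1) < ρ (σ c.2)).card := by
    rw [← Finset.card_union_of_disjoint]
    · congr 1
      ext ⟨p, q⟩
      simp only [mem_invs, Finset.mem_union, Finset.mem_filter, Finset.mem_product]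
      have : p < q → ρ (σ p) ≠ ρ (σ q) := fun h h' => h.ne (σ.injective (ρ.injective h'))
      grind
    · rw [Finset.disjoint_left]
      grind
  have e3 : (invs S (ρ * σ)).card =
      ((S ×ˢ S).filter fun c => c.1 < c.2 ∧ σ c.2 < σ c.1 ∧ ρ (σ c.2) < ρ (σ c.1)).card +
      ((S ×ˢ S).filter fun c => c.1 < c.2 ∧ σ c.1 < σ c.2 ∧ ρ (σ c.2) < ρ (σ c.1)).card := by
    rw [← Finset.card_union_of_disjoint]
    · congr 1
      ext ⟨p, q⟩
      simp only [mem_invs, Finset.mem_union, Finset.mem_filter, Finset.mem_product,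
        Equiv.Perm.mul_apply]
      have : p < q → σ p ≠ σ q := fun h h' => h.ne (σ.injective h')
      grind
    · rw [Finset.disjoint_left]
      grind
  omega

theorem card_invs_mul_le :
    (invs S (ρ * σ)).card ≤ (invs S σ).card + (invs (S.image σ) ρ).card := by
  rw [card_invs_add]; omega

theorem card_invs_mul_eq_iff :
    (invs S (ρ * σ)).card = (invs S σ).card + (invs (S.image σ) ρ).card ↔
      ∀ a ∈ S, ∀ b ∈ S, a < b → σ b < σ a → ρ (σ b) < ρ (σ a) := by
  rw [card_invs_add]
  have : (invs S (ρ * σ)).card = (invs S (ρ * σ)).card +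
      2 * ((S ×ˢ S).filter fun c => c.1 < c.2 ∧ σ c.2 < σ c.1 ∧ ρ (σ c.1) < ρ (σ c.2)).card ↔
    ((S ×ˢ S).filter fun c => c.1 < c.2 ∧ σ c.2 < σ c.1 ∧ ρ (σ c.1) < ρ (σ c.2)).card = 0 := by
    omega
  rw [this, Finset.card_eq_zero, Finset.filter_eq_empty_iff]
  constructor
  · intro h a ha b hb hab hba
    have h' := h (Finset.mk_mem_product ha hb)
    simp only [hab, hba, true_and, not_lt] at h'
    refine lt_of_le_of_ne h' fun h => hab.ne' ?_
    exact σ.injective (ρ.injective h)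
  · rintro h ⟨a, b⟩ hab ⟨h1, h2, h3⟩
    rw [Finset.mem_product] at hab
    exact absurd (h a hab.1 b hab.2 h1 h2) (not_lt.mpr h3.le)

theorem card_invs_swap (ha : a ∈ S) (hb : b ∈ S) (hab : a < b) (hba : σ b < σ a) :
    (invs S (σ * Equiv.swap a b)).card = (((invs S σ).erase (a, b)).filter fun c =>
      ¬ (c.1 = a ∧ c.2 < b ∧ σ b < σ c.2 ∨ c.2 = b ∧ a < c.1 ∧ σ c.1 < σ a)).card := by
  let φ : Fin n × Fin n → Fin n × Fin n := fun c =>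
    if (c.1 = a ∧ c.2 < b) ∨ (c.2 = b ∧ a < c.1) then c else (Equiv.swap a b c.1, Equiv.swap a b c.2)
  have key : ∀ p, Equiv.swap a b p = if p = a then b else if p = b then a else p :=
    fun p => Equiv.swap_apply_def a b p
  have hσ : ∀ p q, σ p = σ q → p = q := fun p q h => σ.injective h
  refine Finset.card_nbij' φ φ ?_ ?_ ?_ ?_
  · rintro ⟨p, q⟩ h
    rw [Finset.mem_coe, mem_invs] at h
    simp only [Finset.coe_filter, Finset.mem_erase, mem_invs, Set.mem_ofPred_eq, φ,
      Equiv.Perm.mul_apply, key, ne_eq, Prod.ext_iff] at h ⊢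
    obtain ⟨⟨h1, h2⟩, h3, h4⟩ := h
    by_cases c1 : p = a <;> by_cases c2 : q = a <;> by_cases c3 : p = b <;> by_cases c4 : q = b <;> grind
  · rintro ⟨p, q⟩ h
    simp only [Finset.coe_filter, Finset.mem_erase, mem_invs, Set.mem_ofPred_eq, φ,
      Equiv.Perm.mul_apply, key, ne_eq, Prod.ext_iff, Finset.mem_coe] at h ⊢
    obtain ⟨⟨h0, ⟨h1, h2⟩, h3, h4⟩, h5⟩ := h
    have := hσ p b
    have := hσ p a
    have := hσ q b
    have := hσ q a
    by_cases c1 : p = a <;> by_cases c2 : q = a <;> by_cases c3 : p = b <;> by_cases c4 : q = b <;> grind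
  · rintro ⟨p, q⟩ h
    rw [Finset.mem_coe, mem_invs] at h
    simp only [φ, key, Prod.ext_iff]
    by_cases c1 : p = a <;> by_cases c2 : q = a <;> by_cases c3 : p = b <;> by_cases c4 : q = b <;> grind
  · rintro ⟨p, q⟩ h
    simp only [φ, key, Prod.ext_iff]
    simp only [Finset.coe_filter, Finset.mem_erase, mem_invs, Set.mem_ofPred_eq, ne_eq,
      Prod.ext_iff] at h
    by_cases c1 : p = a <;> by_cases c2 : q = a <;> by_cases c3 : p = b <;> by_cases c4 : q = b <;> grind

theorem card_invs_swap_lt (ha : a ∈ S) (hb : b ∈ S) (hab : a < b) (hba : σ b < σ a) :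
    (invs S (σ * Equiv.swap a b)).card + 1 ≤ (invs S σ).card := by
  rw [card_invs_swap ha hb hab hba]
  have h1 : (a, b) ∈ invs S σ := mem_invs.mpr ⟨⟨ha, hb⟩, hab, hba⟩
  have := Finset.card_erase_add_one h1
  have := Finset.card_filter_le ((invs S σ).erase (a, b)) fun c =>
      ¬ (c.1 = a ∧ c.2 < b ∧ σ b < σ c.2 ∨ c.2 = b ∧ a < c.1 ∧ σ c.1 < σ a)
  omega

theorem card_invs_swap_eq_iff (ha : a ∈ S) (hb : b ∈ S) (hab : a < b) (hba : σ b < σ a) :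
    (invs S (σ * Equiv.swap a b)).card + 1 = (invs S σ).card ↔
      ∀ m ∈ S, a < m → m < b → σ b < σ m → σ m < σ a → False := by
  rw [card_invs_swap ha hb hab hba]
  have h1 : (a, b) ∈ invs S σ := mem_invs.mpr ⟨⟨ha, hb⟩, hab, hba⟩
  rw [← Finset.card_erase_add_one h1, Nat.add_right_cancel_iff, Finset.card_filter_eq_iff]
  constructor
  · intro h m hm h2 h3 h4 h5
    refine h (a, m) ?_ (Or.inl ⟨rfl, h3, h4⟩)
    rw [Finset.mem_erase, mem_invs]
    exact ⟨fun h => h3.ne (congrArg Prod.snd h), ⟨ha, hm⟩, h2, h5⟩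
  · rintro h ⟨p, q⟩ hc
    rw [Finset.mem_erase, mem_invs] at hc
    simp only at hc
    rintro (⟨rfl, h3, h4⟩ | ⟨rfl, h3, h4⟩)
    · exact h q hc.2.1.2 hc.2.2.1 h3 h4 hc.2.2.2
    · exact h p hc.2.1.1 h3 hc.2.2.1 hc.2.2.2 h4

end Diagram

namespace Diagram

variable {n : ℕ}

/-- Upward partial injections. -/
structure IsDiag (f : Finset (Fin n × Fin n)) : Prop where
  up : ∀ p ∈ f, p.1 ≤ p.2
  inj_fst : ∀ p ∈ f, ∀ q ∈ f, p.1 = q.1 → p = q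
  inj_snd : ∀ p ∈ f, ∀ q ∈ f, p.2 = q.2 → p = q

variable {S : Finset (Fin n)} {σ ρ : Equiv.Perm (Fin n)} {f g h m : Finset (Fin n × Fin n)}

theorem IsDiag.exists_graph (hf : IsDiag f) : ∃ σ, f = graph (f.image Prod.fst) σ :=
  Diagram.exists_graph hf.inj_fst hf.inj_snd

theorem sum_dCount_mul (φ : Finset (Fin n × Fin n) → ZMod 2) :
    ∑ m, (dCount (graph S σ) m : ZMod 2) * φ m = ∑ a ∈ S, ∑ b ∈ S,
      if a < b ∧ σ b < σ a ∧ inv (graph S (σ * Equiv.swap a b)) + 1 = inv (graph S σ) then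
        φ (graph S (σ * Equiv.swap a b)) else 0 := by
  have h1 : ∀ m, (dCount (graph S σ) m : ZMod 2) * φ m = ∑ c ∈ invs S σ,
      if m = graph S (σ * Equiv.swap c.1 c.2) then (if
        inv (graph S (σ * Equiv.swap c.1 c.2)) + 1 = inv (graph S σ) then φ m else 0) else 0 := by
    intro m
    rw [dCount, crossings_graph, Finset.filter_image,
      Finset.card_image_of_injective _ strand_pair_injective, Finset.card_filter, Nat.cast_sum,
      Finset.sum_mul]
    refine Finset.sum_congr rfl fun c hc => ?_
    rw [mem_invs] at hc
    rw [resolve_graph hc.1.1 hc.1.2 hc.2.1.ne]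
    by_cases e : m = graph S (σ * Equiv.swap c.1 c.2)
    · rw [if_pos e]
      simp only [e, true_and]
      split_ifs <;> simp
    · rw [if_neg e, if_neg (fun h => e h.1.symm)]
      simp
  rw [Finset.sum_congr rfl fun m _ => h1 m, Finset.sum_comm]
  simp only [Finset.sum_ite_eq', Finset.mem_univ, if_true]
  rw [invs, Finset.sum_filter, Finset.sum_product]
  refine Finset.sum_congr rfl fun a _ => Finset.sum_congr rfl fun b _ => ?_
  simp only [ite_and]

theorem dCount_graph : (dCount (graph S σ) h : ZMod 2) = ∑ a ∈ S, ∑ b ∈ S,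
      if a < b ∧ σ b < σ a ∧ graph S (σ * Equiv.swap a b) = h ∧ inv h + 1 = inv (graph S σ) then
        1 else 0 := by
  have := sum_dCount_mul (S := S) (σ := σ) fun m => if m = h then 1 else 0
  simp only [mul_ite, mul_one, mul_zero, Finset.sum_ite_eq', Finset.mem_univ, if_true] at this
  rw [this]
  refine Finset.sum_congr rfl fun a _ => Finset.sum_congr rfl fun b _ => ?_
  by_cases e : graph S (σ * Equiv.swap a b) = h
  · simp [e]
  · simp [e]

theorem sum_sum_eq_sum_lt {X : Fin n → Fin n → ZMod 2} (hX : ∀ a, X a a = 0) :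
    ∑ a ∈ S, ∑ b ∈ S, X a b = ∑ a ∈ S, ∑ b ∈ S, if a < b then X a b + X b a else 0 := by
  have h1 : ∑ a ∈ S, ∑ b ∈ S, (if a < b then X b a else 0) =
      ∑ a ∈ S, ∑ b ∈ S, if b < a then X a b else 0 := Finset.sum_comm
  have h2 : ∑ a ∈ S, ∑ b ∈ S, (if a < b then X a b + X b a else 0) =
      ∑ a ∈ S, ∑ b ∈ S, (if a < b then X a b else 0) +
      ∑ a ∈ S, ∑ b ∈ S, (if a < b then X b a else 0) := by
    simp only [← Finset.sum_add_distrib]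
    refine Finset.sum_congr rfl fun a _ => Finset.sum_congr rfl fun b _ => ?_
    split_ifs <;> simp
  rw [h2, h1]
  simp only [← Finset.sum_add_distrib]
  refine Finset.sum_congr rfl fun a _ => Finset.sum_congr rfl fun b _ => ?_
  rcases lt_trichotomy a b with h | rfl | h
  · simp [h, h.le]
  · simp [hX]
  · simp [h, h.le]

theorem image_mul_swap {a b : Fin n} (ha : a ∈ S) (hb : b ∈ S) :
    S.image (σ * Equiv.swap a b) = S.image σ := by
  rw [Equiv.Perm.coe_mul, ← Finset.image_image]
  congr 1
  ext x
  rw [Finset.mem_image]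
  constructor
  · rintro ⟨y, hy, rfl⟩
    rw [Equiv.swap_apply_def]; split_ifs <;> assumption
  · intro hx
    refine ⟨Equiv.swap a b x, ?_, Equiv.swap_apply_self a b x⟩
    rw [Equiv.swap_apply_def]; split_ifs <;> assumption

theorem leibniz_graph :
    ∑ m, (if IsProd (graph S σ) (graph (S.image σ) ρ) m then 1 else 0) * (dCount m h : ZMod 2) +
    ∑ m, (dCount (graph S σ) m : ZMod 2) * (if IsProd m (graph (S.image σ) ρ) h then 1 else 0) +
    ∑ m, (dCount (graph (S.image σ) ρ) m : ZMod 2) * (if IsProd (graph S σ) m h then 1 else 0) = 0 := by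
  obtain ⟨N, hN⟩ : ∃ N, N = inv (graph S σ) + inv (graph (S.image σ) ρ) := ⟨_, rfl⟩
  have e1 : ∑ m, (if IsProd (graph S σ) (graph (S.image σ) ρ) m then 1 else 0) * (dCount m h : ZMod 2)
      = ∑ a ∈ S, ∑ b ∈ S, if a < b ∧ ρ (σ b) < ρ (σ a) ∧
        graph S (ρ * σ * Equiv.swap a b) = h ∧ inv h + 1 = N then 1 else 0 := by
    rw [Finset.sum_eq_single (graph S (ρ * σ))]
    · rw [dCount_graph, Finset.mul_sum]
      refine Finset.sum_congr rfl fun a ha => ?_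
      rw [Finset.mul_sum]
      refine Finset.sum_congr rfl fun b hb => ?_
      rw [ite_zero_mul_ite_zero, one_mul]
      refine if_congr ?_ rfl rfl
      simp only [IsProd, image_snd_graph, image_fst_graph, comp_graph, and_true, true_and]
      constructor
      · rintro ⟨h1, h2, h3, h4, h5⟩
        exact ⟨h2, h3, h4, by omega⟩
      · rintro ⟨h2, h3, h4, h5⟩
        have h6 := card_invs_swap_lt (σ := ρ * σ) ha hb h2 h3
        have h7 := card_invs_mul_le (S := S) (σ := σ) (ρ := ρ)
        rw [← inv_graph, ← inv_graph, ← inv_graph] at h7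
        rw [← inv_graph, ← inv_graph, h4] at h6
        exact ⟨by omega, h2, h3, h4, by omega⟩
    · intro m _ hm
      rw [if_neg, zero_mul]
      rintro ⟨-, -, h3⟩
      rw [comp_graph] at h3
      exact hm h3.symm
    · simp
  have e2 : ∑ m, (dCount (graph S σ) m : ZMod 2) *
        (if IsProd m (graph (S.image σ) ρ) h then 1 else 0)
      = ∑ a ∈ S, ∑ b ∈ S, if a < b ∧ σ b < σ a ∧
        graph S (ρ * σ * Equiv.swap a b) = h ∧ inv h + 1 = N then 1 else 0 := by
    rw [sum_dCount_mul]
    refine Finset.sum_congr rfl fun a ha => Finset.sum_congr rfl fun b hb => ?_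
    rw [← ite_and]
    refine if_congr ?_ rfl rfl
    have him : S.image (σ * Equiv.swap a b) = S.image σ := image_mul_swap ha hb
    have hc : comp (graph S (σ * Equiv.swap a b)) (graph (S.image σ) ρ) =
        graph S (ρ * σ * Equiv.swap a b) := by rw [← him, comp_graph, mul_assoc]
    simp only [IsProd, image_snd_graph, image_fst_graph, hc, him, true_and]
    constructor
    · rintro ⟨⟨h1, h2, h3⟩, h4, h5⟩
      exact ⟨h1, h2, h5, by rw [← h5]; omega⟩
    · rintro ⟨h1, h2, h3, h4⟩
      have h6 := card_invs_swap_lt (σ := σ) ha hb h1 h2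
      have h7 := card_invs_mul_le (S := S) (σ := σ * Equiv.swap a b) (ρ := ρ)
      rw [him, ← inv_graph, ← inv_graph, ← inv_graph, ← mul_assoc, h3] at h7
      rw [← inv_graph, ← inv_graph] at h6
      rw [h3]
      refine ⟨⟨h1, h2, by omega⟩, by omega, rfl⟩
  have e3 : ∑ m, (dCount (graph (S.image σ) ρ) m : ZMod 2) *
        (if IsProd (graph S σ) m h then 1 else 0)
      = ∑ a ∈ S, ∑ b ∈ S, if σ a < σ b ∧ ρ (σ b) < ρ (σ a) ∧
        graph S (ρ * σ * Equiv.swap a b) = h ∧ inv h + 1 = N then 1 else 0 := by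
    rw [sum_dCount_mul, Finset.sum_image fun _ _ _ _ h => σ.injective h]
    refine Finset.sum_congr rfl fun a ha => ?_
    rw [Finset.sum_image fun _ _ _ _ h => σ.injective h]
    refine Finset.sum_congr rfl fun b hb => ?_
    rw [← ite_and]
    refine if_congr ?_ rfl rfl
    have hsw : ρ * Equiv.swap (σ a) (σ b) * σ = ρ * σ * Equiv.swap a b := by
      rw [mul_assoc, mul_assoc, Equiv.swap_mul_eq_mul_swap]
      simp
    simp only [IsProd, image_snd_graph, image_fst_graph, comp_graph, hsw, true_and]
    constructor
    · rintro ⟨⟨h1, h2, h3⟩, h4, h5⟩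
      exact ⟨h1, h2, h5, by rw [← h5]; omega⟩
    · rintro ⟨h1, h2, h3, h4⟩
      have h6 := card_invs_swap_lt (σ := ρ) (Finset.mem_image_of_mem σ ha)
        (Finset.mem_image_of_mem σ hb) h1 h2
      have h7 := card_invs_mul_le (S := S) (σ := σ) (ρ := ρ * Equiv.swap (σ a) (σ b))
      rw [hsw, ← inv_graph, ← inv_graph, ← inv_graph, h3] at h7
      rw [← inv_graph, ← inv_graph] at h6
      rw [h3]
      refine ⟨⟨h1, h2, by omega⟩, by omega, rfl⟩
  rw [e1, e2, e3, sum_sum_eq_sum_lt (X := fun a b => if σ a < σ b ∧ ρ (σ b) < ρ (σ a) ∧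
        graph S (ρ * σ * Equiv.swap a b) = h ∧ inv h + 1 = N then 1 else 0) (by simp)]
  simp only [← Finset.sum_add_distrib]
  refine Finset.sum_eq_zero fun a ha => Finset.sum_eq_zero fun b hb => ?_
  rw [Equiv.swap_comm b a]
  by_cases hab : a < b
  · have h1 : σ a ≠ σ b := fun h => hab.ne (σ.injective h)
    have h2 : ρ (σ a) ≠ ρ (σ b) := fun h => h1 (ρ.injective h)
    by_cases hc : graph S (ρ * σ * Equiv.swap a b) = h ∧ inv h + 1 = N
    · simp only [hab, hc, and_true, true_and, if_true]
      rcases lt_or_gt_of_ne h1 with h3 | h3 <;> rcases lt_or_gt_of_ne h2 with h4 | h4 <;>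
        simp [h3, h4, h3.not_gt, h4.not_gt] <;> decide
    · simp [hc]
  · simp [hab]

theorem dCount_ne_zero (hd : dCount f h ≠ 0) : ∃ c ∈ crossings f, resolve f c = h ∧ inv h + 1 = inv f := by
  obtain ⟨c, hc⟩ := Finset.card_ne_zero.mp hd
  rw [Finset.mem_filter] at hc
  exact ⟨c, hc⟩

theorem dCount_ne_zero_graph (hd : dCount (graph S σ) h ≠ 0) :
    ∃ a ∈ S, ∃ b ∈ S, a < b ∧ σ b < σ a ∧ h = graph S (σ * Equiv.swap a b) ∧
      inv h + 1 = inv (graph S σ) := by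
  obtain ⟨c, hc, h1, h2⟩ := dCount_ne_zero hd
  rw [crossings_graph, Finset.mem_image] at hc
  obtain ⟨⟨a, b⟩, hab, rfl⟩ := hc
  rw [mem_invs] at hab
  rw [resolve_graph hab.1.1 hab.1.2 hab.2.1.ne] at h1
  exact ⟨a, hab.1.1, b, hab.1.2, hab.2.1, hab.2.2, h1.symm, h2⟩

theorem IsDiag.image_of_dCount (hf : IsDiag f) (hd : dCount f h ≠ 0) :
    h.image Prod.fst = f.image Prod.fst ∧ h.image Prod.snd = f.image Prod.snd := by
  obtain ⟨σ, hσ⟩ := hf.exists_graph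
  generalize f.image Prod.fst = S at hσ
  subst hσ
  obtain ⟨a, ha, b, hb, -, -, rfl, -⟩ := dCount_ne_zero_graph hd
  simp only [image_fst_graph, image_snd_graph, image_mul_swap ha hb, and_self]

/-- The differential is a derivation. -/
theorem leibniz (hf : IsDiag f) (hg : IsDiag g) :
    ∑ m, (if IsProd f g m then 1 else 0) * (dCount m h : ZMod 2) +
    ∑ m, (dCount f m : ZMod 2) * (if IsProd m g h then 1 else 0) +
    ∑ m, (dCount g m : ZMod 2) * (if IsProd f m h then 1 else 0) = 0 := by
  by_cases hfg : f.image Prod.snd = g.image Prod.fst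
  · obtain ⟨σ, hσ⟩ := hf.exists_graph
    obtain ⟨ρ, hρ⟩ := hg.exists_graph
    rw [← hfg] at hρ
    clear hfg
    generalize f.image Prod.fst = S at hσ
    subst hσ
    rw [image_snd_graph] at hρ
    subst hρ
    exact leibniz_graph
  · rw [Finset.sum_eq_zero, Finset.sum_eq_zero, Finset.sum_eq_zero]
    · simp
    · intro m _
      by_cases hd : dCount g m = 0
      · simp [hd]
      · rw [if_neg, mul_zero]
        rintro ⟨h1, -⟩
        rw [(hg.image_of_dCount hd).1] at h1
        exact hfg h1
    · intro m _
      by_cases hd : dCount f m = 0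
      · simp [hd]
      · rw [if_neg, mul_zero]
        rintro ⟨h1, -⟩
        rw [(hf.image_of_dCount hd).2] at h1
        exact hfg h1
    · intro m _
      rw [if_neg, zero_mul]
      exact fun h => hfg h.1

theorem IsDiag.of_dCount (hf : IsDiag f) (hd : dCount f h ≠ 0) : IsDiag h := by
  obtain ⟨σ, hσ⟩ := hf.exists_graph
  generalize f.image Prod.fst = S at hσ
  subst hσ
  obtain ⟨a, ha, b, hb, h1, h2, rfl, -⟩ := dCount_ne_zero_graph hd
  have hup : ∀ s ∈ S, s ≤ σ s := fun s hs => hf.up (s, σ s) (mem_graph.mpr ⟨hs, rfl⟩)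
  refine ⟨?_, ?_, ?_⟩
  · rintro ⟨p, q⟩ hp
    obtain ⟨hp, h⟩ := mem_graph.mp hp
    simp only at hp h
    simp only [← h, Equiv.Perm.mul_apply, Equiv.swap_apply_def]
    have := hup b hb
    split_ifs with e1 e2
    · rw [e1]; exact h1.le.trans this
    · rw [e2]; exact this.trans h2.le
    · exact hup p hp
  · rintro ⟨p, q⟩ hp ⟨p', q'⟩ hp' h
    have e1 := (mem_graph.mp hp).2
    have e2 := (mem_graph.mp hp').2
    simp only at h e1 e2
    rw [← e1, ← e2, h]
  · rintro ⟨p, q⟩ hp ⟨p', q'⟩ hp' h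
    have e1 := (mem_graph.mp hp).2
    have e2 := (mem_graph.mp hp').2
    simp only at h e1 e2
    rw [← e1, ← e2] at h
    rw [← e1, ← e2, Equiv.injective _ h]

theorem IsDiag.of_isProd (hf : IsDiag f) (hg : IsDiag g) (hp : IsProd f g h) : IsDiag h ∧
    h.image Prod.fst = f.image Prod.fst ∧ h.image Prod.snd = g.image Prod.snd := by
  obtain ⟨h1, -, rfl⟩ := hp
  have hm : ∀ p, p ∈ comp f g ↔ ∃ m, (p.1, m) ∈ f ∧ (m, p.2) ∈ g := by
    rintro ⟨p, q⟩
    simp only [comp, Finset.mem_image, Finset.mem_filter, Finset.mem_product, Prod.exists,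
      Prod.mk.injEq]
    constructor
    · rintro ⟨_, m, _, _, ⟨⟨h1, h2⟩, rfl⟩, rfl, rfl⟩
      exact ⟨m, h1, h2⟩
    · rintro ⟨m, h1, h2⟩
      exact ⟨_, m, m, _, ⟨⟨h1, h2⟩, rfl⟩, rfl, rfl⟩
  refine ⟨⟨?_, ?_, ?_⟩, ?_, ?_⟩
  · intro p hp
    obtain ⟨m, h2, h3⟩ := (hm p).mp hp
    exact (hf.up _ h2).trans (hg.up _ h3)
  · rintro ⟨p, q⟩ hp ⟨p', q'⟩ hq h
    obtain ⟨m, h2, h3⟩ := (hm _).mp hp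
    obtain ⟨m', h2', h3'⟩ := (hm _).mp hq
    simp only at h h2 h3 h2' h3'
    subst h
    have := hf.inj_fst _ h2 _ h2' rfl
    simp only [Prod.mk.injEq, true_and] at this
    subst this
    have := hg.inj_fst _ h3 _ h3' rfl
    simpa using this
  · rintro ⟨p, q⟩ hp ⟨p', q'⟩ hq h
    obtain ⟨m, h2, h3⟩ := (hm _).mp hp
    obtain ⟨m', h2', h3'⟩ := (hm _).mp hq
    simp only at h h2 h3 h2' h3'
    subst h
    have := hg.inj_snd _ h3 _ h3' rfl
    simp only [Prod.mk.injEq, and_true] at this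
    subst this
    have := hf.inj_snd _ h2 _ h2' rfl
    simpa using this
  · ext s
    simp only [Finset.mem_image, hm]
    constructor
    · rintro ⟨p, ⟨m, h2, h3⟩, rfl⟩
      exact ⟨_, h2, rfl⟩
    · rintro ⟨⟨s, m⟩, h2, rfl⟩
      have : m ∈ g.image Prod.fst := h1 ▸ Finset.mem_image.mpr ⟨_, h2, rfl⟩
      obtain ⟨⟨_, e⟩, h3, rfl⟩ := Finset.mem_image.mp this
      exact ⟨(s, e), ⟨_, h2, h3⟩, rfl⟩
  · ext s
    simp only [Finset.mem_image, hm]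
    constructor
    · rintro ⟨p, ⟨m, h2, h3⟩, rfl⟩
      exact ⟨_, h3, rfl⟩
    · rintro ⟨⟨m, e⟩, h2, rfl⟩
      have : m ∈ f.image Prod.snd := h1 ▸ Finset.mem_image.mpr ⟨_, h2, rfl⟩
      obtain ⟨⟨s, _⟩, h3, rfl⟩ := Finset.mem_image.mp this
      exact ⟨(s, e), ⟨_, h3, h2⟩, rfl⟩

theorem isProd_assoc {l : Finset (Fin n × Fin n)} (hf : IsDiag f) (hg : IsDiag g) (hh : IsDiag h) :
    (∃ m, IsProd f g m ∧ IsProd m h l) ↔ ∃ m, IsProd g h m ∧ IsProd f m l := by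
  have key : f.image Prod.snd = g.image Prod.fst → g.image Prod.snd = h.image Prod.fst →
      comp (comp f g) h = comp f (comp g h) ∧ inv (comp f g) ≤ inv f + inv g ∧
      inv (comp g h) ≤ inv g + inv h ∧ inv (comp (comp f g) h) ≤ inv (comp f g) + inv h ∧
      inv (comp f (comp g h)) ≤ inv f + inv (comp g h) := by
    intro h1 h2
    obtain ⟨σ, hσ⟩ := hf.exists_graph
    obtain ⟨ρ, hρ⟩ := hg.exists_graph
    obtain ⟨ν, hν⟩ := hh.exists_graph
    rw [← h1] at hρ
    rw [← h2] at hν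
    clear h1 h2
    generalize f.image Prod.fst = S at hσ
    subst hσ
    rw [image_snd_graph] at hρ
    subst hρ
    rw [image_snd_graph, Finset.image_image, ← Equiv.Perm.coe_mul] at hν
    subst hν
    have e1 : comp (graph (S.image σ) ρ) (graph (S.image (ρ * σ)) ν) = graph (S.image σ) (ν * ρ) := by
      rw [Equiv.Perm.coe_mul, ← Finset.image_image, comp_graph]
    rw [comp_graph, comp_graph, e1, comp_graph, mul_assoc]
    simp only [inv_graph]
    refine ⟨trivial, card_invs_mul_le, ?_, ?_, ?_⟩
    · have := card_invs_mul_le (S := S.image σ) (σ := ρ) (ρ := ν)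
      rwa [Finset.image_image, ← Equiv.Perm.coe_mul] at this
    · exact card_invs_mul_le (S := S) (σ := ρ * σ) (ρ := ν)
    · exact card_invs_mul_le (S := S) (σ := σ) (ρ := ν * ρ)
  constructor
  · rintro ⟨m, h1, h2⟩
    have e1 := hf.of_isProd hg h1
    have e2 : g.image Prod.snd = h.image Prod.fst := by rw [← e1.2.2]; exact h2.1
    obtain ⟨k1, k2, k3, k4, k5⟩ := key h1.1 e2
    obtain ⟨a1, a2, rfl⟩ := h1
    obtain ⟨b1, b2, rfl⟩ := h2
    rw [k1] at b2 k4
    have c1 : IsProd g h (comp g h) := ⟨e2, by omega, rfl⟩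
    exact ⟨_, c1, by rw [(hg.of_isProd hh c1).2.1]; exact a1, by omega, k1.symm⟩
  · rintro ⟨m, h1, h2⟩
    have e1 := hg.of_isProd hh h1
    have e2 : f.image Prod.snd = g.image Prod.fst := by rw [← e1.2.1]; exact h2.1
    obtain ⟨k1, k2, k3, k4, k5⟩ := key e2 h1.1
    obtain ⟨a1, a2, rfl⟩ := h1
    obtain ⟨b1, b2, rfl⟩ := h2
    rw [← k1] at b2 k5
    have c1 : IsProd f g (comp f g) := ⟨e2, by omega, rfl⟩
    exact ⟨_, c1, by rw [(hf.of_isProd hg c1).2.2]; exact a1, by omega, k1⟩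

end Diagram

/-! ### The strand algebra in terms of classes of diagrams -/

namespace Diagram

variable {n : ℕ} {f g h : Finset (Fin n × Fin n)}

theorem mk_mem_graph {S : Finset (Fin n)} {σ : Equiv.Perm (Fin n)} {s t : Fin n} :
    (s, t) ∈ graph S σ ↔ s ∈ S ∧ σ s = t := mem_graph

/-- `h` is a term of the differential of `f`, with the resolved crossing made explicit. -/
def IsResolved (f h : Finset (Fin n × Fin n)) : Prop :=
  ∃ s u t v, (s, u) ∈ f ∧ (t, v) ∈ f ∧ s < t ∧ v < u ∧
    (∀ p ∈ f, s < p.1 → p.1 < t → v < p.2 → p.2 < u → False) ∧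
    ∀ p, p ∈ h ↔ p = (s, v) ∨ p = (t, u) ∨ (p ∈ f ∧ p.1 ≠ s ∧ p.1 ≠ t)

open Classical in
theorem IsDiag.dCount_eq (hf : IsDiag f) : dCount f h = if IsResolved f h then 1 else 0 := by
  obtain ⟨σ, hσ⟩ := hf.exists_graph
  generalize f.image Prod.fst = S at hσ
  subst hσ
  have h1 : dCount (graph S σ) h ≤ 1 := by
    rw [dCount, Finset.card_le_one]
    intro c hc c' hc'
    simp only [Finset.mem_filter, crossings_graph, Finset.mem_image] at hc hc'
    obtain ⟨⟨⟨a, b⟩, hab, rfl⟩, e1, -⟩ := hc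
    obtain ⟨⟨⟨a', b'⟩, hab', rfl⟩, e1', -⟩ := hc'
    rw [mem_invs] at hab hab'
    simp only at hab hab' e1 e1'
    rw [resolve_graph hab.1.1 hab.1.2 hab.2.1.ne] at e1
    rw [resolve_graph hab'.1.1 hab'.1.2 hab'.2.1.ne, ← e1, graph_eq_graph_iff] at e1'
    have k1 := σ.injective (e1' a hab.1.1)
    rw [Equiv.swap_apply_left, Equiv.swap_apply_def] at k1
    have h3 := hab.2.1
    have h4 := hab'.2.1
    have : a = a' ∧ b = b' := by
      split_ifs at k1 with k2 k3
      · exact ⟨k2, k1.symm⟩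
      · omega
      · omega
    rw [this.1, this.2]
  have h2 : dCount (graph S σ) h ≠ 0 ↔ IsResolved (graph S σ) h := by
    have hmem : ∀ {a b : Fin n}, a ∈ S → b ∈ S → a ≠ b → ∀ p, p ∈ graph S (σ * Equiv.swap a b) ↔
        p = (a, σ b) ∨ p = (b, σ a) ∨ (p ∈ graph S σ ∧ p.1 ≠ a ∧ p.1 ≠ b) := by
      rintro a b ha hb hab ⟨p, q⟩
      simp only [mem_graph, Equiv.Perm.mul_apply, Equiv.swap_apply_def, Prod.mk.injEq]
      split_ifs with k1 k2
      · subst k1; simp [ha, hab, eq_comm]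
      · subst k2; simp [hb, k1, eq_comm]
      · simp [k1, k2]
    constructor
    · intro hd
      obtain ⟨a, ha, b, hb, hab, hba, rfl, hinv⟩ := dCount_ne_zero_graph hd
      rw [inv_graph, inv_graph, card_invs_swap_eq_iff ha hb hab hba] at hinv
      refine ⟨a, σ a, b, σ b, mem_graph.mpr ⟨ha, rfl⟩, mem_graph.mpr ⟨hb, rfl⟩, hab, hba, ?_,
        hmem ha hb hab.ne⟩
      rintro ⟨p, q⟩ hp k1 k2 k3 k4
      obtain ⟨hp, e⟩ := mem_graph.mp hp
      simp only at hp e k1 k2 k3 k4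
      rw [← e] at k3 k4
      exact hinv p hp k1 k2 k3 k4
    · rintro ⟨a, u, b, v, ha, hb, hab, hba, k1, k2⟩
      obtain ⟨ha', rfl⟩ := mk_mem_graph.mp ha
      obtain ⟨hb', rfl⟩ := mk_mem_graph.mp hb
      have e : h = graph S (σ * Equiv.swap a b) := by
        ext p; rw [k2, hmem ha' hb' hab.ne]
      rw [dCount, Finset.card_ne_zero]
      refine ⟨((a, σ a), (b, σ b)), ?_⟩
      rw [Finset.mem_filter, crossings_graph, resolve_graph ha' hb' hab.ne]
      refine ⟨Finset.mem_image.mpr ⟨(a, b), mem_invs.mpr ⟨⟨ha', hb'⟩, hab, hba⟩, rfl⟩, e.symm, ?_⟩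
      rw [e, inv_graph, inv_graph, card_invs_swap_eq_iff ha' hb' hab hba]
      exact fun m hm => k1 (m, σ m) (mem_graph.mpr ⟨hm, rfl⟩)
  split_ifs with h3
  · have := h2.mpr h3
    omega
  · by_contra h4
    exact h3 (h2.mp h4)

theorem mem_comp {p : Fin n × Fin n} : p ∈ comp f g ↔ ∃ m, (p.1, m) ∈ f ∧ (m, p.2) ∈ g := by
  obtain ⟨p, q⟩ := p
  simp only [comp, Finset.mem_image, Finset.mem_filter, Finset.mem_product, Prod.exists,
    Prod.mk.injEq]
  constructor
  · rintro ⟨_, m, _, _, ⟨⟨h1, h2⟩, rfl⟩, rfl, rfl⟩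
    exact ⟨m, h1, h2⟩
  · rintro ⟨m, h1, h2⟩
    exact ⟨_, m, m, _, ⟨⟨h1, h2⟩, rfl⟩, rfl, rfl⟩

theorem IsDiag.isProd_iff (hf : IsDiag f) (hg : IsDiag g) : IsProd f g h ↔
    f.image Prod.snd = g.image Prod.fst ∧
    (∀ p, p ∈ h ↔ ∃ m, (p.1, m) ∈ f ∧ (m, p.2) ∈ g) ∧
    ∀ s m s' m' e e', (s, m) ∈ f → (s', m') ∈ f → (m, e) ∈ g → (m', e') ∈ g →
      s < s' → m' < m → e' < e := by
  rw [IsProd, and_congr_right_iff]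
  intro h1
  rw [and_comm]
  refine and_congr ?_ ?_
  · rw [Finset.ext_iff]
    refine forall_congr' fun p => ?_
    rw [mem_comp]
    exact Iff.comm
  · obtain ⟨σ, hσ⟩ := hf.exists_graph
    obtain ⟨ρ, hρ⟩ := hg.exists_graph
    rw [← h1] at hρ
    clear h1
    generalize f.image Prod.fst = S at hσ
    subst hσ
    rw [image_snd_graph] at hρ
    subst hρ
    rw [comp_graph, inv_graph, inv_graph, inv_graph, card_invs_mul_eq_iff]
    constructor
    · intro k s m s' m' e e' k1 k2 k3 k4 k5 k6
      obtain ⟨k1', rfl⟩ := mk_mem_graph.mp k1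
      obtain ⟨k2', rfl⟩ := mk_mem_graph.mp k2
      obtain ⟨k3', rfl⟩ := mk_mem_graph.mp k3
      obtain ⟨k4', rfl⟩ := mk_mem_graph.mp k4
      exact k s k1' s' k2' k5 k6
    · intro k a ha b hb hab hba
      exact k a (σ a) b (σ b) _ _ (mem_graph.mpr ⟨ha, rfl⟩) (mem_graph.mpr ⟨hb, rfl⟩)
        (mem_graph.mpr ⟨Finset.mem_image_of_mem σ ha, rfl⟩)
        (mem_graph.mpr ⟨Finset.mem_image_of_mem σ hb, rfl⟩) hab hba

end Diagram

open Diagram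

namespace Gen

variable {k : ℕ} {Z : PMC k} {a b c : Gen Z} {f g h : Finset (Fin (4 * k) × Fin (4 * k))}

/-- All strands of `a`, with both strands of each double horizontal. -/
def full (a : Gen Z) : Finset (Fin (4 * k) × Fin (4 * k)) := a.diagram a.hor

theorem mem_diagram {p : Fin (4 * k) × Fin (4 * k)} {c : Finset (Fin (4 * k))} :
    p ∈ a.diagram c ↔ p ∈ a.strands ∨ (p.1 = p.2 ∧ p.1 ∈ c) := by
  obtain ⟨p, q⟩ := p
  simp only [diagram, Finset.mem_union, Finset.mem_image, Prod.mk.injEq]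
  refine or_congr_right ⟨?_, ?_⟩
  · rintro ⟨x, hx, rfl, rfl⟩; exact ⟨rfl, hx⟩
  · rintro ⟨rfl, hx⟩; exact ⟨p, hx, rfl, rfl⟩

theorem mem_full {p : Fin (4 * k) × Fin (4 * k)} :
    p ∈ a.full ↔ p ∈ a.strands ∨ (p.1 = p.2 ∧ p.1 ∈ a.hor) := mem_diagram

theorem mem_strands_iff {p : Fin (4 * k) × Fin (4 * k)} :
    p ∈ a.strands ↔ p ∈ a.full ∧ p.1 < p.2 := by
  rw [mem_full]
  constructor
  · exact fun h => ⟨Or.inl h, a.up p h⟩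
  · rintro ⟨h | h, h'⟩
    · exact h
    · exact absurd h.1 h'.ne

theorem mem_hor_iff {x : Fin (4 * k)} : x ∈ a.hor ↔ (x, x) ∈ a.full := by
  rw [mem_full]
  constructor
  · exact fun h => Or.inr ⟨rfl, h⟩
  · rintro (h | h)
    · exact absurd (a.up _ h) (lt_irrefl x)
    · exact h.2

theorem full_injective : Function.Injective (full : Gen Z → _) := by
  intro a b h
  ext p
  · rw [mem_strands_iff, mem_strands_iff, h]
  · rw [mem_hor_iff, mem_hor_iff, h]

theorem isDiag_full (a : Gen Z) : IsDiag a.full := by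
  refine ⟨?_, ?_, ?_⟩
  · intro p hp
    rcases mem_full.mp hp with h | h
    · exact (a.up p h).le
    · exact h.1.le
  · intro p hp q hq h
    rcases mem_full.mp hp with h1 | h1 <;> rcases mem_full.mp hq with h2 | h2
    · by_contra hne
      exact (a.start_ne p h1 q h2 hne).1 h
    · exact absurd (h ▸ h2.2) (a.start_notMem p h1)
    · exact absurd (h ▸ h1.2) (a.start_notMem q h2)
    · exact Prod.ext h (by rw [← h1.1, ← h2.1, h])
  · intro p hp q hq h
    rcases mem_full.mp hp with h1 | h1 <;> rcases mem_full.mp hq with h2 | h2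
    · by_contra hne
      exact (a.end_ne p h1 q h2 hne).1 h
    · exact absurd (h ▸ h2.1 ▸ h2.2) (a.end_notMem p h1)
    · exact absurd (h ▸ h1.1 ▸ h1.2) (a.end_notMem q h2)
    · exact Prod.ext (by rw [h1.1, h2.1, h]) h

theorem full_fst {s u v : Fin (4 * k)} (h1 : (s, u) ∈ a.full) (h2 : (s, v) ∈ a.full) : u = v :=
  congrArg Prod.snd (a.isDiag_full.inj_fst _ h1 _ h2 rfl)

theorem full_snd {s t v : Fin (4 * k)} (h1 : (s, v) ∈ a.full) (h2 : (t, v) ∈ a.full) : s = t :=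
  congrArg Prod.fst (a.isDiag_full.inj_snd _ h1 _ h2 rfl)

theorem full_pair {x : Fin (4 * k)} (h : (x, x) ∈ a.full) : (Z.pair x, Z.pair x) ∈ a.full := by
  rw [← mem_hor_iff] at h ⊢
  exact a.hor_pair x h

theorem full_start_pair {x u v : Fin (4 * k)} (h1 : (x, u) ∈ a.full) (h2 : (Z.pair x, v) ∈ a.full) :
    x = u ∧ Z.pair x = v := by
  rcases mem_full.mp h1 with h3 | h3 <;> rcases mem_full.mp h2 with h4 | h4
  · exfalso
    refine (a.start_ne _ h4 _ h3 ?_).2 rfl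
    exact fun h => Z.pair_ne x (congrArg Prod.fst h)
  · have := a.hor_pair _ h4.2
    simp only [Z.pair_pair] at this
    exact absurd this (a.start_notMem _ h3)
  · exact absurd (a.hor_pair _ h3.2) (a.start_notMem _ h4)
  · exact ⟨h3.1, h4.1⟩

theorem full_end_pair {x u v : Fin (4 * k)} (h1 : (u, x) ∈ a.full) (h2 : (v, Z.pair x) ∈ a.full) :
    u = x ∧ v = Z.pair x := by
  rcases mem_full.mp h1 with h3 | h3 <;> rcases mem_full.mp h2 with h4 | h4
  · exfalso
    refine (a.end_ne _ h4 _ h3 ?_).2 rfl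
    exact fun h => Z.pair_ne x (congrArg Prod.snd h)
  · have := a.hor_pair _ h4.2
    simp only at h4
    simp only [h4.1, Z.pair_pair] at this
    exact absurd this (a.end_notMem _ h3)
  · refine absurd (a.hor_pair _ h3.2) ?_
    have := a.end_notMem _ h4
    simp only at h3 this ⊢
    rwa [h3.1]
  · exact ⟨h3.1, h4.1⟩

theorem mem_left_pts {x : Fin (4 * k)} :
    x ∈ a.left.pts ↔ ∃ e, (x, e) ∈ a.full ∨ (Z.pair x, e) ∈ a.full := by
  simp only [left, Finset.mem_union, Finset.mem_image]
  constructor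
  · rintro ((h | ⟨⟨s, t⟩, h, rfl⟩) | ⟨⟨s, t⟩, h, rfl⟩)
    · exact ⟨x, Or.inl (mem_hor_iff.mp h)⟩
    · exact ⟨t, Or.inl (mem_full.mpr (Or.inl h))⟩
    · exact ⟨t, Or.inr (mem_full.mpr (Or.inl (by rwa [Z.pair_pair])))⟩
  · rintro ⟨e, h | h⟩ <;> rcases mem_full.mp h with h | h
    · exact Or.inl (Or.inr ⟨_, h, rfl⟩)
    · exact Or.inl (Or.inl h.2)
    · exact Or.inr ⟨_, h, Z.pair_pair x⟩
    · have := a.hor_pair _ h.2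
      rw [Z.pair_pair] at this
      exact Or.inl (Or.inl this)

theorem mem_right_pts {x : Fin (4 * k)} :
    x ∈ a.right.pts ↔ ∃ s, (s, x) ∈ a.full ∨ (s, Z.pair x) ∈ a.full := by
  simp only [right, Finset.mem_union, Finset.mem_image]
  constructor
  · rintro ((h | ⟨⟨s, t⟩, h, rfl⟩) | ⟨⟨s, t⟩, h, rfl⟩)
    · exact ⟨x, Or.inl (mem_hor_iff.mp h)⟩
    · exact ⟨s, Or.inl (mem_full.mpr (Or.inl h))⟩
    · exact ⟨s, Or.inr (mem_full.mpr (Or.inl (by rwa [Z.pair_pair])))⟩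
  · rintro ⟨e, h | h⟩ <;> rcases mem_full.mp h with h | h
    · exact Or.inl (Or.inr ⟨_, h, rfl⟩)
    · refine Or.inl (Or.inl ?_)
      rw [← show e = x from h.1]; exact h.2
    · exact Or.inr ⟨_, h, Z.pair_pair x⟩
    · have h' : e = Z.pair x := h.1
      have := a.hor_pair _ h.2
      simp only [h', Z.pair_pair] at this
      exact Or.inl (Or.inl this)

theorem mem_expand : f ∈ a.expand ↔ f ⊆ a.full ∧ a.strands ⊆ f ∧
    ∀ x ∈ a.hor, ((x, x) ∈ f ↔ (Z.pair x, Z.pair x) ∉ f) := by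
  simp only [expand, Finset.mem_image, Finset.mem_filter, Finset.mem_powerset]
  have hst : ∀ x, (x, x) ∉ a.strands := fun x h => lt_irrefl x (a.up _ h)
  constructor
  · rintro ⟨c, ⟨h1, h2⟩, rfl⟩
    refine ⟨?_, ?_, ?_⟩
    · intro p hp
      rw [mem_diagram] at hp
      exact mem_full.mpr (hp.imp_right fun h => ⟨h.1, h1 h.2⟩)
    · exact fun p hp => mem_diagram.mpr (Or.inl hp)
    · intro x hx
      simpa [mem_diagram, hst] using h2 x hx
  · rintro ⟨h1, h2, h3⟩
    refine ⟨a.hor.filter fun x => (x, x) ∈ f, ⟨Finset.filter_subset _ _, ?_⟩, ?_⟩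
    · intro x hx
      simp only [Finset.mem_filter, hx, true_and, a.hor_pair x hx]
      exact h3 x hx
    · ext ⟨p, q⟩
      rw [mem_diagram]
      simp only [Finset.mem_filter]
      constructor
      · rintro (h | ⟨rfl, -, h⟩)
        · exact h2 h
        · exact h
      · intro h
        rcases mem_full.mp (h1 h) with h' | ⟨h', h''⟩
        · exact Or.inl h'
        · simp only at h' h''
          subst h'
          exact Or.inr ⟨rfl, h'', h⟩

theorem rep_mem_expand (a : Gen Z) : a.rep ∈ a.expand := by
  simp only [expand, Finset.mem_image, Finset.mem_filter, Finset.mem_powerset]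
  refine ⟨_, ⟨Finset.filter_subset _ _, ?_⟩, rfl⟩
  intro x hx
  simp only [Finset.mem_filter, hx, true_and, a.hor_pair x hx, Z.pair_pair, not_lt]
  exact ⟨le_of_lt, fun h => lt_of_le_of_ne h (Z.pair_ne x).symm⟩

theorem mem_full_iff (hf : f ∈ a.expand) {p : Fin (4 * k) × Fin (4 * k)} :
    p ∈ a.full ↔ p ∈ f ∨ (p.1 = p.2 ∧ (Z.pair p.1, Z.pair p.1) ∈ f) := by
  obtain ⟨h1, h2, h3⟩ := mem_expand.mp hf
  obtain ⟨p, q⟩ := p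
  constructor
  · intro h
    rcases mem_full.mp h with h' | ⟨h', h''⟩
    · exact Or.inl (h2 h')
    · simp only at h' h''
      subst h'
      have := h3 p h''
      simp only [true_and]
      tauto
  · rintro (h | ⟨h, h'⟩)
    · exact h1 h
    · simp only at h h'
      subst h
      have := full_pair (h1 h')
      rwa [Z.pair_pair] at this

theorem mem_of_lt (hf : f ∈ a.expand) {s t : Fin (4 * k)} (h : (s, t) ∈ a.full) (hst : s < t) :
    (s, t) ∈ f :=
  (mem_expand.mp hf).2.1 (mem_strands_iff.mpr ⟨h, hst⟩)

theorem mem_of_start (hf : f ∈ a.expand) {s t u : Fin (4 * k)} (h : (s, t) ∈ a.full)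
    (h2 : (s, u) ∈ f) : (s, t) ∈ f := by
  rwa [full_fst h ((mem_expand.mp hf).1 h2)]

/-- A diagram in which no matched pair carries two starts or two ends of strands. -/
structure _root_.Diagram.IsPure (Z : PMC k) (f : Finset (Fin (4 * k) × Fin (4 * k))) : Prop where
  diag : IsDiag f
  start : ∀ x, x ∈ f.image Prod.fst → Z.pair x ∉ f.image Prod.fst
  ends : ∀ x, x ∈ f.image Prod.snd → Z.pair x ∉ f.image Prod.snd

theorem isPure (hf : f ∈ a.expand) : IsPure Z f := by
  obtain ⟨h1, h2, h3⟩ := mem_expand.mp hf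
  have hd := a.isDiag_full
  refine ⟨⟨fun p hp => hd.up p (h1 hp), fun p hp q hq => hd.inj_fst p (h1 hp) q (h1 hq),
    fun p hp q hq => hd.inj_snd p (h1 hp) q (h1 hq)⟩, ?_, ?_⟩
  · intro x hy hy'
    obtain ⟨⟨y, u⟩, hx, e'⟩ := Finset.mem_image.mp hy
    obtain ⟨⟨s, v⟩, hx', e⟩ := Finset.mem_image.mp hy'
    simp only at e e'
    subst e e'
    obtain ⟨e1, e2⟩ := full_start_pair (h1 hx) (h1 hx')
    subst e1 e2
    exact (h3 _ (mem_hor_iff.mpr (h1 hx))).mp hx hx'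
  · intro x hy hy'
    obtain ⟨⟨u, y⟩, hx, e'⟩ := Finset.mem_image.mp hy
    obtain ⟨⟨v, s⟩, hx', e⟩ := Finset.mem_image.mp hy'
    simp only at e e'
    subst e e'
    obtain ⟨e1, e2⟩ := full_end_pair (h1 hx) (h1 hx')
    subst e1 e2
    exact (h3 _ (mem_hor_iff.mpr (h1 hx))).mp hx hx'

theorem not_start_pair (hf : f ∈ a.expand) {x u v : Fin (4 * k)} (h1 : (x, u) ∈ f)
    (h2 : (Z.pair x, v) ∈ f) : False :=
  (isPure hf).start x (Finset.mem_image.mpr ⟨_, h1, rfl⟩) (Finset.mem_image.mpr ⟨_, h2, rfl⟩)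

theorem exists_mem_expand (hf : IsPure Z f) : ∃ a : Gen Z, f ∈ a.expand := by
  have hst : ∀ p ∈ f, ∀ q ∈ f, p.1 ≠ Z.pair q.1 := fun p hp q hq h =>
    hf.start _ (Finset.mem_image_of_mem _ hq) (h ▸ Finset.mem_image_of_mem _ hp)
  have hen : ∀ p ∈ f, ∀ q ∈ f, p.2 ≠ Z.pair q.2 := fun p hp q hq h =>
    hf.ends _ (Finset.mem_image_of_mem _ hq) (h ▸ Finset.mem_image_of_mem _ hp)
  refine ⟨⟨f.filter fun p => p.1 < p.2,
    Finset.univ.filter fun x => (x, x) ∈ f ∨ (Z.pair x, Z.pair x) ∈ f, ?_, ?_, ?_, ?_, ?_, ?_⟩, ?_⟩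
  · exact fun p hp => (Finset.mem_filter.mp hp).2
  · intro p hp q hq hne
    rw [Finset.mem_filter] at hp hq
    exact ⟨fun h => hne (hf.diag.inj_fst p hp.1 q hq.1 h), hst p hp.1 q hq.1⟩
  · intro p hp q hq hne
    rw [Finset.mem_filter] at hp hq
    exact ⟨fun h => hne (hf.diag.inj_snd p hp.1 q hq.1 h), hen p hp.1 q hq.1⟩
  · intro x hx
    simp only [Finset.mem_filter, Finset.mem_univ, true_and, Z.pair_pair] at hx ⊢
    exact hx.symm
  · rintro ⟨p, q⟩ hp hx
    simp only [Finset.mem_filter, Finset.mem_univ, true_and] at hp hx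
    rcases hx with hx | hx
    · have := congrArg Prod.snd (hf.diag.inj_fst _ hp.1 _ hx rfl)
      simp only at this
      exact hp.2.ne this.symm
    · exact hst _ hx _ hp.1 rfl
  · rintro ⟨p, q⟩ hp hx
    simp only [Finset.mem_filter, Finset.mem_univ, true_and] at hp hx
    rcases hx with hx | hx
    · have := congrArg Prod.fst (hf.diag.inj_snd _ hp.1 _ hx rfl)
      simp only at this
      exact hp.2.ne this
    · exact hen _ hx _ hp.1 rfl
  · rw [mem_expand]
    refine ⟨?_, Finset.filter_subset _ _, ?_⟩
    · rintro ⟨p, q⟩ hp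
      rw [mem_full]
      simp only [Finset.mem_filter, Finset.mem_univ, true_and]
      rcases (hf.diag.up _ hp).lt_or_eq with h | h
      · exact Or.inl ⟨hp, h⟩
      · simp only at h
        subst h
        exact Or.inr ⟨rfl, Or.inl hp⟩
    · intro x hx
      simp only [Finset.mem_filter, Finset.mem_univ, true_and] at hx
      constructor
      · exact fun h h' => hst _ h' _ h rfl
      · intro h; tauto

theorem eq_of_mem_expand (ha : f ∈ a.expand) (hb : f ∈ b.expand) : a = b := by
  apply full_injective
  ext p
  rw [mem_full_iff ha, mem_full_iff hb]

theorem eq_of_image_fst (hf : f ∈ a.expand) (hg : g ∈ a.expand)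
    (h : f.image Prod.fst = g.image Prod.fst) : f = g := by
  have key : ∀ {f g : Finset (Fin (4 * k) × Fin (4 * k))}, f ∈ a.expand → g ∈ a.expand →
      f.image Prod.fst = g.image Prod.fst → f ⊆ g := by
    rintro f g hf hg h ⟨p, q⟩ hp
    have : p ∈ g.image Prod.fst := h ▸ Finset.mem_image.mpr ⟨_, hp, rfl⟩
    obtain ⟨⟨_, r⟩, hr, rfl⟩ := Finset.mem_image.mp this
    exact mem_of_start hg ((mem_expand.mp hf).1 hp) hr
  exact Finset.Subset.antisymm (key hf hg h) (key hg hf h.symm)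

/-- A term of `d a` can be found by resolving a crossing of `a`. -/
def DRel (a b : Gen Z) : Prop :=
  ∃ s u t v, (s, u) ∈ a.full ∧ (t, v) ∈ a.full ∧ s < t ∧ v < u ∧
    (∀ p ∈ a.full, s < p.1 → p.1 < t → v < p.2 → p.2 < u → False) ∧
    ∀ p, p ∈ b.full ↔ p = (s, v) ∨ p = (t, u) ∨
      (p ∈ a.full ∧ p.1 ≠ s ∧ p.1 ≠ t ∧ p.1 ≠ Z.pair t)

theorem DRel.of_isResolved (hf : f ∈ a.expand) (hh : h ∈ b.expand) (hd : IsResolved f h) :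
    DRel a b := by
  obtain ⟨s, u, t, v, h1, h2, hst, hvu, h3, h4⟩ := hd
  have hsub := (mem_expand.mp hf).1
  have htv := (isPure hf).diag.up _ h2
  simp only at htv
  refine ⟨s, u, t, v, hsub h1, hsub h2, hst, hvu, ?_, ?_⟩
  · rintro ⟨p, q⟩ hp k1 k2 k3 k4
    rcases (mem_full_iff hf).mp hp with hp | hp
    · exact h3 _ hp k1 k2 k3 k4
    · obtain ⟨hp, -⟩ := hp
      simp only at hp k1 k2 k3 k4
      subst hp
      exact absurd (htv.trans_lt k3) k2.not_gt
  · rintro ⟨p, q⟩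
    rw [mem_full_iff hh]
    simp only [h4, Prod.mk.injEq]
    constructor
    · rintro ((h | h | h) | ⟨rfl, h | h | h⟩)
      · exact Or.inl h
      · exact Or.inr (Or.inl h)
      · refine Or.inr (Or.inr ⟨hsub h.1, h.2.1, h.2.2, ?_⟩)
        rintro rfl
        exact not_start_pair hf h2 h.1
      · omega
      · omega
      · refine Or.inr (Or.inr ⟨?_, ?_, ?_, ?_⟩)
        · have := full_pair (hsub h.1)
          rwa [Z.pair_pair] at this
        · rintro rfl; exact not_start_pair hf h1 h.1
        · rintro rfl; exact not_start_pair hf h2 h.1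
        · rintro rfl; rw [Z.pair_pair] at h; exact h.2.2 rfl
    · rintro (h | h | ⟨h, h5, h6, h7⟩)
      · exact Or.inl (Or.inl h)
      · exact Or.inl (Or.inr (Or.inl h))
      · rcases (mem_full_iff hf).mp h with h | h
        · exact Or.inl (Or.inr (Or.inr ⟨h, h5, h6⟩))
        · refine Or.inr ⟨h.1, Or.inr (Or.inr ⟨h.2, ?_, ?_⟩)⟩
          · intro h8
            have := h.2
            simp only [h8] at this
            have := congrArg Prod.snd ((isPure hf).diag.inj_fst _ this _ h1 rfl)
            simp only at this
            omega
          · intro h8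
            exact h7 (by rw [← h8, Z.pair_pair])

theorem filter_mem_expand {T : Finset (Fin (4 * k))} (h1 : ∀ s t, (s, t) ∈ a.strands → s ∈ T)
    (h2 : ∀ x ∈ a.hor, (x ∈ T ↔ Z.pair x ∉ T)) : a.full.filter (fun p => p.1 ∈ T) ∈ a.expand := by
  rw [mem_expand]
  refine ⟨Finset.filter_subset _ _, ?_, ?_⟩
  · rintro ⟨s, t⟩ hs
    exact Finset.mem_filter.mpr ⟨mem_full.mpr (Or.inl hs), h1 s t hs⟩
  · intro x hx
    simp only [Finset.mem_filter, mem_hor_iff.mp hx, mem_hor_iff.mp (a.hor_pair x hx), true_and]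
    exact h2 x hx

theorem DRel.exists_isResolved (hd : DRel a b) (hh : h ∈ b.expand) :
    ∃ f ∈ a.expand, IsResolved f h := by
  obtain ⟨s, u, t, v, h1, h2, hst, hvu, h3, h4⟩ := hd
  have htv := a.isDiag_full.up _ h2
  simp only at htv
  have hsv : (s, v) ∈ h := mem_of_lt hh ((h4 _).mpr (Or.inl rfl)) (by omega)
  have htu : (t, u) ∈ h := mem_of_lt hh ((h4 _).mpr (Or.inr (Or.inl rfl))) (by omega)
  have hT : ∀ x y, (x, y) ∈ h → x ∈ h.image Prod.fst := fun x y hx => Finset.mem_image.mpr ⟨_, hx, rfl⟩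
  have hs : s ∈ h.image Prod.fst := hT _ _ hsv
  have ht : t ∈ h.image Prod.fst := hT _ _ htu
  have hhor : ∀ x, (x, x) ∈ a.full → x ≠ s := by
    rintro x hx rfl
    have := full_fst hx h1
    omega
  have hmem : a.full.filter (fun p => p.1 ∈ h.image Prod.fst) ∈ a.expand := by
    refine filter_mem_expand ?_ ?_
    · intro x y hx
      have hx' : (x, y) ∈ a.full := mem_full.mpr (Or.inl hx)
      have hxy := a.up _ hx
      simp only at hxy
      by_cases e1 : x = s
      · rwa [e1]
      by_cases e2 : x = t
      · rwa [e2]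
      by_cases e3 : x = Z.pair t
      · subst e3
        have := (full_start_pair h2 hx').2
        omega
      · exact hT _ _ (mem_of_lt hh ((h4 _).mpr (Or.inr (Or.inr ⟨hx', e1, e2, e3⟩))) hxy)
    · intro x hx
      have hx' := mem_hor_iff.mp hx
      by_cases e2 : x = t
      · subst e2
        exact ⟨fun h => (isPure hh).start _ h, fun _ => ht⟩
      by_cases e3 : x = Z.pair t
      · subst e3
        rw [Z.pair_pair]
        exact ⟨fun h h' => (isPure hh).start _ h' h, fun h => absurd ht h⟩
      have hb : (x, x) ∈ b.full := (h4 _).mpr (Or.inr (Or.inr ⟨hx', hhor x hx', e2, e3⟩))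
      refine ⟨fun h => (isPure hh).start _ h, fun h' => ?_⟩
      by_contra h''
      have := ((mem_expand.mp hh).2.2 x (mem_hor_iff.mpr hb)).mpr fun h => h' (hT _ _ h)
      exact h'' (hT _ _ this)
  refine ⟨_, hmem, s, u, t, v, Finset.mem_filter.mpr ⟨h1, hs⟩, Finset.mem_filter.mpr ⟨h2, ht⟩,
    hst, hvu, fun p hp => h3 p (Finset.mem_filter.mp hp).1, ?_⟩
  rintro ⟨p, q⟩
  simp only [Finset.mem_filter]
  constructor
  · intro hp
    rcases (h4 _).mp ((mem_expand.mp hh).1 hp) with e | e | e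
    · exact Or.inl e
    · exact Or.inr (Or.inl e)
    · exact Or.inr (Or.inr ⟨⟨e.1, hT _ _ hp⟩, e.2.1, e.2.2.1⟩)
  · rintro (e | e | ⟨⟨e1, e2⟩, e3, e4⟩)
    · rwa [e]
    · rwa [e]
    · have e5 : p ≠ Z.pair t := by
        rintro rfl
        exact (isPure hh).start _ ht e2
      obtain ⟨⟨_, q'⟩, hq', rfl⟩ := Finset.mem_image.mp e2
      exact mem_of_start hh ((h4 _).mpr (Or.inr (Or.inr ⟨e1, e3, e4, e5⟩))) hq'

open Classical in
theorem sum_dCount_expand (a : Gen Z) (hh : h ∈ b.expand) :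
    ∑ f ∈ a.expand, dCount f h = if DRel a b then 1 else 0 := by
  split_ifs with hd
  · obtain ⟨f, hf, hr⟩ := hd.exists_isResolved hh
    have hfh : dCount f h = 1 := by rw [(isPure hf).diag.dCount_eq, if_pos hr]
    rw [Finset.sum_eq_single_of_mem f hf, hfh]
    intro g hg hne
    by_contra h0
    have e1 := (isPure hg).diag.image_of_dCount h0
    have e2 := (isPure hf).diag.image_of_dCount (by rw [hfh]; exact one_ne_zero : dCount f h ≠ 0)
    exact hne (eq_of_image_fst hg hf (by rw [← e1.1, e2.1]))
  · refine Finset.sum_eq_zero fun f hf => ?_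
    rw [(isPure hf).diag.dCount_eq, if_neg fun hr => hd (DRel.of_isResolved hf hh hr)]

end Gen

open Diagram

namespace Gen

variable {k : ℕ} {Z : PMC k} {a b c : Gen Z} {f g h : Finset (Fin (4 * k) × Fin (4 * k))}

/-- The product of `a` and `b` is `c`. -/
structure MulRel (a b c : Gen Z) : Prop where
  idem : a.right = b.left
  left : ∀ s m, (s, m) ∈ a.strands → ∃ e, (m, e) ∈ b.full
  right : ∀ m e, (m, e) ∈ b.strands → ∃ s, (s, m) ∈ a.full
  comp : ∀ s e, (s, e) ∈ c.full ↔ ∃ m, (s, m) ∈ a.full ∧ (m, e) ∈ b.full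
  cross : ∀ s m s' m' e e', (s, m) ∈ a.full → (s', m') ∈ a.full → (m, e) ∈ b.full →
    (m', e') ∈ b.full → s < s' → m' < m → e' < e

theorem MulRel.of_isProd (hf : f ∈ a.expand) (hg : g ∈ b.expand) (hh : h ∈ c.expand)
    (hp : IsProd f g h) : MulRel a b c := by
  obtain ⟨h1, h2, h3⟩ := ((isPure hf).diag.isProd_iff (isPure hg).diag).mp hp
  have fs := (mem_expand.mp hf).1
  have gs := (mem_expand.mp hg).1
  have ext_g : ∀ {s m}, (s, m) ∈ f → ∃ e, (m, e) ∈ g := by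
    intro s m hs
    have : m ∈ g.image Prod.fst := h1 ▸ Finset.mem_image.mpr ⟨_, hs, rfl⟩
    obtain ⟨⟨m', e⟩, he, rfl⟩ := Finset.mem_image.mp this
    exact ⟨e, he⟩
  have ext_f : ∀ {m e}, (m, e) ∈ g → ∃ s, (s, m) ∈ f := by
    intro m e hs
    have : m ∈ f.image Prod.snd := h1 ▸ Finset.mem_image.mpr ⟨_, hs, rfl⟩
    obtain ⟨⟨s, m'⟩, he, rfl⟩ := Finset.mem_image.mp this
    exact ⟨s, he⟩
  -- a strand of `a` that is not in `f`
  have other : ∀ {s m e}, (s, m) ∈ a.full → (m, e) ∈ b.full → (s, m) ∉ f →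
      s = m ∧ e = m ∧ (Z.pair m, Z.pair m) ∈ f ∧ (Z.pair m, Z.pair m) ∈ g := by
    intro s m e hs he hn
    rcases (mem_full_iff hf).mp hs with h | ⟨h, h'⟩
    · exact absurd h hn
    · simp only at h h'
      subst h
      obtain ⟨e', he'⟩ := ext_g h'
      obtain ⟨e1, e2⟩ := full_start_pair he (gs he')
      subst e1 e2
      exact ⟨rfl, rfl, h', he'⟩
  refine ⟨?_, ?_, ?_, ?_, ?_⟩
  · ext x
    rw [mem_right_pts, mem_left_pts]
    constructor
    · have key : ∀ {x s}, (s, x) ∈ a.full → ∃ e, (x, e) ∈ b.full ∨ (Z.pair x, e) ∈ b.full := by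
        intro x s hs
        rcases (mem_full_iff hf).mp hs with h | ⟨h, h'⟩
        · obtain ⟨e, he⟩ := ext_g h
          exact ⟨e, Or.inl (gs he)⟩
        · simp only at h h'
          subst h
          obtain ⟨e, he⟩ := ext_g h'
          exact ⟨e, Or.inr (gs he)⟩
      rintro ⟨s, hs | hs⟩
      · exact key hs
      · obtain ⟨e, he⟩ := key hs
        rw [Z.pair_pair] at he
        exact ⟨e, he.symm⟩
    · have key : ∀ {x e}, (x, e) ∈ b.full → ∃ s, (s, x) ∈ a.full ∨ (s, Z.pair x) ∈ a.full := by
        intro x e he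
        rcases (mem_full_iff hg).mp he with h | ⟨h, h'⟩
        · obtain ⟨s, hs⟩ := ext_f h
          exact ⟨s, Or.inl (fs hs)⟩
        · obtain ⟨s, hs⟩ := ext_f h'
          exact ⟨s, Or.inr (fs hs)⟩
      rintro ⟨e, he | he⟩
      · exact key he
      · obtain ⟨s, hs⟩ := key he
        rw [Z.pair_pair] at hs
        exact ⟨s, hs.symm⟩
  · intro s m hs
    obtain ⟨e, he⟩ := ext_g ((mem_expand.mp hf).2.1 hs)
    exact ⟨e, gs he⟩
  · intro m e hs
    obtain ⟨s, hs⟩ := ext_f ((mem_expand.mp hg).2.1 hs)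
    exact ⟨s, fs hs⟩
  · intro s e
    rw [mem_full_iff hh]
    simp only [h2]
    constructor
    · rintro (⟨m, h4, h5⟩ | ⟨rfl, m, h4, h5⟩)
      · exact ⟨m, fs h4, gs h5⟩
      · have e1 := (isPure hf).diag.up _ h4
        have e2 := (isPure hg).diag.up _ h5
        obtain rfl : Z.pair s = m := le_antisymm e1 e2
        have i1 := full_pair (fs h4)
        have i2 := full_pair (gs h5)
        rw [Z.pair_pair] at i1 i2
        exact ⟨s, i1, i2⟩
    · rintro ⟨m, h4, h5⟩
      by_cases h6 : (s, m) ∈ f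
      · obtain ⟨e', he'⟩ := ext_g h6
        exact Or.inl ⟨m, h6, mem_of_start hg h5 he'⟩
      · obtain ⟨rfl, rfl, h7, h8⟩ := other h4 h5 h6
        exact Or.inr ⟨rfl, _, h7, h8⟩
  · intro s m s' m' e e' k1 k2 k3 k4 k5 k6
    by_cases h6 : (s, m) ∈ f
    · by_cases h7 : (s', m') ∈ f
      · obtain ⟨x, hx⟩ := ext_g h6
        obtain ⟨x', hx'⟩ := ext_g h7
        exact h3 s m s' m' e e' h6 h7 (mem_of_start hg k3 hx) (mem_of_start hg k4 hx') k5 k6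
      · obtain ⟨rfl, rfl, -, -⟩ := other k2 k4 h7
        have := b.isDiag_full.up _ k3
        simp only at this
        omega
    · obtain ⟨rfl, rfl, -, -⟩ := other k1 k3 h6
      have := a.isDiag_full.up _ k2
      simp only at this
      omega

theorem MulRel.exists_isProd (hm : MulRel a b c) (hh : h ∈ c.expand) :
    ∃ f ∈ a.expand, ∃ g ∈ b.expand, IsProd f g h := by
  have hsub := (mem_expand.mp hh).1
  have hT : ∀ {h : Finset (Fin (4 * k) × Fin (4 * k))} {x y}, (x, y) ∈ h → x ∈ h.image Prod.fst :=
    fun hx => Finset.mem_image.mpr ⟨_, hx, rfl⟩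
  have hU : ∀ {h : Finset (Fin (4 * k) × Fin (4 * k))} {x y}, (x, y) ∈ h → y ∈ h.image Prod.snd :=
    fun hx => Finset.mem_image.mpr ⟨_, hx, rfl⟩
  have hf : a.full.filter (fun p => p.1 ∈ h.image Prod.fst) ∈ a.expand := by
    refine filter_mem_expand ?_ ?_
    · intro s m hs
      obtain ⟨e, he⟩ := hm.left s m hs
      have h1 := a.up _ hs
      have h2 := b.isDiag_full.up _ he
      simp only at h1 h2
      exact hT (mem_of_lt hh ((hm.comp s e).mpr ⟨m, mem_full.mpr (Or.inl hs), he⟩) (by omega))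
    · intro x hx
      have hx1 := mem_hor_iff.mp hx
      have hx2 := full_pair hx1
      refine ⟨fun h => (isPure hh).start _ h, fun hn => ?_⟩
      have hxl : x ∈ b.left.pts := by
        rw [← hm.idem, mem_right_pts]; exact ⟨x, Or.inl hx1⟩
      have main : ∀ {y e}, (y, y) ∈ a.full → (y, e) ∈ b.full → 
          (y ∈ h.image Prod.fst ∨ Z.pair y ∈ h.image Prod.fst) := by
        intro y e hy he
        have hc := (hm.comp y e).mpr ⟨y, hy, he⟩
        rcases (mem_full_iff hh).mp hc with h | ⟨-, h⟩
        · exact Or.inl (hT h)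
        · exact Or.inr (hT h)
      obtain ⟨e, he | he⟩ := mem_left_pts.mp hxl
      · exact (main hx1 he).resolve_right hn
      · have := (main hx2 he).resolve_left hn
        rwa [Z.pair_pair] at this
  obtain ⟨f, hfdef⟩ : ∃ f, f = a.full.filter (fun p => p.1 ∈ h.image Prod.fst) := ⟨_, rfl⟩
  rw [← hfdef] at hf
  have memf : ∀ s m, (s, m) ∈ f ↔ (s, m) ∈ a.full ∧ s ∈ h.image Prod.fst := by
    intro s m; rw [hfdef, Finset.mem_filter]
  have hg : b.full.filter (fun p => p.1 ∈ f.image Prod.snd) ∈ b.expand := by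
    refine filter_mem_expand ?_ ?_
    · intro m e he
      obtain ⟨s, hs⟩ := hm.right m e he
      have h1 := b.up _ he
      have h2 := a.isDiag_full.up _ hs
      simp only at h1 h2
      have := mem_of_lt hh ((hm.comp s e).mpr ⟨m, hs, mem_full.mpr (Or.inl he)⟩) (by omega)
      exact hU ((memf s m).mpr ⟨hs, hT this⟩)
    · intro x hx
      have hx1 := mem_hor_iff.mp hx
      refine ⟨fun h => (isPure hf).ends _ h, fun hn => ?_⟩
      have hxl : x ∈ a.right.pts := by
        rw [hm.idem, mem_left_pts]; exact ⟨x, Or.inl hx1⟩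
      have main : ∀ {y s}, (s, y) ∈ a.full →
          (y ∈ f.image Prod.snd ∨ Z.pair y ∈ f.image Prod.snd) := by
        intro y s hy
        rcases (mem_full_iff hf).mp hy with h | ⟨h, h'⟩
        · exact Or.inl (hU h)
        · simp only at h h'
          subst h
          exact Or.inr (hU h')
      obtain ⟨e, he | he⟩ := mem_right_pts.mp hxl
      · exact (main he).resolve_right hn
      · have := (main he).resolve_left hn
        rwa [Z.pair_pair] at this
  refine ⟨f, hf, _, hg, ?_⟩
  rw [(isPure hf).diag.isProd_iff (isPure hg).diag]
  refine ⟨?_, ?_, ?_⟩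
  · ext m
    constructor
    · intro hm'
      obtain ⟨⟨s, m'⟩, hs, rfl⟩ := Finset.mem_image.mp hm'
      obtain ⟨hs1, hs2⟩ := (memf _ _).mp hs
      obtain ⟨⟨s', e⟩, he, rfl⟩ := Finset.mem_image.mp hs2
      obtain ⟨m', h1, h2⟩ := (hm.comp _ _).mp (hsub he)
      rw [full_fst h1 hs1] at h2
      exact hT (Finset.mem_filter.mpr ⟨h2, hm'⟩)
    · intro hm'
      obtain ⟨⟨m', e⟩, he, rfl⟩ := Finset.mem_image.mp hm'
      exact (Finset.mem_filter.mp he).2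
  · rintro ⟨s, e⟩
    simp only [Finset.mem_filter]
    constructor
    · intro he
      obtain ⟨m, h1, h2⟩ := (hm.comp _ _).mp (hsub he)
      have h3 := (memf s m).mpr ⟨h1, hT he⟩
      exact ⟨m, h3, h2, hU h3⟩
    · rintro ⟨m, h1, h2, h3⟩
      obtain ⟨h4, h5⟩ := (memf _ _).mp h1
      obtain ⟨⟨s', e'⟩, he, rfl⟩ := Finset.mem_image.mp h5
      exact mem_of_start hh ((hm.comp _ _).mpr ⟨m, h4, h2⟩) he
  · intro s m s' m' e e' k1 k2 k3 k4
    exact hm.cross s m s' m' e e' ((memf _ _).mp k1).1 ((memf _ _).mp k2).1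
      (Finset.mem_filter.mp k3).1 (Finset.mem_filter.mp k4).1

open Classical in
theorem card_isProd_expand (a b : Gen Z) (hh : h ∈ c.expand) :
    ((a.expand ×ˢ b.expand).filter fun p => IsProd p.1 p.2 h).card = if MulRel a b c then 1 else 0 := by
  split_ifs with hd
  · rw [Finset.card_eq_one]
    obtain ⟨f, hf, g, hg, hp⟩ := hd.exists_isProd hh
    refine ⟨(f, g), ?_⟩
    ext ⟨f', g'⟩
    simp only [Finset.mem_filter, Finset.mem_product, Finset.mem_singleton, Prod.mk.injEq]
    constructor
    · rintro ⟨⟨hf', hg'⟩, hp'⟩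
      have e1 := (isPure hf).diag.of_isProd (isPure hg).diag hp
      have e2 := (isPure hf').diag.of_isProd (isPure hg').diag hp'
      obtain rfl : f' = f := eq_of_image_fst hf' hf (by rw [← e1.2.1, e2.2.1])
      exact ⟨rfl, eq_of_image_fst hg' hg (by rw [← hp.1, hp'.1])⟩
    · rintro ⟨rfl, rfl⟩
      exact ⟨⟨hf, hg⟩, hp⟩
  · rw [Finset.card_eq_zero, Finset.filter_eq_empty_iff]
    rintro ⟨f, g⟩ hfg hp
    rw [Finset.mem_product] at hfg
    exact hd (MulRel.of_isProd hfg.1 hfg.2 hh hp)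

end Gen

section
variable {k : ℕ} {Z : PMC k} (a b c e : Gen Z)

open Classical in
theorem strandAlg_d : (strandAlg Z).d a b = if Gen.DRel a b then 1 else 0 := by
  simp only [strandAlg, Gen.sum_dCount_expand a b.rep_mem_expand]
  split_ifs <;> simp

open Classical in
theorem strandAlg_mul : (strandAlg Z).mul a b c = if Gen.MulRel a b c then 1 else 0 := by
  simp only [strandAlg, Gen.card_isProd_expand a b c.rep_mem_expand]
  split_ifs <;> simp

variable {a b c e} {h : Finset (Fin (4 * k) × Fin (4 * k))}

theorem strandAlg_d_eq_sum (hh : h ∈ b.expand) :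
    (strandAlg Z).d a b = ∑ f ∈ a.expand, (dCount f h : ZMod 2) := by
  classical
  rw [strandAlg_d, ← Nat.cast_sum, Gen.sum_dCount_expand a hh]
  split_ifs <;> simp

theorem strandAlg_mul_eq_sum (hh : h ∈ c.expand) :
    (strandAlg Z).mul a b c =
      ∑ f ∈ a.expand, ∑ g ∈ b.expand, if IsProd f g h then (1 : ZMod 2) else 0 := by
  classical
  have := Gen.card_isProd_expand a b hh
  rw [Finset.card_filter, Finset.sum_product] at this
  rw [strandAlg_mul, ← Nat.cast_one, ← Nat.cast_zero (R := ZMod 2), ← Nat.cast_ite, ← this]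
  push_cast
  rfl

theorem sum_expand (W : Finset (Fin (4 * k) × Fin (4 * k)) → ZMod 2)
    (hW : ∀ m, ¬ IsPure Z m → W m = 0) : ∑ c : Gen Z, ∑ m ∈ c.expand, W m = ∑ m, W m := by
  have h1 : ∀ c : Gen Z, ∑ m ∈ c.expand, W m = ∑ m, if m ∈ c.expand then W m else 0 := by
    intro c
    rw [← Finset.sum_filter]
    refine Finset.sum_congr ?_ fun _ _ => rfl
    ext; simp
  rw [Finset.sum_congr rfl fun c _ => h1 c, Finset.sum_comm]
  refine Finset.sum_congr rfl fun m _ => ?_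
  by_cases hm : IsPure Z m
  · obtain ⟨a, ha⟩ := Gen.exists_mem_expand hm
    rw [Finset.sum_eq_single a, if_pos ha]
    · intro b _ hb
      rw [if_neg fun h => hb (Gen.eq_of_mem_expand h ha)]
    · simp
  · rw [hW m hm]; simp

theorem sum_d_mul_sum (φ : Finset (Fin (4 * k) × Fin (4 * k)) → ZMod 2) :
    ∑ c, (strandAlg Z).d a c * ∑ m ∈ c.expand, φ m =
      ∑ f ∈ a.expand, ∑ m, (dCount f m : ZMod 2) * φ m := by
  have h1 : ∀ c, (strandAlg Z).d a c * ∑ m ∈ c.expand, φ m =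
      ∑ m ∈ c.expand, (∑ f ∈ a.expand, (dCount f m : ZMod 2)) * φ m := by
    intro c
    rw [Finset.mul_sum]
    exact Finset.sum_congr rfl fun m hm => by rw [strandAlg_d_eq_sum hm]
  rw [Finset.sum_congr rfl fun c _ => h1 c, sum_expand, Finset.sum_comm]
  · simp only [Finset.sum_mul]
  · intro m hm
    rw [Finset.sum_eq_zero, zero_mul]
    intro f hf
    by_contra h0
    have h0 : dCount f m ≠ 0 := fun h => h0 (by rw [h, Nat.cast_zero])
    have hp := Gen.isPure hf
    have e := hp.diag.image_of_dCount h0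
    exact hm ⟨hp.diag.of_dCount h0, e.1 ▸ hp.start, e.2 ▸ hp.ends⟩

theorem sum_mul_mul_sum (φ : Finset (Fin (4 * k) × Fin (4 * k)) → ZMod 2) :
    ∑ c, (strandAlg Z).mul a b c * ∑ m ∈ c.expand, φ m =
      ∑ f ∈ a.expand, ∑ g ∈ b.expand, ∑ m, (if IsProd f g m then 1 else 0) * φ m := by
  have h1 : ∀ c, (strandAlg Z).mul a b c * ∑ m ∈ c.expand, φ m = ∑ m ∈ c.expand,
      (∑ f ∈ a.expand, ∑ g ∈ b.expand, if IsProd f g m then (1 : ZMod 2) else 0) * φ m := by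
    intro c
    rw [Finset.mul_sum]
    exact Finset.sum_congr rfl fun m hm => by rw [strandAlg_mul_eq_sum hm]
  rw [Finset.sum_congr rfl fun c _ => h1 c, sum_expand]
  · simp only [Finset.sum_mul]
    rw [Finset.sum_comm]
    refine Finset.sum_congr rfl fun f _ => ?_
    rw [Finset.sum_comm]
  · intro m hm
    rw [Finset.sum_eq_zero, zero_mul]
    intro f hf
    refine Finset.sum_eq_zero fun g hg => if_neg fun h => hm ?_
    have hp := Gen.isPure hf
    have hq := Gen.isPure hg
    have e := hp.diag.of_isProd hq.diag h
    exact ⟨e.1, e.2.1 ▸ hp.start, e.2.2 ▸ hq.ends⟩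

theorem strandAlg_leibniz (a b e : Gen Z) :
    ∑ c, (strandAlg Z).mul a b c * (strandAlg Z).d c e +
    ∑ c, (strandAlg Z).d a c * (strandAlg Z).mul c b e +
    ∑ c, (strandAlg Z).d b c * (strandAlg Z).mul a c e = 0 := by
  have he := e.rep_mem_expand
  generalize e.rep = h at he
  have e1 : ∀ c, (strandAlg Z).mul a c e =
      ∑ g ∈ c.expand, ∑ f ∈ a.expand, if IsProd f g h then (1 : ZMod 2) else 0 := by
    intro c; rw [strandAlg_mul_eq_sum he, Finset.sum_comm]
  simp only [strandAlg_d_eq_sum he, sum_mul_mul_sum]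
  simp only [e1, strandAlg_mul_eq_sum he, sum_d_mul_sum]
  have e2 : ∑ f ∈ a.expand, ∑ m, (dCount f m : ZMod 2) *
      ∑ g ∈ b.expand, (if IsProd m g h then 1 else 0) = ∑ f ∈ a.expand, ∑ g ∈ b.expand,
        ∑ m, (dCount f m : ZMod 2) * (if IsProd m g h then 1 else 0) := by
    refine Finset.sum_congr rfl fun f _ => ?_
    simp only [Finset.mul_sum]
    rw [Finset.sum_comm]
  have e3 : ∑ g ∈ b.expand, ∑ m, (dCount g m : ZMod 2) *
      ∑ f ∈ a.expand, (if IsProd f m h then 1 else 0) = ∑ f ∈ a.expand, ∑ g ∈ b.expand,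
        ∑ m, (dCount g m : ZMod 2) * (if IsProd f m h then 1 else 0) := by
    conv_rhs => rw [Finset.sum_comm]
    refine Finset.sum_congr rfl fun g _ => ?_
    simp only [Finset.mul_sum]
    rw [Finset.sum_comm]
  rw [e2, e3, ← Finset.sum_add_distrib, ← Finset.sum_add_distrib]
  refine Finset.sum_eq_zero fun f hf => ?_
  rw [← Finset.sum_add_distrib, ← Finset.sum_add_distrib]
  exact Finset.sum_eq_zero fun g hg => leibniz (Gen.isPure hf).diag (Gen.isPure hg).diag

theorem strandAlg_assoc (a b c e : Gen Z) :
    ∑ m, (strandAlg Z).mul a b m * (strandAlg Z).mul m c e =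
    ∑ m, (strandAlg Z).mul b c m * (strandAlg Z).mul a m e := by
  have he := e.rep_mem_expand
  generalize e.rep = l at he
  have e1 : ∀ c, (strandAlg Z).mul a c e =
      ∑ g ∈ c.expand, ∑ f ∈ a.expand, if IsProd f g l then (1 : ZMod 2) else 0 := by
    intro c; rw [strandAlg_mul_eq_sum he, Finset.sum_comm]
  simp only [e1]
  simp only [strandAlg_mul_eq_sum he, sum_mul_mul_sum]
  simp only [Finset.mul_sum]
  have e2 : ∑ g ∈ b.expand, ∑ h ∈ c.expand, ∑ m, ∑ f ∈ a.expand,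
      (if IsProd g h m then 1 else 0) * (if IsProd f m l then (1 : ZMod 2) else 0) =
    ∑ f ∈ a.expand, ∑ g ∈ b.expand, ∑ h ∈ c.expand, ∑ m,
      (if IsProd g h m then 1 else 0) * (if IsProd f m l then (1 : ZMod 2) else 0) := by
    conv_rhs => rw [Finset.sum_comm]
    refine Finset.sum_congr rfl fun g _ => ?_
    conv_rhs => rw [Finset.sum_comm]
    exact Finset.sum_congr rfl fun h _ => Finset.sum_comm
  have e3 : ∀ f g, ∑ m, ∑ h ∈ c.expand,
      (if IsProd f g m then 1 else 0) * (if IsProd m h l then (1 : ZMod 2) else 0) =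
      ∑ h ∈ c.expand, ∑ m,
      (if IsProd f g m then 1 else 0) * (if IsProd m h l then (1 : ZMod 2) else 0) :=
    fun f g => Finset.sum_comm
  rw [e2]
  simp only [e3]
  refine Finset.sum_congr rfl fun f hf => Finset.sum_congr rfl fun g hg =>
    Finset.sum_congr rfl fun h hh => ?_
  have key := isProd_assoc (l := l) (Gen.isPure hf).diag (Gen.isPure hg).diag (Gen.isPure hh).diag
  have s1 : ∑ m, (if IsProd f g m then 1 else 0) * (if IsProd m h l then (1 : ZMod 2) else 0) =
      if ∃ m, IsProd f g m ∧ IsProd m h l then 1 else 0 := by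
    rw [Finset.sum_eq_single (comp f g)]
    · rw [ite_zero_mul_ite_zero, one_mul]
      refine if_congr ⟨fun h => ⟨_, h⟩, ?_⟩ rfl rfl
      rintro ⟨m, h1, h2⟩
      obtain rfl := h1.2.2
      exact ⟨h1, h2⟩
    · intro m _ hm
      rw [if_neg fun h => hm h.2.2.symm, zero_mul]
    · simp
  have s2 : ∑ m, (if IsProd g h m then 1 else 0) * (if IsProd f m l then (1 : ZMod 2) else 0) =
      if ∃ m, IsProd g h m ∧ IsProd f m l then 1 else 0 := by
    rw [Finset.sum_eq_single (comp g h)]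
    · rw [ite_zero_mul_ite_zero, one_mul]
      refine if_congr ⟨fun h => ⟨_, h⟩, ?_⟩ rfl rfl
      rintro ⟨m, h1, h2⟩
      obtain rfl := h1.2.2
      exact ⟨h1, h2⟩
    · intro m _ hm
      rw [if_neg fun h => hm h.2.2.symm, zero_mul]
    · simp
  rw [s1, s2]
  exact if_congr key rfl rfl

end

open Diagram

namespace Gen

variable {k : ℕ} {Z : PMC k} {a b c : Gen Z} {f g h : Finset (Fin (4 * k) × Fin (4 * k))}

theorem mem_left_pts_iff (hf : f ∈ a.expand) {x : Fin (4 * k)} :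
    x ∈ a.left.pts ↔ x ∈ f.image Prod.fst ∨ Z.pair x ∈ f.image Prod.fst := by
  rw [mem_left_pts]
  have hsub := (mem_expand.mp hf).1
  constructor
  · have key : ∀ {x e}, (x, e) ∈ a.full → x ∈ f.image Prod.fst ∨ Z.pair x ∈ f.image Prod.fst := by
      intro x e h
      rcases (mem_full_iff hf).mp h with h | h
      · exact Or.inl (Finset.mem_image.mpr ⟨_, h, rfl⟩)
      · exact Or.inr (Finset.mem_image.mpr ⟨_, h.2, rfl⟩)
    rintro ⟨e, h | h⟩
    · exact key h
    · have := key h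
      rw [Z.pair_pair] at this
      exact this.symm
  · rintro (h | h)
    all_goals
      obtain ⟨⟨y, e⟩, he, e'⟩ := Finset.mem_image.mp h
      simp only at e'
      subst e'
    · exact ⟨e, Or.inl (hsub he)⟩
    · exact ⟨e, Or.inr (hsub he)⟩

theorem mem_right_pts_iff (hf : f ∈ a.expand) {x : Fin (4 * k)} :
    x ∈ a.right.pts ↔ x ∈ f.image Prod.snd ∨ Z.pair x ∈ f.image Prod.snd := by
  rw [mem_right_pts]
  have hsub := (mem_expand.mp hf).1
  constructor
  · have key : ∀ {x e}, (e, x) ∈ a.full → x ∈ f.image Prod.snd ∨ Z.pair x ∈ f.image Prod.snd := by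
      intro x e h
      rcases (mem_full_iff hf).mp h with h | ⟨h, h'⟩
      · exact Or.inl (Finset.mem_image.mpr ⟨_, h, rfl⟩)
      · simp only at h h'
        subst h
        exact Or.inr (Finset.mem_image.mpr ⟨_, h', rfl⟩)
    rintro ⟨e, h | h⟩
    · exact key h
    · have := key h
      rw [Z.pair_pair] at this
      exact this.symm
  · rintro (h | h)
    all_goals
      obtain ⟨⟨e, y⟩, he, e'⟩ := Finset.mem_image.mp h
      simp only at e'
      subst e'
    · exact ⟨e, Or.inl (hsub he)⟩
    · exact ⟨e, Or.inr (hsub he)⟩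

theorem DRel.left_right (hd : DRel a b) : b.left = a.left ∧ b.right = a.right := by
  classical
  have hb := b.rep_mem_expand
  obtain ⟨f, hf, hr⟩ := hd.exists_isResolved hb
  have := (isPure hf).diag.image_of_dCount (h := b.rep)
    (by rw [(isPure hf).diag.dCount_eq, if_pos hr]; exact one_ne_zero)
  constructor
  · ext x; rw [mem_left_pts_iff hb, mem_left_pts_iff hf, this.1]
  · ext x; rw [mem_right_pts_iff hb, mem_right_pts_iff hf, this.2]

theorem MulRel.left_right (hm : MulRel a b c) : c.left = a.left ∧ c.right = b.right := by
  have hc := c.rep_mem_expand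
  obtain ⟨f, hf, g, hg, hp⟩ := hm.exists_isProd hc
  have := (isPure hf).diag.of_isProd (isPure hg).diag hp
  constructor
  · ext x; rw [mem_left_pts_iff hc, mem_left_pts_iff hf, this.2.1]
  · ext x; rw [mem_right_pts_iff hc, mem_right_pts_iff hg, this.2.2]

theorem mem_full_gen {i : Idem Z} {s t : Fin (4 * k)} : (s, t) ∈ i.gen.full ↔ s = t ∧ s ∈ i.pts := by
  rw [mem_full]
  simp [Idem.gen]

theorem left_gen (i : Idem Z) : i.gen.left = i := by
  ext x; simp [left, Idem.gen]

theorem right_gen (i : Idem Z) : i.gen.right = i := by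
  ext x; simp [right, Idem.gen]

theorem mulRel_gen_right {i : Idem Z} : MulRel a i.gen c ↔ a.right = i ∧ a = c := by
  have hr : ∀ {s m}, (s, m) ∈ a.full → m ∈ a.right.pts := fun h => mem_right_pts.mpr ⟨_, Or.inl h⟩
  constructor
  · intro h
    have h1 : a.right = i := by rw [h.idem, left_gen]
    refine ⟨h1, full_injective ?_⟩
    ext ⟨s, e⟩
    rw [h.comp]
    simp only [mem_full_gen]
    constructor
    · exact fun h => ⟨e, h, rfl, h1 ▸ hr h⟩
    · rintro ⟨m, h1, rfl, -⟩; exact h1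
  · rintro ⟨rfl, rfl⟩
    refine ⟨(left_gen _).symm, ?_, ?_, ?_, ?_⟩
    · exact fun s m h => ⟨m, mem_full_gen.mpr ⟨rfl, hr (mem_full.mpr (Or.inl h))⟩⟩
    · intro m e h; simp [Idem.gen] at h
    · intro s e
      simp only [mem_full_gen]
      constructor
      · exact fun h => ⟨e, h, rfl, hr h⟩
      · rintro ⟨m, h1, rfl, -⟩; exact h1
    · intro s m s' m' e e' _ _ h1 h2 _ h3
      rw [mem_full_gen] at h1 h2
      rw [← h1.1, ← h2.1]; exact h3

theorem mulRel_gen_left {i : Idem Z} : MulRel i.gen a c ↔ a.left = i ∧ a = c := by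
  have hr : ∀ {s m}, (s, m) ∈ a.full → s ∈ a.left.pts := fun h => mem_left_pts.mpr ⟨_, Or.inl h⟩
  constructor
  · intro h
    have h1 : a.left = i := by rw [← h.idem, right_gen]
    refine ⟨h1, full_injective ?_⟩
    ext ⟨s, e⟩
    rw [h.comp]
    simp only [mem_full_gen]
    constructor
    · exact fun h => ⟨s, ⟨rfl, h1 ▸ hr h⟩, h⟩
    · rintro ⟨m, ⟨rfl, -⟩, h1⟩; exact h1
  · rintro ⟨rfl, rfl⟩
    refine ⟨right_gen _, ?_, ?_, ?_, ?_⟩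
    · intro m e h; simp [Idem.gen] at h
    · exact fun s m h => ⟨s, mem_full_gen.mpr ⟨rfl, hr (mem_full.mpr (Or.inl h))⟩⟩
    · intro s e
      simp only [mem_full_gen]
      constructor
      · exact fun h => ⟨s, ⟨rfl, hr h⟩, h⟩
      · rintro ⟨m, ⟨rfl, -⟩, h1⟩; exact h1
    · intro s m s' m' e e' h1 h2 _ _ h3 h4
      rw [mem_full_gen] at h1 h2
      rw [← h1.1, ← h2.1] at h4
      exact absurd h3 h4.not_gt

theorem exists_full_eq {F : Finset (Fin (4 * k) × Fin (4 * k))} (hF : IsDiag F)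
    (h1 : ∀ x, (x, x) ∈ F → (Z.pair x, Z.pair x) ∈ F)
    (h2 : ∀ x u v, (x, u) ∈ F → (Z.pair x, v) ∈ F → x = u)
    (h3 : ∀ x u v, (u, x) ∈ F → (v, Z.pair x) ∈ F → u = x) : ∃ a : Gen Z, a.full = F := by
  refine ⟨⟨F.filter fun p => p.1 < p.2, Finset.univ.filter fun x => (x, x) ∈ F,
    ?_, ?_, ?_, ?_, ?_, ?_⟩, ?_⟩
  · exact fun p hp => (Finset.mem_filter.mp hp).2
  · rintro ⟨p, q⟩ hp ⟨p', q'⟩ hq hne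
    simp only [Finset.mem_filter] at hp hq
    refine ⟨fun h => hne (hF.inj_fst _ hp.1 _ hq.1 h), ?_⟩
    rintro rfl
    exact hq.2.ne (h2 _ _ _ hq.1 hp.1)
  · rintro ⟨p, q⟩ hp ⟨p', q'⟩ hq hne
    simp only [Finset.mem_filter] at hp hq
    refine ⟨fun h => hne (hF.inj_snd _ hp.1 _ hq.1 h), ?_⟩
    rintro rfl
    exact hq.2.ne (h3 _ _ _ hq.1 hp.1)
  · intro x hx
    simp only [Finset.mem_filter, Finset.mem_univ, true_and] at hx ⊢
    exact h1 x hx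
  · rintro ⟨p, q⟩ hp hx
    simp only [Finset.mem_filter, Finset.mem_univ, true_and] at hp hx
    exact hp.2.ne (congrArg Prod.snd (hF.inj_fst _ hx _ hp.1 rfl))
  · rintro ⟨p, q⟩ hp hx
    simp only [Finset.mem_filter, Finset.mem_univ, true_and] at hp hx
    exact hp.2.ne (congrArg Prod.fst (hF.inj_snd _ hp.1 _ hx rfl))
  · ext ⟨p, q⟩
    rw [mem_full]
    simp only [Finset.mem_filter, Finset.mem_univ, true_and]
    constructor
    · rintro (h | ⟨rfl, h⟩)
      · exact h.1
      · exact h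
    · intro h
      rcases (hF.up _ h).lt_or_eq with h' | h'
      · exact Or.inl ⟨h, h'⟩
      · simp only at h'
        subst h'
        exact Or.inr ⟨rfl, h⟩

/-! ### Orientation reversal -/

variable {a' b' c' : Gen Z.rev}

theorem pair_rev (x : Fin (4 * k)) : Z.rev.pair x.rev = (Z.pair x).rev := by
  simp [PMC.rev]

theorem mem_full_bar {s t : Fin (4 * k)} : (s, t) ∈ a'.bar.full ↔ (t.rev, s.rev) ∈ a'.full := by
  rw [mem_full, mem_full]
  simp only [bar, Finset.mem_image, Prod.exists, Prod.mk.injEq]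
  refine or_congr ⟨?_, ?_⟩ ⟨?_, ?_⟩
  · rintro ⟨p, q, h, rfl, rfl⟩; simpa using h
  · intro h; exact ⟨_, _, h, by simp, by simp⟩
  · rintro ⟨rfl, x, hx, rfl⟩; simpa using hx
  · rintro ⟨h, h'⟩; exact ⟨(Fin.rev_injective h).symm, _, h', by rw [Fin.rev_injective h]; simp⟩

theorem mem_full_bar' {s t : Fin (4 * k)} : (t.rev, s.rev) ∈ a'.bar.full ↔ (s, t) ∈ a'.full := by
  rw [mem_full_bar, Fin.rev_rev, Fin.rev_rev]

theorem bar_injective : Function.Injective (bar : Gen Z.rev → Gen Z) := by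
  intro a b h
  apply full_injective
  ext ⟨s, t⟩
  rw [← mem_full_bar', ← mem_full_bar', h]

theorem mem_bar_pts {i : Idem Z} {x : Fin (4 * k)} : x.rev ∈ i.bar.pts ↔ x ∈ i.pts := by
  simp [Idem.bar, Finset.mem_image, Fin.rev_inj]

theorem _root_.Idem.bar_injective : Function.Injective (Idem.bar : Idem Z → Idem Z.rev) := by
  intro i j h
  ext x
  rw [← mem_bar_pts (i := i), h, mem_bar_pts]

theorem _root_.Idem.o_o (i : Idem Z) : i.o.o = i := by
  ext x; simp [Idem.o]

theorem left_bar : a'.bar.left.bar = a'.right := by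
  ext x
  rw [← Fin.rev_rev x, mem_bar_pts, mem_left_pts, mem_right_pts]
  simp only [mem_full_bar, Fin.rev_rev]
  constructor
  · rintro ⟨e, h⟩
    refine ⟨e.rev, ?_⟩
    rwa [← Fin.rev_rev x, pair_rev, Fin.rev_rev]
  · rintro ⟨e, h⟩
    refine ⟨e.rev, ?_⟩
    rwa [← Fin.rev_rev x, pair_rev, Fin.rev_rev, ← Fin.rev_rev e] at h

theorem right_bar : a'.bar.right.bar = a'.left := by
  ext x
  rw [← Fin.rev_rev x, mem_bar_pts, mem_right_pts, mem_left_pts]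
  simp only [mem_full_bar, Fin.rev_rev]
  constructor
  · rintro ⟨e, h⟩
    refine ⟨e.rev, ?_⟩
    rwa [← Fin.rev_rev x, pair_rev, Fin.rev_rev]
  · rintro ⟨e, h⟩
    refine ⟨e.rev, ?_⟩
    rwa [← Fin.rev_rev x, pair_rev, Fin.rev_rev, ← Fin.rev_rev e] at h

theorem mem_strands_bar {s t : Fin (4 * k)} :
    (s, t) ∈ a'.bar.strands ↔ (t.rev, s.rev) ∈ a'.strands := by
  rw [mem_strands_iff, mem_strands_iff, mem_full_bar, Fin.rev_lt_rev]

theorem bar_gen (i : Idem Z) : i.bar.gen.bar = i.gen := by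
  apply full_injective
  ext ⟨s, t⟩
  rw [mem_full_bar, mem_full_gen, mem_full_gen, mem_bar_pts, Fin.rev_inj]
  constructor <;> · rintro ⟨rfl, h⟩; exact ⟨rfl, h⟩

theorem mulRel_bar : MulRel b'.bar a'.bar c'.bar ↔ MulRel a' b' c' := by
  constructor
  · intro h
    refine ⟨?_, ?_, ?_, ?_, ?_⟩
    · rw [← left_bar, ← right_bar, h.idem]
    · intro s m hs
      have := mem_strands_bar (a' := a') (s := m.rev) (t := s.rev)
      rw [Fin.rev_rev, Fin.rev_rev] at this
      obtain ⟨e, he⟩ := h.right _ _ (this.mpr hs)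
      rw [mem_full_bar, Fin.rev_rev] at he
      exact ⟨_, he⟩
    · intro s m hs
      have := mem_strands_bar (a' := b') (s := m.rev) (t := s.rev)
      rw [Fin.rev_rev, Fin.rev_rev] at this
      obtain ⟨e, he⟩ := h.left _ _ (this.mpr hs)
      rw [mem_full_bar, Fin.rev_rev] at he
      exact ⟨_, he⟩
    · intro s e
      rw [← mem_full_bar', h.comp]
      constructor
      · rintro ⟨m, h1, h2⟩
        rw [mem_full_bar, Fin.rev_rev] at h1 h2
        exact ⟨_, h2, h1⟩
      · rintro ⟨m, h1, h2⟩
        exact ⟨m.rev, mem_full_bar'.mpr h2, mem_full_bar'.mpr h1⟩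
    · intro s m s' m' e e' h1 h2 h3 h4 h5 h6
      by_contra h7
      have h8 : e ≠ e' := by
        rintro rfl
        rw [full_snd h3 h4] at h6
        exact lt_irrefl _ h6
      have := h.cross e'.rev m'.rev e.rev m.rev s'.rev s.rev
        (mem_full_bar'.mpr h4) (mem_full_bar'.mpr h3)
        (mem_full_bar'.mpr h2) (mem_full_bar'.mpr h1) (Fin.rev_lt_rev.mpr (by omega))
        (Fin.rev_lt_rev.mpr h6)
      rw [Fin.rev_lt_rev] at this
      omega
  · intro h
    refine ⟨?_, ?_, ?_, ?_, ?_⟩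
    · apply Idem.bar_injective; rw [left_bar, right_bar, h.idem]
    · intro s m hs
      obtain ⟨e, he⟩ := h.right _ _ (mem_strands_bar.mp hs)
      exact ⟨e.rev, by rwa [mem_full_bar, Fin.rev_rev]⟩
    · intro s m hs
      obtain ⟨e, he⟩ := h.left _ _ (mem_strands_bar.mp hs)
      exact ⟨e.rev, by rwa [mem_full_bar, Fin.rev_rev]⟩
    · intro s e
      simp only [mem_full_bar, h.comp]
      constructor
      · rintro ⟨m, h1, h2⟩
        exact ⟨m.rev, by rwa [Fin.rev_rev], by rwa [Fin.rev_rev]⟩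
      · rintro ⟨m, h1, h2⟩
        exact ⟨m.rev, h2, h1⟩
    · intro s m s' m' e e' h1 h2 h3 h4 h5 h6
      by_contra h7
      have h8 : e ≠ e' := by
        rintro rfl
        rw [full_snd h3 h4] at h6
        exact lt_irrefl _ h6
      rw [mem_full_bar] at h1 h2 h3 h4
      have := h.cross _ _ _ _ _ _ h4 h3 h2 h1 (Fin.rev_lt_rev.mpr (by omega))
        (Fin.rev_lt_rev.mpr h6)
      rw [Fin.rev_lt_rev] at this
      omega

theorem DRel.bar (h : DRel a' b') : DRel a'.bar b'.bar := by
  obtain ⟨s, u, t, v, h1, h2, h3, h4, h5, h6⟩ := h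
  refine ⟨u.rev, s.rev, v.rev, t.rev, mem_full_bar'.mpr h1, mem_full_bar'.mpr h2,
    Fin.rev_lt_rev.mpr h4, Fin.rev_lt_rev.mpr h3, ?_, ?_⟩
  · rintro ⟨p, q⟩ hp k1 k2 k3 k4
    rw [mem_full_bar] at hp
    refine h5 _ hp ?_ ?_ ?_ ?_ <;> simp only
    · rwa [Fin.lt_rev_iff]
    · rwa [Fin.rev_lt_iff]
    · rwa [Fin.lt_rev_iff]
    · rwa [Fin.rev_lt_iff]
  · rintro ⟨p, q⟩
    rw [mem_full_bar, h6, mem_full_bar]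
    simp only [Prod.mk.injEq, Fin.rev_eq_iff]
    have e : (q.rev, p.rev) ∈ a'.full → ((q ≠ s.rev ∧ q ≠ t.rev ∧ q ≠ (Z.rev.pair t).rev) ↔
        (p ≠ u.rev ∧ p ≠ v.rev ∧ p ≠ Z.pair v.rev)) := by
      intro hp
      have e1 : q = s.rev ↔ p = u.rev := by
        constructor
        · rintro rfl; rw [Fin.rev_rev] at hp; rw [← full_fst hp h1, Fin.rev_rev]
        · rintro rfl; rw [Fin.rev_rev] at hp; rw [← full_snd hp h1, Fin.rev_rev]
      have e2 : q = t.rev ↔ p = v.rev := by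
        constructor
        · rintro rfl; rw [Fin.rev_rev] at hp; rw [← full_fst hp h2, Fin.rev_rev]
        · rintro rfl; rw [Fin.rev_rev] at hp; rw [← full_snd hp h2, Fin.rev_rev]
      have e3 : q = (Z.rev.pair t).rev ↔ p = Z.pair v.rev := by
        have hv : Z.pair v.rev = (Z.rev.pair v).rev := by simp [PMC.rev]
        rw [hv]
        constructor
        · rintro rfl
          rw [Fin.rev_rev] at hp
          obtain ⟨k1, k2⟩ := full_start_pair h2 hp
          rw [← k1, k2, Fin.rev_rev]
        · rintro rfl
          rw [Fin.rev_rev] at hp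
          obtain ⟨k1, k2⟩ := full_end_pair h2 hp
          rw [k1, ← k2, Fin.rev_rev]
      rw [ne_eq, ne_eq, ne_eq, e1, e2, e3]
    constructor
    · rintro (⟨rfl, rfl⟩ | ⟨rfl, rfl⟩ | ⟨k1, k2⟩)
      · exact Or.inr (Or.inl ⟨rfl, rfl⟩)
      · exact Or.inl ⟨rfl, rfl⟩
      · exact Or.inr (Or.inr ⟨k1, (e k1).mp (by simpa [Fin.rev_eq_iff] using k2)⟩)
    · rintro (⟨rfl, rfl⟩ | ⟨rfl, rfl⟩ | ⟨k1, k2⟩)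
      · exact Or.inr (Or.inl ⟨rfl, rfl⟩)
      · exact Or.inl ⟨rfl, rfl⟩
      · exact Or.inr (Or.inr ⟨k1, by simpa [Fin.rev_eq_iff] using (e k1).mpr k2⟩)

theorem DRel.of_bar (h : DRel a'.bar b'.bar) : DRel a' b' := by
  obtain ⟨s, u, t, v, h1, h2, h3, h4, h5, h6⟩ := h
  have h1' := mem_full_bar.mp h1
  have h2' := mem_full_bar.mp h2
  refine ⟨u.rev, s.rev, v.rev, t.rev, h1', h2',
    Fin.rev_lt_rev.mpr h4, Fin.rev_lt_rev.mpr h3, ?_, ?_⟩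
  · rintro ⟨p, q⟩ hp k1 k2 k3 k4
    refine h5 _ (mem_full_bar'.mpr hp) ?_ ?_ ?_ ?_ <;> simp only
    · rwa [Fin.lt_rev_iff]
    · rwa [Fin.rev_lt_iff]
    · rwa [Fin.lt_rev_iff]
    · rwa [Fin.rev_lt_iff]
  · rintro ⟨p, q⟩
    rw [← mem_full_bar', h6, mem_full_bar']
    simp only [Prod.mk.injEq, Fin.rev_eq_iff]
    have e : (p, q) ∈ a'.full → ((q ≠ s.rev ∧ q ≠ t.rev ∧ q ≠ (Z.pair t).rev) ↔
        (p ≠ u.rev ∧ p ≠ v.rev ∧ p ≠ Z.rev.pair v.rev)) := by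
      intro hp
      have e1 : q = s.rev ↔ p = u.rev := by
        constructor
        · rintro rfl; exact full_snd hp h1'
        · rintro rfl; exact full_fst hp h1'
      have e2 : q = t.rev ↔ p = v.rev := by
        constructor
        · rintro rfl; exact full_snd hp h2'
        · rintro rfl; exact full_fst hp h2'
      have e3 : q = (Z.pair t).rev ↔ p = Z.rev.pair v.rev := by
        constructor
        · rintro rfl
          rw [← pair_rev] at hp
          obtain ⟨k1, k2⟩ := full_end_pair h2' hp
          rw [k2, k1]
        · rintro rfl
          obtain ⟨k1, k2⟩ := full_start_pair h2' hp
          rw [← k2, k1, pair_rev]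
      rw [ne_eq, ne_eq, ne_eq, e1, e2, e3]
    constructor
    · rintro (⟨rfl, rfl⟩ | ⟨rfl, rfl⟩ | ⟨k1, k2⟩)
      · exact Or.inr (Or.inl ⟨rfl, rfl⟩)
      · exact Or.inl ⟨rfl, rfl⟩
      · exact Or.inr (Or.inr ⟨k1, (e k1).mp (by simpa [Fin.rev_eq_iff] using k2)⟩)
    · rintro (⟨rfl, rfl⟩ | ⟨rfl, rfl⟩ | ⟨k1, k2⟩)
      · exact Or.inr (Or.inl ⟨rfl, rfl⟩)
      · exact Or.inl ⟨rfl, rfl⟩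
      · exact Or.inr (Or.inr ⟨k1, by simpa [Fin.rev_eq_iff] using (e k1).mpr k2⟩)

theorem dRel_bar : DRel a'.bar b'.bar ↔ DRel a' b' := ⟨DRel.of_bar, DRel.bar⟩

end Gen

open Diagram

/-! ### Generators of the large model as configurations -/

section
variable {k : ℕ} {Z : PMC k}

namespace MGen

theorem left_snd (x : MGen Z) : x.snd.left = x.x := x.idem_p

theorem left_fst (x : MGen Z) : x.fst.left = x.x.o := by
  apply Idem.bar_injective
  rw [fst, Gen.left_bar]
  exact x.idem_q

theorem fst_snd_injective {x y : MGen Z} (h1 : x.fst = y.fst) (h2 : x.snd = y.snd) : x = y := by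
  refine BoxGen.ext (Gen.bar_injective h1) ?_ h2
  rw [← left_snd, ← left_snd, h2]

/-- `t` is the configuration of the pair `[a₁, a₂]`. -/
structure IsCode (a₁ a₂ : Gen Z) (t : Fin (4 * k) → ℕ) : Prop where
  right : ∀ s v : Fin (4 * k), (s, v) ∈ a₂.full ↔ t s = v
  left : ∀ s v : Fin (4 * k), (s, v) ∈ a₁.full ↔ t s + v + 1 = 2 * (4 * k)
  le : ∀ s, t s ≤ 2 * (4 * k)

theorem not_both (x : MGen Z) {s u v : Fin (4 * k)} (h1 : (s, u) ∈ x.fst.full)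
    (h2 : (s, v) ∈ x.snd.full ∨ (Z.pair s, v) ∈ x.snd.full) : False := by
  have e1 : s ∈ x.fst.left.pts := Gen.mem_left_pts.mpr ⟨u, Or.inl h1⟩
  have e2 : s ∈ x.snd.left.pts := Gen.mem_left_pts.mpr ⟨v, h2⟩
  rw [left_fst] at e1
  rw [left_snd] at e2
  exact (Finset.mem_compl.mp e1) e2

theorem exists_isCode (x : MGen Z) : ∃ t, IsCode x.fst x.snd t := by
  have : ∀ s : Fin (4 * k), ∃ t : ℕ, (∀ v : Fin (4 * k), (s, v) ∈ x.snd.full ↔ t = v) ∧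
      (∀ v : Fin (4 * k), (s, v) ∈ x.fst.full ↔ t + v + 1 = 2 * (4 * k)) ∧ t ≤ 2 * (4 * k) := by
    intro s
    by_cases h1 : ∃ v, (s, v) ∈ x.snd.full
    · obtain ⟨v, hv⟩ := h1
      refine ⟨v, fun u => ⟨fun hu => ?_, fun hu => ?_⟩, fun u => ⟨fun hu => ?_, fun hu => ?_⟩, ?_⟩
      · rw [Gen.full_fst hv hu]
      · rwa [← Fin.ext hu]
      · exact (x.not_both hu (Or.inl hv)).elim
      · omega
      · omega
    by_cases h2 : ∃ v, (s, v) ∈ x.fst.full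
    · obtain ⟨v, hv⟩ := h2
      refine ⟨2 * (4 * k) - 1 - v, fun u => ⟨fun hu => ?_, fun hu => ?_⟩,
        fun u => ⟨fun hu => ?_, fun hu => ?_⟩, ?_⟩
      · exact (h1 ⟨u, hu⟩).elim
      · omega
      · rw [Gen.full_fst hv hu]; omega
      · have : v = u := Fin.ext (by omega)
        rwa [← this]
      · omega
    · refine ⟨2 * (4 * k), fun u => ⟨fun hu => ?_, fun hu => ?_⟩,
        fun u => ⟨fun hu => ?_, fun hu => ?_⟩, ?_⟩
      · exact (h1 ⟨u, hu⟩).elim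
      · omega
      · exact (h2 ⟨u, hu⟩).elim
      · omega
      · omega
  choose t ht using this
  exact ⟨t, fun s => (ht s).1, fun s => (ht s).2.1, fun s => (ht s).2.2⟩

/-- The configuration of a generator. -/
noncomputable def code (x : MGen Z) : Fin (4 * k) → ℕ := x.exists_isCode.choose

theorem isCode (x : MGen Z) : IsCode x.fst x.snd x.code := x.exists_isCode.choose_spec

theorem mem_snd (x : MGen Z) {s v : Fin (4 * k)} : (s, v) ∈ x.snd.full ↔ x.code s = v :=
  x.isCode.right s v

theorem mem_fst (x : MGen Z) {s v : Fin (4 * k)} :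
    (s, v) ∈ x.fst.full ↔ x.code s + v + 1 = 2 * (4 * k) :=
  x.isCode.left s v

theorem code_cases (x : MGen Z) (s : Fin (4 * k)) : (∃ v : Fin (4 * k), x.code s = v) ∨
    (∃ v : Fin (4 * k), x.code s + v + 1 = 2 * (4 * k)) ∨ x.code s = 2 * (4 * k) := by
  have h := x.isCode.le s
  by_cases h1 : x.code s < 4 * k
  · exact Or.inl ⟨⟨_, h1⟩, rfl⟩
  by_cases h2 : x.code s = 2 * (4 * k)
  · exact Or.inr (Or.inr h2)
  · exact Or.inr (Or.inl ⟨⟨2 * (4 * k) - 1 - x.code s, by omega⟩, by simp only; omega⟩)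

theorem mem_pts_iff (x : MGen Z) {s : Fin (4 * k)} :
    s ∈ x.x.pts ↔ x.code s < 4 * k ∨ x.code (Z.pair s) < 4 * k := by
  rw [← left_snd, Gen.mem_left_pts]
  simp only [mem_snd]
  constructor
  · rintro ⟨e, h | h⟩
    · exact Or.inl (by omega)
    · exact Or.inr (by omega)
  · rintro (h | h)
    · exact ⟨⟨_, h⟩, Or.inl rfl⟩
    · exact ⟨⟨_, h⟩, Or.inr rfl⟩

theorem not_mem_pts_iff (x : MGen Z) {s : Fin (4 * k)} : s ∉ x.x.pts ↔
    (4 * k ≤ x.code s ∧ x.code s < 2 * (4 * k)) ∨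
    (4 * k ≤ x.code (Z.pair s) ∧ x.code (Z.pair s) < 2 * (4 * k)) := by
  have h : s ∉ x.x.pts ↔ s ∈ x.fst.left.pts := by
    rw [left_fst, Idem.o, Finset.mem_compl]
  rw [h, Gen.mem_left_pts]
  simp only [mem_fst]
  constructor
  · rintro ⟨e, h | h⟩
    · exact Or.inl (by omega)
    · exact Or.inr (by omega)
  · rintro (h | h)
    · exact ⟨⟨2 * (4 * k) - 1 - x.code s, by omega⟩, Or.inl (by simp only; omega)⟩
    · exact ⟨⟨2 * (4 * k) - 1 - x.code (Z.pair s), by omega⟩, Or.inr (by simp only; omega)⟩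

theorem isConf_code (x : MGen Z) : IsConf Z.pair x.code := by
  have hup2 : ∀ s v : Fin (4 * k), x.code s = v → (s : ℕ) ≤ v := fun s v h =>
    x.snd.isDiag_full.up _ (x.mem_snd.mpr h)
  have hup1 : ∀ s v : Fin (4 * k), x.code s + v + 1 = 2 * (4 * k) → (s : ℕ) ≤ v := fun s v h =>
    x.fst.isDiag_full.up _ (x.mem_fst.mpr h)
  refine ⟨?_, ?_, ?_, ?_, ?_, ?_, ?_, ?_⟩
  · intro s
    rcases x.code_cases s with ⟨v, h⟩ | ⟨v, h⟩ | h
    · have := hup2 s v h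
      omega
    · have := hup1 s v h
      omega
    · exact Or.inr h
  · intro s h
    exact x.mem_snd.mp (Gen.full_pair (x.mem_snd.mpr h))
  · intro s h
    exact x.mem_fst.mp (Gen.full_pair (x.mem_fst.mpr h))
  · intro s h1 h2
    rcases x.code_cases s with ⟨v, h⟩ | ⟨v, h⟩ | h
    · have h := x.mem_snd.mpr h
      rcases x.code_cases (Z.pair s) with ⟨u, h'⟩ | ⟨u, h'⟩ | h'
      · have := (Gen.full_start_pair h (x.mem_snd.mpr h')).1
        subst this
        have := x.mem_snd.mp h
        omega
      · exact (x.not_both (x.mem_fst.mpr h') (Or.inr (by rw [Z.pair_pair]; exact h))).elim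
      · exact h'
    · have h := x.mem_fst.mpr h
      rcases x.code_cases (Z.pair s) with ⟨u, h'⟩ | ⟨u, h'⟩ | h'
      · exact (x.not_both h (Or.inr (x.mem_snd.mpr h'))).elim
      · have := (Gen.full_start_pair h (x.mem_fst.mpr h')).1
        subst this
        have := x.mem_fst.mp h
        omega
      · exact h'
    · omega
  · intro s h1 h2
    by_cases h3 : s ∈ x.x.pts
    · rw [mem_pts_iff] at h3; omega
    · rw [not_mem_pts_iff] at h3; omega
  · intro s r h1 h2
    rcases x.code_cases s with ⟨v, h⟩ | ⟨v, h⟩ | h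
    · exact Gen.full_snd (x.mem_snd.mpr h) (x.mem_snd.mpr (h1 ▸ h))
    · exact Gen.full_snd (x.mem_fst.mpr h) (x.mem_fst.mpr (h1 ▸ h))
    · omega
  · intro s r v h1 h2
    obtain ⟨e1, e2⟩ := Gen.full_end_pair (x.mem_snd.mpr h1) (x.mem_snd.mpr h2)
    rw [e1, e2]
  · intro s r v h1 h2
    obtain ⟨e1, e2⟩ := Gen.full_end_pair (x.mem_fst.mpr h1) (x.mem_fst.mpr h2)
    rw [e1, e2]

theorem code_injective : Function.Injective (code : MGen Z → _) := by
  intro x y h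
  apply fst_snd_injective <;> apply Gen.full_injective <;> ext ⟨s, v⟩
  · rw [mem_fst, mem_fst, h]
  · rw [mem_snd, mem_snd, h]

theorem exists_code_eq {t : Fin (4 * k) → ℕ} (ht : IsConf Z.pair t) : ∃ x : MGen Z, x.code = t := by
  have hval := ht.valid
  obtain ⟨p, hp⟩ : ∃ p : Gen Z, p.full =
      Finset.univ.filter fun c : Fin (4 * k) × Fin (4 * k) => t c.1 = c.2 := by
    refine Gen.exists_full_eq ⟨?_, ?_, ?_⟩ ?_ ?_ ?_ <;>
      simp only [Finset.mem_filter, Finset.mem_univ, true_and, Prod.forall]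
    · intro s v h; have := hval s; rw [Fin.le_def]; omega
    · rintro s v h s' v' h' rfl
      rw [Fin.ext (h.symm.trans h')]
    · rintro s v h s' v' h' rfl
      rw [ht.inj s s' (h.trans h'.symm) (by omega)]
    · exact fun x => ht.horR x
    · intro x u v h h'
      have := hval x
      by_contra hne
      have := ht.mov x (lt_of_le_of_ne (by omega) (fun h'' => hne (Fin.ext (h''.trans h)))) (by omega)
      omega
    · intro x u v h h'
      have := ht.pairR u v x h h'
      subst this
      have h1 := hval u
      by_contra hne
      have := ht.mov u (lt_of_le_of_ne (by omega) (fun h'' => hne (Fin.ext (h''.trans h)))) (by omega)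
      omega
  have mp : ∀ s v, (s, v) ∈ p.full ↔ t s = v := by intro s v; rw [hp]; simp
  obtain ⟨q, hq⟩ : ∃ q : Gen Z.rev, q.full = Finset.univ.filter
      fun c : Fin (4 * k) × Fin (4 * k) => t c.2.rev + c.1.rev + 1 = 2 * (4 * k) := by
    have hpr : ∀ x : Fin (4 * k), (Z.rev.pair x).rev = Z.pair x.rev := by
      intro x; simp [PMC.rev]
    refine Gen.exists_full_eq ⟨?_, ?_, ?_⟩ ?_ ?_ ?_ <;>
      simp only [Finset.mem_filter, Finset.mem_univ, true_and, Prod.forall, hpr]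
    · intro s v h
      rw [← Fin.rev_le_rev]
      have := hval v.rev; rw [Fin.le_def]; omega
    · rintro s v h s' v' h' rfl
      rw [Fin.rev_injective (ht.inj v.rev v'.rev (by omega) (by omega))]
    · rintro s v h s' v' h' rfl
      have : s.rev = s'.rev := Fin.ext (by omega)
      rw [Fin.rev_injective this]
    · exact fun x => ht.horL x.rev
    · intro x u v h h'
      have := ht.pairL _ _ _ h h'
      rw [this] at h'
      have h1 := hval u.rev
      by_contra hne
      have := ht.mov u.rev (by omega) (lt_of_le_of_ne (by omega)
        (fun h'' => hne (Fin.rev_injective (Fin.ext (by omega)))))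
      omega
    · intro x u v h h'
      have h1 := hval x.rev
      by_contra hne
      have := ht.mov x.rev (by omega) (lt_of_le_of_ne (by omega)
        (fun h'' => hne (Fin.rev_injective (Fin.ext (by omega)))))
      omega
  have mq : ∀ s v, (s, v) ∈ q.bar.full ↔ t s + v + 1 = 2 * (4 * k) := by
    intro s v
    rw [Gen.mem_full_bar, hq, Finset.mem_filter]
    simp only [Finset.mem_univ, true_and, Fin.rev_rev]
  have hle : ∀ s, t s ≤ 2 * (4 * k) := fun s => by have := hval s; omega
  have hidem : q.bar.left = p.left.o := by
    ext s
    rw [Idem.o, Finset.mem_compl, Gen.mem_left_pts, Gen.mem_left_pts]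
    simp only [mp, mq]
    constructor
    · rintro ⟨e, h⟩ ⟨e', h'⟩
      have h1 := hval s
      have h2 := hval (Z.pair s)
      rcases h with h | h <;> rcases h' with h' | h'
      · omega
      · by_cases h3 : t s + s + 1 = 2 * (4 * k)
        · have := ht.horL s h3
          omega
        · have := ht.mov s (by omega) (by omega)
          omega
      · by_cases h3 : t s = s
        · have := ht.horR s h3
          omega
        · have := ht.mov s (by omega) (by omega)
          omega
      · omega
    · intro h
      by_contra h'
      push Not at h h'
      have key : ∀ r, (∀ v : Fin (4 * k), t r ≠ v) → (∀ v : Fin (4 * k), t r + v + 1 ≠ 2 * (4 * k)) →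
          t r = 2 * (4 * k) := by
        intro r k1 k2
        by_contra k3
        have := hle r
        by_cases k4 : t r < 4 * k
        · exact k1 ⟨_, k4⟩ rfl
        · exact k2 ⟨2 * (4 * k) - 1 - t r, by omega⟩ (by simp only; omega)
      exact ht.none s (key s (fun v => (h v).1) (fun v => (h' v).1))
        (key _ (fun v => (h v).2) (fun v => (h' v).2))
  refine ⟨⟨q, p.left, p, ?_, rfl⟩, ?_⟩
  · change q.right = p.left.o.bar
    rw [← hidem, Gen.left_bar]
  · obtain ⟨x, hx⟩ : ∃ x : MGen Z, x = ⟨q, p.left, p, by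
        change q.right = p.left.o.bar
        rw [← hidem, Gen.left_bar], rfl⟩ := ⟨_, rfl⟩
    rw [← hx]
    have m1 : ∀ s v : Fin (4 * k), x.code s = v ↔ t s = v := by
      intro s v; rw [← mem_snd, ← mp, hx]; rfl
    have m2 : ∀ s v : Fin (4 * k), x.code s + v + 1 = 2 * (4 * k) ↔ t s + v + 1 = 2 * (4 * k) := by
      intro s v; rw [← mem_fst, ← mq, hx]; rfl
    funext s
    have h1 := x.isCode.le s
    have h2 := hle s
    rcases x.code_cases s with ⟨v, h⟩ | ⟨v, h⟩ | h
    · rw [h, (m1 s v).mp h]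
    · have := (m2 s v).mp h
      omega
    · by_contra hne
      by_cases k4 : t s < 4 * k
      · have := (m1 s ⟨_, k4⟩).mpr rfl
        simp only at this
        omega
      · have := (m2 s ⟨2 * (4 * k) - 1 - t s, by omega⟩).mpr (by simp only; omega)
        simp only at this
        omega

end MGen
end

open Diagram

namespace Gen

variable {k : ℕ} {Z : PMC k} {a b c : Gen Z} {s t : Fin (4 * k)}

/-- `c` is the product of `a` with the chord from `s` to `t` on its left. -/
structure ChordRel (s t : Fin (4 * k)) (a c : Gen Z) (e : Fin (4 * k)) : Prop where
  lt : s < t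
  mem : (t, e) ∈ a.full
  iff : ∀ r e', (r, e') ∈ c.full ↔ (r = s ∧ e' = e) ∨ ((r, e') ∈ a.full ∧ r ≠ t ∧ r ≠ Z.pair t)
  cross : ∀ r e', s < r → r < t → (r, e') ∈ a.full → e' < e

theorem mem_full_of_strands (hb : b.strands = {(s, t)}) {p q : Fin (4 * k)} :
    (p, q) ∈ b.full ↔ (p = s ∧ q = t) ∨ (p = q ∧ p ∈ b.hor) := by
  rw [mem_full, hb, Finset.mem_singleton, Prod.mk.injEq]

theorem MulRel.chordRel (hb : b.strands = {(s, t)}) (hm : MulRel b a c) : ∃ e, ChordRel s t a c e := by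
  have hmem : (s, t) ∈ b.strands := by rw [hb]; exact Finset.mem_singleton_self _
  have hst := b.up _ hmem
  have ht : t ∉ b.hor := b.end_notMem _ hmem
  have ht' : Z.pair t ∉ b.hor := fun h => ht (by rw [← Z.pair_pair t]; exact b.hor_pair _ h)
  obtain ⟨e, he⟩ := hm.left s t hmem
  have hhor : ∀ {r e'}, (r, e') ∈ a.full → r ≠ t → r ≠ Z.pair t → r ∈ b.hor := by
    intro r e' h1 h2 h3
    have : r ∈ b.right.pts := by rw [hm.idem, mem_left_pts]; exact ⟨_, Or.inl h1⟩
    simp only [Gen.right, hb, Finset.image_singleton, Finset.mem_union, Finset.mem_singleton] at this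
    tauto
  refine ⟨e, hst, he, ?_, ?_⟩
  · intro r e'
    rw [hm.comp]
    simp only [mem_full_of_strands hb]
    constructor
    · rintro ⟨m, ⟨rfl, rfl⟩ | ⟨rfl, h⟩, h'⟩
      · exact Or.inl ⟨rfl, full_fst h' he⟩
      · refine Or.inr ⟨h', ?_, ?_⟩ <;> rintro rfl
        · exact ht h
        · exact ht' h
    · rintro (⟨rfl, rfl⟩ | ⟨h1, h2, h3⟩)
      · exact ⟨t, Or.inl ⟨rfl, rfl⟩, he⟩
      · exact ⟨r, Or.inr ⟨rfl, hhor h1 h2 h3⟩, h1⟩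
  · intro r e' h1 h2 h3
    by_cases h4 : r = Z.pair t
    · subst h4
      obtain ⟨e1, e2⟩ := full_start_pair he h3
      omega
    · exact hm.cross s t r r e e' (mem_full.mpr (Or.inl hmem))
        (mem_hor_iff.mp (hhor h3 h2.ne h4)) he h3 h1 h2

theorem ChordRel.exists_mulRel {e : Fin (4 * k)} (h : ChordRel s t a c e) :
    ∃ b : Gen Z, b.strands = {(s, t)} ∧ MulRel b a c := by
  obtain ⟨hst, he, h1, h2⟩ := h
  have hte := a.isDiag_full.up _ he
  simp only at hte
  have hse : (s, e) ∈ c.full := (h1 _ _).mpr (Or.inl ⟨rfl, rfl⟩)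
  have hs : s ∉ a.left.pts \ {t, Z.pair t} := by
    intro hs
    simp only [Finset.mem_sdiff, mem_left_pts, Finset.mem_insert, Finset.mem_singleton, not_or] at hs
    obtain ⟨⟨e', h3 | h3⟩, h4, h5⟩ := hs
    · have := (h1 _ _).mpr (Or.inr ⟨h3, h4, h5⟩)
      obtain rfl := full_fst this hse
      exact h4 (full_snd h3 he)
    · have := (h1 _ _).mpr (Or.inr ⟨h3, fun h => h5 (by rw [← h, Z.pair_pair]),
        fun h => h4 (Z.pair.injective h)⟩)
      have := (full_start_pair hse this).1
      omega
  obtain ⟨b, hb1, hb2⟩ : ∃ b : Gen Z, b.strands = {(s, t)} ∧ b.hor = a.left.pts \ {t, Z.pair t} := by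
    refine ⟨⟨{(s, t)}, a.left.pts \ {t, Z.pair t}, ?_, ?_, ?_, ?_, ?_, ?_⟩, rfl, rfl⟩
    · simpa using hst
    · simp
    · simp
    · intro x hx
      simp only [Finset.mem_sdiff, Finset.mem_insert, Finset.mem_singleton, not_or] at hx ⊢
      exact ⟨a.left.pair_mem _ hx.1, fun h => hx.2.2 (by rw [← h, Z.pair_pair]),
        fun h => hx.2.1 (Z.pair.injective h)⟩
    · intro p hp
      rw [Finset.mem_singleton.mp hp]; exact hs
    · intro p hp
      rw [Finset.mem_singleton.mp hp]; simp
  have hl : ∀ {r e'}, (r, e') ∈ a.full → r ∈ a.left.pts := fun h => mem_left_pts.mpr ⟨_, Or.inl h⟩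
  have hmem : ∀ r, r ∈ b.hor ↔ r ∈ a.left.pts ∧ r ≠ t ∧ r ≠ Z.pair t := by
    intro r; rw [hb2]; simp
  refine ⟨b, hb1, ?_, ?_, ?_, ?_, ?_⟩
  · ext x
    simp only [right, hb1, Finset.image_singleton, Finset.mem_union, Finset.mem_singleton, hmem]
    constructor
    · rintro ((h | rfl) | rfl)
      · exact h.1
      · exact hl he
      · exact a.left.pair_mem _ (hl he)
    · tauto
  · intro p m hp
    rw [hb1, Finset.mem_singleton, Prod.mk.injEq] at hp
    rw [hp.2]
    exact ⟨e, he⟩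
  · intro m e' hm
    simp only [mem_full_of_strands hb1, hmem]
    by_cases h3 : m = t
    · exact ⟨s, Or.inl ⟨rfl, h3⟩⟩
    · refine ⟨m, Or.inr ⟨rfl, hl (mem_full.mpr (Or.inl hm)), h3, ?_⟩⟩
      rintro rfl
      have := (full_start_pair he (mem_full.mpr (Or.inl hm))).2
      exact (a.up _ hm).ne this
  · intro r e'
    rw [h1]
    simp only [mem_full_of_strands hb1, hmem]
    constructor
    · rintro (⟨rfl, rfl⟩ | ⟨h3, h4⟩)
      · exact ⟨t, Or.inl ⟨rfl, rfl⟩, he⟩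
      · exact ⟨r, Or.inr ⟨rfl, hl h3, h4⟩, h3⟩
    · rintro ⟨m, ⟨rfl, rfl⟩ | ⟨rfl, -, h⟩, h'⟩
      · exact Or.inl ⟨rfl, full_fst h' he⟩
      · exact Or.inr ⟨h', h⟩
  · intro p m p' m' e1 e2 k1 k2 k3 k4 k5 k6
    rw [mem_full_of_strands hb1] at k1 k2
    rcases k1 with ⟨rfl, rfl⟩ | ⟨rfl, -⟩ <;> rcases k2 with ⟨rfl, rfl⟩ | ⟨rfl, -⟩
    · omega
    · rw [full_fst k3 he]
      exact h2 _ _ k5 k6 k4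
    · omega
    · omega

theorem eq_of_strands_of_left (h1 : b.strands = {(s, t)}) (h2 : c.strands = {(s, t)})
    (h : b.left = c.left) : b = c := by
  have key : ∀ {b : Gen Z}, b.strands = {(s, t)} → ∀ x, x ∈ b.hor ↔ x ∈ b.left.pts ∧ x ≠ s ∧
      x ≠ Z.pair s := by
    intro b hb x
    have hs : s ∉ b.hor := b.start_notMem (s, t) (by rw [hb]; exact Finset.mem_singleton_self _)
    have hs' : Z.pair s ∉ b.hor := fun h => hs (by rw [← Z.pair_pair s]; exact b.hor_pair _ h)
    simp only [left, hb, Finset.image_singleton, Finset.mem_union, Finset.mem_singleton]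
    constructor
    · intro h
      refine ⟨Or.inl (Or.inl h), ?_, ?_⟩ <;> rintro rfl <;> contradiction
    · tauto
  ext x
  · rw [h1, h2]
  · rw [key h1, key h2, h]

end Gen

section
variable {k : ℕ} {Z : PMC k}

theorem IsArrow.unique {n : ℕ} {π : Fin n → Fin n} {x y : Fin n → ℕ} {s t s' t' : Fin n}
    (h : IsArrow π s t x y) (h' : IsArrow π s' t' x y) (hx : IsConf π x) (hy : IsConf π y)
    (h2 : ∀ s, π (π s) = s) (hne : ∀ s, π s ≠ s) : s = s' ∧ t = t' := by
  have key : ∀ {s t}, IsArrow π s t x y → (y s < x s ∧ x s < 2 * n) ∧ y t = x s ∧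
      ∀ r, y r < x r → x r < 2 * n → r = s := by
    intro s t h
    obtain ⟨h3, h4, h5, h6, -, rfl⟩ := h
    have hps := hx.pair_ne_of_start h2 h3 (by omega) h6 h4 (by omega)
    refine ⟨⟨?_, by omega⟩, ?_, ?_⟩
    · rw [cswap_left]; exact h5
    · rw [cswap_right h3.ne]
    · intro r h7 h8
      by_contra h9
      by_cases h10 : r = t
      · rw [h10, cswap_right h3.ne] at h7; omega
      by_cases h11 : r = π t
      · subst h11
        rw [cswap_pair hps (hne t)] at h7
        have hv := hx.valid (π t)
        have hR := hx.horR (π t)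
        have hL := hx.horL (π t)
        have hm := hx.mov (π t)
        rw [h2] at hR hL hm
        split_ifs at h7 <;> omega
      · rw [cswap_of_ne h9 h10 h11] at h7; omega
  obtain ⟨⟨a1, a2⟩, a3, a4⟩ := key h
  obtain ⟨⟨b1, b2⟩, b3, b4⟩ := key h'
  have e := b4 s a1 a2
  subst e
  exact ⟨rfl, hy.inj t t' (a3.trans b3.symm) (by omega)⟩

theorem IsConf.arrow_facts {n : ℕ} {π : Fin n → Fin n} {x : Fin n → ℕ} {s t : Fin n}
    (hx : IsConf π x) (h2 : ∀ s, π (π s) = s) (hne : ∀ s, π s ≠ s) (hst : s < t)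
    (hle : (t : ℕ) ≤ x t) (hlt : x t < x s) (hup : x s + t < 2 * n) :
    π t ≠ s ∧ cswap π s t x s = x t ∧ cswap π s t x t = x s ∧
    (cswap π s t x (π t) = if x s + t + 1 = 2 * n then 2 * n - 1 - π t else 2 * n) ∧
    (∀ r, r ≠ s → r ≠ t → r ≠ π t → cswap π s t x r = x r) ∧
    (x (π t) = if x t = t then (π t : ℕ) else 2 * n) := by
  have hps := hx.pair_ne_of_start h2 hst (by omega) hup hle (by omega)
  refine ⟨hps, cswap_left, cswap_right hst.ne, ?_, fun r => cswap_of_ne, ?_⟩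
  · rw [cswap_pair hps (hne t), if_neg (by omega)]
  · split_ifs with h
    · exact hx.horR t h
    · exact hx.mov t (by omega) (by omega)

namespace MGen

variable {x y : MGen Z} {s t : Fin (4 * k)}

theorem code_eq {w : Fin (4 * k) → ℕ} (h1 : ∀ s v : Fin (4 * k), (s, v) ∈ y.snd.full ↔ w s = v)
    (h2 : ∀ s v : Fin (4 * k), (s, v) ∈ y.fst.full ↔ w s + v + 1 = 2 * (4 * k))
    (h3 : ∀ s, w s ≤ 2 * (4 * k)) : y.code = w := by
  funext s
  have h4 := h3 s
  rcases y.code_cases s with ⟨v, h⟩ | ⟨v, h⟩ | h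
  · rw [h, (h1 s v).mp (y.mem_snd.mpr h)]
  · have := (h2 s v).mp (y.mem_fst.mpr h)
    omega
  · by_contra hne
    by_cases k4 : w s < 4 * k
    · have := y.mem_snd.mp ((h1 s ⟨_, k4⟩).mpr rfl)
      simp only at this
      omega
    · have := y.mem_fst.mp ((h2 s ⟨2 * (4 * k) - 1 - w s, by omega⟩).mpr (by simp only; omega))
      simp only at this
      omega

theorem dRel_snd_iff : (x.fst = y.fst ∧ Gen.DRel x.snd y.snd) ↔
    ∃ s t, IsArrow Z.pair s t x.code y.code ∧ x.code s < 4 * k := by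
  have hx := x.isConf_code
  constructor
  · rintro ⟨h0, s, u, t, v, h1, h2, hst, hvu, h5, h6⟩
    have htv := x.snd.isDiag_full.up _ h2
    simp only at htv
    rw [mem_snd] at h1 h2
    have hc := hx.isConf_cswap Z.pair_pair Z.pair_ne hst (by omega) (by omega) (by omega) (by omega)
    obtain ⟨f1, f2, f3, f4, f5, f6⟩ :=
      hx.arrow_facts Z.pair_pair Z.pair_ne hst (by omega) (by omega) (by omega)
    refine ⟨s, t, ⟨hst, by omega, by omega, by omega, ?_, ?_⟩, by omega⟩
    · intro p k1 k2 k3 k4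
      exact h5 (p, ⟨x.code p, by omega⟩) (x.mem_snd.mpr rfl) k1 k2
        (by rw [Fin.lt_def]; simp only; omega) (by rw [Fin.lt_def]; simp only; omega)
    · refine code_eq (fun r v' => ?_) (fun r v' => ?_) fun r => ?_
      · rw [h6, mem_snd]
        simp only [Prod.mk.injEq, ne_eq, Fin.ext_iff (b := v), Fin.ext_iff (b := u)]
        by_cases e1 : r = s
        · subst e1; have := hst.ne; grind
        by_cases e2 : r = t
        · subst e2; grind
        by_cases e3 : r = Z.pair t
        · subst e3; rw [f4]; have := v'.isLt; split_ifs <;> grind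
        · rw [f5 r e1 e2 e3]; grind
      · rw [← h0, mem_fst]
        by_cases e1 : r = s
        · subst e1; omega
        by_cases e2 : r = t
        · subst e2; omega
        by_cases e3 : r = Z.pair t
        · subst e3; rw [f4, f6]; split_ifs <;> omega
        · rw [f5 r e1 e2 e3]
      · have := hc.valid r; omega
  · rintro ⟨s, t, ⟨hst, hle, hlt, hup, hem, heq⟩, hs⟩
    obtain ⟨f1, f2, f3, f4, f5, f6⟩ :=
      hx.arrow_facts Z.pair_pair Z.pair_ne hst (by omega) (by omega) (by omega)
    rw [← heq] at f2 f3 f4 f5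
    constructor
    · apply Gen.full_injective
      ext ⟨r, v'⟩
      rw [mem_fst, mem_fst]
      by_cases e1 : r = s
      · subst e1; omega
      by_cases e2 : r = t
      · subst e2; omega
      by_cases e3 : r = Z.pair t
      · subst e3; rw [f4, f6]; split_ifs <;> omega
      · rw [f5 r e1 e2 e3]
    · refine ⟨s, ⟨x.code s, hs⟩, t, ⟨x.code t, by omega⟩, x.mem_snd.mpr rfl, x.mem_snd.mpr rfl, hst,
        hlt, ?_, ?_⟩
      · rintro ⟨p, q⟩ hp k1 k2 k3 k4
        rw [mem_snd] at hp
        simp only [Fin.lt_def] at k1 k2 k3 k4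
        exact hem p k1 k2 (by omega) (by omega)
      · rintro ⟨r, v'⟩
        rw [mem_snd, mem_snd]
        simp only [Prod.mk.injEq, ne_eq, Fin.ext_iff (a := v')]
        by_cases e1 : r = s
        · subst e1; have := hst.ne; grind
        by_cases e2 : r = t
        · subst e2; grind
        by_cases e3 : r = Z.pair t
        · subst e3; rw [f4]; have := v'.isLt; split_ifs <;> grind
        · rw [f5 r e1 e2 e3]; grind

theorem dRel_fst_iff : (x.snd = y.snd ∧ Gen.DRel y.fst x.fst) ↔
    ∃ s t, IsArrow Z.pair s t x.code y.code ∧ 4 * k ≤ x.code t := by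
  have hx := x.isConf_code
  constructor
  · rintro ⟨h0, s, u, t, v, h1, h2, hst, hvu, h5, h6⟩
    have htv := y.fst.isDiag_full.up _ h2
    simp only at htv
    have g1 := (h6 (s, v)).mpr (Or.inl rfl)
    have g2 := (h6 (t, u)).mpr (Or.inr (Or.inl rfl))
    have l1 := y.mem_fst.mp h1
    have l2 := y.mem_fst.mp h2
    rw [mem_fst] at g1 g2
    have hc := hx.isConf_cswap Z.pair_pair Z.pair_ne hst (by omega) (by omega) (by omega) (by omega)
    obtain ⟨f1, f2, f3, f4, f5, f6⟩ :=
      hx.arrow_facts Z.pair_pair Z.pair_ne hst (by omega) (by omega) (by omega)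
    rw [if_neg (by omega)] at f6
    refine ⟨s, t, ⟨hst, by omega, by omega, by omega, ?_, ?_⟩, by omega⟩
    · intro p k1 k2 k3 k4
      have hp : (p, (⟨2 * (4 * k) - 1 - x.code p, by omega⟩ : Fin (4 * k))) ∈ x.fst.full :=
        x.mem_fst.mpr (by simp only; omega)
      have hp' := (h6 _).mp hp
      simp only [Prod.mk.injEq] at hp'
      rcases hp' with hp' | hp' | hp'
      · omega
      · omega
      · exact h5 _ hp'.1 k1 k2 (by rw [Fin.lt_def]; simp only; omega)
          (by rw [Fin.lt_def]; simp only; omega)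
    · refine code_eq (fun r v' => ?_) (fun r v' => ?_) fun r => ?_
      · rw [← h0, mem_snd]
        by_cases e1 : r = s
        · subst e1; omega
        by_cases e2 : r = t
        · subst e2; omega
        by_cases e3 : r = Z.pair t
        · subst e3; rw [f4, f6]; split_ifs <;> omega
        · rw [f5 r e1 e2 e3]
      · by_cases e1 : r = s
        · subst e1; rw [mem_fst]; omega
        by_cases e2 : r = t
        · subst e2; rw [mem_fst]; omega
        by_cases e3 : r = Z.pair t
        · subst e3
          rw [f4]
          constructor
          · intro h
            obtain ⟨k1, k2⟩ := Gen.full_start_pair h2 h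
            rw [if_pos (by omega)]
            omega
          · intro h
            split_ifs at h with h7
            · have e4 : v' = Z.pair t := Fin.ext (by omega)
              have e5 : v = t := Fin.ext (by omega)
              rw [e4]
              rw [e5] at h2
              exact Gen.full_pair h2
            · omega
        · rw [f5 r e1 e2 e3, ← mem_fst, h6]
          simp [e1, e2, e3]
      · have := hc.valid r; omega
  · rintro ⟨s, t, ⟨hst, hle, hlt, hup, hem, heq⟩, hs⟩
    obtain ⟨f1, f2, f3, f4, f5, f6⟩ :=
      hx.arrow_facts Z.pair_pair Z.pair_ne hst (by omega) (by omega) (by omega)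
    rw [← heq] at f2 f3 f4 f5
    rw [if_neg (by omega)] at f6
    constructor
    · apply Gen.full_injective
      ext ⟨r, v'⟩
      rw [mem_snd, mem_snd]
      by_cases e1 : r = s
      · subst e1; omega
      by_cases e2 : r = t
      · subst e2; omega
      by_cases e3 : r = Z.pair t
      · subst e3; rw [f4, f6]; split_ifs <;> omega
      · rw [f5 r e1 e2 e3]
    · refine ⟨s, ⟨2 * (4 * k) - 1 - x.code t, by omega⟩, t, ⟨2 * (4 * k) - 1 - x.code s, by omega⟩,
        y.mem_fst.mpr (by simp only; omega), y.mem_fst.mpr (by simp only; omega), hst,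
        by rw [Fin.lt_def]; simp only; omega, ?_, ?_⟩
      · rintro ⟨p, q⟩ hp k1 k2 k3 k4
        rw [mem_fst] at hp
        simp only [Fin.lt_def] at k1 k2 k3 k4
        by_cases e3 : p = Z.pair t
        · subst e3
          rw [f4] at hp
          split_ifs at hp
          · omega
          · omega
        · rw [f5 p (by omega) (by omega) e3] at hp
          exact hem p k1 k2 (by omega) (by omega)
      · rintro ⟨r, v'⟩
        rw [mem_fst, mem_fst]
        simp only [Prod.mk.injEq, ne_eq, Fin.ext_iff (a := v')]
        by_cases e1 : r = s
        · subst e1; simp only [true_and, hst.ne, false_and, not_true, and_false, or_false]; omega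
        by_cases e2 : r = t
        · subst e2
          simp only [hst.ne', true_and, false_and, not_true, and_false, or_false, false_or]; omega
        by_cases e3 : r = Z.pair t
        · subst e3; rw [f6]; simp only [f1, Z.pair_ne, eq_self, not_true_eq_false, and_false, false_and, or_false, iff_false]; omega
        · rw [f5 r e1 e2 e3]; simp [e1, e2, e3]

theorem chordRel_iff : ((∃ e, Gen.ChordRel s t x.snd y.snd e) ∧ ∃ e, Gen.ChordRel s t y.fst x.fst e) ↔
    IsArrow Z.pair s t x.code y.code ∧ x.code t < 4 * k ∧ 4 * k ≤ x.code s := by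
  have hx := x.isConf_code
  constructor
  · rintro ⟨⟨e, hst, h1, h2, h3⟩, e', -, h1', h2', h3'⟩
    have t1 := x.snd.isDiag_full.up _ h1
    have t2 := y.fst.isDiag_full.up _ h1'
    simp only at t1 t2
    have g1 := (h2' s e').mpr (Or.inl ⟨rfl, rfl⟩)
    have g2 := (h2 s e).mpr (Or.inl ⟨rfl, rfl⟩)
    have l1 := x.mem_snd.mp h1
    have l2 := y.mem_fst.mp h1'
    have l3 := x.mem_fst.mp g1
    have l4 := y.mem_snd.mp g2
    have hc := hx.isConf_cswap Z.pair_pair Z.pair_ne hst (by omega) (by omega) (by omega) (by omega)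
    obtain ⟨f1, f2, f3, f4, f5, f6⟩ :=
      hx.arrow_facts Z.pair_pair Z.pair_ne hst (by omega) (by omega) (by omega)
    refine ⟨⟨hst, by omega, by omega, by omega, ?_, ?_⟩, by omega, by omega⟩
    · intro p k1 k2 k3 k4
      by_cases hp : x.code p < 4 * k
      · have := h3 p ⟨_, hp⟩ k1 k2 (x.mem_snd.mpr rfl)
        rw [Fin.lt_def] at this
        simp only at this
        omega
      · have hp' : (p, (⟨2 * (4 * k) - 1 - x.code p, by omega⟩ : Fin (4 * k))) ∈ x.fst.full :=
          x.mem_fst.mpr (by simp only; omega)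
        rcases (h2' _ _).mp hp' with h | h
        · omega
        · have := h3' _ _ k1 k2 h.1
          rw [Fin.lt_def] at this
          simp only at this
          omega
    · refine code_eq (fun r v' => ?_) (fun r v' => ?_) fun r => ?_
      · rw [h2, mem_snd, Fin.ext_iff (b := e)]
        by_cases e1 : r = s
        · subst e1; rw [f2]; have := v'.isLt; simp only [true_and]; omega
        by_cases e2 : r = t
        · subst e2; rw [f3]; simp only [e1, ne_eq, eq_self, not_true_eq_false, false_and, and_false, or_false, iff_false, false_iff]; omega
        by_cases e3 : r = Z.pair t
        · subst e3; rw [f4]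
          simp only [f1, ne_eq, eq_self, not_true_eq_false, false_and, and_false, or_false, iff_false, false_iff]; split_ifs <;> omega
        · rw [f5 r e1 e2 e3]; simp [e1, e2, e3]
      · by_cases e1 : r = s
        · subst e1; rw [mem_fst]; omega
        by_cases e2 : r = t
        · subst e2; rw [mem_fst]; omega
        by_cases e3 : r = Z.pair t
        · subst e3
          rw [f4]
          constructor
          · intro h
            obtain ⟨k1, k2⟩ := Gen.full_start_pair h1' h
            rw [if_pos (by omega)]
            omega
          · intro h
            split_ifs at h with h7
            · have e4 : v' = Z.pair t := Fin.ext (by omega)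
              have e5 : e' = t := Fin.ext (by omega)
              rw [e4]
              rw [e5] at h1'
              exact Gen.full_pair h1'
            · omega
        · rw [f5 r e1 e2 e3, ← mem_fst, h2']
          simp [e1, e2, e3]
      · have := hc.valid r; omega
  · rintro ⟨⟨hst, hle, hlt, hup, hem, heq⟩, ht, hs⟩
    obtain ⟨f1, f2, f3, f4, f5, f6⟩ :=
      hx.arrow_facts Z.pair_pair Z.pair_ne hst (by omega) (by omega) (by omega)
    rw [← heq] at f2 f3 f4 f5
    constructor
    · refine ⟨⟨x.code t, ht⟩, hst, x.mem_snd.mpr rfl, ?_, ?_⟩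
      · intro r v'
        rw [mem_snd, mem_snd, Fin.ext_iff (a := v')]
        by_cases e1 : r = s
        · subst e1; rw [f2]; simp only [true_and]; omega
        by_cases e2 : r = t
        · subst e2; rw [f3]; simp only [e1, ne_eq, eq_self, not_true_eq_false, false_and, and_false, or_false, iff_false, false_iff]; omega
        by_cases e3 : r = Z.pair t
        · subst e3; rw [f4]
          simp only [f1, ne_eq, eq_self, not_true_eq_false, false_and, and_false, or_false, iff_false, false_iff]; split_ifs <;> omega
        · rw [f5 r e1 e2 e3]; simp [e1, e2, e3]
      · intro r e' k1 k2 k3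
        rw [mem_snd] at k3
        have : x.code r ≠ x.code t := fun h => k2.ne (hx.inj _ _ h (by omega))
        rw [Fin.lt_def]; simp only
        by_contra h
        exact hem r k1 k2 (by omega) (by omega)
    · refine ⟨⟨2 * (4 * k) - 1 - x.code s, by omega⟩, hst, y.mem_fst.mpr (by simp only; omega), ?_, ?_⟩
      · intro r v'
        rw [mem_fst, mem_fst, Fin.ext_iff (a := v')]
        by_cases e1 : r = s
        · subst e1; rw [f2]; simp only [true_and]; omega
        by_cases e2 : r = t
        · subst e2; rw [f3]; simp only [e1, ne_eq, eq_self, not_true_eq_false, false_and, and_false, or_false, iff_false, false_iff]; omega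
        by_cases e3 : r = Z.pair t
        · subst e3; rw [f6]
          simp only [f1, ne_eq, eq_self, not_true_eq_false, false_and, and_false, or_false, iff_false, false_iff]; split_ifs <;> omega
        · rw [f5 r e1 e2 e3]; simp [e1, e2, e3]
      · intro r e' k1 k2 k3
        rw [mem_fst] at k3
        rw [Fin.lt_def]; simp only
        by_cases e3 : r = Z.pair t
        · subst e3
          rw [f4] at k3
          split_ifs at k3 <;> omega
        · rw [f5 r (by omega) (by omega) e3] at k3
          have : x.code r ≠ x.code s := fun h => k1.ne' (hx.inj _ _ h (by omega))
          by_contra h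
          exact hem r k1 k2 (by omega) (by omega)

end MGen
end

open Diagram

section
variable {k : ℕ} {Z : PMC k}

theorem Gen.exists_bar_eq (a : Gen Z) : ∃ q : Gen Z.rev, q.bar = a := by
  have hpr : ∀ x : Fin (4 * k), (Z.rev.pair x).rev = Z.pair x.rev := by
    intro x; simp [PMC.rev]
  obtain ⟨q, hq⟩ : ∃ q : Gen Z.rev, q.full = Finset.univ.filter
      fun c : Fin (4 * k) × Fin (4 * k) => (c.2.rev, c.1.rev) ∈ a.full := by
    refine Gen.exists_full_eq ⟨?_, ?_, ?_⟩ ?_ ?_ ?_ <;>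
      simp only [Finset.mem_filter, Finset.mem_univ, true_and, Prod.forall, hpr]
    · intro s v h
      exact Fin.rev_le_rev.mp (a.isDiag_full.up _ h)
    · rintro s v h s' v' h' rfl
      rw [Fin.rev_injective (Gen.full_snd h h')]
    · rintro s v h s' v' h' rfl
      rw [Fin.rev_injective (Gen.full_fst h h')]
    · exact fun x => Gen.full_pair
    · exact fun x u v h h' => (Fin.rev_injective (Gen.full_end_pair h h').1).symm
    · exact fun x u v h h' => (Fin.rev_injective (Gen.full_start_pair h h').1).symm
  refine ⟨q, Gen.full_injective ?_⟩
  ext ⟨s, t⟩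
  rw [Gen.mem_full_bar, hq, Finset.mem_filter]
  simp only [Finset.mem_univ, true_and, Fin.rev_rev]

theorem cfddId_delta {i j : Idem Z} {b : Gen Z} {b' : Gen Z.rev} (h : (cfddId Z).δ i b b' j ≠ 0) :
    ∃ s t, b.strands = {(s, t)} ∧ b.left = i ∧ b'.bar.strands = {(s, t)} ∧ b'.right = j.o.bar := by
  have h0 : (Finset.univ.filter fun ξ : Fin (4 * k) × Fin (4 * k) => ξ.1 < ξ.2 ∧
        (b.strands = {ξ} ∧ b.left = i ∧ b.right = j) ∧
        (b'.bar.strands = {ξ} ∧ b'.left = i.o.bar ∧ b'.right = j.o.bar)).card ≠ 0 := by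
    intro h1
    apply h
    simp only [cfddId, h1, Nat.cast_zero]
  obtain ⟨⟨s, t⟩, hc⟩ := Finset.card_ne_zero.mp h0
  rw [Finset.mem_filter] at hc
  exact ⟨s, t, hc.2.2.1.1, hc.2.2.1.2.1, hc.2.2.2.1, hc.2.2.2.2.2⟩

theorem cfddId_delta_eq_one {i j : Idem Z} {b : Gen Z} {b' : Gen Z.rev} {s t : Fin (4 * k)}
    (h1 : s < t) (h2 : b.strands = {(s, t)}) (h3 : b.left = i) (h4 : b.right = j)
    (h5 : b'.bar.strands = {(s, t)}) (h6 : b'.left = i.o.bar) (h7 : b'.right = j.o.bar) :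
    (cfddId Z).δ i b b' j = 1 := by
  have h0 : (Finset.univ.filter fun ξ : Fin (4 * k) × Fin (4 * k) => ξ.1 < ξ.2 ∧
        (b.strands = {ξ} ∧ b.left = i ∧ b.right = j) ∧
        (b'.bar.strands = {ξ} ∧ b'.left = i.o.bar ∧ b'.right = j.o.bar)) = {(s, t)} := by
    ext ξ
    rw [Finset.mem_filter, Finset.mem_singleton]
    constructor
    · rintro ⟨-, -, h, -⟩
      rw [h2] at h
      exact (Finset.singleton_injective h.1).symm
    · rintro rfl
      exact ⟨Finset.mem_univ _, h1, ⟨h2, h3, h4⟩, h5, h6, h7⟩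
  simp only [cfddId, h0, Finset.card_singleton, Nat.cast_one]

namespace MGen

variable {x y : MGen Z}

theorem exists_chord_of_ne_zero {b : Gen Z} {b' : Gen Z.rev}
    (h : (cfddId Z).δ y.x b b' x.x * (strandAlg Z.rev).mul y.q b' x.q *
      (strandAlg Z).mul b x.p y.p ≠ 0) : ∃ s t, IsArrow Z.pair s t x.code y.code ∧
      x.code t < 4 * k ∧ 4 * k ≤ x.code s ∧ b.strands = {(s, t)} ∧ b.left = y.x ∧
      b'.bar.strands = {(s, t)} ∧ b'.bar.left = x.x.o := by
  classical
  have h1 := left_ne_zero_of_mul (left_ne_zero_of_mul h)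
  have h2 := right_ne_zero_of_mul (left_ne_zero_of_mul h)
  have h3 := right_ne_zero_of_mul h
  rw [strandAlg_mul] at h2 h3
  have m2 : Gen.MulRel y.q b' x.q := by by_contra hn; exact h2 (if_neg hn)
  have m3 : Gen.MulRel b x.p y.p := by by_contra hn; exact h3 (if_neg hn)
  rw [← Gen.mulRel_bar] at m2
  obtain ⟨s, t, k1, k2, k3, k4⟩ := cfddId_delta h1
  obtain ⟨g1, g2, g3⟩ := chordRel_iff.mp ⟨m3.chordRel k1, m2.chordRel k3⟩
  refine ⟨s, t, g1, g2, g3, k1, k2, k3, ?_⟩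
  apply Idem.bar_injective
  rw [Gen.left_bar, k4]

open Classical in
theorem sum_chord : ∑ b' : Gen Z.rev, ∑ b : Gen Z, (cfddId Z).δ y.x b b' x.x *
      (strandAlg Z.rev).mul y.q b' x.q * (strandAlg Z).mul b x.p y.p =
    if ∃ s t, IsArrow Z.pair s t x.code y.code ∧ x.code t < 4 * k ∧ 4 * k ≤ x.code s then 1
      else 0 := by
  split_ifs with h
  · obtain ⟨s, t, h1, h2, h3⟩ := h
    obtain ⟨⟨e, c1⟩, e', c2⟩ := chordRel_iff.mpr ⟨h1, h2, h3⟩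
    obtain ⟨b, hb1, hb2⟩ := c1.exists_mulRel
    obtain ⟨c, hc1, hc2⟩ := c2.exists_mulRel
    obtain ⟨b', rfl⟩ := c.exists_bar_eq
    have lb : b.left = y.x := by rw [← hb2.left_right.1, left_snd]
    have lc : b'.bar.left = x.x.o := by rw [← hc2.left_right.1, left_fst]
    have uniq : ∀ b1 b1', (cfddId Z).δ y.x b1 b1' x.x * (strandAlg Z.rev).mul y.q b1' x.q *
        (strandAlg Z).mul b1 x.p y.p ≠ 0 → b1 = b ∧ b1' = b' := by
      intro b1 b1' hne
      obtain ⟨s1, t1, k1, -, -, k2, k3, k4, k5⟩ := exists_chord_of_ne_zero hne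
      obtain ⟨rfl, rfl⟩ := h1.unique k1 x.isConf_code y.isConf_code Z.pair_pair Z.pair_ne
      refine ⟨Gen.eq_of_strands_of_left k2 hb1 (by rw [k3, lb]), Gen.bar_injective ?_⟩
      exact Gen.eq_of_strands_of_left k4 hc1 (by rw [k5, lc])
    rw [Finset.sum_eq_single b', Finset.sum_eq_single b]
    · have m0 : Gen.MulRel b x.p y.p := hb2
      have m1 : Gen.MulRel y.q b' x.q := Gen.mulRel_bar.mp hc2
      rw [strandAlg_mul, strandAlg_mul, if_pos m0, if_pos m1, mul_one, mul_one]
      refine cfddId_delta_eq_one h1.lt hb1 lb ?_ hc1 ?_ ?_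
      · rw [hb2.idem, left_snd]
      · rw [← Gen.right_bar, hc2.idem, left_fst]
      · rw [← Gen.left_bar, lc]
    · intro b1 _ hne
      by_contra h0
      exact hne (uniq _ _ h0).1
    · simp
    · intro b1' _ hne
      refine Finset.sum_eq_zero fun b1 _ => ?_
      by_contra h0
      exact hne (uniq _ _ h0).2
    · simp
  · refine Finset.sum_eq_zero fun b' _ => Finset.sum_eq_zero fun b _ => ?_
    by_contra h0
    obtain ⟨s, t, k1, k2, k3, -⟩ := exists_chord_of_ne_zero h0
    exact h ⟨s, t, k1, k2, k3⟩

theorem dMat_apply (x y : MGen Z) : dMat Z x y =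
    (if x.x = y.x ∧ x.q = y.q then (strandAlg Z).d x.p y.p else 0) +
    (if x.x = y.x ∧ x.p = y.p then (strandAlg Z.rev).d y.q x.q else 0) +
    ∑ b' : Gen Z.rev, ∑ b : Gen Z, (cfddId Z).δ y.x b b' x.x *
      (strandAlg Z.rev).mul y.q b' x.q * (strandAlg Z).mul b x.p y.p := rfl

open Classical in
theorem dMat_eq (x y : MGen Z) : dMat Z x y = if HasArrow Z.pair x.code y.code then 1 else 0 := by
  have e1 : (if x.x = y.x ∧ x.q = y.q then (strandAlg Z).d x.p y.p else 0) =
      if ∃ s t, IsArrow Z.pair s t x.code y.code ∧ x.code s < 4 * k then 1 else 0 := by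
    rw [strandAlg_d, ← ite_and]
    refine if_congr ?_ rfl rfl
    rw [← dRel_snd_iff]
    constructor
    · rintro ⟨⟨-, h1⟩, h2⟩
      exact ⟨by rw [fst, h1]; rfl, h2⟩
    · rintro ⟨h1, h2⟩
      refine ⟨⟨?_, Gen.bar_injective h1⟩, h2⟩
      rw [← left_snd, ← left_snd]
      exact h2.left_right.1.symm
  have e2 : (if x.x = y.x ∧ x.p = y.p then (strandAlg Z.rev).d y.q x.q else 0) =
      if ∃ s t, IsArrow Z.pair s t x.code y.code ∧ 4 * k ≤ x.code t then 1 else 0 := by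
    rw [strandAlg_d, ← ite_and]
    refine if_congr ?_ rfl rfl
    rw [← dRel_fst_iff]
    constructor
    · rintro ⟨⟨-, h1⟩, h2⟩
      exact ⟨h1, Gen.dRel_bar.mpr h2⟩
    · rintro ⟨h1, h2⟩
      refine ⟨⟨?_, h1⟩, Gen.dRel_bar.mp h2⟩
      rw [← left_snd, ← left_snd, h1]
  rw [dMat_apply, e1, e2, sum_chord]
  by_cases h : HasArrow Z.pair x.code y.code
  · rw [if_pos h]
    obtain ⟨s, t, hst⟩ := h
    have key : ∀ Q : Fin (4 * k) → Fin (4 * k) → Prop,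
        (∃ s t, IsArrow Z.pair s t x.code y.code ∧ Q s t) ↔ Q s t := by
      intro Q
      constructor
      · rintro ⟨s', t', h1, h2⟩
        obtain ⟨rfl, rfl⟩ := hst.unique h1 x.isConf_code y.isConf_code Z.pair_pair Z.pair_ne
        exact h2
      · exact fun h => ⟨s, t, hst, h⟩
    rw [if_congr (key fun s t => x.code s < 4 * k) rfl rfl,
      if_congr (key fun s t => 4 * k ≤ x.code t) rfl rfl,
      if_congr (key fun s t => x.code t < 4 * k ∧ 4 * k ≤ x.code s) rfl rfl]
    have := hst.inv
    by_cases c1 : x.code s < 4 * k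
    · simp [c1, show ¬ 4 * k ≤ x.code t by omega, show ¬ 4 * k ≤ x.code s by omega]
    by_cases c2 : 4 * k ≤ x.code t
    · simp [c1, c2, show ¬ x.code t < 4 * k by omega]
    · simp [c1, c2, show x.code t < 4 * k by omega, show 4 * k ≤ x.code s by omega]
  · have key : ∀ Q : Fin (4 * k) → Fin (4 * k) → Prop,
        ¬ ∃ s t, IsArrow Z.pair s t x.code y.code ∧ Q s t :=
      fun Q ⟨s, t, h1, _⟩ => h ⟨s, t, h1⟩
    rw [if_neg h, if_neg (key _), if_neg (key _), if_neg (key _)]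
    simp

end MGen
end

/-! ### The arrows of the homotopy on configurations -/

section
variable {k : ℕ} {Z : PMC k} {x y : Fin (4 * k) → ℕ} {P i s r : Fin (4 * k)}

theorem IsPivotal.facts (hp : IsPivotal Z x P i) (hx : IsConf Z.pair x) (hB : x i < x P) :
    i < P ∧ (P : ℕ) ≤ x i ∧ x P + P < 2 * (4 * k) ∧ Z.pair P ≠ i ∧
    cswap Z.pair i P x i = x P ∧ cswap Z.pair i P x P = x i ∧
    (cswap Z.pair i P x (Z.pair P) = if x i = P then (Z.pair P : ℕ) else 2 * (4 * k)) ∧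
    (x (Z.pair P) = if x P + P + 1 = 2 * (4 * k) then 2 * (4 * k) - 1 - Z.pair P else 2 * (4 * k)) ∧
    ∀ r, r ≠ i → r ≠ P → r ≠ Z.pair P → cswap Z.pair i P x r = x r := by
  have h1 := hp.good.lt
  have h2 := hp.good.le
  have h3 := hp.good.start'
  have h4 := hp.good.pair_ne hx Z.pair_pair
  have h5 := (Z.pair P).isLt
  refine ⟨h1, h2, h3, h4, cswap_left, cswap_right h1.ne, ?_, ?_, fun r => cswap_of_ne⟩
  · rw [cswap_pair h4 (Z.pair_ne P), if_neg (show ¬ x i + P + 1 = 2 * (4 * k) by omega)]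
  · split_ifs with h
    · have := hx.horL P h; omega
    · exact hx.mov P (by omega) (by omega)

/-- The target of an exceptional arrow of the homotopy. -/
def excSwap (Z : PMC k) (i P r : Fin (4 * k)) (x : Fin (4 * k) → ℕ) : Fin (4 * k) → ℕ :=
  fun p => if p = i then 2 * (4 * k) - 1 - P else if p = r then Z.pair P else x p

theorem IsPivotal.excSwap_eq (hp : IsPivotal Z x P i) (hx : IsConf Z.pair x) (hB : x i < x P)
    (hi : x i = P) (hs : cswap Z.pair i P x s + Z.pair P + 1 = 2 * (4 * k)) (hsP : s < Z.pair P) :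
    IsArrow Z.pair s (Z.pair P) (cswap Z.pair i P x)
      (cswap Z.pair s (Z.pair P) (cswap Z.pair i P x)) ∧
    IsPivotal Z (cswap Z.pair s (Z.pair P) (cswap Z.pair i P x)) P i ∧
    x P + P + 1 ≠ 2 * (4 * k) ∧
    x (if s = i then P else s) + Z.pair P + 1 = 2 * (4 * k) ∧
    excSwap Z i P (if s = i then P else s) x =
      cswap Z.pair i P (cswap Z.pair s (Z.pair P) (cswap Z.pair i P x)) := by
  obtain ⟨f1, f2, f3, f4, f5, f6, f7, f8, f9⟩ := hp.facts hx hB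
  have hq := hp.swap hx
  have hc := hp.good.conf hx Z.pair_pair Z.pair_ne
  have harr := hq.good.isArrow_pair hc (by omega) hs hsP
  obtain ⟨j, hj⟩ := HasArrow.pivotal ⟨_, _, harr⟩ hc hq
  have hPn := P.isLt
  have hqn := (Z.pair P).isLt
  rw [if_pos hi] at f7
  have hsP' : s ≠ P := by rintro rfl; omega
  obtain ⟨u, hu⟩ : ∃ u, u = cswap Z.pair i P x := ⟨_, rfl⟩
  rw [← hu] at hs hc harr hj f5 f6 f7 f9 ⊢
  have harr' := harr
  obtain ⟨v, hv⟩ : ∃ v, v = cswap Z.pair s (Z.pair P) u := ⟨_, rfl⟩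
  rw [← hv] at hj harr ⊢
  have v1 : v s = Z.pair P := by rw [hv, cswap_left, f7]
  have v2 : v (Z.pair P) = u s := by rw [hv, cswap_right hsP.ne]
  have v3 : v P = 2 * (4 * k) - 1 - P := by
    rw [hv]
    have := cswap_pair (x := u) (π := Z.pair) (s := s) (t := Z.pair P)
      (by rw [Z.pair_pair]; exact hsP'.symm) (Z.pair_ne _)
    rw [Z.pair_pair, if_neg (by omega), if_pos (by omega)] at this
    exact this
  have v4 : ∀ r, r ≠ s → r ≠ Z.pair P → r ≠ P → v r = u r := by
    intro r e1 e2 e3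
    rw [hv, cswap_of_ne e1 e2 (by rwa [Z.pair_pair])]
  have hvi : (P : ℕ) ≤ v i ∧ v i + P < 2 * (4 * k) := by
    by_cases e : i = s
    · have := hc.valid s
      rw [e, v1]
      rw [← e, f5] at hs
      have := hx.valid P
      omega
    · rw [v4 i e f4.symm f1.ne, f5]
      omega
  obtain rfl : i = j := hj.good.start_eq f1 hvi.1 hvi.2
  have hxP : x P + P + 1 ≠ 2 * (4 * k) := by
    intro h
    rw [if_pos h] at f8
    by_cases e : s = i
    · rw [e, f5] at hs
      exact Z.pair_ne P (Fin.ext (by omega))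
    · rw [f9 s e hsP' hsP.ne] at hs
      have := hx.inj s (Z.pair P) (by omega) (by omega)
      exact hsP.ne this
  have hr : x (if s = i then P else s) + Z.pair P + 1 = 2 * (4 * k) := by
    split_ifs with e
    · rw [← f5, ← e]; exact hs
    · rw [← f9 s e hsP' hsP.ne]; exact hs
  refine ⟨harr, hj, hxP, hr, ?_⟩
  funext p
  rw [if_neg hxP] at f8
  by_cases e1 : p = i
  · rw [e1, cswap_left, v3, excSwap, if_pos rfl]
  by_cases e2 : p = P
  · rw [e2, cswap_right f1.ne, excSwap, if_neg f1.ne']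
    by_cases e : s = i
    · rw [if_pos e, if_pos rfl, ← e, v1]
    · rw [if_neg e, if_neg hsP'.symm, v4 i (Ne.symm e) f4.symm f1.ne, f5]
  by_cases e3 : p = Z.pair P
  · rw [e3, cswap_pair f4 (Z.pair_ne P), excSwap, if_neg f4, if_neg, f8, if_neg, if_neg]
    · intro h
      by_cases e : s = i
      · rw [← e, v1] at h; omega
      · rw [v4 i (Ne.symm e) f4.symm f1.ne, f5] at h; omega
    · intro h
      by_cases e : s = i
      · rw [← e, v1] at h
        exact Z.pair_ne P (Fin.ext h)
      · rw [v4 i (Ne.symm e) f4.symm f1.ne, f5] at h; omega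
    · split_ifs with e
      · exact Z.pair_ne P
      · exact hsP.ne'
  · rw [cswap_of_ne e1 e2 e3, excSwap, if_neg e1]
    by_cases e : s = i
    · rw [if_pos e, if_neg e2, v4 p (by rw [e]; exact e1) e3 e2, f9 p e1 e2 e3]
    · rw [if_neg e]
      split_ifs with e5
      · rw [e5, v1]
      · rw [v4 p e5 e3 e2, f9 p e1 e2 e3]

theorem IsPivotal.exists_excSwap (hp : IsPivotal Z x P i) (hx : IsConf Z.pair x) (hB : x i < x P)
    (hi : x i = P) (hP : x P + P + 1 ≠ 2 * (4 * k)) (hr : x r + Z.pair P + 1 = 2 * (4 * k)) :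
    ∃ s, r = (if s = i then P else s) ∧
      cswap Z.pair i P x s + Z.pair P + 1 = 2 * (4 * k) ∧ s < Z.pair P := by
  obtain ⟨f1, f2, f3, f4, f5, f6, f7, f8, f9⟩ := hp.facts hx hB
  have hPn := P.isLt
  have hqn := (Z.pair P).isLt
  rw [if_neg hP] at f8
  have hri : r ≠ i := by rintro rfl; omega
  have hrq : r ≠ Z.pair P := by rintro rfl; omega
  have hrv := hx.valid r
  by_cases e : r = P
  · subst e
    refine ⟨i, by rw [if_pos rfl], by rw [f5]; exact hr, ?_⟩
    rw [Fin.lt_def] at f1 ⊢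
    omega
  · refine ⟨r, by rw [if_neg hri], ?_⟩
    rw [f9 r hri e hrq]
    exact ⟨hr, lt_of_le_of_ne (by rw [Fin.le_def]; omega) hrq⟩

theorem hConf_iff (hx : IsConf Z.pair x) (hy : IsConf Z.pair y) : HConf Z x y ↔
    ∃ P i, IsPivotal Z x P i ∧ x i < x P ∧ (y = cswap Z.pair i P x ∨
      (x i = P ∧ x P + P + 1 ≠ 2 * (4 * k) ∧ ∃ r, x r + Z.pair P + 1 = 2 * (4 * k) ∧
        y = excSwap Z i P r x)) := by
  constructor
  · rintro ⟨P, i, j, hp, hq, h1, h2, s, t, ha⟩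
    refine ⟨P, i, hp, h1, ?_⟩
    have hc := hp.good.conf hx Z.pair_pair Z.pair_ne
    have hd := hq.good.conf hy Z.pair_pair Z.pair_ne
    have hB : cswap Z.pair j P y j < cswap Z.pair j P y P := by
      rwa [cswap_left, cswap_right hq.good.lt.ne]
    have hA : cswap Z.pair i P x P < cswap Z.pair i P x i := by
      rwa [cswap_left, cswap_right hp.good.lt.ne]
    rcases ha.eq_or_pair hc Z.pair_pair Z.pair_ne (hp.swap hx).good (hq.swap hy).good hA hB with
      ⟨rfl, rfl⟩ | rfl
    · left
      have := ha.eq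
      rw [hp.swap_swap hx] at this
      have hij : s = j := by
        have e1 := hq.swap hy
        rw [this] at e1
        exact (hp.unique e1).2
      subst hij
      rw [← this, hq.swap_swap hy]
    · right
      obtain ⟨g1, g2, g3, g4⟩ := (hp.swap hx).good.noninverted_of_pair (hq.swap hy).good hc hd
        Z.pair_pair ha
      rw [cswap_right hp.good.lt.ne] at g1
      obtain ⟨k1, k2, k3, k4, k5⟩ := hp.excSwap_eq hx h1 g1 g2 ha.lt
      refine ⟨g1, k3, _, k4, ?_⟩
      rw [k5, ← ha.eq]
      have hij : i = j := by
        have e1 := hq.swap hy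
        rw [ha.eq] at e1
        exact (k2.unique e1).2
      subst hij
      rw [hq.swap_swap hy]
  · rintro ⟨P, i, hp, hB, rfl | ⟨hi, hP, r, hr, rfl⟩⟩
    · refine ⟨P, i, i, hp, hp.swap hx, hB, ?_, i, P, ?_⟩
      · rwa [cswap_left, cswap_right hp.good.lt.ne]
      · refine (hp.swap hx).good.isArrow hy ?_
        rwa [cswap_left, cswap_right hp.good.lt.ne]
    · obtain ⟨f1, f2, f3, f4, f5, f6, f7, f8, f9⟩ := hp.facts hx hB
      have hPn := P.isLt
      have hqn := (Z.pair P).isLt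
      rw [if_neg hP] at f8
      obtain ⟨s, hs, g2⟩ := hp.exists_excSwap hx hB hi hP hr
      obtain ⟨k1, k2, k3, k4, k5⟩ := hp.excSwap_eq hx hB hi g2.1 g2.2
      have hc := hp.good.conf hx Z.pair_pair Z.pair_ne
      have hv := k1.conf hc Z.pair_pair Z.pair_ne
      have k6 := k2.swap hv
      have k7 := k2.swap_swap hv
      rw [hs, k5] at hy ⊢
      refine ⟨P, i, i, hp, k6, hB, ?_, s, Z.pair P, ?_⟩
      · rw [← k5, ← hs, excSwap, excSwap, if_pos rfl, if_neg f1.ne']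
        split_ifs with e
        · rw [← e] at hr
          have := hx.valid P
          have : (P : ℕ) ≠ Z.pair P := fun h => Z.pair_ne P (Fin.ext h.symm)
          omega
        · omega
      · rw [k7]; exact k1

theorem IsPivotal.isConf_excSwap (hp : IsPivotal Z x P i) (hx : IsConf Z.pair x) (hB : x i < x P)
    (hi : x i = P) (hP : x P + P + 1 ≠ 2 * (4 * k)) (hr : x r + Z.pair P + 1 = 2 * (4 * k)) :
    IsConf Z.pair (excSwap Z i P r x) := by
  obtain ⟨s, hs, g1, g2⟩ := hp.exists_excSwap hx hB hi hP hr
  obtain ⟨k1, k2, k3, k4, k5⟩ := hp.excSwap_eq hx hB hi g1 g2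
  have hv := k1.conf (hp.good.conf hx Z.pair_pair Z.pair_ne) Z.pair_pair Z.pair_ne
  rw [hs, k5]
  exact k2.good.conf hv Z.pair_pair Z.pair_ne

end

/-! ### The arrows of the homotopy on generators -/

section
variable {k : ℕ} {Z : PMC k}

namespace MGen

theorem mem_strands_snd (x : MGen Z) {s v : Fin (4 * k)} :
    (s, v) ∈ x.snd.strands ↔ x.code s = v ∧ (s : ℕ) < v := by
  rw [Gen.mem_strands_iff, mem_snd, Fin.lt_def]

theorem mem_strands_fst (x : MGen Z) {s v : Fin (4 * k)} :
    (s, v) ∈ x.fst.strands ↔ x.code s + v + 1 = 2 * (4 * k) ∧ (s : ℕ) < v := by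
  rw [Gen.mem_strands_iff, mem_fst, Fin.lt_def]

theorem mem_hor_snd (x : MGen Z) {s : Fin (4 * k)} : s ∈ x.snd.hor ↔ x.code s = s := by
  rw [Gen.mem_hor_iff, mem_snd]

theorem mem_hor_fst (x : MGen Z) {s : Fin (4 * k)} :
    s ∈ x.fst.hor ↔ x.code s + s + 1 = 2 * (4 * k) := by
  rw [Gen.mem_hor_iff, mem_fst]

theorem mult_eq (x : MGen Z) (p : Fin (4 * k)) : mult x.fst x.snd p = cmult x.code p := by
  classical
  have h1 : (x.fst.strands.filter fun s => s.1 ≤ p ∧ p < s.2).card =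
      (Finset.univ.filter fun s => Cov x.code s p ∧ 4 * k ≤ x.code s).card := by
    refine Finset.card_bij (fun s _ => s.1) ?_ ?_ ?_
    · rintro ⟨s, v⟩ h
      obtain ⟨h1, h2, h3⟩ := Finset.mem_filter.mp h
      rw [mem_strands_fst] at h1
      rw [Fin.le_def] at h2
      rw [Fin.lt_def] at h3
      dsimp only at h2 h3
      refine Finset.mem_filter.mpr ⟨Finset.mem_univ _, ⟨?_, ?_, ?_⟩, ?_⟩ <;> dsimp only <;> omega
    · rintro ⟨s, v⟩ h ⟨s', v'⟩ h' (rfl : s = s')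
      have h1 := x.mem_strands_fst.mp (Finset.mem_filter.mp h).1
      have h2 := x.mem_strands_fst.mp (Finset.mem_filter.mp h').1
      exact Prod.ext rfl (Fin.ext (by dsimp only; omega))
    · intro s h
      obtain ⟨-, ⟨h1, h2, h3⟩, h4⟩ := Finset.mem_filter.mp h
      refine ⟨(s, ⟨2 * (4 * k) - 1 - x.code s, by omega⟩), ?_, rfl⟩
      simp only [Finset.mem_filter, mem_strands_fst, Fin.le_def, Fin.lt_def]
      omega
  have h2 : (x.snd.strands.filter fun s => s.1 ≤ p ∧ p < s.2).card =
      (Finset.univ.filter fun s => Cov x.code s p ∧ ¬ 4 * k ≤ x.code s).card := by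
    refine Finset.card_bij (fun s _ => s.1) ?_ ?_ ?_
    · rintro ⟨s, v⟩ h
      obtain ⟨h1, h2, h3⟩ := Finset.mem_filter.mp h
      rw [mem_strands_snd] at h1
      rw [Fin.le_def] at h2
      rw [Fin.lt_def] at h3
      dsimp only at h2 h3
      refine Finset.mem_filter.mpr ⟨Finset.mem_univ _, ⟨?_, ?_, ?_⟩, ?_⟩ <;> dsimp only <;> omega
    · rintro ⟨s, v⟩ h ⟨s', v'⟩ h' (rfl : s = s')
      have h1 := x.mem_strands_snd.mp (Finset.mem_filter.mp h).1
      have h2 := x.mem_strands_snd.mp (Finset.mem_filter.mp h').1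
      exact Prod.ext rfl (Fin.ext (by dsimp only; omega))
    · intro s h
      obtain ⟨-, ⟨h1, h2, h3⟩, h4⟩ := Finset.mem_filter.mp h
      refine ⟨(s, ⟨x.code s, by omega⟩), ?_, rfl⟩
      exact Finset.mem_filter.mpr ⟨x.mem_strands_snd.mpr ⟨rfl, by dsimp only; omega⟩, h1, h2⟩
  rw [mult, h1, h2, cmult, ← Finset.filter_filter, ← Finset.filter_filter,
    Finset.card_filter_add_card_filter_not]

theorem isKey_iff (x : MGen Z) {P : Fin (4 * k)} :
    IsKey x.fst x.snd P ↔ IsFirst Z (cmult x.code) P := by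
  simp only [IsKey, IsFirst, mult_eq]

theorem isPivot_iff (x : MGen Z) {P : Fin (4 * k)} : IsPivot Z (cmult x.code) P ↔
    (MultOne x.fst x.snd ∧ IsKey x.fst x.snd P) ∨ IsBottom x.fst x.snd P := by
  rw [isKey_iff, IsPivot]
  simp only [MultOne, IsBottom, mult_eq]

variable {x y : MGen Z} {P i r : Fin (4 * k)}

theorem isPivotal_of (h : (MultOne x.fst x.snd ∧ IsKey x.fst x.snd P) ∨ IsBottom x.fst x.snd P)
    (h1 : i < P) (h2 : (P : ℕ) ≤ x.code i) (h3 : x.code i + P < 2 * (4 * k)) :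
    IsPivotal Z x.code P i := by
  have hp := x.isPivot_iff.mpr h
  obtain ⟨j, hj⟩ := hp.good x.isConf_code
  obtain rfl := hj.start_eq h1 h2 h3
  exact ⟨hp, hj⟩

theorem isBottom_iff_of_isPivotal (hp : IsPivotal Z x.code P i) (hB : x.code i < x.code P) :
    IsBottom x.fst x.snd P ↔ (P : ℕ) < x.code i ∧ x.code P + P + 1 < 2 * (4 * k) := by
  obtain ⟨f1, f2, f3, -⟩ := hp.facts x.isConf_code hB
  rw [Fin.lt_def] at f1
  have key : 1 < cmult x.code P ↔ (P : ℕ) < x.code i ∧ x.code P + P + 1 < 2 * (4 * k) := by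
    rw [← not_le, cmult_le_one_iff]
    constructor
    · intro h
      have hcov : ∀ s, Cov x.code s P → s = i ∨ s = P := by
        rintro s ⟨h1, h2, h3⟩
        rcases lt_or_eq_of_le h1 with h | h
        · exact Or.inl (hp.good.start_eq (Fin.lt_def.mpr h) (by omega) (by omega))
        · exact Or.inr (Fin.ext h)
      push Not at h
      obtain ⟨s, s', h1, h2, h3⟩ := h
      rcases hcov s h1 with rfl | rfl <;> rcases hcov s' h2 with rfl | rfl
      · exact absurd rfl h3
      · exact ⟨h1.2.1, h2.2.2⟩
      · exact ⟨h2.2.1, h1.2.2⟩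
      · exact absurd rfl h3
    · intro h h'
      have := congrArg Fin.val (h' i P ⟨by omega, by omega, by omega⟩ ⟨by omega, by omega, by omega⟩)
      omega
  constructor
  · intro h
    rw [← key, ← mult_eq]
    exact h.1
  · intro h
    rw [← key, ← mult_eq] at h
    rcases x.isPivot_iff.mp hp.pivot with h' | h'
    · have := h'.1 P
      omega
    · exact h'

theorem cswap_cases (hp : IsPivotal Z x.code P i) (hB : x.code i < x.code P)
    (hy : y.code = cswap Z.pair i P x.code) (r : Fin (4 * k)) :
    (r = i ∧ y.code r = x.code P) ∨ (r = P ∧ y.code r = x.code i) ∨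
    (r = Z.pair P ∧ y.code r = if x.code i = P then (Z.pair P : ℕ) else 2 * (4 * k)) ∨
    ((r : ℕ) ≠ i ∧ (r : ℕ) ≠ P ∧ (r : ℕ) ≠ Z.pair P ∧ y.code r = x.code r) := by
  obtain ⟨f1, f2, f3, f4, f5, f6, f7, f8, f9⟩ := hp.facts x.isConf_code hB
  rw [← hy] at f5 f6 f7 f9
  by_cases e1 : r = i
  · exact Or.inl ⟨e1, e1 ▸ f5⟩
  by_cases e2 : r = P
  · exact Or.inr (Or.inl ⟨e2, e2 ▸ f6⟩)
  by_cases e3 : r = Z.pair P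
  · exact Or.inr (Or.inr (Or.inl ⟨e3, e3 ▸ f7⟩))
  · exact Or.inr (Or.inr (Or.inr ⟨fun h => e1 (Fin.ext h), fun h => e2 (Fin.ext h),
      fun h => e3 (Fin.ext h), f9 r e1 e2 e3⟩))

theorem cswap_facts (hp : IsPivotal Z x.code P i) (hB : x.code i < x.code P) :
    (i : ℕ) < P ∧ (P : ℕ) ≤ x.code i ∧ x.code P + P < 2 * (4 * k) ∧ (Z.pair P : ℕ) ≠ i ∧
    (Z.pair P : ℕ) ≠ P ∧ (x.code (Z.pair P) =
      if x.code P + P + 1 = 2 * (4 * k) then 2 * (4 * k) - 1 - Z.pair P else 2 * (4 * k)) := by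
  obtain ⟨f1, f2, f3, f4, f5, f6, f7, f8, f9⟩ := hp.facts x.isConf_code hB
  exact ⟨f1, f2, f3, fun h => f4 (Fin.ext h), fun h => Z.pair_ne P (Fin.ext h), f8⟩

theorem sets_eq_split_fst (hp : IsPivotal Z x.code P i) (hB : x.code i < x.code P)
    (hy : y.code = cswap Z.pair i P x.code) {b : Fin (4 * k)}
    (hP : x.code P + P + 1 = 2 * (4 * k)) (hi : x.code i + b + 1 = 2 * (4 * k)) :
    y.fst.strands = x.fst.strands \ {(i, b)} ∪ {(i, P), (P, b)} ∧
    y.fst.hor = x.fst.hor \ {P, Z.pair P} ∧ y.snd = x.snd := by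
  have hc := cswap_cases hp hB hy
  obtain ⟨f1, f2, f3, f4, f5, f6⟩ := cswap_facts hp hB
  refine ⟨?_, ?_, Gen.ext ?_ ?_⟩
  on_goal 1 => ext ⟨r, v⟩
  on_goal 2 => ext r
  on_goal 3 => ext ⟨r, v⟩
  on_goal 4 => ext r
  all_goals
    simp only [mem_strands_fst, mem_strands_snd, mem_hor_fst, mem_hor_snd, Finset.mem_union,
      Finset.mem_sdiff, Finset.mem_insert, Finset.mem_singleton, Prod.mk.injEq, Fin.ext_iff]
    rcases hc r with ⟨rfl, h⟩ | ⟨rfl, h⟩ | ⟨rfl, h⟩ | ⟨h1, h2, h3, h⟩ <;> rw [h] <;>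
      split_ifs at * <;> omega

theorem sets_eq_join_snd (hp : IsPivotal Z x.code P i) (hB : x.code i < x.code P)
    (hy : y.code = cswap Z.pair i P x.code) {j : Fin (4 * k)}
    (hP : x.code P = j) (hi : x.code i = P) :
    y.fst = x.fst ∧ y.snd.strands = x.snd.strands \ {(i, P), (P, j)} ∪ {(i, j)} ∧
    y.snd.hor = x.snd.hor ∪ {P, Z.pair P} := by
  have hc := cswap_cases hp hB hy
  obtain ⟨f1, f2, f3, f4, f5, f6⟩ := cswap_facts hp hB
  refine ⟨Gen.ext ?_ ?_, ?_, ?_⟩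
  on_goal 1 => ext ⟨r, v⟩
  on_goal 2 => ext r
  on_goal 3 => ext ⟨r, v⟩
  on_goal 4 => ext r
  all_goals
    simp only [mem_strands_fst, mem_strands_snd, mem_hor_fst, mem_hor_snd, Finset.mem_union,
      Finset.mem_sdiff, Finset.mem_insert, Finset.mem_singleton, Prod.mk.injEq, Fin.ext_iff]
    rcases hc r with ⟨rfl, h⟩ | ⟨rfl, h⟩ | ⟨rfl, h⟩ | ⟨h1, h2, h3, h⟩ <;> rw [h] <;>
      split_ifs at * <;> omega

theorem sets_eq_split_move (hp : IsPivotal Z x.code P i) (hB : x.code i < x.code P)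
    (hy : y.code = cswap Z.pair i P x.code) {j : Fin (4 * k)}
    (hP : x.code P + P + 1 = 2 * (4 * k)) (hi : x.code i = j) (hj : (P : ℕ) < j) :
    y.fst.strands = x.fst.strands ∪ {(i, P)} ∧ y.fst.hor = x.fst.hor \ {P, Z.pair P} ∧
    y.snd.strands = x.snd.strands \ {(i, j)} ∪ {(P, j)} ∧ y.snd.hor = x.snd.hor := by
  have hc := cswap_cases hp hB hy
  obtain ⟨f1, f2, f3, f4, f5, f6⟩ := cswap_facts hp hB
  refine ⟨?_, ?_, ?_, ?_⟩
  on_goal 1 => ext ⟨r, v⟩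
  on_goal 2 => ext r
  on_goal 3 => ext ⟨r, v⟩
  on_goal 4 => ext r
  all_goals
    simp only [mem_strands_fst, mem_strands_snd, mem_hor_fst, mem_hor_snd, Finset.mem_union,
      Finset.mem_sdiff, Finset.mem_insert, Finset.mem_singleton, Prod.mk.injEq, Fin.ext_iff]
    rcases hc r with ⟨rfl, h⟩ | ⟨rfl, h⟩ | ⟨rfl, h⟩ | ⟨h1, h2, h3, h⟩ <;> rw [h] <;>
      split_ifs at * <;> omega

theorem sets_eq_move (hp : IsPivotal Z x.code P i) (hB : x.code i < x.code P)
    (hy : y.code = cswap Z.pair i P x.code) 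
    (hP : x.code P + P + 1 = 2 * (4 * k)) (hi : x.code i = P) :
    y.fst.strands = x.fst.strands ∪ {(i, P)} ∧ y.fst.hor = x.fst.hor \ {P, Z.pair P} ∧
    y.snd.strands = x.snd.strands \ {(i, P)} ∧ y.snd.hor = x.snd.hor ∪ {P, Z.pair P} := by
  have hc := cswap_cases hp hB hy
  obtain ⟨f1, f2, f3, f4, f5, f6⟩ := cswap_facts hp hB
  refine ⟨?_, ?_, ?_, ?_⟩
  on_goal 1 => ext ⟨r, v⟩
  on_goal 2 => ext r
  on_goal 3 => ext ⟨r, v⟩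
  on_goal 4 => ext r
  all_goals
    simp only [mem_strands_fst, mem_strands_snd, mem_hor_fst, mem_hor_snd, Finset.mem_union,
      Finset.mem_sdiff, Finset.mem_insert, Finset.mem_singleton, Prod.mk.injEq, Fin.ext_iff]
    rcases hc r with ⟨rfl, h⟩ | ⟨rfl, h⟩ | ⟨rfl, h⟩ | ⟨h1, h2, h3, h⟩ <;> rw [h] <;>
      split_ifs at * <;> omega

theorem sets_eq_move_join (hp : IsPivotal Z x.code P i) (hB : x.code i < x.code P)
    (hy : y.code = cswap Z.pair i P x.code) {j : Fin (4 * k)}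
    (hP : x.code P + j + 1 = 2 * (4 * k)) (hj : (P : ℕ) < j) (hi : x.code i = P) :
    y.fst.strands = x.fst.strands \ {(P, j)} ∪ {(i, j)} ∧ y.fst.hor = x.fst.hor ∧
    y.snd.strands = x.snd.strands \ {(i, P)} ∧ y.snd.hor = x.snd.hor ∪ {P, Z.pair P} := by
  have hc := cswap_cases hp hB hy
  obtain ⟨f1, f2, f3, f4, f5, f6⟩ := cswap_facts hp hB
  refine ⟨?_, ?_, ?_, ?_⟩
  on_goal 1 => ext ⟨r, v⟩
  on_goal 2 => ext r
  on_goal 3 => ext ⟨r, v⟩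
  on_goal 4 => ext r
  all_goals
    simp only [mem_strands_fst, mem_strands_snd, mem_hor_fst, mem_hor_snd, Finset.mem_union,
      Finset.mem_sdiff, Finset.mem_insert, Finset.mem_singleton, Prod.mk.injEq, Fin.ext_iff]
    rcases hc r with ⟨rfl, h⟩ | ⟨rfl, h⟩ | ⟨rfl, h⟩ | ⟨h1, h2, h3, h⟩ <;> rw [h] <;>
      split_ifs at * <;> omega

theorem sets_eq_uncross_fst (hp : IsPivotal Z x.code P i) (hB : x.code i < x.code P)
    (hy : y.code = cswap Z.pair i P x.code) {e f : Fin (4 * k)}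
    (hP : x.code P + e + 1 = 2 * (4 * k)) (he : (P : ℕ) < e) (hi : x.code i + f + 1 = 2 * (4 * k)) :
    y.fst.strands = x.fst.strands \ {(P, e), (i, f)} ∪ {(P, f), (i, e)} ∧ y.fst.hor = x.fst.hor ∧
    y.snd = x.snd := by
  have hc := cswap_cases hp hB hy
  obtain ⟨f1, f2, f3, f4, f5, f6⟩ := cswap_facts hp hB
  refine ⟨?_, ?_, Gen.ext ?_ ?_⟩
  on_goal 1 => ext ⟨r, v⟩
  on_goal 2 => ext r
  on_goal 3 => ext ⟨r, v⟩
  on_goal 4 => ext r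
  all_goals
    simp only [mem_strands_fst, mem_strands_snd, mem_hor_fst, mem_hor_snd, Finset.mem_union,
      Finset.mem_sdiff, Finset.mem_insert, Finset.mem_singleton, Prod.mk.injEq, Fin.ext_iff]
    rcases hc r with ⟨rfl, h⟩ | ⟨rfl, h⟩ | ⟨rfl, h⟩ | ⟨h1, h2, h3, h⟩ <;> rw [h] <;>
      split_ifs at * <;> omega

theorem sets_eq_cross_snd (hp : IsPivotal Z x.code P i) (hB : x.code i < x.code P)
    (hy : y.code = cswap Z.pair i P x.code) {e f : Fin (4 * k)}
    (hP : x.code P = e) (hf : (P : ℕ) < f) (hi : x.code i = f) :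
    y.fst = x.fst ∧ y.snd.strands = x.snd.strands \ {(P, e), (i, f)} ∪ {(P, f), (i, e)} ∧
    y.snd.hor = x.snd.hor := by
  have hc := cswap_cases hp hB hy
  obtain ⟨f1, f2, f3, f4, f5, f6⟩ := cswap_facts hp hB
  refine ⟨Gen.ext ?_ ?_, ?_, ?_⟩
  on_goal 1 => ext ⟨r, v⟩
  on_goal 2 => ext r
  on_goal 3 => ext ⟨r, v⟩
  on_goal 4 => ext r
  all_goals
    simp only [mem_strands_fst, mem_strands_snd, mem_hor_fst, mem_hor_snd, Finset.mem_union,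
      Finset.mem_sdiff, Finset.mem_insert, Finset.mem_singleton, Prod.mk.injEq, Fin.ext_iff]
    rcases hc r with ⟨rfl, h⟩ | ⟨rfl, h⟩ | ⟨rfl, h⟩ | ⟨h1, h2, h3, h⟩ <;> rw [h] <;>
      split_ifs at * <;> omega

theorem sets_eq_exchange (hp : IsPivotal Z x.code P i) (hB : x.code i < x.code P)
    (hy : y.code = cswap Z.pair i P x.code) {e f : Fin (4 * k)}
    (hP : x.code P + e + 1 = 2 * (4 * k)) (he : (P : ℕ) < e) (hf : (P : ℕ) < f) (hi : x.code i = f) :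
    y.fst.strands = x.fst.strands \ {(P, e)} ∪ {(i, e)} ∧ y.fst.hor = x.fst.hor ∧
    y.snd.strands = x.snd.strands \ {(i, f)} ∪ {(P, f)} ∧ y.snd.hor = x.snd.hor := by
  have hc := cswap_cases hp hB hy
  obtain ⟨f1, f2, f3, f4, f5, f6⟩ := cswap_facts hp hB
  refine ⟨?_, ?_, ?_, ?_⟩
  on_goal 1 => ext ⟨r, v⟩
  on_goal 2 => ext r
  on_goal 3 => ext ⟨r, v⟩
  on_goal 4 => ext r
  all_goals
    simp only [mem_strands_fst, mem_strands_snd, mem_hor_fst, mem_hor_snd, Finset.mem_union,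
      Finset.mem_sdiff, Finset.mem_insert, Finset.mem_singleton, Prod.mk.injEq, Fin.ext_iff]
    rcases hc r with ⟨rfl, h⟩ | ⟨rfl, h⟩ | ⟨rfl, h⟩ | ⟨h1, h2, h3, h⟩ <;> rw [h] <;>
      split_ifs at * <;> omega

theorem sets_eq_excSwap (hp : IsPivotal Z x.code P i) (hB : x.code i < x.code P)
    (hy : y.code = excSwap Z i P r x.code) (hi : x.code i = P)
    (hP : x.code P + P + 1 ≠ 2 * (4 * k)) (hr : x.code r + Z.pair P + 1 = 2 * (4 * k)) :
    y.fst.strands = x.fst.strands \ {(r, Z.pair P)} ∪ {(i, P)} ∧ y.fst.hor = x.fst.hor ∧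
    y.snd.strands = x.snd.strands \ {(i, P)} ∪ {(r, Z.pair P)} ∧ y.snd.hor = x.snd.hor := by
  obtain ⟨f1, f2, f3, f4, f5, f6⟩ := cswap_facts hp hB
  rw [if_neg hP] at f6
  have hrq : (r : ℕ) ≠ Z.pair P := by
    intro h
    rw [← Fin.ext h] at f6
    omega
  have hri : (r : ℕ) ≠ i := by
    intro h
    rw [Fin.ext h] at hr
    omega
  have hrv := x.isConf_code.valid r
  have hc : ∀ p, (p = i ∧ y.code p + P + 1 = 2 * (4 * k)) ∨ (p = r ∧ y.code p = Z.pair P) ∨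
      ((p : ℕ) ≠ i ∧ (p : ℕ) ≠ r ∧ y.code p = x.code p) := by
    intro p
    rw [hy, excSwap]
    by_cases e1 : p = i
    · exact Or.inl ⟨e1, by rw [if_pos e1]; omega⟩
    by_cases e2 : p = r
    · exact Or.inr (Or.inl ⟨e2, by rw [if_neg e1, if_pos e2]⟩)
    · exact Or.inr (Or.inr ⟨fun h => e1 (Fin.ext h), fun h => e2 (Fin.ext h),
        by rw [if_neg e1, if_neg e2]⟩)
  refine ⟨?_, ?_, ?_, ?_⟩
  on_goal 1 => ext ⟨p, v⟩
  on_goal 2 => ext p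
  on_goal 3 => ext ⟨p, v⟩
  on_goal 4 => ext p
  all_goals
    simp only [mem_strands_fst, mem_strands_snd, mem_hor_fst, mem_hor_snd, Finset.mem_union,
      Finset.mem_sdiff, Finset.mem_insert, Finset.mem_singleton, Prod.mk.injEq, Fin.ext_iff]
    rcases hc p with ⟨rfl, h⟩ | ⟨rfl, h⟩ | ⟨h1, h2, h⟩ <;> omega

end MGen
end

section
variable {k : ℕ} {Z : PMC k}

namespace MGen

variable {x y : MGen Z} {P i r : Fin (4 * k)}

theorem code_eq_of_forall {t : Fin (4 * k) → ℕ} (ht : IsConf Z.pair t)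
    (h : ∀ y' : MGen Z, y'.code = t → y'.fst = y.fst ∧ y'.snd = y.snd) : y.code = t := by
  obtain ⟨y', hy'⟩ := exists_code_eq ht
  obtain ⟨h1, h2⟩ := h y' hy'
  rw [← fst_snd_injective h1 h2, hy']

theorem hConf_of_cswap (hp : IsPivotal Z x.code P i) (hB : x.code i < x.code P)
    (h : ∀ y' : MGen Z, y'.code = cswap Z.pair i P x.code → y'.fst = y.fst ∧ y'.snd = y.snd) :
    HConf Z x.code y.code :=
  (hConf_iff x.isConf_code y.isConf_code).mpr ⟨P, i, hp, hB, Or.inl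
    (code_eq_of_forall (hp.good.conf x.isConf_code Z.pair_pair Z.pair_ne) h)⟩

theorem hConf_of_excSwap (hp : IsPivotal Z x.code P i) (hB : x.code i < x.code P)
    (hi : x.code i = P) (hP : x.code P + P + 1 ≠ 2 * (4 * k))
    (hr : x.code r + Z.pair P + 1 = 2 * (4 * k))
    (h1 : y.fst.strands = x.fst.strands \ {(r, Z.pair P)} ∪ {(i, P)}) (h2 : y.fst.hor = x.fst.hor)
    (h3 : y.snd.strands = x.snd.strands \ {(i, P)} ∪ {(r, Z.pair P)})
    (h4 : y.snd.hor = x.snd.hor) :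
    HConf Z x.code y.code := by
  refine (hConf_iff x.isConf_code y.isConf_code).mpr ⟨P, i, hp, hB, Or.inr ⟨hi, hP, r, hr,
    code_eq_of_forall (hp.isConf_excSwap x.isConf_code hB hi hP hr) fun y' hy' => ?_⟩⟩
  obtain ⟨e1, e2, e3, e4⟩ := sets_eq_excSwap hp hB hy' hi hP hr
  exact ⟨Gen.ext (e1.trans h1.symm) (e2.trans h2.symm), Gen.ext (e3.trans h3.symm) (e4.trans h4.symm)⟩

theorem HArrow.hConf (h : HArrow x.fst x.snd y.fst y.snd) : HConf Z x.code y.code := by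
  rcases h with ⟨hm, P, hk, hP, a, b, hab, h1, h2, h3, h4, h5⟩ |
    ⟨hm, P, hk, i, j, hi, hj, h1, h2, h3⟩ |
    ⟨hm, P, hk, i, j, hi, hj, r, hr, h1, h2, h3, h4⟩ |
    ⟨hm, P, hk, hP, i, j, hi, h1, h2, h3, h4, h5⟩ |
    ⟨hm, P, hk, i, j, hi, hj, h1, h2, h3, h4⟩ |
    ⟨hm, P, hk, i, j, hi, hj, r, hrP, hr, h1, h2, h3, h4⟩ |
    ⟨hm, P, hk, i, hi, hr, h1, h2, h3, h4⟩ |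
    ⟨P, hb, i, e, f, hP, hi, h1, h2, h3, h4, h5, h6⟩ |
    ⟨P, hb, i, e, f, hP, hi, h1, h2, h3, h4, h5, h6⟩ |
    ⟨P, hb, i, e, f, hP, hi, h1, h2, h3, h4, h5, h6⟩
  · rw [mem_strands_fst] at hab
    rw [mem_hor_fst] at hP
    rw [Fin.lt_def] at h1 h2
    have hp := isPivotal_of (i := a) (Or.inl ⟨hm, hk⟩) h1 (by omega) (by omega)
    refine hConf_of_cswap hp (by omega) fun y' hy' => ?_
    obtain ⟨e1, e2, e3⟩ := sets_eq_split_fst hp (by omega) hy' hP hab.1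
    exact ⟨Gen.ext (e1.trans h3.symm) (e2.trans h4.symm), e3.trans h5.symm⟩
  · rw [mem_strands_snd] at hi hj
    have hp := isPivotal_of (i := i) (Or.inl ⟨hm, hk⟩) hi.2 (by omega) (by omega)
    refine hConf_of_cswap hp (by omega) fun y' hy' => ?_
    obtain ⟨e1, e2, e3⟩ := sets_eq_join_snd hp (by omega) hy' hj.1 hi.1
    exact ⟨e1.trans h1.symm, Gen.ext (e2.trans h2.symm) (e3.trans h3.symm)⟩
  · rw [mem_strands_snd] at hi hj
    rw [mem_strands_fst] at hr
    have hp := isPivotal_of (i := i) (Or.inl ⟨hm, hk⟩) hi.2 (by omega) (by omega)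
    exact hConf_of_excSwap hp (by omega) hi.1 (by omega) hr.1 h1 h2 h3 h4
  · rw [mem_strands_snd] at hi
    rw [mem_hor_fst] at hP
    rw [Fin.le_def] at h2
    have hp := isPivotal_of (i := i) (Or.inl ⟨hm, hk⟩) h1 (by omega) (by omega)
    refine hConf_of_cswap hp (by omega) fun y' hy' => ?_
    rcases h5 with ⟨h5, h6, h7⟩ | ⟨rfl, h6, h7⟩
    · obtain ⟨e1, e2, e3, e4⟩ := sets_eq_split_move hp (by omega) hy' hP hi.1 h5
      exact ⟨Gen.ext (e1.trans h3.symm) (e2.trans h4.symm),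
        Gen.ext (e3.trans h6.symm) (e4.trans h7.symm)⟩
    · obtain ⟨e1, e2, e3, e4⟩ := sets_eq_move hp (by omega) hy' hP hi.1
      exact ⟨Gen.ext (e1.trans h3.symm) (e2.trans h4.symm),
        Gen.ext (e3.trans h6.symm) (e4.trans h7.symm)⟩
  · rw [mem_strands_snd] at hi
    rw [mem_strands_fst] at hj
    have hp := isPivotal_of (i := i) (Or.inl ⟨hm, hk⟩) hi.2 (by omega) (by omega)
    refine hConf_of_cswap hp (by omega) fun y' hy' => ?_
    obtain ⟨e1, e2, e3, e4⟩ := sets_eq_move_join hp (by omega) hy' hj.1 hj.2 hi.1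
    exact ⟨Gen.ext (e1.trans h1.symm) (e2.trans h2.symm),
      Gen.ext (e3.trans h3.symm) (e4.trans h4.symm)⟩
  · rw [mem_strands_snd] at hi
    rw [mem_strands_fst] at hj hr
    have hp := isPivotal_of (i := i) (Or.inl ⟨hm, hk⟩) hi.2 (by omega) (by omega)
    exact hConf_of_excSwap hp (by omega) hi.1 (by omega) hr.1 h1 h2 h3 h4
  · rw [mem_strands_snd] at hi
    rw [mem_strands_fst] at hr
    have hp := isPivotal_of (i := i) (Or.inl ⟨hm, hk⟩) hi.2 (by omega) (by omega)
    exact hConf_of_excSwap hp (by omega) hi.1 (by omega) hr.1 h1 h2 h3 h4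
  · rw [mem_strands_fst] at hP hi
    rw [Fin.lt_def] at h1 h2 h3
    have hp := isPivotal_of (i := i) (Or.inr hb) h1 (by omega) (by omega)
    refine hConf_of_cswap hp (by omega) fun y' hy' => ?_
    obtain ⟨e1, e2, e3⟩ := sets_eq_uncross_fst hp (by omega) hy' hP.1 hP.2 hi.1
    exact ⟨Gen.ext (e1.trans h4.symm) (e2.trans h5.symm), e3.trans h6.symm⟩
  · rw [mem_strands_snd] at hP hi
    rw [Fin.lt_def] at h1 h2 h3
    have hp := isPivotal_of (i := i) (Or.inr hb) h1 (by omega) (by omega)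
    refine hConf_of_cswap hp (by omega) fun y' hy' => ?_
    obtain ⟨e1, e2, e3⟩ := sets_eq_cross_snd hp (by omega) hy' hP.1 h2 hi.1
    exact ⟨e1.trans h4.symm, Gen.ext (e2.trans h5.symm) (e3.trans h6.symm)⟩
  · rw [mem_strands_fst] at hP
    rw [mem_strands_snd] at hi
    rw [Fin.lt_def] at h1 h2
    have hp := isPivotal_of (i := i) (Or.inr hb) h1 (by omega) (by omega)
    refine hConf_of_cswap hp (by omega) fun y' hy' => ?_
    obtain ⟨e1, e2, e3, e4⟩ := sets_eq_exchange hp (by omega) hy' hP.1 hP.2 h2 hi.1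
    exact ⟨Gen.ext (e1.trans h3.symm) (e2.trans h4.symm),
      Gen.ext (e3.trans h5.symm) (e4.trans h6.symm)⟩

theorem hArrow_iff : HArrow x.fst x.snd y.fst y.snd ↔ HConf Z x.code y.code := by
  refine ⟨HArrow.hConf, fun h => ?_⟩
  obtain ⟨P, i, hp, hB, h⟩ := (hConf_iff x.isConf_code y.isConf_code).mp h
  obtain ⟨f1, f2, f3, f4, f5, f6⟩ := cswap_facts hp hB
  have hbot := isBottom_iff_of_isPivotal hp hB
  have hpiv := x.isPivot_iff.mp hp.pivot
  have hone : ¬ ((P : ℕ) < x.code i ∧ x.code P + P + 1 < 2 * (4 * k)) →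
      MultOne x.fst x.snd ∧ IsKey x.fst x.snd P :=
    fun h => hpiv.resolve_right fun h' => h (hbot.mp h')
  have hlt : i < P := Fin.lt_def.mpr f1
  rcases h with hy | ⟨hi, hP, r, hr, hy⟩
  · by_cases c1 : x.code P + P + 1 = 2 * (4 * k)
    · obtain ⟨g1, g2⟩ := hone (by omega)
      rcases x.code_cases i with ⟨j, hi⟩ | ⟨b, hi⟩ | hi
      · right; right; right; left
        refine ⟨g1, P, g2, x.mem_hor_fst.mpr c1, i, j, x.mem_strands_snd.mpr ⟨hi, by omega⟩, hlt,
          by rw [Fin.le_def]; omega, ?_⟩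
        by_cases c2 : (P : ℕ) < j
        · obtain ⟨e1, e2, e3, e4⟩ := sets_eq_split_move hp hB hy c1 hi c2
          exact ⟨e1, e2, Or.inl ⟨c2, e3, e4⟩⟩
        · have : P = j := Fin.ext (by omega)
          subst this
          obtain ⟨e1, e2, e3, e4⟩ := sets_eq_move hp hB hy c1 hi
          exact ⟨e1, e2, Or.inr ⟨rfl, e3, e4⟩⟩
      · left
        exact ⟨g1, P, g2, x.mem_hor_fst.mpr c1, i, b, x.mem_strands_fst.mpr ⟨hi, by omega⟩, hlt,
          by rw [Fin.lt_def]; omega, sets_eq_split_fst hp hB hy c1 hi⟩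
      · omega
    · by_cases c2 : x.code i = P
      · obtain ⟨g1, g2⟩ := hone (by omega)
        rcases x.code_cases P with ⟨j, hj⟩ | ⟨j, hj⟩ | hj
        · right; left
          exact ⟨g1, P, g2, i, j, x.mem_strands_snd.mpr ⟨c2, f1⟩,
            x.mem_strands_snd.mpr ⟨hj, by omega⟩, sets_eq_join_snd hp hB hy hj c2⟩
        · right; right; right; right; left
          exact ⟨g1, P, g2, i, j, x.mem_strands_snd.mpr ⟨c2, f1⟩,
            x.mem_strands_fst.mpr ⟨hj, by omega⟩, sets_eq_move_join hp hB hy hj (by omega) c2⟩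
        · omega
      · have hb := hbot.mpr ⟨by omega, by omega⟩
        right; right; right; right; right; right; right
        rcases x.code_cases P with ⟨e, he⟩ | ⟨e, he⟩ | he
        · right; left
          rcases x.code_cases i with ⟨f, hf⟩ | ⟨f, hf⟩ | hf
          · exact ⟨P, hb, i, e, f, x.mem_strands_snd.mpr ⟨he, by omega⟩,
              x.mem_strands_snd.mpr ⟨hf, by omega⟩, hlt, by rw [Fin.lt_def]; omega,
              by rw [Fin.lt_def]; omega, sets_eq_cross_snd hp hB hy he (by omega) hf⟩
          · omega
          · omega
        · rcases x.code_cases i with ⟨f, hf⟩ | ⟨f, hf⟩ | hf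
          · right; right
            exact ⟨P, hb, i, e, f, x.mem_strands_fst.mpr ⟨he, by omega⟩,
              x.mem_strands_snd.mpr ⟨hf, by omega⟩, hlt, by rw [Fin.lt_def]; omega,
              sets_eq_exchange hp hB hy he (by omega) (by omega) hf⟩
          · left
            exact ⟨P, hb, i, e, f, x.mem_strands_fst.mpr ⟨he, by omega⟩,
              x.mem_strands_fst.mpr ⟨hf, by omega⟩, hlt, by rw [Fin.lt_def]; omega,
              by rw [Fin.lt_def]; omega, sets_eq_uncross_fst hp hB hy he (by omega) hf⟩
          · omega
        · omega
  · obtain ⟨g1, g2⟩ := hone (by omega)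
    have hs := sets_eq_excSwap hp hB hy hi hP hr
    rw [if_neg hP] at f6
    have hrv := x.isConf_code.valid r
    have hrq : (r : ℕ) ≠ Z.pair P := by
      intro h
      rw [← Fin.ext h] at f6
      omega
    have hr' := x.mem_strands_fst.mpr ⟨hr, by omega⟩
    rcases x.code_cases P with ⟨j, hj⟩ | ⟨j, hj⟩ | hj
    · right; right; left
      exact ⟨g1, P, g2, i, j, x.mem_strands_snd.mpr ⟨hi, f1⟩,
        x.mem_strands_snd.mpr ⟨hj, by omega⟩, r, hr', hs⟩
    · right; right; right; right; right
      by_cases e : r = P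
      · right; left
        subst e
        exact ⟨g1, r, g2, i, x.mem_strands_snd.mpr ⟨hi, f1⟩, hr', hs⟩
      · left
        exact ⟨g1, P, g2, i, j, x.mem_strands_snd.mpr ⟨hi, f1⟩,
          x.mem_strands_fst.mpr ⟨hj, by omega⟩, r, e, hr', hs⟩
    · omega

end MGen
end

/-! ### The matrix identities -/

section
variable {k : ℕ} {Z : PMC k}

namespace MGen

theorem fst_idemGen (i : Idem Z) : (idemGen i : MGen Z).fst = i.o.gen := Gen.bar_gen _

theorem snd_idemGen (i : Idem Z) : (idemGen i : MGen Z).snd = i.gen := rfl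

theorem idemGen_injective : Function.Injective (idemGen : Idem Z → MGen Z) :=
  fun _ _ h => congrArg BoxGen.x h

theorem eq_gen_of_strands_eq_empty {a : Gen Z} (h : a.strands = ∅) : a = a.left.gen := by
  refine Gen.ext h ?_
  simp [Idem.gen, Gen.left, h]

theorem exists_isPivotal_iff (x : MGen Z) :
    (∃ P j, IsPivotal Z x.code P j) ↔ ¬ ∃ i, x = idemGen i := by
  constructor
  · rintro ⟨P, j, hp⟩ ⟨i, rfl⟩
    have h1 := hp.good.lt
    have h2 := hp.good.le
    have h3 := hp.good.up
    rw [Fin.lt_def] at h1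
    rcases (idemGen i).code_cases j with ⟨v, h⟩ | ⟨v, h⟩ | h
    · have := (idemGen i).mem_strands_snd.mpr ⟨h, by omega⟩
      rw [snd_idemGen] at this
      simp [Idem.gen] at this
    · have := (idemGen i).mem_strands_fst.mpr ⟨h, by omega⟩
      rw [fst_idemGen] at this
      simp [Idem.gen] at this
    · omega
  · intro h
    by_contra h'
    have key : ∀ s : Fin (4 * k), (s : ℕ) < x.code s → ¬ x.code s + s + 1 < 2 * (4 * k) := by
      intro s h1 h2
      obtain ⟨P, hP⟩ := exists_isPivot (Z := Z) ⟨s, cmult_ne_zero_iff.mpr ⟨s, le_rfl, h1, h2⟩⟩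
        (cmult_top x.code)
      obtain ⟨j, hj⟩ := hP.good x.isConf_code
      exact h' ⟨P, j, hP, hj⟩
    refine h ⟨x.x, fst_snd_injective ?_ ?_⟩
    · rw [fst_idemGen, ← left_fst]
      refine eq_gen_of_strands_eq_empty (Finset.eq_empty_of_forall_notMem ?_)
      rintro ⟨s, v⟩ hs
      rw [mem_strands_fst] at hs
      exact key s (by omega) (by omega)
    · rw [snd_idemGen, ← left_snd]
      refine eq_gen_of_strands_eq_empty (Finset.eq_empty_of_forall_notMem ?_)
      rintro ⟨s, v⟩ hs
      rw [mem_strands_snd] at hs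
      exact key s (by omega) (by omega)

open Classical in
theorem hMat_eq (x y : MGen Z) : hMat Z x y = if HConf Z x.code y.code then 1 else 0 := by
  rw [hMat]
  exact if_congr hArrow_iff rfl rfl

end MGen

theorem dMat_mul_dMat (Z : PMC k) : dMat Z * dMat Z = 0 := by
  classical
  ext x y
  simp only [Matrix.mul_apply, MGen.dMat_eq, Matrix.zero_apply]
  exact sum_hasArrow_hasArrow (fun x : MGen Z => x.code) MGen.code_injective
    (fun x => x.isConf_code) (fun _ => MGen.exists_code_eq) Z.pair_pair Z.pair_ne x y

theorem hMat_mul_hMat (Z : PMC k) : hMat Z * hMat Z = 0 := by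
  classical
  ext x y
  simp only [Matrix.mul_apply, MGen.hMat_eq, Matrix.zero_apply]
  exact (hConf_identities (fun x : MGen Z => x.code) MGen.code_injective
    (fun x => x.isConf_code) (fun _ => MGen.exists_code_eq)).2 x y

theorem hMat_mul_dMat_add (Z : PMC k) :
    hMat Z * dMat Z + dMat Z * hMat Z = 1 + gMat Z * fMat Z := by
  classical
  ext x y
  have := (hConf_identities (fun x : MGen Z => x.code) MGen.code_injective
    (fun x => x.isConf_code) (fun _ => MGen.exists_code_eq)).1 x y
  simp only [Matrix.add_apply, Matrix.mul_apply, MGen.hMat_eq, MGen.dMat_eq]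
  rw [this, Matrix.one_apply]
  simp only [MGen.exists_isPivotal_iff, gMat, fMat]
  by_cases h : ∃ i, x = idemGen i
  · obtain ⟨i, rfl⟩ := h
    rw [Finset.sum_eq_single i]
    · rw [if_neg (fun h => h.2 ⟨i, rfl⟩), if_pos rfl, one_mul]
      by_cases e : idemGen i = y
      · rw [if_pos e, if_pos e.symm]; rfl
      · rw [if_neg e, if_neg (Ne.symm e)]; rfl
    · intro j _ hj
      rw [if_neg (fun h => hj (MGen.idemGen_injective h).symm), zero_mul]
    · exact fun h => absurd (Finset.mem_univ _) h
  · rw [Finset.sum_eq_zero, add_zero]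
    · exact if_congr (and_iff_left h) rfl rfl
    · intro j _
      rw [if_neg (fun e => h ⟨j, e⟩), zero_mul]

theorem not_hConf_idemGen (i : Idem Z) (x : MGen Z) :
    ¬ HConf Z (idemGen i).code x.code ∧ ¬ HConf Z x.code (idemGen i).code := by
  constructor
  · rintro ⟨P, j, j', h1, h2, -⟩
    exact (MGen.exists_isPivotal_iff _).mp ⟨P, j, h1⟩ ⟨i, rfl⟩
  · rintro ⟨P, j, j', h1, h2, -⟩
    exact (MGen.exists_isPivotal_iff _).mp ⟨P, j', h2⟩ ⟨i, rfl⟩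

theorem not_hasArrow_idemGen (i : Idem Z) (x : MGen Z) :
    ¬ HasArrow Z.pair (idemGen i).code x.code ∧ ¬ HasArrow Z.pair x.code (idemGen i).code := by
  constructor
  · intro h
    exact (MGen.exists_isPivotal_iff _).mp (isConf_hasArrow_pivotal (MGen.isConf_code _) h).1 ⟨i, rfl⟩
  · intro h
    exact (MGen.exists_isPivotal_iff _).mp (isConf_hasArrow_pivotal (MGen.isConf_code _) h).2 ⟨i, rfl⟩

theorem fMat_mul_apply {Y : Type*} (T : Matrix (MGen Z) Y (ZMod 2)) (i : Idem Z) (y : Y) :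
    (fMat Z * T) i y = T (idemGen i) y := by
  rw [Matrix.mul_apply, Finset.sum_eq_single (idemGen i)]
  · rw [fMat, if_pos rfl, one_mul]
  · intro x _ hx
    rw [fMat, if_neg hx, zero_mul]
  · exact fun h => absurd (Finset.mem_univ _) h

theorem mul_gMat_apply {Y : Type*} (T : Matrix Y (MGen Z) (ZMod 2)) (i : Idem Z) (y : Y) :
    (T * gMat Z) y i = T y (idemGen i) := by
  rw [Matrix.mul_apply, Finset.sum_eq_single (idemGen i)]
  · rw [gMat, if_pos rfl, mul_one]
  · intro x _ hx
    rw [gMat, if_neg hx, mul_zero]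
  · exact fun h => absurd (Finset.mem_univ _) h

theorem fMat_mul_hMat (Z : PMC k) : fMat Z * hMat Z = 0 := by
  ext i y
  rw [fMat_mul_apply, MGen.hMat_eq, if_neg (not_hConf_idemGen i y).1, Matrix.zero_apply]

theorem hMat_mul_gMat (Z : PMC k) : hMat Z * gMat Z = 0 := by
  ext y i
  rw [mul_gMat_apply, MGen.hMat_eq, if_neg (not_hConf_idemGen i y).2, Matrix.zero_apply]

theorem fMat_mul_dMat (Z : PMC k) : fMat Z * dMat Z = 0 := by
  ext i y
  rw [fMat_mul_apply, MGen.dMat_eq, if_neg (not_hasArrow_idemGen i y).1, Matrix.zero_apply]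

theorem dMat_mul_gMat (Z : PMC k) : dMat Z * gMat Z = 0 := by
  ext y i
  rw [mul_gMat_apply, MGen.dMat_eq, if_neg (not_hasArrow_idemGen i y).2, Matrix.zero_apply]

theorem fMat_mul_gMat (Z : PMC k) : fMat Z * gMat Z = 1 := by
  ext i j
  rw [fMat_mul_apply, gMat, Matrix.one_apply]
  exact if_congr MGen.idemGen_injective.eq_iff rfl rfl

end

/-! ### The large model is a bimodule -/

section
variable {k : ℕ} {Z : PMC k}

namespace MGen

variable (s t : MGen Z)

/-- The right action of a generator of `A(Z)`. -/
noncomputable def ract (b : Gen Z) (s t : MGen Z) : ZMod 2 :=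
  if s.x = t.x ∧ s.q = t.q then (strandAlg Z).mul s.p b t.p else 0

/-- The right action of a generator of `A(-Z)`. -/
noncomputable def ract' (b' : Gen Z.rev) (s t : MGen Z) : ZMod 2 :=
  if s.x = t.x ∧ s.p = t.p then (strandAlg Z.rev).mul b' t.q s.q else 0

theorem left_p : s.p.left = s.x := s.idem_p

theorem right_q : s.q.right = s.x.o.bar := s.idem_q

theorem sum_eq_sum_p (F : MGen Z → ZMod 2) (φ : Gen Z → ZMod 2)
    (h0 : ∀ u, ¬ (u.x = s.x ∧ u.q = s.q) → F u = 0)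
    (h1 : ∀ u : MGen Z, u.x = s.x → u.q = s.q → F u = φ u.p)
    (h2 : ∀ p, φ p ≠ 0 → p.left = s.x) : ∑ u, F u = ∑ p, φ p := by
  refine Finset.sum_bij_ne_zero (fun u _ _ => u.p) (fun _ _ _ => Finset.mem_univ _) ?_ ?_ ?_
  · intro u _ hu v _ hv h
    have e1 := not_not.mp (mt (h0 u) hu)
    have e2 := not_not.mp (mt (h0 v) hv)
    exact BoxGen.ext (e1.2.trans e2.2.symm) (e1.1.trans e2.1.symm) h
  · intro p _ hp
    obtain ⟨u, e1, e2, rfl⟩ : ∃ u : MGen Z, u.x = s.x ∧ u.q = s.q ∧ u.p = p :=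
      ⟨⟨s.q, s.x, p, s.idem_q, h2 p hp⟩, rfl, rfl, rfl⟩
    exact ⟨u, Finset.mem_univ _, by rwa [h1 u e1 e2], rfl⟩
  · intro u _ hu
    have e1 := not_not.mp (mt (h0 u) hu)
    exact h1 u e1.1 e1.2

theorem sum_eq_sum_q (F : MGen Z → ZMod 2) (φ : Gen Z.rev → ZMod 2)
    (h0 : ∀ u, ¬ (u.x = s.x ∧ u.p = s.p) → F u = 0)
    (h1 : ∀ u : MGen Z, u.x = s.x → u.p = s.p → F u = φ u.q)
    (h2 : ∀ q, φ q ≠ 0 → q.right = s.x.o.bar) : ∑ u, F u = ∑ q, φ q := by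
  refine Finset.sum_bij_ne_zero (fun u _ _ => u.q) (fun _ _ _ => Finset.mem_univ _) ?_ ?_ ?_
  · intro u _ hu v _ hv h
    have e1 := not_not.mp (mt (h0 u) hu)
    have e2 := not_not.mp (mt (h0 v) hv)
    exact BoxGen.ext h (e1.1.trans e2.1.symm) (e1.2.trans e2.2.symm)
  · intro q _ hq
    obtain ⟨u, e1, e2, rfl⟩ : ∃ u : MGen Z, u.x = s.x ∧ u.p = s.p ∧ u.q = q :=
      ⟨⟨q, s.x, s.p, h2 q hq, s.idem_p⟩, rfl, rfl, rfl⟩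
    exact ⟨u, Finset.mem_univ _, by rwa [h1 u e1 e2], rfl⟩
  · intro u _ hu
    have e1 := not_not.mp (mt (h0 u) hu)
    exact h1 u e1.1 e1.2

end MGen

theorem strandAlg_mul_ne_zero {a b c : Gen Z} (h : (strandAlg Z).mul a b c ≠ 0) :
    a.right = b.left ∧ c.left = a.left ∧ c.right = b.right := by
  rw [strandAlg_mul] at h
  have h' : Gen.MulRel a b c := by by_contra h'; exact h (if_neg h')
  exact ⟨h'.idem, h'.left_right⟩

theorem strandAlg_d_ne_zero {a b : Gen Z} (h : (strandAlg Z).d a b ≠ 0) :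
    b.left = a.left ∧ b.right = a.right := by
  rw [strandAlg_d] at h
  have h' : Gen.DRel a b := by by_contra h'; exact h (if_neg h')
  exact h'.left_right

namespace MGen

variable (s t : MGen Z) (b c : Gen Z) (b' c' : Gen Z.rev)

noncomputable def dSnd (s t : MGen Z) : ZMod 2 :=
  if s.x = t.x ∧ s.q = t.q then (strandAlg Z).d s.p t.p else 0

noncomputable def dFst (s t : MGen Z) : ZMod 2 :=
  if s.x = t.x ∧ s.p = t.p then (strandAlg Z.rev).d t.q s.q else 0

noncomputable def dChord (s t : MGen Z) : ZMod 2 :=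
  ∑ a' : Gen Z.rev, ∑ a : Gen Z, (cfddId Z).δ t.x a a' s.x * (strandAlg Z.rev).mul t.q a' s.q *
    (strandAlg Z).mul a s.p t.p

theorem dMat_eq_add : dMat Z s t = dSnd s t + dFst s t + dChord s t := rfl

theorem ract_mul_ract : ∑ u, ract b s u * ract c u t =
    ∑ e, (strandAlg Z).mul b c e * ract e s t := by
  by_cases h : s.x = t.x ∧ s.q = t.q
  · rw [sum_eq_sum_p s _ (fun p => (strandAlg Z).mul s.p b p * (strandAlg Z).mul p c t.p)]
    · rw [strandAlg_assoc]
      refine Finset.sum_congr rfl fun e _ => ?_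
      rw [ract, if_pos h]
    · intro u hu
      rw [ract, if_neg (fun h' => hu ⟨h'.1.symm, h'.2.symm⟩), zero_mul]
    · intro u h1 h2
      rw [ract, ract, if_pos ⟨h1.symm, h2.symm⟩, h1, h2, if_pos h]
    · intro p hp
      rw [(strandAlg_mul_ne_zero (left_ne_zero_of_mul hp)).2.1, left_p]
  · rw [Finset.sum_eq_zero, Finset.sum_eq_zero]
    · intro e _
      rw [ract, if_neg h, mul_zero]
    · intro u _
      rw [ract, ract]
      split_ifs with h1 h2
      · exact absurd ⟨h1.1.trans h2.1, h1.2.trans h2.2⟩ h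
      all_goals simp

theorem ract'_mul_ract' : ∑ u, ract' b' s u * ract' c' u t =
    ∑ e, (strandAlg Z.rev).mul b' c' e * ract' e s t := by
  by_cases h : s.x = t.x ∧ s.p = t.p
  · rw [sum_eq_sum_q s _ (fun q => (strandAlg Z.rev).mul c' t.q q * (strandAlg Z.rev).mul b' q s.q)]
    · rw [← strandAlg_assoc]
      refine Finset.sum_congr rfl fun e _ => ?_
      rw [ract', if_pos h]
    · intro u hu
      rw [ract', if_neg (fun h' => hu ⟨h'.1.symm, h'.2.symm⟩), zero_mul]
    · intro u h1 h2
      rw [ract', ract', if_pos ⟨h1.symm, h2.symm⟩, h1, h2, if_pos h, mul_comm]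
    · intro q hq
      rw [← right_q, ← (strandAlg_mul_ne_zero (right_ne_zero_of_mul hq)).2.2]
  · rw [Finset.sum_eq_zero, Finset.sum_eq_zero]
    · intro e _
      rw [ract', if_neg h, mul_zero]
    · intro u _
      rw [ract', ract']
      split_ifs with h1 h2
      · exact absurd ⟨h1.1.trans h2.1, h1.2.trans h2.2⟩ h
      all_goals simp

/-- Maps that act on the two entries separately commute. -/
theorem sum_comm_of_separate (φ : Gen Z → Gen Z → ZMod 2) (ψ : Gen Z.rev → Gen Z.rev → ZMod 2) :
    ∑ u : MGen Z, (if s.x = u.x ∧ s.q = u.q then φ s.p u.p else 0) *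
      (if u.x = t.x ∧ u.p = t.p then ψ u.q t.q else 0) =
    ∑ u : MGen Z, (if s.x = u.x ∧ s.p = u.p then ψ s.q u.q else 0) *
      (if u.x = t.x ∧ u.q = t.q then φ u.p t.p else 0) := by
  have key : ∀ F : MGen Z → ZMod 2, ∀ v : MGen Z, (∀ u, u ≠ v → F u = 0) → ∑ u, F u = F v :=
    fun F v h => Finset.sum_eq_single v (fun u _ => h u) fun h => absurd (Finset.mem_univ _) h
  by_cases h : s.x = t.x
  · obtain ⟨v, v1, v2, v3⟩ : ∃ v : MGen Z, v.x = s.x ∧ v.q = s.q ∧ v.p = t.p :=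
      ⟨⟨s.q, s.x, t.p, s.idem_q, by rw [h]; exact t.idem_p⟩, rfl, rfl, rfl⟩
    obtain ⟨w, w1, w2, w3⟩ : ∃ w : MGen Z, w.x = s.x ∧ w.q = t.q ∧ w.p = s.p :=
      ⟨⟨t.q, s.x, s.p, by rw [h]; exact t.idem_q, s.idem_p⟩, rfl, rfl, rfl⟩
    rw [key _ v, key _ w]
    · rw [v1, v2, v3, w1, w2, w3]
      simp only [h, and_self, if_true, mul_comm]
    · intro u hu
      split_ifs with h1 h2
      · exact absurd (BoxGen.ext (h2.2.trans w2.symm) (h1.1.symm.trans w1.symm)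
          (h1.2.symm.trans w3.symm)) hu
      all_goals simp
    · intro u hu
      split_ifs with h1 h2
      · exact absurd (BoxGen.ext (h1.2.symm.trans v2.symm) (h1.1.symm.trans v1.symm)
          (h2.2.trans v3.symm)) hu
      all_goals simp
  · rw [Finset.sum_eq_zero, Finset.sum_eq_zero]
    all_goals
      intro u _
      split_ifs with h1 h2
      · exact absurd (h1.1.trans h2.1) h
      all_goals simp

theorem ract_mul_ract' : ∑ u, ract b s u * ract' b' u t = ∑ u, ract' b' s u * ract b u t :=
  sum_comm_of_separate s t (fun p p' => (strandAlg Z).mul p b p')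
    (fun q q' => (strandAlg Z.rev).mul b' q' q)

theorem dFst_mul_ract : ∑ u, dFst s u * ract b u t = ∑ u, ract b s u * dFst u t :=
  (sum_comm_of_separate s t (fun p p' => (strandAlg Z).mul p b p')
    (fun q q' => (strandAlg Z.rev).d q' q)).symm

theorem dSnd_mul_ract' : ∑ u, dSnd s u * ract' b' u t = ∑ u, ract' b' s u * dSnd u t :=
  sum_comm_of_separate s t (fun p p' => (strandAlg Z).d p p')
    (fun q q' => (strandAlg Z.rev).mul b' q' q)

theorem dChord_mul_ract : ∑ u, dChord s u * ract b u t = ∑ u, ract b s u * dChord u t := by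
  rw [sum_eq_sum_p t _ (fun p => (∑ a' : Gen Z.rev, ∑ a : Gen Z, (cfddId Z).δ t.x a a' s.x *
      (strandAlg Z.rev).mul t.q a' s.q * (strandAlg Z).mul a s.p p) * (strandAlg Z).mul p b t.p),
    sum_eq_sum_p s _ (fun p => (strandAlg Z).mul s.p b p * ∑ a' : Gen Z.rev, ∑ a : Gen Z,
      (cfddId Z).δ t.x a a' s.x * (strandAlg Z.rev).mul t.q a' s.q * (strandAlg Z).mul a p t.p)]
  · simp only [Finset.sum_mul, Finset.mul_sum]
    rw [Finset.sum_comm]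
    conv_rhs => rw [Finset.sum_comm]
    refine Finset.sum_congr rfl fun a' _ => ?_
    rw [Finset.sum_comm]
    conv_rhs => rw [Finset.sum_comm]
    refine Finset.sum_congr rfl fun a _ => ?_
    simp only [mul_assoc, mul_left_comm ((strandAlg Z).mul s.p b _), ← Finset.mul_sum]
    rw [strandAlg_assoc]
  · intro u hu
    rw [ract, if_neg (fun h' => hu ⟨h'.1.symm, h'.2.symm⟩), zero_mul]
  · intro u h1 h2
    rw [ract, if_pos ⟨h1.symm, h2.symm⟩, dChord, h1, h2]
  · intro p hp
    rw [(strandAlg_mul_ne_zero (left_ne_zero_of_mul hp)).2.1, left_p]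
  · intro u hu
    rw [ract, if_neg hu, mul_zero]
  · intro u h1 h2
    rw [ract, if_pos ⟨h1, h2⟩, dChord, h1, h2]
  · intro p hp
    rw [← (strandAlg_mul_ne_zero (right_ne_zero_of_mul hp)).2.1, left_p]

theorem dChord_mul_ract' : ∑ u, dChord s u * ract' b' u t = ∑ u, ract' b' s u * dChord u t := by
  rw [sum_eq_sum_q t _ (fun q => (∑ a' : Gen Z.rev, ∑ a : Gen Z, (cfddId Z).δ t.x a a' s.x *
      (strandAlg Z.rev).mul q a' s.q * (strandAlg Z).mul a s.p t.p) *
        (strandAlg Z.rev).mul b' t.q q),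
    sum_eq_sum_q s _ (fun q => (strandAlg Z.rev).mul b' q s.q * ∑ a' : Gen Z.rev, ∑ a : Gen Z,
      (cfddId Z).δ t.x a a' s.x * (strandAlg Z.rev).mul t.q a' q * (strandAlg Z).mul a s.p t.p)]
  · simp only [Finset.sum_mul, Finset.mul_sum]
    rw [Finset.sum_comm]
    conv_rhs => rw [Finset.sum_comm]
    refine Finset.sum_congr rfl fun a' _ => ?_
    rw [Finset.sum_comm]
    conv_rhs => rw [Finset.sum_comm]
    refine Finset.sum_congr rfl fun a _ => ?_
    have := strandAlg_assoc b' t.q a' s.q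
    calc _ = (cfddId Z).δ t.x a a' s.x * (strandAlg Z).mul a s.p t.p *
          ∑ m, (strandAlg Z.rev).mul b' t.q m * (strandAlg Z.rev).mul m a' s.q := by
          rw [Finset.mul_sum]; exact Finset.sum_congr rfl fun _ _ => by ring
      _ = _ := by
          rw [this, Finset.mul_sum]; exact Finset.sum_congr rfl fun _ _ => by ring
  · intro u hu
    rw [ract', if_neg (fun h' => hu ⟨h'.1.symm, h'.2.symm⟩), zero_mul]
  · intro u h1 h2
    rw [ract', if_pos ⟨h1.symm, h2.symm⟩, dChord, h1, h2]
  · intro p hp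
    rw [← (strandAlg_mul_ne_zero (left_ne_zero_of_mul hp)).2.2, right_q]
  · intro u hu
    rw [ract', if_neg hu, mul_zero]
  · intro u h1 h2
    rw [ract', if_pos ⟨h1, h2⟩, dChord, h1, h2]
  · intro p hp
    rw [(strandAlg_mul_ne_zero (right_ne_zero_of_mul hp)).2.2, right_q]

theorem dSnd_mul_ract : ∑ u, dSnd s u * ract b u t + ∑ u, ract b s u * dSnd u t +
    ∑ c, (strandAlg Z).d b c * ract c s t = 0 := by
  by_cases h : s.x = t.x ∧ s.q = t.q
  · rw [sum_eq_sum_p s _ (fun p => (strandAlg Z).d s.p p * (strandAlg Z).mul p b t.p),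
      sum_eq_sum_p s _ (fun p => (strandAlg Z).mul s.p b p * (strandAlg Z).d p t.p)]
    · rw [← strandAlg_leibniz s.p b t.p, add_comm (∑ p, (strandAlg Z).d s.p p * _)]
      congr 1
      refine Finset.sum_congr rfl fun e _ => ?_
      rw [ract, if_pos h]
    · intro u hu
      rw [ract, if_neg (fun h' => hu ⟨h'.1.symm, h'.2.symm⟩), zero_mul]
    · intro u h1 h2
      rw [ract, dSnd, if_pos ⟨h1.symm, h2.symm⟩, h1, h2, if_pos h]
    · intro p hp
      rw [(strandAlg_mul_ne_zero (left_ne_zero_of_mul hp)).2.1, left_p]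
    · intro u hu
      rw [dSnd, if_neg (fun h' => hu ⟨h'.1.symm, h'.2.symm⟩), zero_mul]
    · intro u h1 h2
      rw [ract, dSnd, if_pos ⟨h1.symm, h2.symm⟩, h1, h2, if_pos h]
    · intro p hp
      rw [(strandAlg_d_ne_zero (left_ne_zero_of_mul hp)).1, left_p]
  · rw [Finset.sum_eq_zero, Finset.sum_eq_zero, Finset.sum_eq_zero, add_zero, add_zero]
    · intro e _
      rw [ract, if_neg h, mul_zero]
    all_goals
      intro u _
      rw [ract, dSnd]
      split_ifs with h1 h2
      · exact absurd ⟨h1.1.trans h2.1, h1.2.trans h2.2⟩ h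
      all_goals simp

theorem dFst_mul_ract' : ∑ u, dFst s u * ract' b' u t + ∑ u, ract' b' s u * dFst u t +
    ∑ c, (strandAlg Z.rev).d b' c * ract' c s t = 0 := by
  by_cases h : s.x = t.x ∧ s.p = t.p
  · rw [sum_eq_sum_q s _ (fun q => (strandAlg Z.rev).mul b' t.q q * (strandAlg Z.rev).d q s.q),
      sum_eq_sum_q s _ (fun q => (strandAlg Z.rev).d t.q q * (strandAlg Z.rev).mul b' q s.q)]
    · rw [← strandAlg_leibniz b' t.q s.q, add_assoc, add_assoc, add_comm (∑ q, (strandAlg Z.rev).d t.q q * _)]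
      congr 2
      refine Finset.sum_congr rfl fun e _ => ?_
      rw [ract', if_pos h]
    · intro u hu
      rw [ract', if_neg (fun h' => hu ⟨h'.1.symm, h'.2.symm⟩), zero_mul]
    · intro u h1 h2
      rw [ract', dFst, if_pos ⟨h1.symm, h2.symm⟩, h1, h2, if_pos h, mul_comm]
    · intro p hp
      rw [← (strandAlg_mul_ne_zero (right_ne_zero_of_mul hp)).2.2, right_q]
    · intro u hu
      rw [dFst, if_neg (fun h' => hu ⟨h'.1.symm, h'.2.symm⟩), zero_mul]
    · intro u h1 h2
      rw [ract', dFst, if_pos ⟨h1.symm, h2.symm⟩, h1, h2, if_pos h, mul_comm]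
    · intro p hp
      rw [← (strandAlg_d_ne_zero (right_ne_zero_of_mul hp)).2, right_q]
  · rw [Finset.sum_eq_zero, Finset.sum_eq_zero, Finset.sum_eq_zero, add_zero, add_zero]
    · intro e _
      rw [ract', if_neg h, mul_zero]
    all_goals
      intro u _
      rw [ract', dFst]
      split_ifs with h1 h2
      · exact absurd ⟨h1.1.trans h2.1, h1.2.trans h2.2⟩ h
      all_goals simp

theorem dMat_mul_ract : ∑ u, dMat Z s u * ract b u t + ∑ u, ract b s u * dMat Z u t +
    ∑ c, (strandAlg Z).d b c * ract c s t = 0 := by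
  simp only [dMat_eq_add, add_mul, mul_add, Finset.sum_add_distrib]
  rw [← dChord_mul_ract, ← dFst_mul_ract, ← dSnd_mul_ract s t b]
  linear_combination CharTwo.add_self_eq_zero (∑ u, dFst s u * ract b u t) +
    CharTwo.add_self_eq_zero (∑ u, dChord s u * ract b u t)

theorem dMat_mul_ract' : ∑ u, dMat Z s u * ract' b' u t + ∑ u, ract' b' s u * dMat Z u t +
    ∑ c, (strandAlg Z.rev).d b' c * ract' c s t = 0 := by
  simp only [dMat_eq_add, add_mul, mul_add, Finset.sum_add_distrib]
  rw [← dChord_mul_ract', ← dSnd_mul_ract', ← dFst_mul_ract' s t b']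
  linear_combination CharTwo.add_self_eq_zero (∑ u, dSnd s u * ract' b' u t) +
    CharTwo.add_self_eq_zero (∑ u, dChord s u * ract' b' u t)

end MGen
end

section
variable {k : ℕ} {Z : PMC k}

theorem largeModel_m_left (s t : MGen Z) (b' : Gen Z.rev) :
    (largeModel Z).m s [b'] [] t = MGen.ract' b' s t := rfl

theorem largeModel_m_right (s t : MGen Z) (b : Gen Z) :
    (largeModel Z).m s [] [b] t = MGen.ract b s t := rfl

theorem largeModel_m_high (s t : MGen Z) {l' : List (Gen Z.rev)} {l : List (Gen Z)}
    (h : 2 ≤ l'.length + l.length) : (largeModel Z).m s l' l t = 0 := by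
  rcases l' with _ | ⟨b', _ | ⟨c', l'⟩⟩
  · rcases l with _ | ⟨b, _ | ⟨c, l⟩⟩
    · simp at h
    · simp at h
    · rfl
  · rcases l with _ | ⟨b, l⟩
    · simp at h
    · rfl
  · rfl

theorem DGAlg.dSum_eq_zero {G I : Type} [Fintype G] (A : DGAlg G I) :
    ∀ (φ : List G → ZMod 2) (l : List G), (∀ l', l'.length = l.length → φ l' = 0) → A.dSum φ l = 0
  | _, [], _ => rfl
  | φ, a :: l, h => by
    rw [DGAlg.dSum, Finset.sum_eq_zero fun c _ => by rw [h (c :: l) rfl, mul_zero],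
      DGAlg.dSum_eq_zero A _ l fun l' hl => h _ (by simp [hl]), add_zero]

theorem DGAlg.mulSum_eq_zero {G I : Type} [Fintype G] (A : DGAlg G I) :
    ∀ (φ : List G → ZMod 2) (l : List G), (∀ l', l'.length + 1 = l.length → φ l' = 0) →
      A.mulSum φ l = 0
  | _, [], _ => rfl
  | _, [_], _ => rfl
  | φ, a :: b :: l, h => by
    rw [DGAlg.mulSum, Finset.sum_eq_zero fun c _ => by rw [h (c :: l) rfl, mul_zero],
      DGAlg.mulSum_eq_zero A _ (b :: l) fun l' hl => h _ (by simpa using hl), add_zero]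

theorem largeModel_relation (s t : MGen Z) (l' : List (Gen Z.rev)) (l : List (Gen Z)) :
    (largeModel Z).m.comp (largeModel Z).m s l' l t +
      (largeModel Z).m.alg (strandAlg Z.rev) (strandAlg Z) s l' l t = 0 := by
  have hd : ∀ u v : MGen Z, (largeModel Z).m u [] [] v = dMat Z u v := fun _ _ => rfl
  by_cases h3 : 3 ≤ l'.length + l.length
  · rw [Coeffs.comp, Coeffs.alg, DGAlg.dSum_eq_zero, DGAlg.dSum_eq_zero, DGAlg.mulSum_eq_zero,
      DGAlg.mulSum_eq_zero, Finset.sum_eq_zero]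
    · simp
    · intro i _
      refine Finset.sum_eq_zero fun j _ => Finset.sum_eq_zero fun u _ => ?_
      have e1 : (l'.take i).length + (l'.drop i).length = l'.length := by
        rw [← List.length_append, List.take_append_drop]
      have e2 : (l.take j).length + (l.drop j).length = l.length := by
        rw [← List.length_append, List.take_append_drop]
      by_cases h : 2 ≤ (l'.take i).length + (l.take j).length
      · rw [largeModel_m_high _ _ h, zero_mul]
      · rw [largeModel_m_high _ _ (by omega : 2 ≤ (l'.drop i).length + (l.drop j).length), mul_zero]
    all_goals exact fun r hr => largeModel_m_high _ _ (by omega)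
  rw [Coeffs.comp, Coeffs.alg]
  rcases l' with _ | ⟨b', _ | ⟨c', l'⟩⟩
  · rcases l with _ | ⟨b, _ | ⟨c, l⟩⟩
    · have := congrFun (congrFun (dMat_mul_dMat Z) s) t
      simp only [Matrix.mul_apply, Matrix.zero_apply] at this
      simpa [DGAlg.dSum, DGAlg.mulSum, hd] using this
    · have := MGen.dMat_mul_ract s t b
      simpa [DGAlg.dSum, DGAlg.mulSum, hd, Finset.sum_range_succ, largeModel_m_right] using this
    · have hl : l = [] := by
        rw [← List.length_eq_zero_iff]; simp only [List.length_cons] at h3; omega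
      subst hl
      have := MGen.ract_mul_ract s t b c
      simp [DGAlg.dSum, DGAlg.mulSum, hd, Finset.sum_range_succ, largeModel_m_right,
        largeModel_m_high, this, CharTwo.add_self_eq_zero]
  · rcases l with _ | ⟨b, l⟩
    · have := MGen.dMat_mul_ract' s t b'
      simpa [DGAlg.dSum, DGAlg.mulSum, hd, Finset.sum_range_succ, largeModel_m_left] using this
    · have hl : l = [] := by
        rw [← List.length_eq_zero_iff]; simp only [List.length_cons] at h3; omega
      subst hl
      have := MGen.ract_mul_ract' s t b b'
      simp [DGAlg.dSum, DGAlg.mulSum, hd, Finset.sum_range_succ, largeModel_m_right,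
        largeModel_m_left, largeModel_m_high, this, CharTwo.add_self_eq_zero]
  · have hl : l' = [] ∧ l = [] := by
      rw [← List.length_eq_zero_iff, ← List.length_eq_zero_iff]
      simp only [List.length_cons] at h3; omega
    obtain ⟨rfl, rfl⟩ := hl
    have := MGen.ract'_mul_ract' s t b' c'
    simp [DGAlg.dSum, DGAlg.mulSum, hd, Finset.sum_range_succ, largeModel_m_left,
      largeModel_m_high, this, CharTwo.add_self_eq_zero]

theorem largeModel_balanced (Z : PMC k) :
    IdemBalanced (largeModel Z) (largeModel Z) (largeModel Z).m := by
  intro s l' l t h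
  change (strandAlg Z.rev).Matches s.q.left l' t.q.left ∧ (strandAlg Z).Matches s.p.right l t.p.right
  by_cases h2 : 2 ≤ l'.length + l.length
  · exact absurd (largeModel_m_high s t h2) h
  rcases l' with _ | ⟨b', l'⟩
  · rcases l with _ | ⟨b, l⟩
    · change s.q.left = t.q.left ∧ s.p.right = t.p.right
      change dMat Z s t ≠ 0 at h
      rw [MGen.dMat_eq_add] at h
      by_cases h3 : MGen.dSnd s t = 0
      · by_cases h4 : MGen.dFst s t = 0
        · rw [h3, h4, zero_add, zero_add, MGen.dChord] at h
          obtain ⟨a', -, h⟩ := Finset.exists_ne_zero_of_sum_ne_zero h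
          obtain ⟨a, -, h⟩ := Finset.exists_ne_zero_of_sum_ne_zero h
          exact ⟨(strandAlg_mul_ne_zero (right_ne_zero_of_mul (left_ne_zero_of_mul h))).2.1,
            (strandAlg_mul_ne_zero (right_ne_zero_of_mul h)).2.2.symm⟩
        · rw [MGen.dFst] at h4
          split_ifs at h4 with h5
          · exact ⟨(strandAlg_d_ne_zero h4).1, by rw [h5.2]⟩
          · exact absurd rfl h4
      · rw [MGen.dSnd] at h3
        split_ifs at h3 with h5
        · exact ⟨by rw [h5.2], (strandAlg_d_ne_zero h3).2.symm⟩
        · exact absurd rfl h3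
    · have hl : l = [] := by
        rw [← List.length_eq_zero_iff]; simp only [List.length_cons] at h2; omega
      subst hl
      rw [largeModel_m_right, MGen.ract] at h
      split_ifs at h with h5
      · obtain ⟨e1, e2, e3⟩ := strandAlg_mul_ne_zero h
        exact ⟨congrArg Gen.left h5.2, e1.symm, e3.symm⟩
      · exact absurd rfl h
  · have hl : l' = [] ∧ l = [] := by
      rw [← List.length_eq_zero_iff, ← List.length_eq_zero_iff]
      simp only [List.length_cons] at h2; omega
    obtain ⟨rfl, rfl⟩ := hl
    rw [largeModel_m_left, MGen.ract'] at h
    split_ifs at h with h5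
    · obtain ⟨e1, e2, e3⟩ := strandAlg_mul_ne_zero h
      exact ⟨⟨e2.symm, e1⟩, congrArg Gen.right h5.2⟩
    · exact absurd rfl h

theorem largeModel_isAInf (Z : PMC k) : (largeModel Z).IsAInf where
  balanced := largeModel_balanced Z
  relation := fun s l' l t => largeModel_relation s t l' l
  unit_left := by
    intro s t
    change MGen.ract' s.q.left.gen s t = _
    rw [MGen.ract', strandAlg_mul, Gen.mulRel_gen_left]
    by_cases h : s = t
    · subst h
      simp
    · rw [if_neg h]
      split_ifs with h1 h2
      · exact absurd (BoxGen.ext h2.2.symm h1.1 h1.2) h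
      all_goals rfl
  unit_right := by
    intro s t
    change MGen.ract s.p.right.gen s t = _
    rw [MGen.ract, strandAlg_mul, Gen.mulRel_gen_right]
    by_cases h : s = t
    · subst h
      simp
    · rw [if_neg h]
      split_ifs with h1 h2
      · exact absurd (BoxGen.ext h1.2 h1.1 h2.2) h
      all_goals rfl
  unit_high := fun s l' l t h _ => largeModel_m_high s t h

end

/-! ### Noncommutative power series -/

section
variable {G A : Type}

/-- `F` summed over all ways to cut a list into two. -/
def splitSum [AddCommMonoid A] (F : List G → List G → A) (l : List G) : A :=
  ∑ i ∈ Finset.range (l.length + 1), F (l.take i) (l.drop i)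

section
variable [AddCommMonoid A] (F F' : List G → List G → A) (a : G) (l : List G)

theorem splitSum_nil : splitSum F [] = F [] [] := by simp [splitSum]

theorem splitSum_cons : splitSum F (a :: l) = F [] (a :: l) + splitSum (fun u v => F (a :: u) v) l := by
  rw [splitSum, List.length_cons, Finset.sum_range_succ', add_comm]
  rfl

theorem splitSum_add : splitSum (fun u v => F u v + F' u v) l = splitSum F l + splitSum F' l :=
  Finset.sum_add_distrib

theorem splitSum_sum {κ : Type*} (s : Finset κ) (F : κ → List G → List G → A) (l : List G) :
    splitSum (fun u v => ∑ c ∈ s, F c u v) l = ∑ c ∈ s, splitSum (F c) l :=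
  Finset.sum_comm

theorem splitSum_assoc : ∀ (F : List G → List G → List G → A) (l : List G),
    splitSum (fun u v => splitSum (fun u₁ u₂ => F u₁ u₂ v) u) l =
      splitSum (fun u v => splitSum (fun v₁ v₂ => F u v₁ v₂) v) l
  | F, [] => by simp only [splitSum_nil]
  | F, a :: l => by
    simp only [splitSum_cons, splitSum_nil, splitSum_add]
    rw [splitSum_assoc (fun u₁ u₂ v => F (a :: u₁) u₂ v) l, add_assoc]

theorem splitSum_ne_zero {F : List G → List G → A} {l : List G} (h : splitSum F l ≠ 0) :
    ∃ u v, u ++ v = l ∧ F u v ≠ 0 := by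
  obtain ⟨i, -, hi⟩ := Finset.exists_ne_zero_of_sum_ne_zero h
  exact ⟨_, _, List.take_append_drop i l, hi⟩

end

/-- Power series in noncommuting variables `G`. -/
def Conv (G A : Type) : Type := List G → A

namespace Conv

instance [AddCommGroup A] : AddCommGroup (Conv G A) := inferInstanceAs (AddCommGroup (List G → A))

/-- The constant power series. -/
def C [Zero A] (c : A) : Conv G A := fun l => match l with
  | [] => c
  | _ :: _ => 0

variable [Ring A]

instance : Mul (Conv G A) := ⟨fun φ ψ => splitSum fun u v => φ u * ψ v⟩

instance : One (Conv G A) := ⟨C 1⟩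

theorem mul_apply (φ ψ : Conv G A) (l : List G) : (φ * ψ) l = splitSum (fun u v => φ u * ψ v) l := rfl

theorem add_apply (φ ψ : Conv G A) (l : List G) : (φ + ψ) l = φ l + ψ l := rfl

theorem C_mul (c : A) (φ : Conv G A) (l : List G) : (C c * φ : Conv G A) l = c * φ l := by
  rw [mul_apply]
  cases l with
  | nil => rw [splitSum_nil]; rfl
  | cons a l =>
    rw [splitSum_cons]
    simp [C, splitSum]

theorem mul_C (c : A) : ∀ (φ : Conv G A) (l : List G), (φ * C c : Conv G A) l = φ l * c
  | φ, [] => by rw [mul_apply, splitSum_nil]; rfl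
  | φ, a :: l => by
    rw [mul_apply, splitSum_cons]
    rw [show splitSum (fun u v => φ (a :: u) * (C c : Conv G A) v) l = φ (a :: l) * c from
      mul_C c (fun u => φ (a :: u)) l]
    simp [C]

instance : Ring (Conv G A) where
  __ := (inferInstance : AddCommGroup (Conv G A))
  zero_mul φ := by
    funext l
    rw [mul_apply, splitSum]
    exact Finset.sum_eq_zero fun i _ => zero_mul (φ (l.drop i))
  mul_zero φ := by
    funext l
    rw [mul_apply, splitSum]
    exact Finset.sum_eq_zero fun i _ => mul_zero (φ (l.take i))
  left_distrib φ ψ χ := by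
    funext l
    simp only [add_apply, mul_apply, mul_add, splitSum_add]
  right_distrib φ ψ χ := by
    funext l
    simp only [add_apply, mul_apply, add_mul, splitSum_add]
  mul_assoc φ ψ χ := by
    funext l
    simp only [mul_apply]
    rw [splitSum]
    simp only [splitSum, Finset.sum_mul, Finset.mul_sum, mul_assoc]
    exact splitSum_assoc (fun u v w => φ u * (ψ v * χ w)) l
  one_mul φ := by
    funext l
    exact (C_mul 1 φ l).trans (one_mul _)
  mul_one φ := by
    funext l
    exact (mul_C 1 φ l).trans (mul_one _)

end Conv
end

/-! ### Derivations -/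

namespace DGAlg

variable {G I : Type} [Fintype G] (A : DGAlg G I)

theorem dSum_sum {κ : Type*} (s : Finset κ) : ∀ (φ : κ → List G → ZMod 2) (l : List G),
    A.dSum (fun r => ∑ c ∈ s, φ c r) l = ∑ c ∈ s, A.dSum (φ c) l
  | _, [] => by simp [dSum]
  | φ, a :: l => by
    simp only [dSum, Finset.mul_sum, Finset.sum_add_distrib]
    rw [Finset.sum_comm, dSum_sum s (fun c l' => φ c (a :: l')) l]

theorem mulSum_sum {κ : Type*} (s : Finset κ) : ∀ (φ : κ → List G → ZMod 2) (l : List G),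
    A.mulSum (fun r => ∑ c ∈ s, φ c r) l = ∑ c ∈ s, A.mulSum (φ c) l
  | _, [] => by simp [mulSum]
  | _, [_] => by simp [mulSum]
  | φ, a :: b :: l => by
    simp only [mulSum, Finset.mul_sum, Finset.sum_add_distrib]
    rw [Finset.sum_comm, mulSum_sum s (fun c l' => φ c (a :: l')) (b :: l)]

theorem dSum_mul_right (c : ZMod 2) : ∀ (φ : List G → ZMod 2) (l : List G),
    A.dSum (fun r => φ r * c) l = A.dSum φ l * c
  | _, [] => by simp [dSum]
  | φ, a :: l => by
    simp only [dSum, add_mul, Finset.sum_mul, mul_assoc]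
    rw [dSum_mul_right c (fun l' => φ (a :: l')) l]

theorem mulSum_mul_right (c : ZMod 2) : ∀ (φ : List G → ZMod 2) (l : List G),
    A.mulSum (fun r => φ r * c) l = A.mulSum φ l * c
  | _, [] => by simp [mulSum]
  | _, [_] => by simp [mulSum]
  | φ, a :: b :: l => by
    simp only [mulSum, add_mul, Finset.sum_mul, mul_assoc]
    rw [mulSum_mul_right c (fun l' => φ (a :: l')) (b :: l)]

theorem dSum_add (φ ψ : List G → ZMod 2) (l : List G) :
    A.dSum (fun r => φ r + ψ r) l = A.dSum φ l + A.dSum ψ l := by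
  simpa using A.dSum_sum Finset.univ (fun b : Bool => if b then φ else ψ) l

theorem mulSum_add (φ ψ : List G → ZMod 2) (l : List G) :
    A.mulSum (fun r => φ r + ψ r) l = A.mulSum φ l + A.mulSum ψ l := by
  simpa using A.mulSum_sum Finset.univ (fun b : Bool => if b then φ else ψ) l

theorem dSum_splitSum : ∀ (F : List G → List G → ZMod 2) (l : List G),
    A.dSum (splitSum F) l =
      splitSum (fun u v => A.dSum (fun r => F r v) u + A.dSum (F u) v) l
  | F, [] => by simp [dSum, splitSum_nil]
  | F, a :: l => by
    have ih := dSum_splitSum (fun u v => F (a :: u) v) l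
    simp only [dSum, splitSum_cons, splitSum_add, mul_add, Finset.sum_add_distrib, dSum_add] at ih ⊢
    rw [show (A.dSum (fun r => splitSum (fun u v => F (a :: u) v) r) l) = _ from ih, splitSum_sum]
    simp only [splitSum, Finset.mul_sum]
    ring

theorem mulSum_splitSum : ∀ (F : List G → List G → ZMod 2) (l : List G),
    A.mulSum (splitSum F) l =
      splitSum (fun u v => A.mulSum (fun r => F r v) u + A.mulSum (F u) v) l
  | F, [] => by simp [mulSum, splitSum_nil]
  | F, [a] => by simp [mulSum, splitSum_nil, splitSum_cons]
  | F, a :: b :: l => by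
    have ih := mulSum_splitSum (fun u v => F (a :: u) v) (b :: l)
    simp only [mulSum, splitSum_cons, splitSum_add, mul_add, Finset.sum_add_distrib, mulSum_add]
      at ih ⊢
    rw [show (A.mulSum (fun r => splitSum (fun u v => F (a :: u) v) r) (b :: l)) = _ from ih,
      splitSum_sum]
    simp only [splitSum, Finset.mul_sum]
    ring

/-- The sum of the differential and of the multiplication. -/
def algSum (φ : List G → ZMod 2) (l : List G) : ZMod 2 := A.dSum φ l + A.mulSum φ l

theorem algSum_sum {κ : Type*} (s : Finset κ) (φ : κ → List G → ZMod 2) (l : List G) :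
    A.algSum (fun r => ∑ c ∈ s, φ c r) l = ∑ c ∈ s, A.algSum (φ c) l := by
  simp only [algSum, dSum_sum, mulSum_sum, Finset.sum_add_distrib]

theorem algSum_mul_right (c : ZMod 2) (φ : List G → ZMod 2) (l : List G) :
    A.algSum (fun r => φ r * c) l = A.algSum φ l * c := by
  simp only [algSum, dSum_mul_right, mulSum_mul_right, add_mul]

theorem algSum_mul_left (c : ZMod 2) (φ : List G → ZMod 2) (l : List G) :
    A.algSum (fun r => c * φ r) l = c * A.algSum φ l := by
  simp only [mul_comm c, algSum_mul_right]

theorem algSum_add (φ ψ : List G → ZMod 2) (l : List G) :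
    A.algSum (fun r => φ r + ψ r) l = A.algSum φ l + A.algSum ψ l := by
  simp only [algSum, dSum_add, mulSum_add]
  ring

theorem algSum_splitSum (F : List G → List G → ZMod 2) (l : List G) :
    A.algSum (splitSum F) l =
      splitSum (fun u v => A.algSum (fun r => F r v) u + A.algSum (F u) v) l := by
  simp only [algSum, dSum_splitSum, mulSum_splitSum, splitSum_add]
  ring

theorem algSum_eq_zero {φ : List G → ZMod 2} (h : ∀ a l, φ (a :: l) = 0) (l : List G) :
    A.algSum φ l = 0 := by
  have hφ : ∀ l : List G, 0 < l.length → φ l = 0 := by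
    intro l hl
    cases l with
    | nil => simp at hl
    | cons a l => exact h a l
  rcases l with _ | ⟨a, _ | ⟨b, l⟩⟩
  · rfl
  · rw [algSum, A.dSum_eq_zero _ _ fun r hr => hφ r (by simp [hr])]; rfl
  · rw [algSum, A.dSum_eq_zero _ _ fun r hr => hφ r (by simp [hr]),
      A.mulSum_eq_zero _ _ fun r hr => hφ r (by simp at hr; omega), add_zero]

end DGAlg

/-! ### Multilinear maps as power series of matrices -/

section

theorem Conv.sum_apply {G A κ : Type} [Ring A] (s : Finset κ) (φ : κ → Conv G A) (l : List G) :
    (∑ c ∈ s, φ c) l = ∑ c ∈ s, φ c l :=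
  Finset.sum_apply l s φ

instance {G A : Type} [Ring A] [Module (ZMod 2) A] : Module (ZMod 2) (Conv G A) :=
  inferInstanceAs (Module (ZMod 2) (List G → A))

variable {G' G I' I X : Type} [Fintype X] [DecidableEq X]

/-- Power series of square matrices in two sets of variables. -/
abbrev Op (G' G X : Type) : Type := Conv G' (Conv G (Matrix X X (ZMod 2)))

namespace Op

/-- The constant power series. -/
def const (c : Matrix X X (ZMod 2)) : Op G' G X := Conv.C (Conv.C c)

theorem const_cons_left (c : Matrix X X (ZMod 2)) (a : G') (l' : List G') (l : List G) (x y : X) :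
    (const c : Op G' G X) (a :: l') l x y = 0 := rfl

theorem const_cons_right (c : Matrix X X (ZMod 2)) (l' : List G') (a : G) (l : List G) (x y : X) :
    (const c : Op G' G X) l' (a :: l) x y = 0 := by cases l' <;> rfl

theorem const_mul (c : Matrix X X (ZMod 2)) (T : Op G' G X) (l' : List G') (l : List G) :
    (const c * T : Op G' G X) l' l = c * T l' l := by
  rw [const, Conv.C_mul, Conv.C_mul]

theorem mul_const (c : Matrix X X (ZMod 2)) (T : Op G' G X) (l' : List G') (l : List G) :
    (T * const c : Op G' G X) l' l = T l' l * c := by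
  rw [const, Conv.mul_C, Conv.mul_C]

theorem const_mul_const (c c' : Matrix X X (ZMod 2)) :
    (const c * const c' : Op G' G X) = const (c * c') := by
  funext l' l
  rw [const_mul]
  cases l' <;> cases l
  · rfl
  all_goals exact mul_zero c

theorem const_add (c c' : Matrix X X (ZMod 2)) :
    (const (c + c') : Op G' G X) = const c + const c' := by
  funext l' l
  cases l' <;> cases l
  · rfl
  all_goals exact (add_zero _).symm

theorem const_zero : (const 0 : Op G' G X) = 0 := by
  funext l' l
  cases l' <;> cases l <;> rfl

theorem const_one : (const 1 : Op G' G X) = 1 := rfl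

theorem mul_apply (S T : Op G' G X) (l' : List G') (l : List G) (x z : X) : (S * T) l' l x z =
    splitSum (fun u' v' => splitSum (fun u v => ∑ y, S u' u x y * T v' v y z) l) l' := by
  rw [Conv.mul_apply, splitSum, Conv.sum_apply, Matrix.sum_apply]
  refine Finset.sum_congr rfl fun i _ => ?_
  rw [Conv.mul_apply, splitSum, Matrix.sum_apply]
  rfl

theorem add_apply (S T : Op G' G X) (l' : List G') (l : List G) (x z : X) :
    (S + T) l' l x z = S l' l x z + T l' l x z := rfl

variable [Fintype G'] [Fintype G] (A' : DGAlg G' I') (A : DGAlg G I)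

/-- The derivation induced by the differential and the multiplication on the inputs. -/
def alg : Op G' G X →+ Op G' G X where
  toFun T := fun l' l x y =>
    A'.algSum (fun r' => T r' l x y) l' + A.algSum (fun r => T l' r x y) l
  map_zero' := by
    funext l' l x y
    change A'.algSum (fun _ => 0) l' + A.algSum (fun _ => 0) l = 0
    rw [A'.algSum_eq_zero fun _ _ => rfl, A.algSum_eq_zero fun _ _ => rfl, add_zero]
  map_add' S T := by
    funext l' l x y
    simp only [add_apply, DGAlg.algSum_add]
    exact add_add_add_comm _ _ _ _

theorem alg_apply (T : Op G' G X) (l' : List G') (l : List G) (x y : X) : alg A' A T l' l x y =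
    A'.algSum (fun r' => T r' l x y) l' + A.algSum (fun r => T l' r x y) l := rfl

theorem alg_mul (S T : Op G' G X) : alg A' A (S * T) = alg A' A S * T + S * alg A' A T := by
  funext l' l x z
  have e1 : A'.algSum (fun r' => (S * T) r' l x z) l' =
      splitSum (fun u' v' => splitSum (fun u v => ∑ y,
        (A'.algSum (fun r' => S r' u x y) u' * T v' v y z +
          S u' u x y * A'.algSum (fun r' => T r' v y z) v')) l) l' := by
    simp only [mul_apply]
    rw [DGAlg.algSum_splitSum]
    simp only [splitSum, DGAlg.algSum_sum, DGAlg.algSum_mul_left, DGAlg.algSum_mul_right,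
      Finset.sum_add_distrib]
  have e2 : A.algSum (fun r => (S * T) l' r x z) l =
      splitSum (fun u' v' => splitSum (fun u v => ∑ y,
        (A.algSum (fun r => S u' r x y) u * T v' v y z +
          S u' u x y * A.algSum (fun r => T v' r y z) v)) l) l' := by
    simp only [mul_apply]
    rw [splitSum]
    conv_lhs => rw [show (fun r => splitSum (fun u' v' => splitSum (fun u v => ∑ y,
      S u' u x y * T v' v y z) r) l') = fun r => ∑ i ∈ Finset.range (l'.length + 1),
        splitSum (fun u v => ∑ y, S (l'.take i) u x y * T (l'.drop i) v y z) r from rfl]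
    rw [DGAlg.algSum_sum]
    refine Finset.sum_congr rfl fun i _ => ?_
    rw [DGAlg.algSum_splitSum]
    simp only [splitSum, DGAlg.algSum_sum, DGAlg.algSum_mul_left, DGAlg.algSum_mul_right,
      Finset.sum_add_distrib]
  rw [alg_apply, e1, e2, add_apply, mul_apply, mul_apply, ← splitSum_add, ← splitSum_add]
  congr 1
  funext u' v'
  rw [← splitSum_add, ← splitSum_add]
  congr 1
  funext u v
  rw [← Finset.sum_add_distrib, ← Finset.sum_add_distrib]
  refine Finset.sum_congr rfl fun y _ => ?_
  rw [alg_apply, alg_apply]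
  ring

theorem alg_const (c : Matrix X X (ZMod 2)) : alg A' A (const c : Op G' G X) = 0 := by
  funext l' l x y
  rw [alg_apply, A'.algSum_eq_zero fun a r => const_cons_left c a r l x y,
    A.algSum_eq_zero fun a r => const_cons_right c l' a r x y]
  rfl

end Op

variable [Fintype G'] [Fintype G]

/-- The multilinear maps `T` as a power series of matrices. -/
def Coeffs.op (T : Coeffs G' G X X) : Op G' G X := fun l' l x y => T x l' l y

theorem Coeffs.alg_eq {Y : Type} (A' : DGAlg G' I') (A : DGAlg G I) (T : Coeffs G' G X Y) (x : X)
    (l' : List G') (l : List G) (y : Y) : T.alg A' A x l' l y =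
      A'.algSum (fun r' => T x r' l y) l' + A.algSum (fun r => T x l' r y) l := by
  rw [Coeffs.alg, DGAlg.algSum, DGAlg.algSum]
  ring

end

/-! ### Perturbation of a contraction in a differential algebra -/

section Perturbation

variable {R : Type} [Ring R] [Module (ZMod 2) R] {d ν H e Φ : R} {δ : R →+ R}

theorem perturbation_comm (hΦ : Φ = ν + ν * H * Φ) :
    (Φ + (ν + Φ * H * ν)) + ν * (H * (Φ + (ν + Φ * H * ν))) = 0 := by
  linear_combination (norm := (simp only [mul_add, add_mul, mul_sub, sub_mul, mul_assoc, one_mul,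
      mul_one, zero_mul, mul_zero]; refine (one_smul (ZMod 2) _).symm.trans ?_; match_scalars <;> decide)) hΦ + hΦ * (H * ν)

theorem eq_of_add_eq_zero_of_module {a b : R} (h : a + b = 0) : a = b := by
  linear_combination (norm := (refine (one_smul (ZMod 2) _).symm.trans ?_; match_scalars <;> decide)) h

theorem perturbation_diff (hδ : ∀ a b, δ (a * b) = δ a * b + a * δ b) (hδH : δ H = 0)
    (hm : d * ν + ν * d + ν * ν + δ ν = 0) (hH : H * d + d * H = 1 + e)
    (hΦ : Φ = ν + ν * H * Φ) (hΦ' : Φ = ν + Φ * H * ν) :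
    δ Φ + d * Φ + Φ * d = Φ * e * Φ := by
  have h1 : δ Φ = δ ν + (δ ν * H * Φ + ν * H * δ Φ) := by
    conv_lhs => rw [hΦ]
    rw [map_add, hδ, hδ, hδH, mul_zero, add_zero]
  have h2 : (δ Φ + d * Φ + Φ * d) + ν * H * (δ Φ + d * Φ + Φ * d) = ν * e * Φ := by
    linear_combination (norm := (simp only [mul_add, add_mul, mul_sub, sub_mul, mul_assoc, one_mul,
      mul_one, zero_mul, mul_zero]; refine (one_smul (ZMod 2) _).symm.trans ?_; match_scalars <;> decide)) h1 + hm + hm * (H * Φ) +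
        d * hΦ + ν * hH * Φ + hΦ * d + ν * hΦ
  have h3 : ∀ y : R, (y + ν * H * y) + Φ * H * (y + ν * H * y) = y := by
    intro y
    linear_combination (norm := (simp only [mul_add, add_mul, mul_sub, sub_mul, mul_assoc, one_mul,
      mul_one, zero_mul, mul_zero]; refine (one_smul (ZMod 2) _).symm.trans ?_; match_scalars <;> decide)) hΦ' * (H * y)
  rw [← h3 (δ Φ + d * Φ + Φ * d), h2]
  linear_combination (norm := (simp only [mul_add, add_mul, mul_sub, sub_mul, mul_assoc, one_mul,
      mul_one, zero_mul, mul_zero]; refine (one_smul (ZMod 2) _).symm.trans ?_; match_scalars <;> decide)) hΦ' * (e * Φ)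

theorem perturbation_incl (hδ : ∀ a b, δ (a * b) = δ a * b + a * δ b) (hδH : δ H = 0)
    (hδ1 : δ 1 = 0) (hH : H * d + d * H = 1 + e) (hΦ' : Φ = ν + Φ * H * ν)
    (hD : δ Φ + d * Φ + Φ * d = Φ * e * Φ) :
    Φ * e * (1 + Φ * H) + (1 + Φ * H) * (d + ν) + δ (1 + Φ * H) = d * (1 + Φ * H) := by
  rw [map_add, hδ, hδH, hδ1, mul_zero, add_zero, zero_add]
  linear_combination (norm := (simp only [mul_add, add_mul, mul_sub, sub_mul, mul_assoc, one_mul,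
      mul_one, zero_mul, mul_zero]; refine (one_smul (ZMod 2) _).symm.trans ?_; match_scalars <;> decide)) hΦ' + Φ * hH + hD * H

theorem perturbation_proj (hδ : ∀ a b, δ (a * b) = δ a * b + a * δ b) (hδH : δ H = 0)
    (hδ1 : δ 1 = 0) (hH : H * d + d * H = 1 + e) (hΦ : Φ = ν + ν * H * Φ)
    (hD : δ Φ + d * Φ + Φ * d = Φ * e * Φ) :
    (d + ν) * (1 + H * Φ) + (1 + H * Φ) * e * Φ + δ (1 + H * Φ) = (1 + H * Φ) * d := by
  rw [map_add, hδ, hδH, hδ1, zero_mul, zero_add, zero_add]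
  linear_combination (norm := (simp only [mul_add, add_mul, mul_sub, sub_mul, mul_assoc, one_mul,
      mul_one, zero_mul, mul_zero]; refine (one_smul (ZMod 2) _).symm.trans ?_; match_scalars <;> decide)) hΦ + hH * Φ + H * hD

theorem perturbation_homotopy (hδ : ∀ a b, δ (a * b) = δ a * b + a * δ b) (hδH : δ H = 0)
    (hH : H * d + d * H = 1 + e) (hΦ : Φ = ν + ν * H * Φ) (hΦ' : Φ = ν + Φ * H * ν)
    (hD : δ Φ + d * Φ + Φ * d = Φ * e * Φ) :
    (d + ν) * (H + H * Φ * H) + (H + H * Φ * H) * (d + ν) + δ (H + H * Φ * H) =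
      (1 + H * Φ) * e * (1 + Φ * H) + 1 := by
  rw [map_add, hδ, hδ, hδH, zero_mul, mul_zero, add_zero, zero_add, zero_add]
  linear_combination (norm := (simp only [mul_add, add_mul, mul_sub, sub_mul, mul_assoc, one_mul,
      mul_one, zero_mul, mul_zero]; refine (one_smul (ZMod 2) _).symm.trans ?_; match_scalars <;> decide)) hH + hΦ * H + H * hΦ' +
        hH * (Φ * H) + H * Φ * hH + H * hD * H

end Perturbation

/-! ### Counting lists -/

theorem Set.ncard_list {E : Type} [Fintype E] {S : Set (List E)} (hS : S.Finite) [Decidable ([] ∈ S)] :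
    S.ncard = (if [] ∈ S then 1 else 0) + ∑ t, {w | t :: w ∈ S}.ncard := by
  classical
  have h1 : S.ncard = hS.toFinset.card := Set.ncard_eq_toFinset_card S hS
  rw [h1, Finset.card_eq_sum_card_fiberwise (f := List.head?) (t := Finset.univ)
    (fun _ _ => Finset.mem_coe.mpr (Finset.mem_univ _)), Fintype.sum_option]
  congr 1
  · by_cases h : [] ∈ S
    · rw [if_pos h, Finset.card_eq_one]
      refine ⟨[], ?_⟩
      ext w
      simp only [Finset.mem_filter, Set.Finite.mem_toFinset, List.head?_eq_none_iff,
        Finset.mem_singleton]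
      exact ⟨fun h => h.2, fun e => ⟨e ▸ h, e⟩⟩
    · rw [if_neg h, Finset.card_eq_zero, Finset.filter_eq_empty_iff]
      intro w hw e
      rw [List.head?_eq_none_iff] at e
      exact h (e ▸ hS.mem_toFinset.mp hw)
  · refine Finset.sum_congr rfl fun t _ => ?_
    rw [← Set.ncard_image_of_injective _ (List.cons_injective (a := t)), ← Set.ncard_coe_finset]
    congr 1
    ext w
    simp only [Finset.coe_filter, Set.Finite.mem_toFinset, Set.mem_ofPred_eq, Set.mem_image]
    constructor
    · rintro ⟨hw, e⟩
      cases w with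
      | nil => simp at e
      | cons u w =>
        simp only [List.head?_cons, Option.some.injEq] at e
        subst e
        exact ⟨w, hw, rfl⟩
    · rintro ⟨w, hw, rfl⟩
      exact ⟨hw, rfl⟩

section
variable {k : ℕ} {Z : PMC k}

namespace MGen

/-- The sequences that are counted by the rank one model, with arbitrary ends. -/
structure IsSeq (x z : MGen Z) (l' : List (Gen Z.rev)) (l : List (Gen Z))
    (w : List (MGen Z × (Gen Z.rev ⊕ Gen Z) × MGen Z)) : Prop where
  first : w.head?.map (fun t => t.1) = some x
  last : w.getLast?.map (fun t => t.2.2) = some z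
  step : ∀ t ∈ w, IsStep t.1 t.2.1 t.2.2
  arrow : w.IsChain fun t u => HArrow t.2.2.fst t.2.2.snd u.1.fst u.1.snd
  inputs' : w.filterMap (fun t => t.2.1.getLeft?) = l'
  inputs : w.filterMap (fun t => t.2.1.getRight?) = l

theorem isArrowSeq_iff {i j : Idem Z} {l' : List (Gen Z.rev)} {l : List (Gen Z)}
    {w : List (MGen Z × (Gen Z.rev ⊕ Gen Z) × MGen Z)} :
    IsArrowSeq i j l' l w ↔ IsSeq (idemGen i) (idemGen j) l' l w :=
  ⟨fun h => ⟨h.1, h.2, h.3, h.4, h.5, h.6⟩, fun h => ⟨h.1, h.2, h.3, h.4, h.5, h.6⟩⟩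

/-- The rest of a sequence, after a step that ends at `y`. -/
def IsTail (y z : MGen Z) (l' : List (Gen Z.rev)) (l : List (Gen Z))
    (w : List (MGen Z × (Gen Z.rev ⊕ Gen Z) × MGen Z)) : Prop :=
  (w = [] ∧ y = z ∧ l' = [] ∧ l = []) ∨
    ∃ x, HArrow y.fst y.snd x.fst x.snd ∧ IsSeq x z l' l w

variable {x y z : MGen Z} {l' : List (Gen Z.rev)} {l : List (Gen Z)}
  {t : MGen Z × (Gen Z.rev ⊕ Gen Z) × MGen Z} {w : List (MGen Z × (Gen Z.rev ⊕ Gen Z) × MGen Z)}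

theorem isSeq_cons : IsSeq x z l' l (t :: w) ↔ t.1 = x ∧ IsStep t.1 t.2.1 t.2.2 ∧
    ∃ r' r, l' = t.2.1.getLeft?.toList ++ r' ∧ l = t.2.1.getRight?.toList ++ r ∧
      IsTail t.2.2 z r' r w := by
  have e1 : (t :: w).filterMap (fun t => t.2.1.getLeft?) =
      t.2.1.getLeft?.toList ++ w.filterMap (fun t => t.2.1.getLeft?) := by
    rcases t with ⟨x, b' | b, y⟩ <;> rfl
  have e2 : (t :: w).filterMap (fun t => t.2.1.getRight?) =
      t.2.1.getRight?.toList ++ w.filterMap (fun t => t.2.1.getRight?) := by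
    rcases t with ⟨x, b' | b, y⟩ <;> rfl
  constructor
  · rintro ⟨h1, h2, h3, h4, h5, h6⟩
    refine ⟨by simpa using h1, h3 t List.mem_cons_self, _, _, by rw [← h5, e1], by rw [← h6, e2], ?_⟩
    cases w with
    | nil => exact Or.inl ⟨rfl, by simpa using h2, rfl, rfl⟩
    | cons u w =>
      rw [List.isChain_cons_cons] at h4
      exact Or.inr ⟨u.1, h4.1, rfl, by simpa using h2, fun t ht => h3 t (List.mem_cons_of_mem _ ht),
        h4.2, rfl, rfl⟩
  · rintro ⟨rfl, h1, r', r, rfl, rfl, ⟨rfl, rfl, rfl, rfl⟩ | ⟨x', h2, h3⟩⟩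
    · refine ⟨rfl, rfl, by simpa using h1, List.isChain_singleton _, ?_, ?_⟩
      · rw [e1]; rfl
      · rw [e2]; rfl
    · cases w with
      | nil => simpa using h3.first
      | cons u w =>
        have hu : u.1 = x' := by simpa using h3.first
        refine ⟨rfl, by simpa using h3.last, ?_, ?_, ?_, ?_⟩
        · intro v hv
          rcases List.mem_cons.mp hv with rfl | hv
          · exact h1
          · exact h3.step v hv
        · rw [List.isChain_cons_cons]
          exact ⟨hu ▸ h2, h3.arrow⟩
        · rw [e1, h3.inputs']
        · rw [e2, h3.inputs]

theorem not_isSeq_nil : ¬ IsSeq x z l' l [] := fun h => by simpa using h.first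

theorem IsSeq.length_eq (h : IsSeq x z l' l w) : w.length = l'.length + l.length := by
  rw [← h.inputs', ← h.inputs]
  clear h
  induction w with
  | nil => rfl
  | cons t w ih => rcases t with ⟨x, b' | b, y⟩ <;> simp [List.filterMap_cons] at ih ⊢ <;> omega

theorem finite_isSeq : {w | IsSeq x z l' l w}.Finite :=
  (List.finite_length_eq _ (l'.length + l.length)).subset fun _ h => IsSeq.length_eq h

theorem finite_isTail : {w | IsTail y z l' l w}.Finite := by
  refine (List.finite_length_eq _ (l'.length + l.length)).subset ?_
  rintro w (⟨rfl, -, rfl, rfl⟩ | ⟨x, -, h⟩)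
  · rfl
  · exact h.length_eq

end MGen

/-- The sum of all sequences of actions connected by arrows of the homotopy. -/
noncomputable def seqOp (Z : PMC k) : Op (Gen Z.rev) (Gen Z) (MGen Z) :=
  fun l' l x y => (({w | MGen.IsSeq x y l' l w}.ncard : ℕ) : ZMod 2)

namespace MGen

variable (x y z : MGen Z) (l' : List (Gen Z.rev)) (l : List (Gen Z))

theorem ncard_isTail : (({w | IsTail y z l' l w}.ncard : ℕ) : ZMod 2) =
    (1 + Op.const (hMat Z) * seqOp Z : Op (Gen Z.rev) (Gen Z) (MGen Z)) l' l y z := by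
  classical
  rw [Set.ncard_list finite_isTail, Op.add_apply, Op.const_mul, Nat.cast_add]
  congr 1
  · have e : [] ∈ {w | IsTail y z l' l w} ↔ y = z ∧ l' = [] ∧ l = [] := by
      constructor
      · rintro (⟨-, h⟩ | ⟨x, -, h⟩)
        · exact h
        · exact absurd h not_isSeq_nil
      · exact fun h => Or.inl ⟨rfl, h⟩
    rw [if_congr e rfl rfl]
    cases l' <;> cases l
    · simp only [and_true]
      push_cast
      exact Matrix.one_apply.symm
    all_goals
      simp only [reduceCtorEq, and_false, false_and, if_false]
      rfl
  · rw [Matrix.mul_apply, Nat.cast_sum]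
    have e : ∀ x', hMat Z y x' * seqOp Z l' l x' z =
        ∑ t, if t.1 = x' then hMat Z y x' * (({w | IsSeq x' z l' l (t :: w)}.ncard : ℕ) : ZMod 2)
          else 0 := by
      intro x'
      rw [seqOp, Set.ncard_list finite_isSeq, if_neg (show ¬ [] ∈ {w | IsSeq x' z l' l w} from not_isSeq_nil), zero_add, Nat.cast_sum,
        Finset.mul_sum]
      refine Finset.sum_congr rfl fun t _ => ?_
      split_ifs with h
      · rfl
      · have : {w | t :: w ∈ {w | IsSeq x' z l' l w}} = ∅ :=
          Set.eq_empty_of_forall_notMem fun w hw => h (isSeq_cons.mp hw).1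
        rw [this, Set.ncard_empty, Nat.cast_zero, mul_zero]
    simp only [e]
    rw [Finset.sum_comm]
    refine Finset.sum_congr rfl fun t _ => ?_
    rw [Finset.sum_ite_eq, if_pos (Finset.mem_univ _), hMat]
    split_ifs with h
    · rw [one_mul]
      congr 2
      ext w
      constructor
      · rintro (⟨h', -⟩ | ⟨x', h1, h2⟩)
        · simp at h'
        · obtain rfl := (isSeq_cons.mp h2).1
          exact h2
      · exact fun h' => Or.inr ⟨_, h, h'⟩
    · rw [zero_mul]
      have : {w | t :: w ∈ {w | IsTail y z l' l w}} = ∅ := by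
        refine Set.eq_empty_of_forall_notMem fun w hw => ?_
        rcases hw with ⟨h', -⟩ | ⟨x', h1, h2⟩
        · simp at h'
        · obtain rfl := (isSeq_cons.mp h2).1
          exact h h1
      rw [this, Set.ncard_empty, Nat.cast_zero]

theorem ract_eq (b : Gen Z) [Decidable (IsStep x (Sum.inr b) y)] :
    ract b x y = if IsStep x (Sum.inr b) y then 1 else 0 := by
  have hs : IsStep x (Sum.inr b) y ↔ (strandAlg Z).mul x.snd b y.snd = 1 ∧ x.fst = y.fst := Iff.rfl
  rw [ract, if_congr hs rfl rfl]
  by_cases h : x.fst = y.fst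
  · have h1 : x.x = y.x ∧ x.q = y.q := by
      refine ⟨?_, Gen.bar_injective h⟩
      have := congrArg Gen.left h
      rw [left_fst, left_fst] at this
      rw [← Idem.o_o x.x, this, Idem.o_o]
    rw [if_pos h1, if_congr (and_iff_left h) rfl rfl]
    change (strandAlg Z).mul x.snd b y.snd = _
    rw [strandAlg_mul]
    split_ifs <;> simp_all
  · rw [if_neg (fun h' => h (congrArg Gen.bar h'.2)), if_neg (fun h' => h h'.2)]

theorem ract'_eq (b' : Gen Z.rev) [Decidable (IsStep x (Sum.inl b') y)] :
    ract' b' x y = if IsStep x (Sum.inl b') y then 1 else 0 := by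
  have hs : IsStep x (Sum.inl b') y ↔ (strandAlg Z).mul y.fst b'.bar x.fst = 1 ∧ x.snd = y.snd :=
    Iff.rfl
  rw [ract', if_congr hs rfl rfl]
  by_cases h : x.snd = y.snd
  · have h1 : x.x = y.x ∧ x.p = y.p := by
      refine ⟨?_, h⟩
      rw [← left_snd, h, left_snd]
    rw [if_pos h1, if_congr (and_iff_left h) rfl rfl, strandAlg_mul, strandAlg_mul,
      show Gen.MulRel y.fst b'.bar x.fst ↔ Gen.MulRel b' y.q x.q from Gen.mulRel_bar]
    split_ifs <;> simp_all
  · rw [if_neg (fun h' => h h'.2), if_neg (fun h' => h h'.2)]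

end MGen
end

section
variable {G : Type}

/-- `F` applied to the head and the tail of a list. -/
def headSum {A : Type} [Zero A] (F : G → List G → A) : List G → A
  | [] => 0
  | b :: r => F b r

theorem splitSum_eq_nil {A : Type} [AddCommMonoid A] {F : List G → List G → A}
    (h : ∀ a u v, F (a :: u) v = 0) (l : List G) : splitSum F l = F [] l := by
  cases l with
  | nil => rw [splitSum_nil]
  | cons a l =>
    rw [splitSum_cons, splitSum, Finset.sum_eq_zero fun i _ => h _ _ _, add_zero]

theorem splitSum_eq_headSum {A : Type} [AddCommMonoid A] {F : List G → List G → A}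
    (h0 : ∀ v, F [] v = 0) (h : ∀ a b u v, F (a :: b :: u) v = 0) (l : List G) :
    splitSum F l = headSum (fun b r => F [b] r) l := by
  cases l with
  | nil => rw [splitSum_nil, h0]; rfl
  | cons a l =>
    rw [splitSum_cons, h0, zero_add, splitSum_eq_nil fun b u v => h a b u v]
    rfl

end

section
variable {k : ℕ} {Z : PMC k}

open MGen

/-- The two actions on the large model. -/
noncomputable def actOp (Z : PMC k) : Op (Gen Z.rev) (Gen Z) (MGen Z) := fun l' l x y =>
  match l', l with
  | [b'], [] => ract' b' x y
  | [], [b] => ract b x y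
  | _, _ => 0

theorem op_largeModel (Z : PMC k) : (largeModel Z).m.op = Op.const (dMat Z) + actOp Z := by
  funext l' l x y
  rw [Op.add_apply]
  rcases l' with _ | ⟨b', _ | ⟨c', l'⟩⟩ <;> rcases l with _ | ⟨b, _ | ⟨c, l⟩⟩
  on_goal 1 => exact (add_zero _).symm
  all_goals exact (zero_add _).symm

theorem actOp_mul (T : Op (Gen Z.rev) (Gen Z) (MGen Z)) (l' : List (Gen Z.rev)) (l : List (Gen Z))
    (x z : MGen Z) : (actOp Z * T) l' l x z =
      headSum (fun b' r' => ∑ y, ract' b' x y * T r' l y z) l' +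
      headSum (fun b r => ∑ y, ract b x y * T l' r y z) l := by
  have hnil : ∀ (v' : List (Gen Z.rev)) (l : List (Gen Z)),
      splitSum (fun u v => ∑ y, actOp Z [] u x y * T v' v y z) l =
        headSum (fun b r => ∑ y, ract b x y * T v' r y z) l := fun v' l =>
    splitSum_eq_headSum (fun v => Finset.sum_eq_zero fun y _ => zero_mul _)
      (fun a b u v => Finset.sum_eq_zero fun y _ => zero_mul _) l
  have hone : ∀ (b' : Gen Z.rev) (v' : List (Gen Z.rev)) (l : List (Gen Z)),
      splitSum (fun u v => ∑ y, actOp Z [b'] u x y * T v' v y z) l =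
        ∑ y, ract' b' x y * T v' l y z := fun b' v' l =>
    splitSum_eq_nil (fun a u v => Finset.sum_eq_zero fun y _ => zero_mul _) l
  have htwo : ∀ (b' c' : Gen Z.rev) (u' v' : List (Gen Z.rev)) (l : List (Gen Z)),
      splitSum (fun u v => ∑ y, actOp Z (b' :: c' :: u') u x y * T v' v y z) l = 0 :=
    fun b' c' u' v' l => Finset.sum_eq_zero fun i _ => Finset.sum_eq_zero fun y _ => zero_mul _
  rw [Op.mul_apply]
  cases l' with
  | nil => rw [splitSum_nil, hnil, headSum, zero_add]
  | cons b' l' =>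
    rw [splitSum_cons, hnil, splitSum_eq_nil fun c' u' v' => htwo b' c' u' v' l, hone, add_comm]
    rfl

theorem seqOp_eq (Z : PMC k) :
    seqOp Z = actOp Z * (1 + Op.const (hMat Z) * seqOp Z) := by
  classical
  funext l' l x z
  rw [actOp_mul, seqOp, Set.ncard_list finite_isSeq,
    if_neg (show ¬ [] ∈ {w | IsSeq x z l' l w} from not_isSeq_nil), zero_add, Nat.cast_sum]
  have e : ∀ t : MGen Z × (Gen Z.rev ⊕ Gen Z) × MGen Z,
      (({w | t :: w ∈ {w | IsSeq x z l' l w}}.ncard : ℕ) : ZMod 2) =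
      if x = t.1 then (if IsStep x t.2.1 t.2.2 then
        Sum.elim (fun b' => headSum (fun c r' => if c = b' then
            (1 + Op.const (hMat Z) * seqOp Z : Op (Gen Z.rev) (Gen Z) (MGen Z)) r' l t.2.2 z
            else 0) l')
          (fun b => headSum (fun c r => if c = b then
            (1 + Op.const (hMat Z) * seqOp Z : Op (Gen Z.rev) (Gen Z) (MGen Z)) l' r t.2.2 z
            else 0) l) t.2.1 else 0) else 0 := by
    have hz : ∀ S : Set (List (MGen Z × (Gen Z.rev ⊕ Gen Z) × MGen Z)), (∀ w, w ∉ S) →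
        ((S.ncard : ℕ) : ZMod 2) = 0 := by
      intro S hS
      rw [Set.eq_empty_of_forall_notMem hS, Set.ncard_empty, Nat.cast_zero]
    rintro ⟨x', c, y⟩
    split_ifs with h1 h2
    · dsimp only at h1 h2
      subst h1
      rcases c with b' | b
      · rcases l' with _ | ⟨c', r'⟩
        · refine hz _ fun w hw => ?_
          obtain ⟨-, -, r', r, h3, -⟩ := isSeq_cons.mp hw
          simp at h3
        · simp only [Sum.elim_inl, headSum]
          split_ifs with h3
          · subst h3
            rw [← ncard_isTail]
            congr 2
            ext w
            refine isSeq_cons.trans ⟨?_, fun h => ⟨rfl, h2, r', l, rfl, rfl, h⟩⟩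
            rintro ⟨-, -, s', s, h4, h5, h6⟩
            simp only [Sum.getLeft?_inl, Option.toList_some, List.cons_append, List.nil_append,
              List.cons.injEq, true_and, Sum.getRight?_inl, Option.toList_none] at h4 h5
            rw [h4, h5]
            exact h6
          · refine hz _ fun w hw => ?_
            obtain ⟨-, -, s', s, h4, -⟩ := isSeq_cons.mp hw
            simp only [Sum.getLeft?_inl, Option.toList_some, List.cons_append, List.nil_append,
              List.cons.injEq] at h4
            exact h3 h4.1
      · rcases l with _ | ⟨c, r⟩
        · refine hz _ fun w hw => ?_
          obtain ⟨-, -, r', r, -, h3, -⟩ := isSeq_cons.mp hw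
          simp at h3
        · simp only [Sum.elim_inr, headSum]
          split_ifs with h3
          · subst h3
            rw [← ncard_isTail]
            congr 2
            ext w
            refine isSeq_cons.trans ⟨?_, fun h => ⟨rfl, h2, l', r, rfl, rfl, h⟩⟩
            rintro ⟨-, -, s', s, h4, h5, h6⟩
            simp only [Sum.getRight?_inr, Option.toList_some, List.cons_append, List.nil_append,
              List.cons.injEq, true_and, Sum.getLeft?_inr, Option.toList_none] at h4 h5
            rw [h4, h5]
            exact h6
          · refine hz _ fun w hw => ?_
            obtain ⟨-, -, s', s, -, h4, -⟩ := isSeq_cons.mp hw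
            simp only [Sum.getRight?_inr, Option.toList_some, List.cons_append, List.nil_append,
              List.cons.injEq] at h4
            exact h3 h4.1
    · refine hz _ fun w hw => h2 ?_
      have := (isSeq_cons.mp hw).2.1
      rwa [← h1] at this
    · exact hz _ fun w hw => h1 (isSeq_cons.mp hw).1.symm
  rw [Finset.sum_congr rfl fun t _ => e t, Fintype.sum_prod_type, Finset.sum_eq_single x]
  · simp only [if_true, Fintype.sum_prod_type, Fintype.sum_sum_type, Sum.elim_inl, Sum.elim_inr]
    congr 1
    · rcases l' with _ | ⟨c', r'⟩
      · simp [headSum]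
      · simp only [headSum]
        rw [Finset.sum_eq_single c']
        · refine Finset.sum_congr rfl fun y _ => ?_
          rw [ract'_eq, if_pos rfl, ite_mul, one_mul, zero_mul]
        · intro b' _ hb
          refine Finset.sum_eq_zero fun y _ => ?_
          rw [if_neg hb.symm, ite_self]
        · exact fun h => absurd (Finset.mem_univ _) h
    · rcases l with _ | ⟨c, r⟩
      · simp [headSum]
      · simp only [headSum]
        rw [Finset.sum_eq_single c]
        · refine Finset.sum_congr rfl fun y _ => ?_
          rw [ract_eq, if_pos rfl, ite_mul, one_mul, zero_mul]
        · intro b' _ hb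
          refine Finset.sum_eq_zero fun y _ => ?_
          rw [if_neg hb.symm, ite_self]
        · exact fun h => absurd (Finset.mem_univ _) h
  · intro x' _ hx
    simp only [if_neg hx.symm, Finset.sum_const_zero]
  · exact fun h => absurd (Finset.mem_univ _) h

theorem eq_zero_of_add_actOp_mul (T : Op (Gen Z.rev) (Gen Z) (MGen Z))
    (h : T + actOp Z * (Op.const (hMat Z) * T) = 0) : T = 0 := by
  have key : ∀ n, ∀ (l' : List (Gen Z.rev)) (l : List (Gen Z)), l'.length + l.length = n →
      T l' l = 0 := by
    intro n
    induction n using Nat.strong_induction_on with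
    | _ n ih =>
      intro l' l hn
      ext x z
      have h1 := congrFun (congrFun (congrFun (congrFun h l') l) x) z
      rw [Op.add_apply, actOp_mul] at h1
      have h2 : headSum (fun b' r' => ∑ y, ract' b' x y *
          (Op.const (hMat Z) * T : Op (Gen Z.rev) (Gen Z) (MGen Z)) r' l y z) l' = 0 := by
        rcases l' with _ | ⟨b', r'⟩
        · rfl
        · refine Finset.sum_eq_zero fun y _ => ?_
          rw [Op.const_mul, ih _ (by simp at hn; omega) r' l rfl, mul_zero]
          exact mul_zero _
      have h3 : headSum (fun b r => ∑ y, ract b x y *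
          (Op.const (hMat Z) * T : Op (Gen Z.rev) (Gen Z) (MGen Z)) l' r y z) l = 0 := by
        rcases l with _ | ⟨b, r⟩
        · rfl
        · refine Finset.sum_eq_zero fun y _ => ?_
          rw [Op.const_mul, ih _ (by simp at hn; omega) l' r rfl, mul_zero]
          exact mul_zero _
      rw [h2, h3, add_zero, add_zero] at h1
      exact h1
  funext l' l
  exact key _ l' l rfl

theorem seqOp_eq_left (Z : PMC k) :
    seqOp Z = actOp Z + actOp Z * Op.const (hMat Z) * seqOp Z := by
  conv_lhs => rw [seqOp_eq]
  rw [mul_add, mul_one, mul_assoc]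

theorem seqOp_eq_right (Z : PMC k) :
    seqOp Z = actOp Z + seqOp Z * Op.const (hMat Z) * actOp Z :=
  eq_of_add_eq_zero_of_module (eq_zero_of_add_actOp_mul _ (perturbation_comm (seqOp_eq_left Z)))

end

/-! ### The transferred structure -/

section
variable {k : ℕ} {Z : PMC k}

open MGen

/-- The power series of matrices over the generators of the large model. -/
abbrev MOp (Z : PMC k) : Type := Op (Gen Z.rev) (Gen Z) (MGen Z)

/-- The projection to the span of the idempotent generators. -/
noncomputable def eMat (Z : PMC k) : Matrix (MGen Z) (MGen Z) (ZMod 2) := gMat Z * fMat Z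

section Composition

variable {V W : Type} (σ : V → MGen Z) (τ : W → MGen Z) (S T : MOp Z)
  (x : V) (l' : List (Gen Z.rev)) (l : List (Gen Z)) (z : W)

theorem comp_eq_mul : Coeffs.comp (Y := MGen Z) (fun x l' l y => S l' l (σ x) y)
    (fun y l' l z => T l' l y (τ z)) x l' l z = (S * T) l' l (σ x) (τ z) :=
  (Op.mul_apply S T l' l (σ x) (τ z)).symm

theorem comp_idem_eq_mul : Coeffs.comp (Y := Idem Z) (fun x l' l j => S l' l (σ x) (idemGen j))
    (fun j l' l z => T l' l (idemGen j) (τ z)) x l' l z =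
      (S * Op.const (eMat Z) * T : MOp Z) l' l (σ x) (τ z) := by
  rw [mul_assoc, Op.mul_apply]
  refine Finset.sum_congr rfl fun i _ => Finset.sum_congr rfl fun j _ => ?_
  generalize l'.take i = u'
  generalize l'.drop i = v'
  generalize l.take j = u
  generalize l.drop j = v
  have h : S u' u * gMat Z * (fMat Z * T v' v) = S u' u * (eMat Z * T v' v) := by
    rw [eMat, Matrix.mul_assoc, Matrix.mul_assoc]
  have h1 := congrFun (congrFun h (σ x)) (τ z)
  rw [Matrix.mul_apply, Matrix.mul_apply] at h1
  simp only [mul_gMat_apply, fMat_mul_apply] at h1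
  rw [h1]
  refine Finset.sum_congr rfl fun y _ => ?_
  rw [Op.const_mul]

theorem alg_eq_alg {V : Type} [Fintype V] [DecidableEq V] (σ : V → MGen Z) (x : V) :
    Coeffs.alg (strandAlg Z.rev) (strandAlg Z) (fun x l' l y => T l' l (σ x) (τ y)) x l' l z =
      Op.alg (strandAlg Z.rev) (strandAlg Z) T l' l (σ x) (τ z) :=
  Coeffs.alg_eq _ _ _ _ _ _ _

end Composition

theorem actOp_relation (Z : PMC k) : Op.const (dMat Z) * actOp Z + actOp Z * Op.const (dMat Z) +
    actOp Z * actOp Z + Op.alg (strandAlg Z.rev) (strandAlg Z) (actOp Z) = 0 := by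
  have h : (largeModel Z).m.op * (largeModel Z).m.op +
      Op.alg (strandAlg Z.rev) (strandAlg Z) (largeModel Z).m.op = 0 := by
    funext l' l x z
    have := largeModel_relation x z l' l
    rw [Coeffs.alg_eq] at this
    rw [Op.add_apply, Op.mul_apply]
    exact this
  rw [op_largeModel, map_add, Op.alg_const, zero_add, mul_add, add_mul, add_mul,
    Op.const_mul_const, dMat_mul_dMat, Op.const_zero, zero_add] at h
  rw [← h]
  abel

theorem const_homotopy : (Op.const (hMat Z) * Op.const (dMat Z) +
    Op.const (dMat Z) * Op.const (hMat Z) : MOp Z) = 1 + Op.const (eMat Z) := by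
  rw [Op.const_mul_const, Op.const_mul_const, ← Op.const_add, hMat_mul_dMat_add, Op.const_add,
    Op.const_one, eMat]

theorem alg_one : Op.alg (strandAlg Z.rev) (strandAlg Z) (1 : MOp Z) = 0 := Op.alg_const _ _ 1

theorem seqOp_diff (Z : PMC k) : Op.alg (strandAlg Z.rev) (strandAlg Z) (seqOp Z) +
    Op.const (dMat Z) * seqOp Z + seqOp Z * Op.const (dMat Z) =
      seqOp Z * Op.const (eMat Z) * seqOp Z :=
  perturbation_diff (Op.alg_mul _ _) (Op.alg_const _ _ _) (actOp_relation Z) const_homotopy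
    (seqOp_eq_left Z) (seqOp_eq_right Z)

/-- The inclusion of the rank one model, extended to the large model. -/
noncomputable def inclOp (Z : PMC k) : MOp Z := 1 + seqOp Z * Op.const (hMat Z)

/-- The projection to the rank one model, extended to the large model. -/
noncomputable def projOp (Z : PMC k) : MOp Z := 1 + Op.const (hMat Z) * seqOp Z

/-- The homotopy on the large model. -/
noncomputable def homOp (Z : PMC k) : MOp Z :=
  Op.const (hMat Z) + Op.const (hMat Z) * seqOp Z * Op.const (hMat Z)

theorem inclOp_diff (Z : PMC k) :
    seqOp Z * Op.const (eMat Z) * inclOp Z + inclOp Z * (largeModel Z).m.op +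
      Op.alg (strandAlg Z.rev) (strandAlg Z) (inclOp Z) = Op.const (dMat Z) * inclOp Z := by
  rw [op_largeModel]
  exact perturbation_incl (Op.alg_mul _ _) (Op.alg_const _ _ _) alg_one const_homotopy
    (seqOp_eq_right Z) (seqOp_diff Z)

theorem projOp_diff (Z : PMC k) :
    (largeModel Z).m.op * projOp Z + projOp Z * Op.const (eMat Z) * seqOp Z +
      Op.alg (strandAlg Z.rev) (strandAlg Z) (projOp Z) = projOp Z * Op.const (dMat Z) := by
  rw [op_largeModel]
  exact perturbation_proj (Op.alg_mul _ _) (Op.alg_const _ _ _) alg_one const_homotopy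
    (seqOp_eq_left Z) (seqOp_diff Z)

theorem homOp_diff (Z : PMC k) :
    (largeModel Z).m.op * homOp Z + homOp Z * (largeModel Z).m.op +
      Op.alg (strandAlg Z.rev) (strandAlg Z) (homOp Z) =
        projOp Z * Op.const (eMat Z) * inclOp Z + 1 := by
  rw [op_largeModel]
  exact perturbation_homotopy (Op.alg_mul _ _) (Op.alg_const _ _ _) const_homotopy
    (seqOp_eq_left Z) (seqOp_eq_right Z) (seqOp_diff Z)

theorem dMat_mul_idemGen_left (T : Matrix (MGen Z) (MGen Z) (ZMod 2)) (i : Idem Z) (y : MGen Z) :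
    (dMat Z * T) (idemGen i) y = 0 := by
  rw [← fMat_mul_apply (dMat Z * T), ← Matrix.mul_assoc, fMat_mul_dMat, Matrix.zero_mul, Matrix.zero_apply]

theorem mul_dMat_idemGen_right (T : Matrix (MGen Z) (MGen Z) (ZMod 2)) (y : MGen Z) (i : Idem Z) :
    (T * dMat Z) y (idemGen i) = 0 := by
  rw [← mul_gMat_apply (T * dMat Z), Matrix.mul_assoc, dMat_mul_gMat, Matrix.mul_zero, Matrix.zero_apply]

theorem hMat_mul_idemGen_left (T : Matrix (MGen Z) (MGen Z) (ZMod 2)) (i : Idem Z) (y : MGen Z) :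
    (hMat Z * T) (idemGen i) y = 0 := by
  rw [← fMat_mul_apply (hMat Z * T), ← Matrix.mul_assoc, fMat_mul_hMat, Matrix.zero_mul, Matrix.zero_apply]

theorem mul_hMat_idemGen_right (T : Matrix (MGen Z) (MGen Z) (ZMod 2)) (y : MGen Z) (i : Idem Z) :
    (T * hMat Z) y (idemGen i) = 0 := by
  rw [← mul_gMat_apply (T * hMat Z), Matrix.mul_assoc, hMat_mul_gMat, Matrix.mul_zero, Matrix.zero_apply]

theorem rankOneModel_m (Z : PMC k) :
    (rankOneModel Z).m = fun i l' l j => seqOp Z l' l (idemGen i) (idemGen j) := by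
  funext i l' l j
  change ((Set.ncard {w | IsArrowSeq i j l' l w} : ℕ) : ZMod 2) = _
  simp only [isArrowSeq_iff]
  rfl

theorem rankOneModel_relation (i : Idem Z) (l' : List (Gen Z.rev)) (l : List (Gen Z)) (j : Idem Z) :
    (rankOneModel Z).m.comp (rankOneModel Z).m i l' l j +
      (rankOneModel Z).m.alg (strandAlg Z.rev) (strandAlg Z) i l' l j = 0 := by
  have h := congrFun (congrFun (congrFun (congrFun (seqOp_diff Z) l') l) (idemGen i))
    (idemGen j)
  rw [rankOneModel_m, comp_idem_eq_mul idemGen idemGen, alg_eq_alg idemGen, ← h, Op.add_apply,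
    Op.add_apply, Op.const_mul, Op.mul_const, dMat_mul_idemGen_left, mul_dMat_idemGen_right,
    add_zero, add_zero]
  exact CharTwo.add_self_eq_zero _

/-! ### Idempotents -/

theorem DGAlg.Matches.append {G I : Type} {A : DGAlg G I} : ∀ {i j m : I} {u v : List G},
    A.Matches i u j → A.Matches j v m → A.Matches i (u ++ v) m
  | _, _, _, [], _, h, h' => by
    have h : _ = _ := h
    subst h
    exact h'
  | _, _, _, _ :: _, _, h, h' => ⟨h.1, h.2.append h'⟩

theorem HConf.idem_eq {x y : MGen Z} (h : HConf Z x.code y.code) :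
    (largeModel Z).idem' x = (largeModel Z).idem' y ∧
      (largeModel Z).idem x = (largeModel Z).idem y := by
  have key : ∀ u v : MGen Z, HasArrow Z.pair u.code v.code →
      (largeModel Z).idem' u = (largeModel Z).idem' v ∧
        (largeModel Z).idem u = (largeModel Z).idem v := by
    intro u v huv
    refine largeModel_balanced Z u [] [] v ?_
    change dMat Z u v ≠ 0
    rw [dMat_eq, if_pos huv]
    exact one_ne_zero
  obtain ⟨P, i, j, hp, hq, h1, h2, ha⟩ := h
  obtain ⟨u, hu⟩ := exists_code_eq (hp.good.conf x.isConf_code Z.pair_pair Z.pair_ne)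
  obtain ⟨v, hv⟩ := exists_code_eq (hq.good.conf y.isConf_code Z.pair_pair Z.pair_ne)
  have e1 : HasArrow Z.pair u.code x.code := by
    refine ⟨i, P, ?_⟩
    rw [← hp.swap_swap x.isConf_code, ← hu]
    have hup := hp.swap x.isConf_code
    rw [← hu] at hup
    refine hup.good.isArrow u.isConf_code ?_
    rw [hu, cswap_left, cswap_right hp.good.lt.ne]
    exact h1
  have e2 : HasArrow Z.pair y.code v.code := by
    refine ⟨j, P, ?_⟩
    rw [hv]
    exact hq.good.isArrow y.isConf_code h2
  rw [← hu, ← hv] at ha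
  have k1 := key u x e1
  have k2 := key y v e2
  have k3 := key u v ha
  exact ⟨k1.1.symm.trans (k3.1.trans k2.1.symm), k1.2.symm.trans (k3.2.trans k2.2.symm)⟩

theorem hMat_idem_eq {x y : MGen Z} (h : hMat Z x y ≠ 0) :
    (largeModel Z).idem' x = (largeModel Z).idem' y ∧
      (largeModel Z).idem x = (largeModel Z).idem y := by
  rw [hMat_eq] at h
  exact HConf.idem_eq (by by_contra h'; exact h (if_neg h'))

theorem IsStep.matches {x y : MGen Z} {c : Gen Z.rev ⊕ Gen Z} (h : IsStep x c y) :
    (strandAlg Z.rev).Matches ((largeModel Z).idem' x) c.getLeft?.toList ((largeModel Z).idem' y) ∧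
      (strandAlg Z).Matches ((largeModel Z).idem x) c.getRight?.toList ((largeModel Z).idem y) := by
  classical
  refine largeModel_balanced Z x _ _ y ?_
  rcases c with b' | b
  · change ract' b' x y ≠ 0
    rw [ract'_eq, if_pos h]
    exact one_ne_zero
  · change ract b x y ≠ 0
    rw [ract_eq, if_pos h]
    exact one_ne_zero

theorem MGen.IsSeq.matches {z : MGen Z} {w : List (MGen Z × (Gen Z.rev ⊕ Gen Z) × MGen Z)} :
    ∀ {x : MGen Z} {l' : List (Gen Z.rev)} {l : List (Gen Z)}, IsSeq x z l' l w →
    (strandAlg Z.rev).Matches ((largeModel Z).idem' x) l' ((largeModel Z).idem' z) ∧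
      (strandAlg Z).Matches ((largeModel Z).idem x) l ((largeModel Z).idem z) := by
  induction w with
  | nil => exact fun h => absurd h not_isSeq_nil
  | cons t w ih =>
    intro x l' l h
    obtain ⟨rfl, h1, r', r, rfl, rfl, h2⟩ := isSeq_cons.mp h
    have h3 := h1.matches
    suffices h4 : (strandAlg Z.rev).Matches ((largeModel Z).idem' t.2.2) r'
          ((largeModel Z).idem' z) ∧
        (strandAlg Z).Matches ((largeModel Z).idem t.2.2) r ((largeModel Z).idem z) from
      ⟨h3.1.append h4.1, h3.2.append h4.2⟩
    rcases h2 with ⟨-, rfl, rfl, rfl⟩ | ⟨x', h5, h6⟩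
    · exact ⟨rfl, rfl⟩
    · have h7 := HConf.idem_eq (hArrow_iff.mp h5)
      rw [h7.1, h7.2]
      exact ih h6

theorem seqOp_balanced (Z : PMC k) :
    IdemBalanced (largeModel Z) (largeModel Z) fun x l' l y => seqOp Z l' l x y := by
  intro x l' l y h
  have : {w | IsSeq x y l' l w}.Nonempty := by
    by_contra h'
    rw [Set.not_nonempty_iff_eq_empty] at h'
    apply h
    change (({w | IsSeq x y l' l w}.ncard : ℕ) : ZMod 2) = 0
    rw [h', Set.ncard_empty, Nat.cast_zero]
  obtain ⟨w, hw⟩ := this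
  exact hw.matches

theorem idem_idemGen (i : Idem Z) :
    (largeModel Z).idem' (idemGen i) = (rankOneModel Z).idem' i ∧
      (largeModel Z).idem (idemGen i) = (rankOneModel Z).idem i :=
  ⟨Gen.left_gen i.o.bar, Gen.right_gen i⟩

end

section
variable {k : ℕ} {Z : PMC k}

open MGen

theorem const_hMat_balanced (Z : PMC k) : IdemBalanced (largeModel Z) (largeModel Z)
    fun x l' l y => (Op.const (hMat Z) : MOp Z) l' l x y := by
  intro x l' l y h
  rcases l' with _ | ⟨b', l'⟩
  · rcases l with _ | ⟨b, l⟩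
    · exact hMat_idem_eq h
    · exact absurd rfl h
  · exact absurd rfl h

theorem one_balanced (Z : PMC k) : IdemBalanced (largeModel Z) (largeModel Z)
    fun x l' l y => (1 : MOp Z) l' l x y := by
  intro x l' l y h
  rcases l' with _ | ⟨b', l'⟩
  · rcases l with _ | ⟨b, l⟩
    · have : x = y := by
        by_contra hne
        exact h (Matrix.one_apply_ne hne)
      subst this
      exact ⟨rfl, rfl⟩
    · exact absurd rfl h
  · exact absurd rfl h

theorem mul_balanced {S T : MOp Z}
    (hS : IdemBalanced (largeModel Z) (largeModel Z) fun x l' l y => S l' l x y)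
    (hT : IdemBalanced (largeModel Z) (largeModel Z) fun x l' l y => T l' l x y) :
    IdemBalanced (largeModel Z) (largeModel Z) fun x l' l y => (S * T) l' l x y := by
  intro x l' l z h
  dsimp only at h
  rw [Op.mul_apply] at h
  obtain ⟨u', v', hl', h1⟩ := splitSum_ne_zero h
  obtain ⟨u, v, hl, h2⟩ := splitSum_ne_zero h1
  obtain ⟨y, -, h3⟩ := Finset.exists_ne_zero_of_sum_ne_zero h2
  subst hl' hl
  have h1 := hS x u' u y (left_ne_zero_of_mul h3)
  have h2 := hT y v' v z (right_ne_zero_of_mul h3)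
  exact ⟨h1.1.append h2.1, h1.2.append h2.2⟩

theorem add_balanced {S T : MOp Z}
    (hS : IdemBalanced (largeModel Z) (largeModel Z) fun x l' l y => S l' l x y)
    (hT : IdemBalanced (largeModel Z) (largeModel Z) fun x l' l y => T l' l x y) :
    IdemBalanced (largeModel Z) (largeModel Z) fun x l' l y => (S + T) l' l x y := by
  intro x l' l z h
  by_cases h1 : S l' l x z = 0
  · refine hT x l' l z fun h2 => h ?_
    dsimp only at h2 ⊢
    rw [Op.add_apply, h1, h2, add_zero]
  · exact hS x l' l z h1

/-! ### Units -/

theorem ract'_gen (i : Idem Z.rev) (x y : MGen Z) :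
    ract' i.gen x y = if x = y ∧ (largeModel Z).idem' x = i then 1 else 0 := by
  have h := (largeModel_isAInf Z).unit_left x y
  change ract' ((largeModel Z).idem' x).gen x y = _ at h
  by_cases hi : (largeModel Z).idem' x = i
  · subst hi
    rw [h, if_congr (and_iff_left rfl) rfl rfl]
  · rw [if_neg (fun h => hi h.2)]
    by_contra h'
    have := (largeModel_balanced Z x [i.gen] [] y h').1.1
    exact hi (this.symm.trans (Gen.left_gen i))

theorem ract_gen (i : Idem Z) (x y : MGen Z) :
    ract i.gen x y = if x = y ∧ (largeModel Z).idem x = i then 1 else 0 := by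
  have h := (largeModel_isAInf Z).unit_right x y
  change ract ((largeModel Z).idem x).gen x y = _ at h
  by_cases hi : (largeModel Z).idem x = i
  · subst hi
    rw [h, if_congr (and_iff_left rfl) rfl rfl]
  · rw [if_neg (fun h => hi h.2)]
    by_contra h'
    have := (largeModel_balanced Z x [] [i.gen] y h').2.1
    exact hi (this.symm.trans (Gen.left_gen i))

/-- A matrix that preserves idempotents. -/
def IdemDiag (T : Matrix (MGen Z) (MGen Z) (ZMod 2)) : Prop :=
  ∀ x y, T x y ≠ 0 → (largeModel Z).idem' x = (largeModel Z).idem' y ∧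
    (largeModel Z).idem x = (largeModel Z).idem y

theorem IdemDiag.mul_projection {T B : Matrix (MGen Z) (MGen Z) (ZMod 2)} (hTB : T * B = 0)
    {p : MGen Z → Prop} [DecidablePred p] (hp : ∀ x y, T x y ≠ 0 → (p x ↔ p y))
    {N : Matrix (MGen Z) (MGen Z) (ZMod 2)} (hN : ∀ x y, N x y = if x = y ∧ p x then 1 else 0) :
    T * N * B = 0 := by
  have hd : N = Matrix.diagonal fun x => if p x then 1 else 0 := by
    ext x y
    rw [hN, Matrix.diagonal_apply]
    by_cases h : x = y <;> simp [h]
  ext x z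
  rw [hd, Matrix.mul_apply]
  have h0 := congrFun (congrFun hTB x) z
  rw [Matrix.mul_apply] at h0
  have : ∀ y, (T * Matrix.diagonal (fun x => if p x then 1 else 0) :
      Matrix (MGen Z) (MGen Z) (ZMod 2)) x y * B y z =
      (if p x then 1 else 0) * (T x y * B y z) := by
    intro y
    rw [Matrix.mul_diagonal]
    by_cases h : T x y = 0
    · simp [h]
    · rw [if_congr (hp x y h) rfl rfl]; ring
  rw [Finset.sum_congr rfl fun y _ => this y, ← Finset.mul_sum, h0]
  exact mul_zero _

theorem IdemDiag.mul_ract'_gen {T B : Matrix (MGen Z) (MGen Z) (ZMod 2)} (hT : IdemDiag T)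
    (hTB : T * B = 0) (i : Idem Z.rev) : T * Matrix.of (ract' i.gen) * B = 0 :=
  IdemDiag.mul_projection (p := fun x => (largeModel Z).idem' x = i) hTB
    (fun x y h => by rw [(hT x y h).1]) fun x y => ract'_gen i x y

theorem IdemDiag.mul_ract_gen {T B : Matrix (MGen Z) (MGen Z) (ZMod 2)} (hT : IdemDiag T)
    (hTB : T * B = 0) (i : Idem Z) : T * Matrix.of (ract i.gen) * B = 0 :=
  IdemDiag.mul_projection (p := fun x => (largeModel Z).idem x = i) hTB
    (fun x y h => by rw [(hT x y h).2]) fun x y => ract_gen i x y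

theorem seqOp_apply (l' : List (Gen Z.rev)) (l : List (Gen Z)) : seqOp Z l' l =
    headSum (fun b' r' => Matrix.of (ract' b') * projOp Z r' l) l' +
    headSum (fun b r => Matrix.of (ract b) * projOp Z l' r) l := by
  ext x z
  have h := congrFun (congrFun (congrFun (congrFun (seqOp_eq Z) l') l) x) z
  rw [actOp_mul] at h
  rw [h]
  cases l' <;> cases l <;> rfl

theorem projOp_apply (l' : List (Gen Z.rev)) (l : List (Gen Z)) :
    projOp Z l' l = (1 : MOp Z) l' l + hMat Z * seqOp Z l' l := by
  rw [← Op.const_mul]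
  rfl

theorem HasIdem.one_apply {l' : List (Gen Z.rev)} {l : List (Gen Z)}
    (h : HasIdem (strandAlg Z.rev) (strandAlg Z) l' l) : (1 : MOp Z) l' l = 0 := by
  cases l' with
  | nil =>
    cases l with
    | nil => simp [HasIdem] at h
    | cons b l => rfl
  | cons b' l' => rfl

theorem one_apply_of_length {l' : List (Gen Z.rev)} {l : List (Gen Z)}
    (h : 1 ≤ l'.length + l.length) : (1 : MOp Z) l' l = 0 := by
  cases l' with
  | nil =>
    cases l with
    | nil => simp at h
    | cons b l => rfl
  | cons b' l' => rfl

theorem seqOp_unit {B : Matrix (MGen Z) (MGen Z) (ZMod 2)} (hB : hMat Z * B = 0) : ∀ (n : ℕ)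
    (l' : List (Gen Z.rev)) (l : List (Gen Z)), l'.length + l.length = n →
    HasIdem (strandAlg Z.rev) (strandAlg Z) l' l → ∀ T, IdemDiag T → T * hMat Z = 0 →
    (T * B = 0 ∨ 2 ≤ n) → T * seqOp Z l' l * B = 0 := by
  intro n
  induction n with
  | zero =>
    intro l' l hn h
    have h1 : l' = [] := List.length_eq_zero_iff.mp (by omega)
    have h2 : l = [] := List.length_eq_zero_iff.mp (by omega)
    subst h1 h2
    simp [HasIdem] at h
  | succ n ih =>
    intro l' l hn h T hT hTh hTB
    have hh : IdemDiag (hMat Z) := fun x y => hMat_idem_eq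
    have tail : ∀ (r' : List (Gen Z.rev)) (r : List (Gen Z)) (N : Matrix (MGen Z) (MGen Z) (ZMod 2)),
        r'.length + r.length = n → ((∀ B', T * B' = 0 → T * N * B' = 0) ∨
          HasIdem (strandAlg Z.rev) (strandAlg Z) r' r) → T * (N * projOp Z r' r) * B = 0 := by
      intro r' r N hr hN
      rw [projOp_apply, mul_add, mul_add, add_mul]
      rcases hN with hN | hN
      · have e1 : T * (N * (hMat Z * seqOp Z r' r)) * B = 0 := by
          rw [← Matrix.mul_assoc N, ← Matrix.mul_assoc T, ← Matrix.mul_assoc T N, hN _ hTh,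
            Matrix.zero_mul, Matrix.zero_mul]
        rw [e1, add_zero]
        rcases hTB with hTB | h2
        · by_cases hn0 : 1 ≤ r'.length + r.length
          · rw [one_apply_of_length hn0, Matrix.mul_zero, Matrix.mul_zero, Matrix.zero_mul]
          · have h1 : r' = [] := List.length_eq_zero_iff.mp (by omega)
            have h2 : r = [] := List.length_eq_zero_iff.mp (by omega)
            subst h1 h2
            rw [show (1 : MOp Z) [] [] = 1 from rfl, Matrix.mul_one, hN _ hTB]
        · rw [one_apply_of_length (by omega), Matrix.mul_zero, Matrix.mul_zero, Matrix.zero_mul]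
      · rw [hN.one_apply, Matrix.mul_zero, Matrix.mul_zero, Matrix.zero_mul, zero_add,
          ← Matrix.mul_assoc T, Matrix.mul_assoc (T * N),
          ih r' r hr hN _ hh (hMat_mul_hMat Z) (Or.inl hB), Matrix.mul_zero]
    rw [seqOp_apply, mul_add, add_mul]
    have e1 : T * headSum (fun b' r' => Matrix.of (ract' b') * projOp Z r' l) l' * B = 0 := by
      rcases l' with _ | ⟨b', r'⟩
      · rw [headSum, Matrix.mul_zero, Matrix.zero_mul]
      · refine tail r' l _ (by simp at hn; omega) ?_
        by_cases hb : ∃ i, Idem.gen i = b'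
        · obtain ⟨i, rfl⟩ := hb
          exact Or.inl fun B' hB' => hT.mul_ract'_gen hB' i
        · right
          rcases h with ⟨i, h⟩ | h
          · rcases List.mem_cons.mp h with h | h
            · exact absurd ⟨i, h⟩ hb
            · exact Or.inl ⟨i, h⟩
          · exact Or.inr h
    have e2 : T * headSum (fun b r => Matrix.of (ract b) * projOp Z l' r) l * B = 0 := by
      rcases l with _ | ⟨b, r⟩
      · rw [headSum, Matrix.mul_zero, Matrix.zero_mul]
      · refine tail l' r _ (by simp at hn; omega) ?_
        by_cases hb : ∃ i, Idem.gen i = b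
        · obtain ⟨i, rfl⟩ := hb
          exact Or.inl fun B' hB' => hT.mul_ract_gen hB' i
        · right
          rcases h with h | ⟨i, h⟩
          · exact Or.inl h
          · rcases List.mem_cons.mp h with h | h
            · exact absurd ⟨i, h⟩ hb
            · exact Or.inr ⟨i, h⟩
    rw [e1, e2, add_zero]

theorem eMat_idemDiag (Z : PMC k) : IdemDiag (eMat Z) := by
  intro x y h
  rw [eMat, Matrix.mul_apply] at h
  obtain ⟨i, -, h⟩ := Finset.exists_ne_zero_of_sum_ne_zero h
  have h1 : x = idemGen i := by
    by_contra h'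
    exact left_ne_zero_of_mul h (if_neg h')
  have h2 : y = idemGen i := by
    by_contra h'
    exact right_ne_zero_of_mul h (if_neg h')
  rw [h1, h2]
  exact ⟨rfl, rfl⟩

theorem hMat_idemDiag (Z : PMC k) : IdemDiag (hMat Z) := fun _ _ => hMat_idem_eq

theorem eMat_mul_hMat (Z : PMC k) : eMat Z * hMat Z = 0 := by
  rw [eMat, Matrix.mul_assoc, fMat_mul_hMat, Matrix.mul_zero]

theorem hMat_mul_eMat (Z : PMC k) : hMat Z * eMat Z = 0 := by
  rw [eMat, ← Matrix.mul_assoc, hMat_mul_gMat, Matrix.zero_mul]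

theorem eMat_mul_idemGen (T : Matrix (MGen Z) (MGen Z) (ZMod 2)) (i : Idem Z) (y : MGen Z) :
    (eMat Z * T) (idemGen i) y = T (idemGen i) y := by
  rw [← fMat_mul_apply (eMat Z * T), eMat, ← Matrix.mul_assoc, ← Matrix.mul_assoc, fMat_mul_gMat,
    Matrix.one_mul, fMat_mul_apply]

theorem mul_eMat_idemGen (T : Matrix (MGen Z) (MGen Z) (ZMod 2)) (y : MGen Z) (i : Idem Z) :
    (T * eMat Z) y (idemGen i) = T y (idemGen i) := by
  rw [← mul_gMat_apply (T * eMat Z), eMat, Matrix.mul_assoc, Matrix.mul_assoc, fMat_mul_gMat,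
    Matrix.mul_one, mul_gMat_apply]

section
variable {l' : List (Gen Z.rev)} {l : List (Gen Z)}

theorem homOp_unit (h : HasIdem (strandAlg Z.rev) (strandAlg Z) l' l) : homOp Z l' l = 0 := by
  have h1 := seqOp_unit (hMat_mul_hMat Z) _ l' l rfl h (hMat Z) (hMat_idemDiag Z)
    (hMat_mul_hMat Z) (Or.inl (hMat_mul_hMat Z))
  have h2 : (Op.const (hMat Z) : MOp Z) l' l = 0 := by
    cases l' with
    | nil =>
      cases l with
      | nil => simp [HasIdem] at h
      | cons b l => rfl
    | cons b' l' => rfl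
  have h3 : homOp Z l' l = (Op.const (hMat Z) : MOp Z) l' l +
      (Op.const (hMat Z) * seqOp Z * Op.const (hMat Z) : MOp Z) l' l := rfl
  rw [h3, h2, Op.mul_const, Op.const_mul, h1, add_zero]

theorem inclOp_unit (h : HasIdem (strandAlg Z.rev) (strandAlg Z) l' l)
    (i : Idem Z) (y : MGen Z) : inclOp Z l' l (idemGen i) y = 0 := by
  have h1 := seqOp_unit (hMat_mul_hMat Z) _ l' l rfl h (eMat Z) (eMat_idemDiag Z)
    (eMat_mul_hMat Z) (Or.inl (eMat_mul_hMat Z))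
  have h3 : inclOp Z l' l = (1 : MOp Z) l' l + (seqOp Z * Op.const (hMat Z) : MOp Z) l' l := rfl
  rw [h3, h.one_apply, Op.mul_const, zero_add,
    ← eMat_mul_idemGen (seqOp Z l' l * hMat Z), ← Matrix.mul_assoc, h1]
  rfl

theorem projOp_unit (h : HasIdem (strandAlg Z.rev) (strandAlg Z) l' l)
    (x : MGen Z) (j : Idem Z) : projOp Z l' l x (idemGen j) = 0 := by
  have h1 := seqOp_unit (hMat_mul_eMat Z) _ l' l rfl h (hMat Z) (hMat_idemDiag Z)
    (hMat_mul_hMat Z) (Or.inl (hMat_mul_eMat Z))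
  rw [projOp_apply, h.one_apply, zero_add,
    ← mul_eMat_idemGen (hMat Z * seqOp Z l' l), h1]
  rfl

theorem rankOneModel_unit_high (h : HasIdem (strandAlg Z.rev) (strandAlg Z) l' l)
    (h2 : 2 ≤ l'.length + l.length) (i j : Idem Z) :
    (rankOneModel Z).m i l' l j = 0 := by
  have h1 := seqOp_unit (hMat_mul_eMat Z) _ l' l rfl h (eMat Z) (eMat_idemDiag Z)
    (eMat_mul_hMat Z) (Or.inr h2)
  rw [rankOneModel_m]
  dsimp only
  rw [← mul_eMat_idemGen (seqOp Z l' l), ← eMat_mul_idemGen (seqOp Z l' l * eMat Z),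
    ← Matrix.mul_assoc, h1]
  rfl

end

theorem seqOp_nil : seqOp Z [] [] = 0 := by
  rw [seqOp_apply, headSum, headSum, add_zero]

theorem rankOneModel_isAInf (Z : PMC k) : (rankOneModel Z).IsAInf where
  balanced := by
    intro i l' l j h
    rw [rankOneModel_m] at h
    have := seqOp_balanced Z (idemGen i) l' l (idemGen j) h
    rwa [(idem_idemGen i).1, (idem_idemGen i).2, (idem_idemGen j).1, (idem_idemGen j).2] at this
  relation := rankOneModel_relation
  unit_left := by
    intro i j
    rw [rankOneModel_m]
    dsimp only
    rw [seqOp_apply, headSum, headSum, add_zero, projOp_apply, seqOp_nil, Matrix.mul_zero, add_zero,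
      show (1 : MOp Z) [] [] = 1 from rfl, Matrix.mul_one]
    have h := (largeModel_isAInf Z).unit_left (idemGen i) (idemGen j)
    rw [(idem_idemGen i).1] at h
    rw [← if_congr idemGen_injective.eq_iff rfl rfl]
    exact h
  unit_right := by
    intro i j
    rw [rankOneModel_m]
    dsimp only
    rw [seqOp_apply, headSum, headSum, zero_add, projOp_apply, seqOp_nil, Matrix.mul_zero, add_zero,
      show (1 : MOp Z) [] [] = 1 from rfl, Matrix.mul_one]
    have h := (largeModel_isAInf Z).unit_right (idemGen i) (idemGen j)
    rw [(idem_idemGen i).2] at h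
    rw [← if_congr idemGen_injective.eq_iff rfl rfl]
    exact h
  unit_high := fun i l' l j h2 h => rankOneModel_unit_high h h2 i j

theorem rankOneModel_isRankOne (Z : PMC k) : (rankOneModel Z).IsRankOne := by
  refine ⟨⟨fun i j h => ?_, fun j => ?_⟩, Function.bijective_id⟩
  · have := Idem.bar_injective (show i.o.bar = j.o.bar from h)
    rw [← Idem.o_o i, this, Idem.o_o]
  · obtain ⟨i, hi⟩ : ∃ i : Idem Z, i.bar = j := by
      refine ⟨⟨j.pts.image Fin.rev, fun x hx => ?_⟩, ?_⟩
      · obtain ⟨y, hy, rfl⟩ := Finset.mem_image.mp hx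
        exact Finset.mem_image.mpr ⟨_, j.pair_mem y hy, by simp [PMC.rev]⟩
      · ext x
        simp [Idem.bar]
    refine ⟨i.o, ?_⟩
    change i.o.o.bar = j
    rw [Idem.o_o, hi]

theorem projOp_inclOp_comp (i : Idem Z) (l' : List (Gen Z.rev)) (l : List (Gen Z)) (j : Idem Z) :
    (inclOp Z * projOp Z) l' l (idemGen i) (idemGen j) = (1 : MOp Z) l' l (idemGen i) (idemGen j) := by
  have h : inclOp Z * projOp Z = 1 + Op.const (hMat Z) * seqOp Z + seqOp Z * Op.const (hMat Z) := by
    have h1 : seqOp Z * Op.const (hMat Z) * (Op.const (hMat Z) * seqOp Z) = 0 := by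
      rw [mul_assoc, ← mul_assoc (Op.const (hMat Z)), Op.const_mul_const, hMat_mul_hMat,
        Op.const_zero, zero_mul, mul_zero]
    rw [inclOp, projOp, add_mul, one_mul, mul_add, mul_one, h1, add_zero]
  rw [h, Op.add_apply, Op.add_apply, Op.const_mul, Op.mul_const, hMat_mul_idemGen_left,
    mul_hMat_idemGen_right, add_zero, add_zero]

theorem homotopyEquivalent (Z : PMC k) :
    HomotopyEquivalent (rankOneModel Z) (largeModel Z) := by
  have bincl : IdemBalanced (largeModel Z) (largeModel Z) fun x l' l y => inclOp Z l' l x y :=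
    add_balanced (one_balanced Z) (mul_balanced (seqOp_balanced Z) (const_hMat_balanced Z))
  have bproj : IdemBalanced (largeModel Z) (largeModel Z) fun x l' l y => projOp Z l' l x y :=
    add_balanced (one_balanced Z) (mul_balanced (const_hMat_balanced Z) (seqOp_balanced Z))
  have bhom : IdemBalanced (largeModel Z) (largeModel Z) fun x l' l y => homOp Z l' l x y :=
    add_balanced (const_hMat_balanced Z) (mul_balanced
      (mul_balanced (const_hMat_balanced Z) (seqOp_balanced Z)) (const_hMat_balanced Z))
  refine ⟨fun i l' l y => inclOp Z l' l (idemGen i) y, fun x l' l j => projOp Z l' l x (idemGen j),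
    fun _ _ _ _ => 0, fun x l' l y => homOp Z l' l x y, ⟨?_, ?_⟩, ⟨?_, ?_⟩, ⟨?_, ?_⟩, ⟨bhom, ?_⟩,
    ?_, ?_, ?_, ?_⟩
  · intro i l' l y h
    have := bincl (idemGen i) l' l y h
    rwa [(idem_idemGen i).1, (idem_idemGen i).2] at this
  · exact fun i l' l y h => inclOp_unit h i y
  · intro x l' l j h
    have := bproj x l' l (idemGen j) h
    rwa [(idem_idemGen j).1, (idem_idemGen j).2] at this
  · exact fun x l' l j h => projOp_unit h x j
  · exact fun _ _ _ _ h => absurd rfl h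
  · exact fun _ _ _ _ _ => rfl
  · intro x l' l y h
    change homOp Z l' l x y = 0
    rw [homOp_unit h]
    rfl
  · intro i l' l y
    have h := congrFun (congrFun (congrFun (congrFun (inclOp_diff Z) l') l) (idemGen i)) y
    rw [Op.const_mul, dMat_mul_idemGen_left] at h
    rw [← h, morD, rankOneModel_m]
    rw [comp_idem_eq_mul idemGen (fun y => y), alg_eq_alg (fun y => y) _ _ _ _ idemGen]
    rw [Op.add_apply, Op.add_apply]
    congr 2
    exact comp_eq_mul idemGen (fun y => y) (inclOp Z) (largeModel Z).m.op i l' l y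
  · intro x l' l j
    have h := congrFun (congrFun (congrFun (congrFun (projOp_diff Z) l') l) x) (idemGen j)
    rw [Op.mul_const, mul_dMat_idemGen_right] at h
    rw [← h, morD, rankOneModel_m]
    rw [comp_idem_eq_mul (fun y => y) idemGen, alg_eq_alg idemGen _ _ _ _ (fun y => y)]
    rw [Op.add_apply, Op.add_apply]
    congr 2
    exact comp_eq_mul (fun y => y) idemGen (largeModel Z).m.op (projOp Z) x l' l j
  · intro i l' l j
    rw [comp_eq_mul idemGen idemGen, projOp_inclOp_comp, morD]
    have e1 : Coeffs.id i l' l j = (1 : MOp Z) l' l (idemGen i) (idemGen j) := by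
      cases l' <;> cases l
      · rw [show (1 : MOp Z) [] [] = 1 from rfl, Matrix.one_apply, Coeffs.id]
        simp only [and_true]
        exact if_congr idemGen_injective.eq_iff.symm rfl rfl
      all_goals
        simp only [Coeffs.id, reduceCtorEq, and_false, if_false, false_and]
        rfl
    rw [e1, CharTwo.add_self_eq_zero, Coeffs.alg_eq,
      DGAlg.algSum_eq_zero _ fun _ _ => rfl, DGAlg.algSum_eq_zero _ fun _ _ => rfl]
    simp [Coeffs.comp]
  · intro x l' l z
    have h := congrFun (congrFun (congrFun (congrFun (homOp_diff Z) l') l) x) z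
    rw [comp_idem_eq_mul (fun y => y) (fun y => y), morD,
      alg_eq_alg (fun y => y) _ _ _ _ (fun y => y)]
    have e1 : Coeffs.id x l' l z = (1 : MOp Z) l' l x z := by
      cases l' <;> cases l
      · rw [show (1 : MOp Z) [] [] = 1 from rfl, Matrix.one_apply, Coeffs.id]
        simp only [and_true]
      all_goals
        simp only [Coeffs.id, reduceCtorEq, and_false, if_false, false_and]
        rfl
    rw [e1, ← Op.add_apply, ← h, Op.add_apply, Op.add_apply]
    congr 2
    · exact (comp_eq_mul (fun y => y) (fun y => y) (largeModel Z).m.op (homOp Z) x l' l z).symm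
    · exact (comp_eq_mul (fun y => y) (fun y => y) (homOp Z) (largeModel Z).m.op x l' l z).symm

end

theorem mainTheorem1 {k : ℕ} (Z : PMC k) :
    (largeModel Z).IsAInf ∧
    hMat Z * dMat Z + dMat Z * hMat Z = 1 + gMat Z * fMat Z ∧
    (rankOneModel Z).IsAInf ∧
    (rankOneModel Z).IsRankOne ∧
    HomotopyEquivalent (rankOneModel Z) (largeModel Z) :=
  ⟨largeModel_isAInf Z, hMat_mul_dMat_add Z, rankOneModel_isAInf Z, rankOneModel_isRankOne Z,
    homotopyEquivalent Z⟩
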